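/- \textbf{Notation.} Let $d\ge 1$, $\mathbb T^d=(\mathbb R/2\pi\mathbb Z)^d$, $\langle k,\eta\rangle=(1+|k|^2+|\eta|^2)^{1/2}$ and $\langle k\rangle=\langle k,0\rangle$. For $f\in L^2(\mathbb T^d\times\mathbb R^d)$ and $u\in L^2(\mathbb T^d;\mathbb R^d)$ put $$\hat f_k(\eta)=\frac1{(2\pi)^d}\iint_{\mathbb T^d\times\mathbb R^d} e^{-ix\cdot k-iv\cdot\eta}f(x,v)\,dx\,dv,\qquad \hat u_k=\frac1{(2\pi)^d}\int_{\mathbb T^d}e^{-ix\cdot k}u(x)\,dx .$$ For $\lambda\ge0$, $s\in(0,1]$, $\sigma>0$, $M\in\mathbb N$ define, with $D_\eta^\alpha=(i\partial_{\eta_1})^{\alpha_1}\cdots(i\partial_{\eta_d})^{\alpha_d}$ (so that $D^\alpha_\eta\hat f$ is the Fourier transform of $v^\alpha f$), $$\|f\|_{\lambda,\sigma,M,s}^2=\sum_{|\alpha|\le M}\sum_{k\in\mathbb Z^d}\int_{\mathbb R^d}\langle k,\eta\rangle^{2\sigma}e^{2\lambda\langle k,\eta\rangle^s}|D_\eta^\alpha\hat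 f_k(\eta)|^2\,d\eta,\qquad \|u\|_{\lambda,\sigma,s}^2=\sum_{k\in\mathbb Z^d}\langle k\rangle^{2\sigma}e^{2\lambda\langle k\rangle^s}|\hat u_k|^2,$$ and let $\|f\|_{\sigma,M}$, $\|u\|_\sigma$ be the same quantities with $\lambda=0$; $\|u\|_{W^{1,\infty}}=\|u\|_{L^\infty}+\|\nabla u\|_{L^\infty}$. The Gevrey class $\mathcal G^{\lambda,\sigma,M,1/s}(\mathbb T^d\times\mathbb R^d)$ (resp. $\mathcal G^{\lambda,\sigma,1/s}(\mathbb T^d)$) is the set of real-valued $f\in C^\infty\cap L^2$ (resp. $\mathbb R^d$-valued $u\in C^\infty$) for which $\|f\|_{\lambda,\sigma,M,s}$ (resp. $\|u\|_{\lambda,\sigma,s}$) is finite. \textbf{Proposition.} Let $s\in(0,1]$, let $M\ge 1$ be an integer and let $\sigma>\frac d2+\frac s2+2$. There is a constant $C>0$, depending only on $d,s,\sigma,M$, such that the following holds. Let $T>0$, let $\lambda:[0,T)\to(0,\infty)$ be smooth, and let $u=u(t,x)$ and $f=f(t,x,v)$ satisfy $$f\in C\big([0,T);\mathcal G^{\lambda,\sigma+\frac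 s2,M,\frac1s}(\mathbb T^d\times\mathbb R^d)\big),\qquad u\in C\big([0,T);\mathcal G^{\lambda,\sigma+\frac s2,\frac1s}(\mathbb T^d)\big),$$ meaning that for each $t$ the functions $f(t)$, $u(t)$ lie in the class with radius $\lambda(t)$ and that $t\mapsto \langle k,\eta\rangle^{\sigma+\frac s2}e^{\lambda(t)\langle k,\eta\rangle^s}D^\alpha_\eta\hat f_k(t,\eta)$ ($|\alpha|\le M$) and $t\mapsto\langle k\rangle^{\sigma+\frac s2}e^{\lambda(t)\langle k\rangle^s}\hat u_k(t)$ are continuous into $L^2_{k,\eta}$ and $L^2_k$. Assume that $f$ is a classical ($C^1$ in $(t,x,v)$) solution of the Vlasov equation $$\partial_tf+v\cdot\nabla_xf+\nabla_v\cdot\big[(u-v)f\big]=0\quad\text{on }[0,T)\times\mathbb T^d\times\mathbb R^d .$$ (No compact support of $f$ in $v$ is assumed.) Then $t\mapsto\|f(t)\|^2_{\lambda(t),\sigma,M,s}$ is differentiable on $[0,T)$ (one-sidedly at $t=0$) and for every $t\in[0,T)$, all quantities being taken at time $t$ and $\dot\lambda$ denoting the derivative of $\lambda$, $$\begin{aligned}\frac12\frac{d}{dt}\|f\|_{\lambda,\sigma,M,s}^2\le\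 &\dot\lambda\,\|f\|_{\lambda,\sigma+\frac s2,M,s}^2+C\Big[\big(\|u\|_{W^{1,\infty}}+1\big)\|f\|_{\lambda,\sigma,M,s}^2+\|u\|_\sigma\|f\|_{\sigma,M}\|f\|_{\lambda,\sigma,M,s}\\&+\big(\lambda(1+\|u\|_\sigma)+\lambda^2\|u\|_{\lambda,\sigma,s}\big)\|f\|_{\lambda,\sigma+\frac s2,M,s}^2\\&+\big(\lambda\|f\|_{\sigma,M}+\lambda^2\|f\|_{\lambda,\sigma,M,s}\big)\|u\|_{\lambda,\sigma+\frac s2,s}\|f\|_{\lambda,\sigma+\frac s2,M,s}\Big].\end{aligned}$$ -/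

import Mathlib

open MeasureTheory Set Filter Topology
open scoped ContDiff FourierTransform

namespace VlasovGevrey

/-- The Euclidean space `ℝ^d`. Functions on the torus `𝕋^d = (ℝ / 2πℤ)^d` are represented by
functions on `ℝ^d` that are `2π`-periodic in each coordinate. -/
abbrev Eucl (d : ℕ) : Type := EuclideanSpace ℝ (Fin d)

/-- The fundamental cell `[0, 2π)^d` of the torus. -/
def torusCell (d : ℕ) : Set (Eucl d) := {x | ∀ i, x i ∈ Ico (0 : ℝ) (2 * Real.pi)}

/-- `2π`-periodicity in each coordinate. -/
def TorusPeriodic {d : ℕ} {F : Type*} (g : Eucl d → F) : Prop :=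
  ∀ (x : Eucl d) (i : Fin d), g (x + EuclideanSpace.single i (2 * Real.pi)) = g x

/-- The Fourier coefficient `(2π)^{-d} ∫_{𝕋^d} e^{-i x·k} g(x) dx` of a real function. -/
noncomputable def torusFourier {d : ℕ} (g : Eucl d → ℝ) (k : Fin d → ℤ) : ℂ :=
  (((2 * Real.pi) ^ d)⁻¹ : ℂ) *
    ∫ x in torusCell d, Complex.exp (-Complex.I * ((∑ i, x i * (k i : ℝ) : ℝ) : ℂ)) * (g x : ℂ)

open Classical in
/-- The Fourier transform `∫ e^{-i v·η} h(v) dv` of `h ∈ L²(ℝ^d; ℂ)`, in the sense of Plancherel.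
Mathlib's kernel is `e^{-2πi v·ξ}`, hence the dilation `ξ = η / (2π)`. -/
noncomputable def velocityFourier {d : ℕ} (h : Eucl d → ℂ) (η : Eucl d) : ℂ :=
  if hh : MemLp h 2 (volume : Measure (Eucl d)) then
    (𝓕 (hh.toLp h) : Lp ℂ 2 (volume : Measure (Eucl d))) ((2 * Real.pi)⁻¹ • η)
  else 0

/-- The Fourier transform
`(2π)^{-d} ∬_{𝕋^d × ℝ^d} e^{-i x·k - i v·η} f(x,v) dx dv` on `L²(𝕋^d × ℝ^d)`. -/
noncomputable def phaseFourier {d : ℕ} (f : Eucl d → Eucl d → ℝ) (k : Fin d → ℤ) (η : Eucl d) : ℂ :=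
  velocityFourier (fun v => torusFourier (fun x => f x v) k) η

/-- The multi-indices `α ∈ ℕ^d` with `|α| ≤ M`. -/
def multiIndices (d M : ℕ) : Finset (Fin d → ℕ) :=
  (Fintype.piFinset fun _ => Finset.range (M + 1)).filter fun α => ∑ i, α i ≤ M

/-- The function `(x, v) ↦ v^α f(x, v)`. -/
def vPowMul {d : ℕ} (α : Fin d → ℕ) (f : Eucl d → Eucl d → ℝ) (x v : Eucl d) : ℝ :=
  (∏ i, v i ^ α i) * f x v

/-- The Japanese bracket `⟨k, η⟩ = (1 + |k|² + |η|²)^{1/2}`; `⟨k⟩ = ⟨k, 0⟩`. -/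
noncomputable def bracket {d : ℕ} (k : Fin d → ℤ) (η : Eucl d) : ℝ :=
  Real.sqrt (1 + ∑ i, (k i : ℝ) ^ 2 + ‖η‖ ^ 2)

/-- The multiplier `A_k(η) = ⟨k, η⟩^σ e^{λ ⟨k, η⟩^s}`. -/
noncomputable def gevreyMul {d : ℕ} (lam σ s : ℝ) (k : Fin d → ℤ) (η : Eucl d) : ℝ :=
  bracket k η ^ σ * Real.exp (lam * bracket k η ^ s)

/-- `A_k(η) D_η^α \hat f_k(η)`, where `D_η^α \hat f` is the Fourier transform of `v^α f`. -/
noncomputable def kinMode {d : ℕ} (lam σ s : ℝ) (α : Fin d → ℕ) (f : Eucl d → Eucl d → ℝ)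
    (k : Fin d → ℤ) (η : Eucl d) : ℂ :=
  (gevreyMul lam σ s k η : ℂ) * phaseFourier (vPowMul α f) k η

/-- `A_k(0) \hat u_k^j`. -/
noncomputable def fluidMode {d : ℕ} (lam σ s : ℝ) (u : Eucl d → Eucl d) (k : Fin d → ℤ)
    (j : Fin d) : ℂ :=
  (gevreyMul lam σ s k 0 : ℂ) * torusFourier (fun x => u x j) k

/-- `∑_{|α| ≤ M} ‖A D_η^α \hat f‖²_{L²(k, η)}`, with values in `[0, ∞]`. -/
noncomputable def kinNormSq {d : ℕ} (lam σ : ℝ) (M : ℕ) (s : ℝ) (f : Eucl d → Eucl d → ℝ) : ENNReal :=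
  ∑ α ∈ multiIndices d M, ∑' k : Fin d → ℤ, ∫⁻ η : Eucl d, ‖kinMode lam σ s α f k η‖ₑ ^ 2

/-- `∑_k ⟨k⟩^{2σ} e^{2λ⟨k⟩^s} |\hat u_k|²`, with values in `[0, ∞]`. -/
noncomputable def fluidNormSq {d : ℕ} (lam σ s : ℝ) (u : Eucl d → Eucl d) : ENNReal :=
  ∑' k : Fin d → ℤ, ∑ j, ‖fluidMode lam σ s u k j‖ₑ ^ 2

/-- The Gevrey norm `‖f‖_{λ,σ,M,s}`. -/
noncomputable def kinNorm {d : ℕ} (lam σ : ℝ) (M : ℕ) (s : ℝ) (f : Eucl d → Eucl d → ℝ) : ℝ :=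
  Real.sqrt (kinNormSq lam σ M s f).toReal

/-- The Gevrey norm `‖u‖_{λ,σ,s}`. -/
noncomputable def fluidNorm {d : ℕ} (lam σ s : ℝ) (u : Eucl d → Eucl d) : ℝ :=
  Real.sqrt (fluidNormSq lam σ s u).toReal

/-- The weighted Sobolev norm `‖f‖_{σ,M}`: for `λ = 0` the multiplier is `⟨k, η⟩^σ`. -/
noncomputable def kinSobolevNorm {d : ℕ} (σ : ℝ) (M : ℕ) (f : Eucl d → Eucl d → ℝ) : ℝ :=
  kinNorm 0 σ M 1 f

/-- The Sobolev norm `‖u‖_σ`: for `λ = 0` the multiplier is `⟨k⟩^σ`. -/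
noncomputable def fluidSobolevNorm {d : ℕ} (σ : ℝ) (u : Eucl d → Eucl d) : ℝ :=
  fluidNorm 0 σ 1 u

/-- The norm `‖u‖_{W^{1,∞}} = ‖u‖_{L^∞} + ‖∇u‖_{L^∞}`. -/
noncomputable def lipNorm {d : ℕ} (u : Eucl d → Eucl d) : ℝ :=
  (eLpNorm u ⊤ volume).toReal + (eLpNorm (fderiv ℝ u) ⊤ volume).toReal

/-- `f ∈ 𝒢^{λ,σ,M,1/s}(𝕋^d × ℝ^d)`. The condition on `v^α f` makes the Fourier transforms in the
norm meaningful. -/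
structure IsKinGevrey {d : ℕ} (lam σ : ℝ) (M : ℕ) (s : ℝ) (f : Eucl d → Eucl d → ℝ) : Prop where
  smooth : ContDiff ℝ ∞ (fun p : Eucl d × Eucl d => f p.1 p.2)
  periodic : ∀ v, TorusPeriodic (fun x => f x v)
  memLp : ∀ α ∈ multiIndices d M, MemLp (fun p : Eucl d × Eucl d => vPowMul α f p.1 p.2) 2
    ((volume.restrict (torusCell d)).prod volume)
  finite : kinNormSq lam σ M s f < ⊤

/-- `u ∈ 𝒢^{λ,σ,1/s}(𝕋^d)`. -/
structure IsFluidGevrey {d : ℕ} (lam σ s : ℝ) (u : Eucl d → Eucl d) : Prop where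
  smooth : ContDiff ℝ ∞ u
  periodic : TorusPeriodic u
  finite : fluidNormSq lam σ s u < ⊤

/-- `f ∈ C(I; 𝒢^{λ,σ,M,1/s}(𝕋^d × ℝ^d))` for a time-dependent radius `λ(t)`: every `f(t)` is in the
class with radius `λ(t)`, and `t ↦ A(t) D_η^α \hat f(t)` is continuous into `L²(k, η)` for all
`|α| ≤ M`. -/
structure IsKinGevreyCurve {d : ℕ} (I : Set ℝ) (lam : ℝ → ℝ) (σ : ℝ) (M : ℕ) (s : ℝ)
    (f : ℝ → Eucl d → Eucl d → ℝ) : Prop where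
  mem : ∀ t ∈ I, IsKinGevrey (lam t) σ M s (f t)
  continuous : ∀ t₀ ∈ I, Tendsto
    (fun t => ∑ α ∈ multiIndices d M, ∑' k : Fin d → ℤ, ∫⁻ η : Eucl d,
      ‖kinMode (lam t) σ s α (f t) k η - kinMode (lam t₀) σ s α (f t₀) k η‖ₑ ^ 2)
    (𝓝[I] t₀) (𝓝 0)

/-- `u ∈ C(I; 𝒢^{λ,σ,1/s}(𝕋^d))` for a time-dependent radius `λ(t)`. -/
structure IsFluidGevreyCurve {d : ℕ} (I : Set ℝ) (lam : ℝ → ℝ) (σ s : ℝ)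
    (u : ℝ → Eucl d → Eucl d) : Prop where
  mem : ∀ t ∈ I, IsFluidGevrey (lam t) σ s (u t)
  continuous : ∀ t₀ ∈ I, Tendsto
    (fun t => ∑' k : Fin d → ℤ, ∑ j,
      ‖fluidMode (lam t) σ s (u t) k j - fluidMode (lam t₀) σ s (u t₀) k j‖ₑ ^ 2)
    (𝓝[I] t₀) (𝓝 0)

/-- `f` is a classical (jointly `C¹`) solution on the time interval `I` of the Vlasov equation
`∂_t f + v·∇_x f + ∇_v·[(u - v) f] = 0`. -/
structure IsVlasovSolution {d : ℕ} (I : Set ℝ) (u : ℝ → Eucl d → Eucl d)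
    (f : ℝ → Eucl d → Eucl d → ℝ) : Prop where
  contDiffOn : ContDiffOn ℝ 1 (fun p : ℝ × Eucl d × Eucl d => f p.1 p.2.1 p.2.2) (I ×ˢ univ)
  equation : ∀ t ∈ I, ∀ x v : Eucl d,
    derivWithin (fun τ => f τ x v) I t + fderiv ℝ (fun y => f t y v) x v +
      ∑ j, fderiv ℝ (fun w : Eucl d => (u t x j - w j) * f t x w) v (EuclideanSpace.single j 1) = 0

end VlasovGevrey

open VlasovGevrey

/-! Everything happens in Fourier variables, with the multiplier `A_k(η) = ⟨k,η⟩^σ e^{λ⟨k,η⟩^s}`.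
The equation is read as transport along the explicit flow `x' = v`, `v' = -v`, with source `d f -
u·∇_v f`. In frequency this flow dilates `η - k`, so `⟨k,η⟩` changes at relative rate at most 2. The
flow therefore costs a multiple of `‖f‖_{λ,σ}²`, plus `λ` times `‖f‖_{λ,σ+s/2}²` from
differentiating `e^{λξ^s}`. The derivative of the radius produces exactly the term with `λ'`.

Since `u` does not depend on `v`, the term `u_j ∂_{v_j} f` is a convolution in `k` alone: it
involves `û_{k-l} iη_j f̂_l(η)` with the same `η`. Tested against `A_k² f̂_k`, its symbol `iη_j
A_k²` splits into `iη_j A_k A_l` and the commutator `iη_j A_k (A_k - A_l)`. The former is purely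
imaginary and symmetric in `k, l`; because `u` is real it has vanishing real part
(`re_integral_triForm_eq_zero`). For the commutator, if `⟨k-l⟩ ≤ ⟨l,η⟩`, the mean value theorem
turns the factor `η_j` into `⟨k-l⟩`, which `û` can pay. If `⟨l,η⟩ ≤ ⟨k-l⟩`, the factor `η_j` is at
most the lower frequency `⟨l,η⟩` and no cancellation is needed. Subadditivity of `ξ ↦ ξ^s`
factorizes the exponentials. The inequalities `e^y ≤ 1 + y e^y` and `e^y ≤ 1 + y + y² e^y` trade
exponentials for Sobolev weights and powers of `λ`, and in the terms carrying a power of `λ` a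
factor `⟨k,η⟩^{s/2}` is placed on the output frequency. The outcome is `abs_cutWeight_sub_le`: five
products of weights (`majorant`) times a left-over decay `⟨k-l⟩^{-r} + ⟨l⟩^{-r}` with `r = σ - 2 -
s/2 > d/2`, square summable in either variable. A Young and Cauchy-Schwarz argument
(`trilinear_lintegral_le`) turns this into five products of norms (`triBound`). A derivative falling
on `v^α` gives a term without `η_j`, controlled by `weight_le_majorant`. The product `‖u‖_σ
‖f‖_{λ,σ}²` is brought to the required form by interpolation (`IsKinGevrey.kinNorm_sq_le`).

To justify the differentiation, `A` is replaced by a weight vanishing for `εξ² ≥ 1`, which leaves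
finitely many `k` and bounded `η`. A mode pulled back along the free flow is differentiable in `L²`,
because its source is continuous in time with values in `L²` (`eventually_flowMode_sub_le`). A
change of variables moves the flow onto the compactly supported weight (`integral_flowWeight_mul`),
so no derivative of `f̂` in `η` is ever taken. This gives the derivative of the truncated energy
(`hasDerivWithinAt_energy`). The commutator bounds are uniform in `ε`, hence these derivatives
converge jointly as `ε → 0` and `τ → t`. By `hasDerivWithinAt_of_tendsto` the full norm is then
genuinely differentiable, with the limiting derivative. -/

namespace VlasovGevrey

/-! ### The one-variable weight, its truncation and elementary exponential inequalities -/

/-- The weight `ξ^σ e^{λ ξ^s}`, so that `gevreyMul` is its value at the bracket. -/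
noncomputable def weight (lam σ s ξ : ℝ) : ℝ := ξ ^ σ * Real.exp (lam * ξ ^ s)

/-- A compactly supported `C¹` cutoff on the half line. -/
noncomputable def cutoff (y : ℝ) : ℝ := max 0 (1 - y) ^ 2

/-- The truncated weight; it equals `weight` for `ε = 0` and is bounded for `ε > 0`. -/
noncomputable def cutWeight (lam σ s ε ξ : ℝ) : ℝ := weight lam σ s ξ * cutoff (ε * ξ ^ 2)

/-- The logarithmic derivative `ξ ψ'(ξ) / weight` of the truncated weight `ψ`. -/
noncomputable def cutRate (lam σ s ε ξ : ℝ) : ℝ :=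
  (σ + lam * s * ξ ^ s) * cutoff (ε * ξ ^ 2) - 4 * (ε * ξ ^ 2) * max 0 (1 - ε * ξ ^ 2)

lemma gevreyMul_eq_weight {d : ℕ} (lam σ s : ℝ) (k : Fin d → ℤ) (η : Eucl d) :
    gevreyMul lam σ s k η = weight lam σ s (bracket k η) := rfl

lemma weight_pos {lam σ s ξ : ℝ} (h : 0 < ξ) : 0 < weight lam σ s ξ := by
  unfold weight; positivity

lemma weight_add {lam σ σ' s ξ : ℝ} (h : 0 < ξ) :
    weight lam (σ + σ') s ξ = ξ ^ σ' * weight lam σ s ξ := by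
  unfold weight; rw [Real.rpow_add h]; ring

lemma weight_zero (σ s ξ : ℝ) : weight 0 σ s ξ = ξ ^ σ := by simp [weight]

lemma cutoff_zero : cutoff 0 = 1 := by simp [cutoff]

lemma cutoff_nonneg (y : ℝ) : 0 ≤ cutoff y := by unfold cutoff; positivity

lemma cutoff_le_one {y : ℝ} (hy : 0 ≤ y) : cutoff y ≤ 1 := by
  unfold cutoff
  exact pow_le_one₀ (le_max_left _ _) (max_le zero_le_one (by linarith))

lemma cutoff_eq_zero {y : ℝ} (hy : 1 ≤ y) : cutoff y = 0 := by
  unfold cutoff; rw [max_eq_left (by linarith)]; simp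

lemma continuous_cutoff : Continuous cutoff := by unfold cutoff; fun_prop

lemma cutWeight_zero (lam σ s ξ : ℝ) : cutWeight lam σ s 0 ξ = weight lam σ s ξ := by
  simp [cutWeight, cutoff_zero]

lemma hasDerivAt_cutoff (y : ℝ) : HasDerivAt cutoff (-(2 * max 0 (1 - y))) y := by
  rcases lt_trichotomy y 1 with h | h | h
  · have h1 : HasDerivAt (fun y : ℝ => (1 - y) ^ 2) (-(2 * max 0 (1 - y))) y := by
      have := ((hasDerivAt_id y).const_sub 1).pow 2
      refine this.congr_deriv ?_
      rw [max_eq_right (by linarith)]; simp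
    refine h1.congr_of_eventuallyEq ?_
    filter_upwards [gt_mem_nhds h] with z hz
    simp only [cutoff]; rw [max_eq_right (by linarith)]
  -- At the junction point the cutoff is at most `(z - 1)²`, hence has derivative 0.
  · subst h
    rw [hasDerivAt_iff_isLittleO]
    refine Asymptotics.IsBigO.trans_isLittleO (g := fun z : ℝ => (z - 1) ^ 2) ?_ ?_
    · refine Asymptotics.IsBigO.of_bound 1 (Eventually.of_forall fun z => ?_)
      simp only [cutoff, sub_self, max_self, mul_zero, neg_zero, smul_zero, sub_zero, norm_pow,
        one_mul, ne_eq, OfNat.ofNat_ne_zero, not_false_eq_true, zero_pow]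
      gcongr
      rw [Real.norm_eq_abs, Real.norm_eq_abs, abs_of_nonneg (le_max_left _ _)]
      exact max_le (abs_nonneg _) (by rw [abs_sub_comm]; exact le_abs_self _)
    · simpa using Asymptotics.isLittleO_pow_sub_sub (1 : ℝ) (m := 2) (by norm_num)
  · have h1 : HasDerivAt (fun _ : ℝ => (0 : ℝ)) (-(2 * max 0 (1 - y))) y := by
      rw [max_eq_left (by linarith)]; simpa using hasDerivAt_const y (0 : ℝ)
    refine h1.congr_of_eventuallyEq ?_
    filter_upwards [lt_mem_nhds h] with z hz
    exact cutoff_eq_zero hz.le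

lemma hasDerivAt_weight (lam σ s : ℝ) {ξ : ℝ} (h : 0 < ξ) :
    HasDerivAt (weight lam σ s) (weight lam σ s ξ * (σ + lam * s * ξ ^ s) / ξ) ξ := by
  have h1 := (Real.hasDerivAt_rpow_const (x := ξ) (p := σ) (Or.inl h.ne'))
  have h2 := ((Real.hasDerivAt_rpow_const (x := ξ) (p := s) (Or.inl h.ne')).const_mul lam).exp
  refine (h1.mul h2).congr_deriv ?_
  unfold weight
  rw [Real.rpow_sub_one h.ne', Real.rpow_sub_one h.ne']
  field_simp

/-- The derivative is normalized by the untruncated weight: dividing by the truncated one would be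
singular where the cutoff vanishes. -/
lemma hasDerivAt_cutWeight (lam σ s ε : ℝ) {ξ : ℝ} (h : 0 < ξ) :
    HasDerivAt (cutWeight lam σ s ε) (weight lam σ s ξ * cutRate lam σ s ε ξ / ξ) ξ := by
  have h1 := hasDerivAt_weight lam σ s h
  have h2 := (hasDerivAt_cutoff (ε * ξ ^ 2)).comp ξ (((hasDerivAt_id ξ).pow 2).const_mul ε)
  refine (h1.mul h2).congr_deriv ?_
  simp only [Function.comp_apply, id, cutRate, Pi.pow_apply]
  field_simp
  ring

/-- The truncation enters only through `y = εξ²`, and `4y(1-y) ≤ 1`. The bound is thus uniform in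
`ε`, which the final limit relies on. -/
lemma abs_cutRate_le {lam σ s ε ξ : ℝ} (hl : 0 ≤ lam) (hσ : 0 ≤ σ) (hs : s ∈ Ioc (0 : ℝ) 1)
    (hε : 0 ≤ ε) (h : 0 < ξ) : |cutRate lam σ s ε ξ| ≤ σ + 1 + lam * ξ ^ s := by
  have hy : 0 ≤ ε * ξ ^ 2 := by positivity
  set y := ε * ξ ^ 2
  have h1 := cutoff_nonneg y
  have h2 := cutoff_le_one hy
  have h3 : 0 ≤ lam * ξ ^ s := by positivity
  have h4 : 0 ≤ 4 * y * max 0 (1 - y) := by positivity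
  have h5 : 4 * y * max 0 (1 - y) ≤ 1 := by
    rcases le_total (1 - y) 0 with h | h
    · rw [max_eq_left h]; simp
    · rw [max_eq_right h]; nlinarith [sq_nonneg (2 * y - 1)]
  have h6 : 0 ≤ lam * s * ξ ^ s := by have := hs.1; positivity
  have h7 : lam * s * ξ ^ s ≤ lam * ξ ^ s := by
    have : s * (lam * ξ ^ s) ≤ 1 * (lam * ξ ^ s) := by gcongr; exact hs.2
    linarith
  have h8 : (σ + lam * s * ξ ^ s) * cutoff y ≤ (σ + lam * s * ξ ^ s) * 1 := by gcongr
  have h9 : 0 ≤ (σ + lam * s * ξ ^ s) * cutoff y := by positivity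
  unfold cutRate
  rw [abs_le]; constructor <;> linarith

lemma cutWeight_nonneg {lam σ s ε ξ : ℝ} (h : 0 < ξ) : 0 ≤ cutWeight lam σ s ε ξ :=
  mul_nonneg (weight_pos h).le (cutoff_nonneg _)

lemma cutWeight_le {lam σ s ε ξ : ℝ} (hε : 0 ≤ ε) (h : 0 < ξ) :
    cutWeight lam σ s ε ξ ≤ weight lam σ s ξ := by
  unfold cutWeight
  exact mul_le_of_le_one_right (weight_pos h).le (cutoff_le_one (by positivity))

/-- Multiply `1 - y ≤ e^{-y}` by `e^y`. With `y = λξ^s` this trades an exponential weight for a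
Sobolev weight plus a term carrying a factor `λ`; iterating once gives the version with `λ²`. -/
lemma exp_le_one_add_mul_exp {y : ℝ} : Real.exp y ≤ 1 + y * Real.exp y := by
  have h := Real.add_one_le_exp (-y)
  have h2 : Real.exp (-y) * Real.exp y = 1 := by rw [← Real.exp_add]; simp
  nlinarith [Real.exp_pos y]

lemma exp_le_one_add_add_sq_mul_exp {y : ℝ} (hy : 0 ≤ y) :
    Real.exp y ≤ 1 + y + y ^ 2 * Real.exp y := by
  have h := exp_le_one_add_mul_exp (y := y)
  nlinarith

/-- The majorant of the commutator kernel, homogeneous in the weights at `a`, `b` and `c`. -/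
noncomputable def majorant (lam σ s a b c : ℝ) : ℝ :=
  c ^ σ * weight lam σ s b + lam * (c ^ σ * weight lam (σ + s / 2) s b * a ^ (s / 2)) +
    lam ^ 2 * (weight lam σ s c * weight lam (σ + s / 2) s b * a ^ (s / 2)) +
    lam ^ 2 * (weight lam (σ + s / 2) s c * weight lam σ s b * a ^ (s / 2)) +
    lam * (weight lam (σ + s / 2) s c * b ^ σ * a ^ (s / 2))

/-! ### Pointwise commutator bounds; `a`, `b`, `c` stand for `⟨k,η⟩`, `⟨l,η⟩`, `⟨k-l⟩` -/

section Kernel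

variable {lam σ s r a b c : ℝ} (hl : 0 ≤ lam) (hs : s ∈ Ioc (0 : ℝ) 1) (hr : 0 ≤ r)
  (hσ : σ = r + (2 + s / 2)) (ha : 1 ≤ a) (hb : 1 ≤ b) (hc : 1 ≤ c)

include hl ha hb hc in
lemma majorant_nonneg : 0 ≤ majorant lam σ s a b c := by
  have := weight_pos (lam := lam) (σ := σ) (s := s) (ξ := b) (by linarith)
  have := weight_pos (lam := lam) (σ := σ) (s := s) (ξ := c) (by linarith)
  have := weight_pos (lam := lam) (σ := σ + s / 2) (s := s) (ξ := b) (by linarith)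
  have := weight_pos (lam := lam) (σ := σ + s / 2) (s := s) (ξ := c) (by linarith)
  unfold majorant; positivity

include hl hs hσ ha hb hc in
-- Meant for `c ≤ b`, where `c` is the gain of the mean value theorem. Write `c^σ = c^r c^{2+s/2}`:
-- the second factor pays for `c` and for the powers of `c^s` that appear when `e^{λc^s}` is
-- expanded to second order, the first is cancelled by `c^{-r}`. The three terms of the expansion
-- match the first, second and fourth terms of the majorant.
lemma low_frequency_le :
    c * (b ^ σ * Real.exp (lam * b ^ s) * Real.exp (lam * c ^ s)) ≤
      c ^ (-r) * majorant lam σ s a b c := by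
  obtain ⟨hs0, hs1⟩ := hs
  have hc0 : 0 < c := by linarith
  have hb0 : 0 < b := by linarith
  have hwb := weight_pos (lam := lam) (σ := σ) (s := s) hb0
  have hwc := weight_pos (lam := lam) (σ := σ) (s := s) hc0
  have e1 : c ^ σ = c ^ r * c ^ (2 + s / 2) := by rw [hσ, Real.rpow_add hc0]
  have e2 : c ^ (-r) * c ^ r = 1 := by rw [← Real.rpow_add hc0]; simp
  have p1 : c ≤ c ^ (2 + s / 2) := by
    conv_lhs => rw [← Real.rpow_one c]
    exact Real.rpow_le_rpow_of_exponent_le hc (by linarith)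
  have p2 : c * c ^ s ≤ c ^ (2 + s / 2) := by
    rw [mul_comm, ← Real.rpow_add_one hc0.ne']
    exact Real.rpow_le_rpow_of_exponent_le hc (by linarith)
  -- The exponents compare because `1 + 2s ≤ 2 + s`; this is where `s ≤ 1` is sharp.
  have p3 : c * c ^ s * c ^ s ≤ c ^ (2 + s / 2) * c ^ (s / 2) := by
    rw [mul_comm c, ← Real.rpow_add_one hc0.ne', ← Real.rpow_add hc0, ← Real.rpow_add hc0]
    exact Real.rpow_le_rpow_of_exponent_le hc (by linarith)
  have qa : 1 ≤ a ^ (s / 2) := Real.one_le_rpow ha (by linarith)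
  have qb : 1 ≤ b ^ (s / 2) := Real.one_le_rpow hb (by linarith)
  have hE := exp_le_one_add_add_sq_mul_exp (y := lam * c ^ s) (by positivity)
  have key : c ^ (-r) * majorant lam σ s a b c ≥ c ^ (2 + s / 2) * weight lam σ s b +
      lam * (c ^ (2 + s / 2) * (b ^ (s / 2) * weight lam σ s b) * a ^ (s / 2)) +
      lam ^ 2 * (c ^ (2 + s / 2) * c ^ (s / 2) * Real.exp (lam * c ^ s) *
        weight lam σ s b * a ^ (s / 2)) := by
    have hm : majorant lam σ s a b c ≥ c ^ σ * weight lam σ s b +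
        lam * (c ^ σ * weight lam (σ + s / 2) s b * a ^ (s / 2)) +
        lam ^ 2 * (weight lam (σ + s / 2) s c * weight lam σ s b * a ^ (s / 2)) := by
      have h1 : 0 ≤ lam ^ 2 * (weight lam σ s c * weight lam (σ + s / 2) s b * a ^ (s / 2)) := by
        rw [weight_add hb0]; positivity
      have h2 : 0 ≤ lam * (weight lam (σ + s / 2) s c * b ^ σ * a ^ (s / 2)) := by
        rw [weight_add hc0]; positivity
      unfold majorant; linarith
    have h0 : 0 ≤ c ^ (-r) := by positivity
    refine le_trans (le_of_eq ?_) (mul_le_mul_of_nonneg_left hm h0)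
    rw [weight_add hb0, weight_add hc0]
    have : weight lam σ s c = c ^ r * c ^ (2 + s / 2) * Real.exp (lam * c ^ s) := by
      rw [weight, e1]
    rw [this, e1]
    linear_combination (-(c ^ (2 + s / 2) * weight lam σ s b +
      lam * (c ^ (2 + s / 2) * (b ^ (s / 2) * weight lam σ s b) * a ^ (s / 2)) +
      lam ^ 2 * (c ^ (2 + s / 2) * c ^ (s / 2) * Real.exp (lam * c ^ s) *
        weight lam σ s b * a ^ (s / 2)))) * e2
  refine le_trans ?_ key
  change c * (weight lam σ s b * Real.exp (lam * c ^ s)) ≤ _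
  calc c * (weight lam σ s b * Real.exp (lam * c ^ s))
      ≤ c * (weight lam σ s b * (1 + lam * c ^ s +
          (lam * c ^ s) ^ 2 * Real.exp (lam * c ^ s))) := by gcongr
    _ = c * weight lam σ s b * 1 + lam * ((c * c ^ s) * (1 * weight lam σ s b) * 1) +
        lam ^ 2 * (c * c ^ s * c ^ s * Real.exp (lam * c ^ s) * weight lam σ s b * 1) := by ring
    _ ≤ c ^ (2 + s / 2) * weight lam σ s b * 1 +
      lam * (c ^ (2 + s / 2) * (b ^ (s / 2) * weight lam σ s b) * a ^ (s / 2)) +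
      lam ^ 2 * (c ^ (2 + s / 2) * c ^ (s / 2) * Real.exp (lam * c ^ s) *
        weight lam σ s b * a ^ (s / 2)) := by gcongr
    _ = _ := by rw [mul_one]

/-- Subadditivity of `t ↦ t^{s/2}`, followed by `x + y ≤ 2xy` for `x, y ≥ 1`. It moves half of a
loss of `s` derivatives from one input frequency to the output and the other input. -/
lemma rpow_half_le_two_mul (hs : s ∈ Ioc (0 : ℝ) 1) (ha : 1 ≤ a) (hb : 1 ≤ b)
    (habc : c ≤ a + b) (hc0 : 0 ≤ c) : c ^ (s / 2) ≤ 2 * (a ^ (s / 2) * b ^ (s / 2)) := by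
  obtain ⟨hs0, hs1⟩ := hs
  have qa : 1 ≤ a ^ (s / 2) := Real.one_le_rpow ha (by linarith)
  have qb : 1 ≤ b ^ (s / 2) := Real.one_le_rpow hb (by linarith)
  have h1 : c ^ (s / 2) ≤ (a + b) ^ (s / 2) :=
    Real.rpow_le_rpow hc0 habc (by linarith)
  have h2 : (a + b) ^ (s / 2) ≤ a ^ (s / 2) + b ^ (s / 2) :=
    Real.rpow_add_le_add_rpow (by linarith) (by linarith) (by linarith) (by linarith)
  nlinarith

include hl hs hσ ha hb hc in
-- The extra factor `λb^s` comes from differentiating `e^{λξ^s}`. Half of `b^s` stays on `b`, the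
-- other half is moved to `a` and `c`. One power of `λ` is already present, so a first order
-- expansion of `e^{λc^s}` suffices; it lands in the second and third terms of the majorant.
lemma low_frequency_loss_le (habc : b ≤ a + c) :
    c * (lam * b ^ s) * (b ^ σ * Real.exp (lam * b ^ s) * Real.exp (lam * c ^ s)) ≤
      2 * (c ^ (-r) * majorant lam σ s a b c) := by
  have hhalf := rpow_half_le_two_mul hs ha hc habc (by linarith)
  obtain ⟨hs0, hs1⟩ := hs
  have hc0 : 0 < c := by linarith
  have hb0 : 0 < b := by linarith
  have hwb := weight_pos (lam := lam) (σ := σ) (s := s) hb0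
  have hwc := weight_pos (lam := lam) (σ := σ) (s := s) hc0
  have e1 : c ^ σ = c ^ r * c ^ (2 + s / 2) := by rw [hσ, Real.rpow_add hc0]
  have e2 : c ^ (-r) * c ^ r = 1 := by rw [← Real.rpow_add hc0]; simp
  have p1 : c * c ^ (s / 2) ≤ c ^ (2 + s / 2) := by
    rw [mul_comm, ← Real.rpow_add_one hc0.ne']
    exact Real.rpow_le_rpow_of_exponent_le hc (by linarith)
  have p2 : c * c ^ (s / 2) * c ^ s ≤ c ^ (2 + s / 2) := by
    rw [mul_comm c, ← Real.rpow_add_one hc0.ne', ← Real.rpow_add hc0]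
    exact Real.rpow_le_rpow_of_exponent_le hc (by linarith)
  have qa : 1 ≤ a ^ (s / 2) := Real.one_le_rpow ha (by linarith)
  have hE := exp_le_one_add_mul_exp (y := lam * c ^ s)
  have key : c ^ (-r) * majorant lam σ s a b c ≥
      lam * (c ^ (2 + s / 2) * (b ^ (s / 2) * weight lam σ s b) * a ^ (s / 2)) +
      lam ^ 2 * (c ^ (2 + s / 2) * Real.exp (lam * c ^ s) *
        (b ^ (s / 2) * weight lam σ s b) * a ^ (s / 2)) := by
    have hm : majorant lam σ s a b c ≥
        lam * (c ^ σ * weight lam (σ + s / 2) s b * a ^ (s / 2)) +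
        lam ^ 2 * (weight lam σ s c * weight lam (σ + s / 2) s b * a ^ (s / 2)) := by
      have h1 : 0 ≤ lam ^ 2 * (weight lam (σ + s / 2) s c * weight lam σ s b * a ^ (s / 2)) := by
        rw [weight_add hc0]; positivity
      have h2 : 0 ≤ lam * (weight lam (σ + s / 2) s c * b ^ σ * a ^ (s / 2)) := by
        rw [weight_add hc0]; positivity
      have h3 : 0 ≤ c ^ σ * weight lam σ s b := by positivity
      unfold majorant; linarith
    have h0 : 0 ≤ c ^ (-r) := by positivity
    refine le_trans (le_of_eq ?_) (mul_le_mul_of_nonneg_left hm h0)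
    rw [weight_add hb0]
    have : weight lam σ s c = c ^ r * c ^ (2 + s / 2) * Real.exp (lam * c ^ s) := by
      rw [weight, e1]
    rw [this, e1]
    linear_combination (-(lam * (c ^ (2 + s / 2) * (b ^ (s / 2) * weight lam σ s b) *
        a ^ (s / 2)) +
      lam ^ 2 * (c ^ (2 + s / 2) * Real.exp (lam * c ^ s) *
        (b ^ (s / 2) * weight lam σ s b) * a ^ (s / 2)))) * e2
  refine le_trans ?_ (mul_le_mul_of_nonneg_left key zero_le_two)
  have eb : b ^ s = b ^ (s / 2) * b ^ (s / 2) := by rw [← Real.rpow_add hb0]; ring_nf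
  change c * (lam * b ^ s) * (weight lam σ s b * Real.exp (lam * c ^ s)) ≤ _
  calc c * (lam * b ^ s) * (weight lam σ s b * Real.exp (lam * c ^ s))
      = c * (lam * (b ^ (s / 2) * b ^ (s / 2))) * (weight lam σ s b * Real.exp (lam * c ^ s)) := by
        rw [eb]
    _ ≤ c * (lam * ((2 * (a ^ (s / 2) * c ^ (s / 2))) * b ^ (s / 2))) *
          (weight lam σ s b * (1 + lam * c ^ s * Real.exp (lam * c ^ s))) := by gcongr
    _ = 2 * (lam * ((c * c ^ (s / 2)) * (b ^ (s / 2) * weight lam σ s b) * a ^ (s / 2)) +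
        lam ^ 2 * ((c * c ^ (s / 2) * c ^ s) * Real.exp (lam * c ^ s) *
          (b ^ (s / 2) * weight lam σ s b) * a ^ (s / 2))) := by ring
    _ ≤ _ := by gcongr

include hl hs hσ ha hb hc in
-- Meant for `b ≤ c`, where `u` carries the high frequency. The exponential `e^{λc^s}` is expanded
-- once. In the resulting term with `λ`, half of `c^s` is moved to `a` and `b`, and there alone
-- `e^{λb^s}` is expanded as well. This is what leaves a pure Sobolev weight on `b` in the last term
-- of the majorant.
lemma high_frequency_le (habc : c ≤ a + b) :
    b * (c ^ σ * Real.exp (lam * b ^ s) * Real.exp (lam * c ^ s)) ≤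
      2 * (b ^ (-r) * majorant lam σ s a b c) := by
  have hhalf := rpow_half_le_two_mul hs ha hb habc (by linarith)
  obtain ⟨hs0, hs1⟩ := hs
  have hc0 : 0 < c := by linarith
  have hb0 : 0 < b := by linarith
  have hwb := weight_pos (lam := lam) (σ := σ) (s := s) hb0
  have hwc := weight_pos (lam := lam) (σ := σ) (s := s) hc0
  have e1 : b ^ σ = b ^ r * b ^ (2 + s / 2) := by rw [hσ, Real.rpow_add hb0]
  have e2 : b ^ (-r) * b ^ r = 1 := by rw [← Real.rpow_add hb0]; simp
  have p1 : b ≤ b ^ (2 + s / 2) := by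
    conv_lhs => rw [← Real.rpow_one b]
    exact Real.rpow_le_rpow_of_exponent_le hb (by linarith)
  have p2 : b * b ^ (s / 2) ≤ b ^ (2 + s / 2) := by
    rw [mul_comm, ← Real.rpow_add_one hb0.ne']
    exact Real.rpow_le_rpow_of_exponent_le hb (by linarith)
  have p3 : b * b ^ (s / 2) * b ^ s ≤ b ^ (2 + s / 2) := by
    rw [mul_comm b, ← Real.rpow_add_one hb0.ne', ← Real.rpow_add hb0]
    exact Real.rpow_le_rpow_of_exponent_le hb (by linarith)
  have qa : 1 ≤ a ^ (s / 2) := Real.one_le_rpow ha (by linarith)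
  have hE := exp_le_one_add_mul_exp (y := lam * c ^ s)
  have hE' := exp_le_one_add_mul_exp (y := lam * b ^ s)
  have key : b ^ (-r) * majorant lam σ s a b c ≥
      b ^ (2 + s / 2) * (c ^ σ * Real.exp (lam * b ^ s)) +
      lam ^ 2 * (b ^ (2 + s / 2) * Real.exp (lam * b ^ s) *
        (c ^ (s / 2) * weight lam σ s c) * a ^ (s / 2)) +
      lam * (b ^ (2 + s / 2) * (c ^ (s / 2) * weight lam σ s c) * a ^ (s / 2)) := by
    have hm : majorant lam σ s a b c ≥ c ^ σ * weight lam σ s b +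
        lam ^ 2 * (weight lam (σ + s / 2) s c * weight lam σ s b * a ^ (s / 2)) +
        lam * (weight lam (σ + s / 2) s c * b ^ σ * a ^ (s / 2)) := by
      have h1 : 0 ≤ lam ^ 2 * (weight lam σ s c * weight lam (σ + s / 2) s b * a ^ (s / 2)) := by
        rw [weight_add hb0]; positivity
      have h2 : 0 ≤ lam * (c ^ σ * weight lam (σ + s / 2) s b * a ^ (s / 2)) := by
        rw [weight_add hb0]; positivity
      unfold majorant; linarith
    have h0 : 0 ≤ b ^ (-r) := by positivity
    refine le_trans (le_of_eq ?_) (mul_le_mul_of_nonneg_left hm h0)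
    rw [weight_add hc0]
    have : weight lam σ s b = b ^ r * b ^ (2 + s / 2) * Real.exp (lam * b ^ s) := by
      rw [weight, e1]
    rw [this, e1]
    linear_combination (-(b ^ (2 + s / 2) * (c ^ σ * Real.exp (lam * b ^ s)) +
      lam ^ 2 * (b ^ (2 + s / 2) * Real.exp (lam * b ^ s) *
        (c ^ (s / 2) * weight lam σ s c) * a ^ (s / 2)) +
      lam * (b ^ (2 + s / 2) * (c ^ (s / 2) * weight lam σ s c) * a ^ (s / 2)))) * e2
  refine le_trans ?_ (mul_le_mul_of_nonneg_left key zero_le_two)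
  have ec : c ^ s = c ^ (s / 2) * c ^ (s / 2) := by rw [← Real.rpow_add hc0]; ring_nf
  calc b * (c ^ σ * Real.exp (lam * b ^ s) * Real.exp (lam * c ^ s))
      ≤ b * (c ^ σ * Real.exp (lam * b ^ s) * (1 + lam * c ^ s * Real.exp (lam * c ^ s))) := by
        gcongr
    _ = b * (c ^ σ * Real.exp (lam * b ^ s)) + (lam * (b * (c ^ (s / 2) * weight lam σ s c))) *
          (c ^ (s / 2) * Real.exp (lam * b ^ s)) := by rw [weight, ec]; ring
    _ ≤ b * (c ^ σ * Real.exp (lam * b ^ s)) + (lam * (b * (c ^ (s / 2) * weight lam σ s c))) *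
          ((2 * (a ^ (s / 2) * b ^ (s / 2))) * (1 + lam * b ^ s * Real.exp (lam * b ^ s))) := by
        gcongr
    _ = b * (c ^ σ * Real.exp (lam * b ^ s)) +
        2 * (lam ^ 2 * ((b * b ^ (s / 2) * b ^ s) * Real.exp (lam * b ^ s) *
          (c ^ (s / 2) * weight lam σ s c) * a ^ (s / 2)) +
        lam * ((b * b ^ (s / 2)) * (c ^ (s / 2) * weight lam σ s c) * a ^ (s / 2))) := by ring
    _ ≤ b ^ (2 + s / 2) * (c ^ σ * Real.exp (lam * b ^ s)) +
        2 * (lam ^ 2 * (b ^ (2 + s / 2) * Real.exp (lam * b ^ s) *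
          (c ^ (s / 2) * weight lam σ s c) * a ^ (s / 2)) +
        lam * (b ^ (2 + s / 2) * (c ^ (s / 2) * weight lam σ s c) * a ^ (s / 2))) := by gcongr
    _ ≤ _ := by
      have : 0 ≤ b ^ (2 + s / 2) * (c ^ σ * Real.exp (lam * b ^ s)) := by positivity
      linarith

include hl hs hr hσ in
-- As `s ≤ 1`, `ξ^s ≤ b^s + c^s`, so the exponential factorizes; since `ξ ≤ 2m`, the polynomial
-- factor costs `2^σ`.
lemma weight_le_of_le_add {ξ m : ℝ} (hξ : 0 ≤ ξ) (hb : 0 ≤ b) (hc : 0 ≤ c) (h : ξ ≤ b + c)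
    (hbm : b ≤ m) (hcm : c ≤ m) :
    weight lam σ s ξ ≤ 2 ^ σ * (m ^ σ * Real.exp (lam * b ^ s) * Real.exp (lam * c ^ s)) := by
  obtain ⟨hs0, hs1⟩ := hs
  have h1 : ξ ^ s ≤ b ^ s + c ^ s := (Real.rpow_le_rpow hξ h hs0.le).trans
    (Real.rpow_add_le_add_rpow hb hc hs0.le hs1)
  have h2 : ξ ^ σ ≤ 2 ^ σ * m ^ σ := by
    rw [← Real.mul_rpow (by norm_num) (by linarith)]
    exact Real.rpow_le_rpow hξ (by linarith) (by linarith)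
  have hm : 0 ≤ m := by linarith
  unfold weight
  calc ξ ^ σ * Real.exp (lam * ξ ^ s)
      ≤ (2 ^ σ * m ^ σ) * Real.exp (lam * (b ^ s + c ^ s)) := by gcongr
    _ = _ := by rw [mul_add, Real.exp_add]; ring

include hl hs hr hσ ha hb hc in
-- For the term in which a derivative has hit `v^α`: no factor `η_j` is present, so the size of the
-- weight suffices and no cancellation is needed. Inserting the factor `c ≥ 1` or `b ≥ 1` reduces it
-- to the two frequency regimes above.
lemma weight_le_majorant (habc : a ≤ b + c) (hcab : c ≤ a + b) :
    weight lam σ s a ≤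
      (σ + 10) * 2 ^ σ * ((c ^ (-r) + b ^ (-r)) * majorant lam σ s a b c) := by
  have hmaj := majorant_nonneg (σ := σ) (s := s) hl ha hb hc
  have hs0 := hs.1
  have hcr : 0 ≤ c ^ (-r) := by positivity
  have hbr : 0 ≤ b ^ (-r) := by positivity
  have hσ0 : 0 ≤ σ := by rw [hσ]; linarith
  have hbM : 0 ≤ b ^ (-r) * majorant lam σ s a b c := by positivity
  have hcM : 0 ≤ c ^ (-r) * majorant lam σ s a b c := by positivity
  have fin : ∀ t : ℝ, weight lam σ s a ≤ 2 ^ σ * t →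
      t ≤ 2 * (c ^ (-r) * majorant lam σ s a b c) + 2 * (b ^ (-r) * majorant lam σ s a b c) →
      weight lam σ s a ≤
        (σ + 10) * 2 ^ σ * ((c ^ (-r) + b ^ (-r)) * majorant lam σ s a b c) := by
    intro t h1 h2
    refine h1.trans ?_
    calc 2 ^ σ * t ≤ 2 ^ σ * (2 * ((c ^ (-r) + b ^ (-r)) * majorant lam σ s a b c)) := by
          gcongr; linarith
      _ ≤ 2 ^ σ * ((σ + 10) * ((c ^ (-r) + b ^ (-r)) * majorant lam σ s a b c)) := by
          gcongr; linarith
      _ = _ := by ring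
  rcases le_total c b with h | h
  · refine fin _ (weight_le_of_le_add hl hs hr hσ (by linarith) (by linarith) (by linarith)
      habc le_rfl h) ?_
    have h1 := low_frequency_le hl hs hσ ha hb hc
    have h2 : b ^ σ * Real.exp (lam * b ^ s) * Real.exp (lam * c ^ s) ≤
      c * (b ^ σ * Real.exp (lam * b ^ s) * Real.exp (lam * c ^ s)) :=
      le_mul_of_one_le_left (by positivity) hc
    linarith
  · refine fin _ (weight_le_of_le_add hl hs hr hσ (by linarith) (by linarith) (by linarith)
      habc h le_rfl) ?_
    have h1 := high_frequency_le hl hs hσ ha hb hc hcab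
    have h2 : c ^ σ * Real.exp (lam * b ^ s) * Real.exp (lam * c ^ s) ≤
      b * (c ^ σ * Real.exp (lam * b ^ s) * Real.exp (lam * c ^ s)) :=
      le_mul_of_one_le_left (by positivity) hb
    linarith

include hl hs hr hσ ha hb hc in
-- The commutator estimate, with `m` in the role of `|η_j|`. For `c ≤ b` it is the mean value
-- theorem on the segment between `a` and `b`, of length at most `c`. For `b ≤ c` both weights are
-- bounded separately and `m ≤ b` is absorbed by the low frequency.
lemma abs_cutWeight_sub_le {ε m : ℝ} (hε : 0 ≤ ε) (hma : m ≤ a) (hmb : m ≤ b)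
    (habc : a ≤ b + c) (hbac : b ≤ a + c) (hcab : c ≤ a + b) :
    m * |cutWeight lam σ s ε a - cutWeight lam σ s ε b| ≤
      (σ + 10) * 2 ^ σ * ((c ^ (-r) + b ^ (-r)) * majorant lam σ s a b c) := by
  have hmaj := majorant_nonneg (σ := σ) (s := s) hl ha hb hc
  have hs' := hs
  obtain ⟨hs0, hs1⟩ := hs'
  have hcr : 0 ≤ c ^ (-r) := by positivity
  have hbr : 0 ≤ b ^ (-r) := by positivity
  have hσ0 : 0 ≤ σ := by rw [hσ]; linarith
  have hbM : 0 ≤ b ^ (-r) * majorant lam σ s a b c := by positivity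
  have hcM : 0 ≤ c ^ (-r) * majorant lam σ s a b c := by positivity
  have h2σ : (0 : ℝ) < 2 ^ σ := by positivity
  have ha0 : 0 < a := by linarith
  have hb0 : 0 < b := by linarith
  rcases le_total c b with h | h
  · set t := b ^ σ * Real.exp (lam * b ^ s) * Real.exp (lam * c ^ s) with ht
    have ht0 : 0 ≤ t := by positivity
    have hq : 0 < min a b := lt_min ha0 hb0
    have hder : ∀ ξ ∈ uIcc a b, ‖weight lam σ s ξ * cutRate lam σ s ε ξ / ξ‖ ≤
        (σ + 1 + 2 * (lam * b ^ s)) * (2 ^ σ * t) / min a b := by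
      intro ξ hξ
      have hξ1 : min a b ≤ ξ := hξ.1
      have hξ2 : ξ ≤ b + c := hξ.2.trans (max_le habc (by linarith))
      have hξ0 : 0 < ξ := hq.trans_le hξ1
      have h1 := weight_le_of_le_add hl hs hr hσ hξ0.le hb0.le (by linarith) hξ2 le_rfl h
      have h2 := abs_cutRate_le hl hσ0 hs hε hξ0
      have h3 : ξ ^ s ≤ 2 * b ^ s := by
        have : ξ ^ s ≤ b ^ s + c ^ s := (Real.rpow_le_rpow hξ0.le hξ2 hs0.le).trans
          (Real.rpow_add_le_add_rpow hb0.le (by linarith) hs0.le hs1)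
        have : c ^ s ≤ b ^ s := Real.rpow_le_rpow (by linarith) h hs0.le
        linarith
      have hw := weight_pos (lam := lam) (σ := σ) (s := s) hξ0
      rw [norm_div, norm_mul, Real.norm_eq_abs, Real.norm_eq_abs, Real.norm_eq_abs,
        abs_of_pos hξ0, abs_of_pos hw, mul_comm]
      have h4 : |cutRate lam σ s ε ξ| ≤ σ + 1 + 2 * (lam * b ^ s) := by
        refine h2.trans ?_
        have : lam * ξ ^ s ≤ lam * (2 * b ^ s) := by gcongr
        linarith
      gcongr
    have hmv := Convex.norm_image_sub_le_of_norm_hasDerivWithin_le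
      (f := cutWeight lam σ s ε) (s := uIcc a b) (x := b) (y := a)
      (fun ξ hξ => (hasDerivAt_cutWeight lam σ s ε (hq.trans_le hξ.1)).hasDerivWithinAt)
      hder (convex_uIcc a b) right_mem_uIcc left_mem_uIcc
    rw [Real.norm_eq_abs, Real.norm_eq_abs] at hmv
    have hab : |a - b| ≤ c := abs_le.2 ⟨by linarith, by linarith⟩
    have hmin : m ≤ min a b := le_min hma hmb
    have hA : 0 ≤ (σ + 1 + 2 * (lam * b ^ s)) * (2 ^ σ * t) := by positivity
    have l1 := low_frequency_le hl hs hσ ha hb hc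
    have l2 := low_frequency_loss_le hl hs hσ ha hb hc hbac
    rw [← ht] at l1 l2
    -- The factor `m ≤ min a b` cancels the `1/ξ` of the logarithmic derivative, leaving only the
    -- increment `c`.
    calc m * |cutWeight lam σ s ε a - cutWeight lam σ s ε b|
        ≤ min a b * ((σ + 1 + 2 * (lam * b ^ s)) * (2 ^ σ * t) / min a b * c) := by
          gcongr
          exact hmv.trans (by gcongr)
      _ = 2 ^ σ * ((σ + 1) * (c * t) + 2 * (c * (lam * b ^ s) * t)) := by
          field_simp
      _ ≤ 2 ^ σ * ((σ + 1) * (c ^ (-r) * majorant lam σ s a b c) +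
            2 * (2 * (c ^ (-r) * majorant lam σ s a b c))) := by gcongr
      _ ≤ 2 ^ σ * ((σ + 10) * (c ^ (-r) * majorant lam σ s a b c +
            b ^ (-r) * majorant lam σ s a b c)) := by
          gcongr
          nlinarith [mul_nonneg hσ0 hbM]
      _ = _ := by ring
  · have hwa := weight_le_of_le_add hl hs hr hσ ha0.le hb0.le (by linarith) habc h le_rfl
    have hwb := weight_le_of_le_add hl hs hr hσ hb0.le hb0.le (by linarith)
      (by linarith : b ≤ b + c) h le_rfl
    have h1 := cutWeight_nonneg (lam := lam) (σ := σ) (s := s) (ε := ε) ha0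
    have h2 := cutWeight_nonneg (lam := lam) (σ := σ) (s := s) (ε := ε) hb0
    have h3 := cutWeight_le (lam := lam) (σ := σ) (s := s) hε ha0
    have h4 := cutWeight_le (lam := lam) (σ := σ) (s := s) hε hb0
    have h5 := high_frequency_le hl hs hσ ha hb hc hcab
    set t := c ^ σ * Real.exp (lam * b ^ s) * Real.exp (lam * c ^ s) with ht
    have ht0 : 0 ≤ t := by positivity
    calc m * |cutWeight lam σ s ε a - cutWeight lam σ s ε b| ≤ b * (2 ^ σ * t) := by
          gcongr
          exact abs_le.2 ⟨by linarith, by linarith⟩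
      _ = 2 ^ σ * (b * t) := by ring
      _ ≤ 2 ^ σ * (2 * (b ^ (-r) * majorant lam σ s a b c)) := by gcongr
      _ ≤ 2 ^ σ * ((σ + 10) * (c ^ (-r) * majorant lam σ s a b c +
            b ^ (-r) * majorant lam σ s a b c)) := by
          gcongr
          · linarith
          · linarith
      _ = _ := by ring

include hl hs ha hb hc in
-- A crude bound with a polynomial in `λ`, used only to dominate the kernels when the truncation is
-- removed; the quantitative estimate keeps the five terms apart.
lemma majorant_le :
    majorant lam σ s a b c ≤ (1 + 2 * lam + 2 * lam ^ 2) *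
      (a ^ (s / 2) * weight lam (σ + s / 2) s b * weight lam (σ + s / 2) s c) := by
  obtain ⟨hs0, hs1⟩ := hs
  have key : ∀ ξ : ℝ, 1 ≤ ξ → ξ ^ σ ≤ weight lam σ s ξ ∧
      weight lam σ s ξ ≤ weight lam (σ + s / 2) s ξ := by
    intro ξ hξ
    have h0 : 0 < ξ := by linarith
    refine ⟨?_, ?_⟩
    · unfold weight
      exact le_mul_of_one_le_right (by positivity) (Real.one_le_exp (by positivity))
    · rw [weight_add h0]
      exact le_mul_of_one_le_left (weight_pos h0).le (Real.one_le_rpow hξ (by linarith))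
  obtain ⟨b1, b2⟩ := key b hb
  obtain ⟨c1, c2⟩ := key c hc
  have qa : 1 ≤ a ^ (s / 2) := Real.one_le_rpow ha (by linarith)
  have hwb := weight_pos (lam := lam) (σ := σ) (s := s) (ξ := b) (by linarith)
  have hwc := weight_pos (lam := lam) (σ := σ) (s := s) (ξ := c) (by linarith)
  have b3 := b1.trans b2
  have c3 := c1.trans c2
  have b4 := hwb.trans_le b2
  have c4 := hwc.trans_le c2
  set Wb := weight lam (σ + s / 2) s b
  set Wc := weight lam (σ + s / 2) s c
  unfold majorant
  have hbσ : 0 ≤ b ^ σ := by positivity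
  calc c ^ σ * weight lam σ s b + lam * (c ^ σ * Wb * a ^ (s / 2)) +
    lam ^ 2 * (weight lam σ s c * Wb * a ^ (s / 2)) +
    lam ^ 2 * (Wc * weight lam σ s b * a ^ (s / 2)) +
    lam * (Wc * b ^ σ * a ^ (s / 2))
      = c ^ σ * weight lam σ s b * 1 + lam * (c ^ σ * Wb * a ^ (s / 2)) +
    lam ^ 2 * (weight lam σ s c * Wb * a ^ (s / 2)) +
    lam ^ 2 * (Wc * weight lam σ s b * a ^ (s / 2)) +
    lam * (Wc * b ^ σ * a ^ (s / 2)) := by ring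
    _ ≤ Wc * Wb * a ^ (s / 2) + lam * (Wc * Wb * a ^ (s / 2)) +
    lam ^ 2 * (Wc * Wb * a ^ (s / 2)) +
    lam ^ 2 * (Wc * Wb * a ^ (s / 2)) +
    lam * (Wc * Wb * a ^ (s / 2)) := by gcongr
    _ = _ := by ring

end Kernel

end VlasovGevrey

namespace VlasovGevrey

/-! ### Triangle inequalities for the bracket and summability over the lattice -/

section Bracket

variable {d : ℕ}

lemma bracket_sq (k : Fin d → ℤ) (η : Eucl d) :
    bracket k η ^ 2 = 1 + ∑ i, (k i : ℝ) ^ 2 + ‖η‖ ^ 2 := by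
  unfold bracket; rw [Real.sq_sqrt (by positivity)]

lemma one_le_bracket (k : Fin d → ℤ) (η : Eucl d) : 1 ≤ bracket k η := by
  unfold bracket
  rw [Real.one_le_sqrt]
  have : 0 ≤ ∑ i, (k i : ℝ) ^ 2 := by positivity
  nlinarith [sq_nonneg ‖η‖]

lemma bracket_pos (k : Fin d → ℤ) (η : Eucl d) : 0 < bracket k η :=
  zero_lt_one.trans_le (one_le_bracket k η)

lemma norm_le_bracket (k : Fin d → ℤ) (η : Eucl d) : ‖η‖ ≤ bracket k η := by
  refine Real.le_sqrt_of_sq_le ?_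
  have : 0 ≤ ∑ i, (k i : ℝ) ^ 2 := by positivity
  linarith

lemma bracket_zero_le (k : Fin d → ℤ) (η : Eucl d) : bracket k 0 ≤ bracket k η := by
  refine Real.sqrt_le_sqrt ?_
  simp

/-- The lattice point `k` as a Euclidean vector. -/
noncomputable def intVec (k : Fin d → ℤ) : Eucl d := WithLp.toLp 2 fun i => (k i : ℝ)

@[simp] lemma intVec_apply (k : Fin d → ℤ) (i : Fin d) : intVec k i = k i := rfl

lemma norm_intVec_sq (k : Fin d → ℤ) : ‖intVec k‖ ^ 2 = ∑ i, (k i : ℝ) ^ 2 := by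
  rw [EuclideanSpace.norm_sq_eq]; simp

lemma norm_intVec_le_bracket (k : Fin d → ℤ) (η : Eucl d) : ‖intVec k‖ ≤ bracket k η := by
  refine Real.le_sqrt_of_sq_le ?_
  rw [norm_intVec_sq]; nlinarith [sq_nonneg ‖η‖]

/-- Minkowski's inequality. The shift acts on the lattice slot only, so the third bracket carries no
`η`; this matches a velocity field independent of `v`. -/
lemma bracket_le_add (k l : Fin d → ℤ) (η : Eucl d) :
    bracket k η ≤ bracket l η + bracket (k - l) 0 := by
  have hn : ‖intVec k‖ ≤ ‖intVec l‖ + ‖intVec (k - l)‖ := by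
    have : intVec k = intVec l + intVec (k - l) := by ext i; simp
    rw [this]; exact norm_add_le _ _
  have hl := bracket_sq l η
  rw [← norm_intVec_sq] at hl
  have hb := norm_intVec_le_bracket l η
  have hc := norm_intVec_le_bracket (k - l) 0
  have h0 := bracket_pos l η
  refine Real.sqrt_le_iff.2 ⟨by linarith [bracket_pos (k - l) 0], ?_⟩
  rw [← norm_intVec_sq]
  nlinarith [norm_nonneg (intVec k), norm_nonneg (intVec l), norm_nonneg (intVec (k - l)),
    mul_nonneg (norm_nonneg (intVec (k - l))) (sub_nonneg.2 hb),
    mul_nonneg h0.le (sub_nonneg.2 hc), mul_self_le_mul_self (norm_nonneg _) hn,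
    mul_self_le_mul_self (norm_nonneg _) hc]

lemma bracket_neg (k : Fin d → ℤ) (η : Eucl d) : bracket (-k) η = bracket k η := by
  simp [bracket]

lemma bracket_sub_le_add (k l : Fin d → ℤ) (η : Eucl d) :
    bracket (k - l) 0 ≤ bracket k η + bracket l η := by
  have h := bracket_le_add (k - l) k 0
  have : k - l - k = -l := by ring
  rw [this, bracket_neg] at h
  linarith [bracket_zero_le k η, bracket_zero_le l η]

lemma bracket_le_add' (k l : Fin d → ℤ) (η : Eucl d) :
    bracket l η ≤ bracket k η + bracket (k - l) 0 := by
  have h := bracket_le_add l k η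
  rwa [← neg_sub k l, bracket_neg] at h

lemma continuous_bracket (k : Fin d → ℤ) : Continuous (bracket k) := by
  unfold bracket; fun_prop

lemma summable_prod_pi {g : ℤ → ℝ} (h0 : ∀ n, 0 ≤ g n) (hg : Summable g) :
    Summable fun k : Fin d → ℤ => ∏ i, g (k i) := by
  classical
  refine summable_of_sum_le (c := (∑' n, g n) ^ d) (fun k => Finset.prod_nonneg fun i _ => h0 _) ?_
  intro S
  calc ∑ k ∈ S, ∏ i, g (k i)
      ≤ ∑ k ∈ Fintype.piFinset fun i => S.image fun k => k i, ∏ i, g (k i) := by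
        refine Finset.sum_le_sum_of_subset_of_nonneg ?_
          fun k _ _ => Finset.prod_nonneg fun i _ => h0 _
        intro k hk
        rw [Fintype.mem_piFinset]
        exact fun i => Finset.mem_image_of_mem _ hk
    _ = ∏ i : Fin d, ∑ n ∈ S.image (fun k => k i), g n := by rw [Finset.prod_univ_sum]
    _ ≤ ∏ _i : Fin d, ∑' n, g n := by
        refine Finset.prod_le_prod (fun i _ => Finset.sum_nonneg fun _ _ => h0 _) fun i _ => ?_
        exact hg.sum_le_tsum _ fun _ _ => h0 _
    _ = _ := by simp

lemma summable_one_add_sq_rpow {q : ℝ} (hq : 1 / 2 < q) :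
    Summable fun n : ℤ => (1 + (n : ℝ) ^ 2) ^ (-q) := by
  have h := Real.summable_abs_int_rpow (b := 2 * q) (by linarith)
  refine h.of_norm_bounded_eventually ?_
  have : ({0} : Set ℤ).Finite := Set.finite_singleton 0
  filter_upwards [this.compl_mem_cofinite] with n hn
  have hn' : (n : ℝ) ≠ 0 := by exact_mod_cast hn
  rw [Real.norm_eq_abs, abs_of_nonneg (by positivity), show -(2 * q) = 2 * (-q) by ring,
    Real.rpow_mul (abs_nonneg _)]
  have : |(n : ℝ)| ^ (2 : ℝ) = (n : ℝ) ^ 2 := by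
    rw [show (2 : ℝ) = ((2 : ℕ) : ℝ) by norm_num, Real.rpow_natCast, sq_abs]
  rw [this]
  exact Real.rpow_le_rpow_of_nonpos (by positivity) (by linarith) (by linarith)

/-- Each `1 + k_i²` is at most `⟨k⟩²`, so `⟨k⟩^{-q}` is dominated by the product over `i` of `(1 +
k_i²)^{-q/(2d)}`, and `q/(2d) > 1/2`. Dimension 0 is separate because of the division by `d`. -/
lemma summable_bracket_rpow {q : ℝ} (hq : (d : ℝ) < q) :
    Summable fun k : Fin d → ℤ => bracket k 0 ^ (-q) := by
  rcases Nat.eq_zero_or_pos d with rfl | hd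
  · exact Summable.of_finite
  have hd' : (0 : ℝ) < d := by exact_mod_cast hd
  have h := summable_prod_pi (d := d) (fun n => by positivity)
    (summable_one_add_sq_rpow (q := q / (2 * d)) (by
      rw [lt_div_iff₀ (by positivity)]; linarith))
  refine h.of_nonneg_of_le (fun k => by have := bracket_pos k 0; positivity) fun k => ?_
  have h1 : bracket k 0 ^ (-q) = ∏ _i : Fin d, (bracket k 0 ^ 2) ^ (-(q / (2 * d))) := by
    rw [Finset.prod_const, Finset.card_univ, Fintype.card_fin, ← Real.rpow_natCast (_ ^ _) d,
      ← Real.rpow_natCast _ 2, ← Real.rpow_mul (bracket_pos k 0).le,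
      ← Real.rpow_mul (bracket_pos k 0).le]
    congr 1; field_simp; norm_num
  rw [h1]
  refine Finset.prod_le_prod (fun i _ => by positivity) fun i _ => ?_
  refine Real.rpow_le_rpow_of_nonpos (by positivity) ?_ (by
    rw [neg_nonpos]; have := hd'.trans hq; positivity)
  rw [bracket_sq]
  have := Finset.single_le_sum (f := fun i => (k i : ℝ) ^ 2) (fun _ _ => sq_nonneg _)
    (Finset.mem_univ i)
  simp only [norm_zero]; linarith

end Bracket

/-! ### Cauchy-Schwarz in `L²` -/

section L2

variable {α : Type*} [MeasurableSpace α]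

lemma lintegral_mul_le_sqrt_mul_sqrt (μ : Measure α) {f g : α → ENNReal} (hf : AEMeasurable f μ)
    (hg : AEMeasurable g μ) :
    ∫⁻ a, f a * g a ∂μ ≤ (∫⁻ a, f a ^ 2 ∂μ) ^ (1 / 2 : ℝ) * (∫⁻ a, g a ^ 2 ∂μ) ^ (1 / 2 : ℝ) := by
  have := ENNReal.lintegral_mul_le_Lp_mul_Lq μ Real.HolderConjugate.two_two hf hg
  simpa using this

lemma eLpNorm_two_eq {E : Type*} [NormedAddCommGroup E] (μ : Measure α) (f : α → E) :
    eLpNorm f 2 μ = (∫⁻ a, ‖f a‖ₑ ^ 2 ∂μ) ^ (1 / 2 : ℝ) := by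
  rw [eLpNorm_eq_lintegral_rpow_enorm_toReal (by norm_num) (by norm_num)]
  simp

lemma eLpNorm_two_sq {E : Type*} [NormedAddCommGroup E] (μ : Measure α) (f : α → E) :
    eLpNorm f 2 μ ^ 2 = ∫⁻ a, ‖f a‖ₑ ^ 2 ∂μ := by
  rw [eLpNorm_two_eq, ← ENNReal.rpow_natCast, ← ENNReal.rpow_mul]
  simp

lemma lintegral_enorm_mul_le {E F : Type*} [NormedAddCommGroup E] [NormedAddCommGroup F]
    {μ : Measure α} {f : α → E} {g : α → F} (hf : AEStronglyMeasurable f μ)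
    (hg : AEStronglyMeasurable g μ) :
    ∫⁻ a, ‖f a‖ₑ * ‖g a‖ₑ ∂μ ≤ eLpNorm f 2 μ * eLpNorm g 2 μ := by
  rw [eLpNorm_two_eq, eLpNorm_two_eq]
  exact lintegral_mul_le_sqrt_mul_sqrt μ hf.enorm hg.enorm

end L2

/-! ### The trilinear convolution estimate -/

section Trilinear

variable {d : ℕ}

/-- Counting measure on the frequencies `k` times Lebesgue measure in `η`. -/
noncomputable abbrev modeMeasure (d : ℕ) : Measure ((Fin d → ℤ) × Eucl d) :=
  Measure.count.prod volume

/-- The measure on triples `(k, l, η)`. -/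
noncomputable abbrev pairMeasure (d : ℕ) : Measure ((Fin d → ℤ) × (Fin d → ℤ) × Eucl d) :=
  Measure.count.prod (Measure.count.prod volume)

lemma lintegral_modeMeasure {f : (Fin d → ℤ) × Eucl d → ENNReal} (hf : Measurable f) :
    ∫⁻ p, f p ∂(modeMeasure d) = ∑' k, ∫⁻ η, f (k, η) := by
  rw [lintegral_prod _ hf.aemeasurable, lintegral_count]

lemma lintegral_pairMeasure {f : (Fin d → ℤ) × (Fin d → ℤ) × Eucl d → ENNReal}
    (hf : Measurable f) :
    ∫⁻ p, f p ∂(pairMeasure d) = ∑' k, ∑' l, ∫⁻ η, f (k, l, η) := by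
  rw [lintegral_prod _ hf.aemeasurable, lintegral_count]
  refine tsum_congr fun k => ?_
  rw [lintegral_modeMeasure (f := fun p => f (k, p)) (by fun_prop)]

/-- The decay of the convolution kernels in either of the two interacting frequencies. -/
noncomputable def decay (r : ℝ) (k l : Fin d → ℤ) : ℝ := bracket (k - l) 0 ^ (-r) + bracket l 0 ^ (-r)

lemma decay_pos (r : ℝ) (k l : Fin d → ℤ) : 0 < decay r k l := by
  have := bracket_pos (k - l) 0
  have := bracket_pos l 0
  unfold decay; positivity

/-- The constant of the trilinear convolution estimate. -/
noncomputable def convConst (d : ℕ) (r : ℝ) : ENNReal :=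
  2 * (∑' k : Fin d → ℤ, ENNReal.ofReal (bracket k 0 ^ (-r)) ^ 2) ^ (1 / 2 : ℝ)

lemma convConst_lt_top {r : ℝ} (hr : (d : ℝ) / 2 < r) : convConst d r < ⊤ := by
  unfold convConst
  refine ENNReal.mul_lt_top (by simp) (ENNReal.rpow_lt_top_of_nonneg (by norm_num) ?_)
  have h := (summable_bracket_rpow (d := d) (q := 2 * r) (by linarith)).tsum_ofReal_ne_top
  convert h using 3 with k
  have := bracket_pos k 0
  rw [← ENNReal.ofReal_pow (by positivity), ← Real.rpow_natCast, ← Real.rpow_mul this.le]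
  ring_nf

lemma tsum_mul_le_sqrt_mul_sqrt (f g : (Fin d → ℤ) → ENNReal) :
    ∑' k, f k * g k ≤ (∑' k, f k ^ 2) ^ (1 / 2 : ℝ) * (∑' k, g k ^ 2) ^ (1 / 2 : ℝ) := by
  have := lintegral_mul_le_sqrt_mul_sqrt Measure.count (f := f) (g := g)
    (Measurable.of_discrete).aemeasurable (Measurable.of_discrete).aemeasurable
  simpa only [lintegral_count] using this

lemma measurable_comp_pair {E : Type*} [MeasurableSpace E] (g : (Fin d → ℤ) → (Fin d → ℤ) → E) :
    Measurable fun p : (Fin d → ℤ) × (Fin d → ℤ) × Eucl d => g p.1 p.2.1 :=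
  (Measurable.of_discrete (f := fun q : (Fin d → ℤ) × (Fin d → ℤ) => g q.1 q.2)).comp
    (by fun_prop : Measurable fun p : (Fin d → ℤ) × (Fin d → ℤ) × Eucl d => (p.1, p.2.1))

lemma measurable_comp_fst_sub {E : Type*} [MeasurableSpace E] (g : (Fin d → ℤ) → E) :
    Measurable fun p : (Fin d → ℤ) × (Fin d → ℤ) × Eucl d => g (p.1 - p.2.1) :=
  measurable_comp_pair fun k l => g (k - l)

lemma measurable_comp_snd_fst {E : Type*} [MeasurableSpace E] (g : (Fin d → ℤ) → E) :
    Measurable fun p : (Fin d → ℤ) × (Fin d → ℤ) × Eucl d => g p.2.1 :=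
  (Measurable.of_discrete (f := g)).comp (by fun_prop)

/-- The two halves of the decay are treated differently. If it sits on `k - l`, the product with `V`
is summable by Cauchy-Schwarz, and translation invariance in `k` gives Young's inequality `ℓ¹ * ℓ² ⊂
ℓ²`. If it sits on `l`, the norms of the slices `w(l,·)` become summable, and `V` is kept in `ℓ²`
for each `l`. With values in `[0,∞]` no finiteness is needed. -/
lemma trilinear_lintegral_le (r : ℝ) (V : (Fin d → ℤ) → ENNReal)
    {w w' : (Fin d → ℤ) × Eucl d → ENNReal} (hw : Measurable w) (hw' : Measurable w') :
    ∫⁻ p, ENNReal.ofReal (decay r p.1 p.2.1) * V (p.1 - p.2.1) * w p.2 * w' (p.1, p.2.2)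
        ∂(pairMeasure d) ≤
      convConst d r * (∑' k, V k ^ 2) ^ (1 / 2 : ℝ) *
        (∫⁻ p, w p ^ 2 ∂(modeMeasure d)) ^ (1 / 2 : ℝ) *
        (∫⁻ p, w' p ^ 2 ∂(modeMeasure d)) ^ (1 / 2 : ℝ) := by
  set β : (Fin d → ℤ) → ENNReal := fun k => ENNReal.ofReal (bracket k 0 ^ (-r)) with hβ
  set B := (∑' k, β k ^ 2) ^ (1 / 2 : ℝ) with hB
  set NV := (∑' k, V k ^ 2) ^ (1 / 2 : ℝ) with hNV
  set Nw := (∫⁻ p, w p ^ 2 ∂(modeMeasure d)) ^ (1 / 2 : ℝ) with hNw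
  set Nw' := (∫⁻ p, w' p ^ 2 ∂(modeMeasure d)) ^ (1 / 2 : ℝ) with hNw'
  have hdec : ∀ k l : Fin d → ℤ, ENNReal.ofReal (decay r k l) = β (k - l) + β l := by
    intro k l
    have := bracket_pos (k - l) 0
    have := bracket_pos l 0
    rw [decay, ENNReal.ofReal_add (by positivity) (by positivity)]
  have m1 := measurable_comp_fst_sub V
  have m2 := measurable_comp_fst_sub β
  have m3 := measurable_comp_snd_fst β
  have m4 : Measurable fun p : (Fin d → ℤ) × (Fin d → ℤ) × Eucl d => w p.2 := by fun_prop
  have m5 : Measurable fun p : (Fin d → ℤ) × (Fin d → ℤ) × Eucl d => w' (p.1, p.2.2) := by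
    fun_prop
  have wk : ∀ k, Measurable fun η => w (k, η) := fun k => by fun_prop
  have wk' : ∀ k, Measurable fun η => w' (k, η) := fun k => by fun_prop
  have hNws : Nw = (∑' k, ∫⁻ η, w (k, η) ^ 2) ^ (1 / 2 : ℝ) := by
    rw [hNw, lintegral_modeMeasure (hw.pow_const 2)]
  have part1 : ∑' k, ∑' l, ∫⁻ η, β (k - l) * V (k - l) * w (l, η) * w' (k, η) ≤
      B * NV * (Nw * Nw') := by
    calc ∑' k, ∑' l, ∫⁻ η, β (k - l) * V (k - l) * w (l, η) * w' (k, η)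
        = ∑' k, ∑' m, β m * V m * ∫⁻ η, w (k - m, η) * w' (k, η) := by
          refine tsum_congr fun k => ?_
          rw [← (Equiv.subLeft k).tsum_eq]
          refine tsum_congr fun m => ?_
          simp only [Equiv.subLeft_apply, sub_sub_cancel]
          simp only [mul_assoc]
          rw [lintegral_const_mul _ (by fun_prop), lintegral_const_mul _ (by fun_prop)]
      _ = ∑' m, β m * V m * ∑' k, ∫⁻ η, w (k - m, η) * w' (k, η) := by
          rw [ENNReal.tsum_comm]
          simp only [ENNReal.tsum_mul_left]
      _ ≤ ∑' m, β m * V m * (Nw * Nw') := by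
          gcongr with m
          have hm : Measurable fun p : (Fin d → ℤ) × Eucl d => w (p.1 - m, p.2) :=
            hw.comp (((Measurable.of_discrete (f := fun k : Fin d → ℤ => k - m)).comp
              measurable_fst).prodMk measurable_snd)
          have := lintegral_mul_le_sqrt_mul_sqrt (modeMeasure d) hm.aemeasurable hw'.aemeasurable
          rw [lintegral_modeMeasure (by fun_prop), lintegral_modeMeasure (by fun_prop)] at this
          refine this.trans (le_of_eq ?_)
          rw [hNws, ← (Equiv.subRight m).tsum_eq fun k => ∫⁻ η, w (k, η) ^ 2]
          simp only [Equiv.subRight_apply, hNw']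
      _ ≤ B * NV * (Nw * Nw') := by
          rw [ENNReal.tsum_mul_right]
          gcongr
          exact tsum_mul_le_sqrt_mul_sqrt _ _
  have part2 : ∑' k, ∑' l, ∫⁻ η, β l * V (k - l) * w (l, η) * w' (k, η) ≤
      B * NV * (Nw * Nw') := by
    calc ∑' k, ∑' l, ∫⁻ η, β l * V (k - l) * w (l, η) * w' (k, η)
        = ∑' l, β l * ∑' k, ∫⁻ η, (V (k - l) * w (l, η)) * w' (k, η) := by
          rw [ENNReal.tsum_comm]
          refine tsum_congr fun l => ?_
          rw [← ENNReal.tsum_mul_left]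
          refine tsum_congr fun k => ?_
          simp only [mul_assoc]
          rw [lintegral_const_mul _ (by fun_prop), lintegral_const_mul _ (by fun_prop)]
      _ ≤ ∑' l, β l * ((NV * (∫⁻ η, w (l, η) ^ 2) ^ (1 / 2 : ℝ)) * Nw') := by
          gcongr with l
          have hm : Measurable fun p : (Fin d → ℤ) × Eucl d => V (p.1 - l) * w (l, p.2) :=
            ((Measurable.of_discrete (f := fun k : Fin d → ℤ => V (k - l))).comp
              measurable_fst).mul (by fun_prop)
          have := lintegral_mul_le_sqrt_mul_sqrt (modeMeasure d) hm.aemeasurable hw'.aemeasurable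
          rw [lintegral_modeMeasure (by fun_prop), lintegral_modeMeasure (by fun_prop)] at this
          refine this.trans (le_of_eq ?_)
          congr 1
          rw [hNV, ← ENNReal.mul_rpow_of_nonneg _ _ (by norm_num)]
          congr 1
          rw [← ENNReal.tsum_mul_right,
            ← (Equiv.subRight l).tsum_eq fun k => V k ^ 2 * ∫⁻ η, w (l, η) ^ 2]
          refine tsum_congr fun k => ?_
          simp only [Equiv.subRight_apply, mul_pow]
          rw [lintegral_const_mul _ (by fun_prop)]
      _ = NV * Nw' * ∑' l, β l * (∫⁻ η, w (l, η) ^ 2) ^ (1 / 2 : ℝ) := by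
          rw [← ENNReal.tsum_mul_left]
          refine tsum_congr fun l => ?_
          ring
      _ ≤ NV * Nw' * (B * Nw) := by
          gcongr
          refine (tsum_mul_le_sqrt_mul_sqrt _ _).trans (le_of_eq ?_)
          rw [hNws]
          congr 3
          ext l
          rw [← ENNReal.rpow_natCast, ← ENNReal.rpow_mul]
          simp
      _ = _ := by ring
  rw [lintegral_pairMeasure (by simp only [hdec]; fun_prop)]
  simp only [hdec, add_mul]
  have hsplit : ∀ k l : Fin d → ℤ,
      ∫⁻ η, (β (k - l) * V (k - l) * w (l, η) * w' (k, η) +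
        β l * V (k - l) * w (l, η) * w' (k, η)) =
      (∫⁻ η, β (k - l) * V (k - l) * w (l, η) * w' (k, η)) +
        ∫⁻ η, β l * V (k - l) * w (l, η) * w' (k, η) := fun k l =>
    lintegral_add_left (((wk l).const_mul _).mul (wk' k)) _
  simp only [hsplit, ENNReal.tsum_add]
  refine (add_le_add part1 part2).trans (le_of_eq ?_)
  rw [convConst, show (∑' k : Fin d → ℤ, ENNReal.ofReal (bracket k 0 ^ (-r)) ^ 2) ^ (1 / 2 : ℝ) = B
    from rfl]
  ring

end Trilinear

end VlasovGevrey

namespace VlasovGevrey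

/-! ### Trilinear forms with bounded kernels: integrability and continuity -/

section Forms

variable {d : ℕ}

/-- The integrand of a trilinear convolution form with kernel `κ`. -/
noncomputable def triForm (κ : (Fin d → ℤ) × (Fin d → ℤ) × Eucl d → ℂ) (V : (Fin d → ℤ) → ℂ)
    (w w' : (Fin d → ℤ) × Eucl d → ℂ) (p : (Fin d → ℤ) × (Fin d → ℤ) × Eucl d) : ℂ :=
  κ p * V (p.1 - p.2.1) * w p.2 * (starRingEnd ℂ) (w' (p.1, p.2.2))

lemma measurable_triForm {κ : (Fin d → ℤ) × (Fin d → ℤ) × Eucl d → ℂ} (hκ : Measurable κ)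
    (V : (Fin d → ℤ) → ℂ) {w w' : (Fin d → ℤ) × Eucl d → ℂ} (hw : Measurable w)
    (hw' : Measurable w') : Measurable (triForm κ V w w') := by
  have h1 := measurable_comp_fst_sub V
  have h2 : Measurable fun p : (Fin d → ℤ) × (Fin d → ℤ) × Eucl d =>
      (starRingEnd ℂ) (w' (p.1, p.2.2)) :=
    Complex.continuous_conj.measurable.comp (hw'.comp (by fun_prop))
  unfold triForm
  fun_prop

lemma lintegral_triForm_le {κ : (Fin d → ℤ) × (Fin d → ℤ) × Eucl d → ℂ} {r B : ℝ}
    (hκ : ∀ p, ‖κ p‖ ≤ B * decay r p.1 p.2.1)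
    (V : (Fin d → ℤ) → ℂ) {w w' : (Fin d → ℤ) × Eucl d → ℂ} (hw : Measurable w)
    (hw' : Measurable w') :
    ∫⁻ p, ‖triForm κ V w w' p‖ₑ ∂(pairMeasure d) ≤
      ENNReal.ofReal B * convConst d r * eLpNorm V 2 Measure.count *
        eLpNorm w 2 (modeMeasure d) * eLpNorm w' 2 (modeMeasure d) := by
  have h := trilinear_lintegral_le r (fun k => ‖V k‖ₑ) hw.enorm hw'.enorm
  have hV : eLpNorm V 2 Measure.count = (∑' k, ‖V k‖ₑ ^ 2) ^ (1 / 2 : ℝ) := by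
    rw [eLpNorm_two_eq, lintegral_count]
  rw [hV, eLpNorm_two_eq, eLpNorm_two_eq]
  calc ∫⁻ p, ‖triForm κ V w w' p‖ₑ ∂(pairMeasure d)
      ≤ ∫⁻ p, ENNReal.ofReal B * (ENNReal.ofReal (decay r p.1 p.2.1) * ‖V (p.1 - p.2.1)‖ₑ *
          ‖w p.2‖ₑ * ‖w' (p.1, p.2.2)‖ₑ) ∂(pairMeasure d) := by
        refine lintegral_mono fun p => ?_
        simp only [triForm, enorm_mul, RCLike.enorm_conj]
        have : ‖κ p‖ₑ ≤ ENNReal.ofReal B * ENNReal.ofReal (decay r p.1 p.2.1) := by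
          rw [← ofReal_norm, ← ENNReal.ofReal_mul' (decay_pos r _ _).le]
          exact ENNReal.ofReal_le_ofReal (hκ p)
        calc _ ≤ ENNReal.ofReal B * ENNReal.ofReal (decay r p.1 p.2.1) * ‖V (p.1 - p.2.1)‖ₑ *
              ‖w p.2‖ₑ * ‖w' (p.1, p.2.2)‖ₑ := by gcongr
          _ = _ := by ring
    _ = ENNReal.ofReal B * ∫⁻ p, (ENNReal.ofReal (decay r p.1 p.2.1) * ‖V (p.1 - p.2.1)‖ₑ *
          ‖w p.2‖ₑ * ‖w' (p.1, p.2.2)‖ₑ) ∂(pairMeasure d) :=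
        lintegral_const_mul' _ _ (by simp)
    _ ≤ _ := (mul_le_mul_right h _).trans (le_of_eq (by ring))

lemma integrable_triForm {κ : (Fin d → ℤ) × (Fin d → ℤ) × Eucl d → ℂ} {r B : ℝ}
    (hr : (d : ℝ) / 2 < r) (hκm : Measurable κ) (hκ : ∀ p, ‖κ p‖ ≤ B * decay r p.1 p.2.1)
    {V : (Fin d → ℤ) → ℂ} {w w' : (Fin d → ℤ) × Eucl d → ℂ} (hw : Measurable w)
    (hw' : Measurable w') (hV2 : eLpNorm V 2 Measure.count < ⊤)
    (hw2 : eLpNorm w 2 (modeMeasure d) < ⊤) (hw2' : eLpNorm w' 2 (modeMeasure d) < ⊤) :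
    Integrable (triForm κ V w w') (pairMeasure d) := by
  refine ⟨(measurable_triForm hκm V hw hw').aestronglyMeasurable, ?_⟩
  refine (lintegral_triForm_le hκ V hw hw').trans_lt ?_
  exact ENNReal.mul_lt_top (ENNReal.mul_lt_top (ENNReal.mul_lt_top
    (ENNReal.mul_lt_top ENNReal.ofReal_lt_top (convConst_lt_top hr)) hV2) hw2) hw2'

lemma integral_triForm_le {κ : (Fin d → ℤ) × (Fin d → ℤ) × Eucl d → ℂ} {r B : ℝ}
    (hr : (d : ℝ) / 2 < r) (hB : 0 ≤ B) (hκ : ∀ p, ‖κ p‖ ≤ B * decay r p.1 p.2.1)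
    {V : (Fin d → ℤ) → ℂ} {w w' : (Fin d → ℤ) × Eucl d → ℂ} (hw : Measurable w)
    (hw' : Measurable w') (hV2 : eLpNorm V 2 Measure.count < ⊤)
    (hw2 : eLpNorm w 2 (modeMeasure d) < ⊤) (hw2' : eLpNorm w' 2 (modeMeasure d) < ⊤) :
    ∫ p, ‖triForm κ V w w' p‖ ∂(pairMeasure d) ≤
      B * (convConst d r).toReal * (eLpNorm V 2 Measure.count).toReal *
        (eLpNorm w 2 (modeMeasure d)).toReal * (eLpNorm w' 2 (modeMeasure d)).toReal := by
  -- The kernel is not assumed measurable; in the non-measurable case the integral is 0 by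
  -- convention and the bound is trivial.
  by_cases hm : AEStronglyMeasurable (fun p => ‖triForm κ V w w' p‖) (pairMeasure d)
  · rw [integral_eq_lintegral_of_nonneg_ae (Eventually.of_forall fun _ => norm_nonneg _) hm]
    simp only [ofReal_norm]
    have := ENNReal.toReal_mono ?_ (lintegral_triForm_le hκ V hw hw')
    · simpa only [ENNReal.toReal_mul, ENNReal.toReal_ofReal hB] using this
    · exact (ENNReal.mul_lt_top (ENNReal.mul_lt_top (ENNReal.mul_lt_top
        (ENNReal.mul_lt_top ENNReal.ofReal_lt_top (convConst_lt_top hr)) hV2) hw2) hw2').ne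
  · rw [integral_non_aestronglyMeasurable hm]; positivity

lemma tendsto_eLpNorm_of_sub {α ι E : Type*} [MeasurableSpace α] {μ : Measure α}
    [NormedAddCommGroup E] {l : Filter ι} {f : ι → α → E} {g : α → E}
    (hf : ∀ i, AEStronglyMeasurable (f i) μ) (hg : AEStronglyMeasurable g μ)
    (h : Tendsto (fun i => eLpNorm (f i - g) 2 μ) l (𝓝 0)) :
    ∀ᶠ i in l, eLpNorm (f i) 2 μ ≤ eLpNorm g 2 μ + 1 := by
  filter_upwards [h.eventually (Iic_mem_nhds (zero_lt_one))] with i hi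
  calc eLpNorm (f i) 2 μ = eLpNorm ((f i - g) + g) 2 μ := by simp
    _ ≤ eLpNorm (f i - g) 2 μ + eLpNorm g 2 μ :=
      eLpNorm_add_le ((hf i).sub hg) hg (by norm_num)
    _ ≤ _ := by rw [add_comm]; gcongr

/-- The three functions converge in norm, so their differences are telescoped through the trilinear
bound. The kernels converge only pointwise; their difference is tested on the fixed limit functions,
where the bound `2B` times the decay permits dominated convergence. -/
lemma tendsto_integral_triForm {ι : Type*} {l : Filter ι} [l.IsCountablyGenerated] {r B : ℝ}
    (hr : (d : ℝ) / 2 < r)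
    {κ : ι → (Fin d → ℤ) × (Fin d → ℤ) × Eucl d → ℂ}
    {κ₀ : (Fin d → ℤ) × (Fin d → ℤ) × Eucl d → ℂ}
    {V : ι → (Fin d → ℤ) → ℂ} {V₀ : (Fin d → ℤ) → ℂ}
    {w w' : ι → (Fin d → ℤ) × Eucl d → ℂ} {w₀ w₀' : (Fin d → ℤ) × Eucl d → ℂ}
    (hκm : ∀ i, Measurable (κ i)) (hκm₀ : Measurable κ₀)
    (hκ : ∀ᶠ i in l, ∀ p, ‖κ i p‖ ≤ B * decay r p.1 p.2.1)
    (hκ₀ : ∀ p, ‖κ₀ p‖ ≤ B * decay r p.1 p.2.1)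
    (hlim : ∀ p, Tendsto (fun i => κ i p) l (𝓝 (κ₀ p)))
    (hw : ∀ i, Measurable (w i)) (hw₀ : Measurable w₀)
    (hw' : ∀ i, Measurable (w' i)) (hw₀' : Measurable w₀')
    (hV2 : eLpNorm V₀ 2 Measure.count < ⊤) (hw2 : eLpNorm w₀ 2 (modeMeasure d) < ⊤)
    (hw2' : eLpNorm w₀' 2 (modeMeasure d) < ⊤)
    (hVl : Tendsto (fun i => eLpNorm (V i - V₀) 2 Measure.count) l (𝓝 0))
    (hwl : Tendsto (fun i => eLpNorm (w i - w₀) 2 (modeMeasure d)) l (𝓝 0))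
    (hwl' : Tendsto (fun i => eLpNorm (w' i - w₀') 2 (modeMeasure d)) l (𝓝 0)) :
    Tendsto (fun i => ∫ p, triForm (κ i) (V i) (w i) (w' i) p ∂(pairMeasure d)) l
      (𝓝 (∫ p, triForm κ₀ V₀ w₀ w₀' p ∂(pairMeasure d))) := by
  have bw := tendsto_eLpNorm_of_sub (fun i => (hw i).aestronglyMeasurable)
    hw₀.aestronglyMeasurable hwl
  have bw' := tendsto_eLpNorm_of_sub (fun i => (hw' i).aestronglyMeasurable)
    hw₀'.aestronglyMeasurable hwl'
  have bV := tendsto_eLpNorm_of_sub (μ := Measure.count) (f := V) (g := V₀)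
    (fun i => (Measurable.of_discrete).aestronglyMeasurable)
    (Measurable.of_discrete).aestronglyMeasurable hVl
  have fw : eLpNorm w₀ 2 (modeMeasure d) + 1 < ⊤ := ENNReal.add_lt_top.2 ⟨hw2, by simp⟩
  have fw' : eLpNorm w₀' 2 (modeMeasure d) + 1 < ⊤ := ENNReal.add_lt_top.2 ⟨hw2', by simp⟩
  have fV : eLpNorm V₀ 2 Measure.count + 1 < ⊤ := ENNReal.add_lt_top.2 ⟨hV2, by simp⟩
  set A := ENNReal.ofReal B * convConst d r with hA
  have fA : A < ⊤ := ENNReal.mul_lt_top ENNReal.ofReal_lt_top (convConst_lt_top hr)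
  refine tendsto_integral_of_L1 _
    (integrable_triForm hr hκm₀ hκ₀ hw₀ hw₀' hV2 hw2 hw2').aestronglyMeasurable ?_ ?_
  · filter_upwards [hκ, bw, bw', bV] with i h1 h2 h3 h4
    exact integrable_triForm hr (hκm i) h1 (hw i) (hw' i) (h4.trans_lt fV) (h2.trans_lt fw)
      (h3.trans_lt fw')
  have hdct : Tendsto (fun i => ∫⁻ p, ‖triForm (κ i - κ₀) V₀ w₀ w₀' p‖ₑ ∂(pairMeasure d)) l
      (𝓝 0) := by
    have hbd := integrable_triForm (κ := fun p => ((2 * B * decay r p.1 p.2.1 : ℝ) : ℂ))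
      (B := 2 * |B|) hr
      (Complex.measurable_ofReal.comp (measurable_comp_pair fun k l => 2 * B * decay r k l))
      (fun p => by
        rw [Complex.norm_real, Real.norm_eq_abs, abs_mul, abs_mul, abs_of_pos (decay_pos r _ _),
          abs_two])
      hw₀ hw₀' hV2 hw2 hw2'
    have := tendsto_lintegral_filter_of_dominated_convergence (μ := pairMeasure d) (l := l)
      (F := fun i p => ‖triForm (κ i - κ₀) V₀ w₀ w₀' p‖ₑ) (f := fun _ => 0) _
      (Eventually.of_forall fun i => (measurable_triForm ((hκm i).sub hκm₀) V₀ hw₀ hw₀').enorm)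
      ?_ hbd.hasFiniteIntegral.ne ?_
    · simpa using this
    · filter_upwards [hκ] with i hi
      refine Eventually.of_forall fun p => ?_
      simp only [triForm, enorm_mul]
      gcongr
      rw [enorm_le_iff_norm_le, Complex.norm_real, Real.norm_eq_abs]
      refine le_trans ?_ (le_abs_self _)
      calc ‖(κ i - κ₀) p‖ ≤ ‖κ i p‖ + ‖κ₀ p‖ := norm_sub_le _ _
        _ ≤ _ := by linarith [hi p, hκ₀ p]
    · refine Eventually.of_forall fun p => ?_
      have h1 : Tendsto (fun i => triForm (κ i - κ₀) V₀ w₀ w₀' p) l (𝓝 0) := by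
        have h0 : Tendsto (fun i => (κ i - κ₀) p) l (𝓝 0) := by
          simpa using (hlim p).sub_const (κ₀ p)
        have := ((h0.mul_const (V₀ (p.1 - p.2.1))).mul_const (w₀ p.2)).mul_const
          ((starRingEnd ℂ) (w₀' (p.1, p.2.2)))
        simpa [triForm] using this
      simpa using h1.enorm
  have hub : Tendsto (fun i => A * eLpNorm (V i - V₀) 2 Measure.count *
        (eLpNorm w₀ 2 (modeMeasure d) + 1) * (eLpNorm w₀' 2 (modeMeasure d) + 1) +
      A * eLpNorm V₀ 2 Measure.count * eLpNorm (w i - w₀) 2 (modeMeasure d) *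
        (eLpNorm w₀' 2 (modeMeasure d) + 1) +
      A * eLpNorm V₀ 2 Measure.count * eLpNorm w₀ 2 (modeMeasure d) *
        eLpNorm (w' i - w₀') 2 (modeMeasure d) +
      ∫⁻ p, ‖triForm (κ i - κ₀) V₀ w₀ w₀' p‖ₑ ∂(pairMeasure d)) l (𝓝 0) := by
    have t1 := ENNReal.Tendsto.mul_const (ENNReal.Tendsto.mul_const (ENNReal.Tendsto.const_mul hVl
      (Or.inr fA.ne)) (Or.inr fw.ne)) (Or.inr fw'.ne)
    have t2 := ENNReal.Tendsto.mul_const (ENNReal.Tendsto.const_mul hwl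
      (Or.inr (ENNReal.mul_lt_top fA hV2).ne)) (Or.inr fw'.ne)
    have t3 := ENNReal.Tendsto.const_mul hwl'
      (Or.inr (ENNReal.mul_lt_top (ENNReal.mul_lt_top fA hV2) hw2).ne)
    have := ((t1.add t2).add t3).add hdct
    simpa using this
  refine tendsto_of_tendsto_of_tendsto_of_le_of_le' tendsto_const_nhds hub
    (Eventually.of_forall fun _ => zero_le) ?_
  filter_upwards [hκ, bw, bw', bV] with i h1 h2 h3 h4
  calc ∫⁻ p, ‖triForm (κ i) (V i) (w i) (w' i) p - triForm κ₀ V₀ w₀ w₀' p‖ₑ ∂(pairMeasure d)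
      ≤ ∫⁻ p, (‖triForm (κ i) (V i - V₀) (w i) (w' i) p‖ₑ +
          ‖triForm (κ i) V₀ (w i - w₀) (w' i) p‖ₑ +
          ‖triForm (κ i) V₀ w₀ (w' i - w₀') p‖ₑ +
          ‖triForm (κ i - κ₀) V₀ w₀ w₀' p‖ₑ) ∂(pairMeasure d) := by
        refine lintegral_mono fun p => ?_
        have : triForm (κ i) (V i) (w i) (w' i) p - triForm κ₀ V₀ w₀ w₀' p =
            triForm (κ i) (V i - V₀) (w i) (w' i) p +
            triForm (κ i) V₀ (w i - w₀) (w' i) p + triForm (κ i) V₀ w₀ (w' i - w₀') p +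
            triForm (κ i - κ₀) V₀ w₀ w₀' p := by
          simp only [triForm, Pi.sub_apply, map_sub]; ring
        rw [this]
        exact (enorm_add_le _ _).trans (add_le_add ((enorm_add_le _ _).trans
          (add_le_add (enorm_add_le _ _) le_rfl)) le_rfl)
    _ = ∫⁻ p, ‖triForm (κ i) (V i - V₀) (w i) (w' i) p‖ₑ ∂(pairMeasure d) +
          ∫⁻ p, ‖triForm (κ i) V₀ (w i - w₀) (w' i) p‖ₑ ∂(pairMeasure d) +
          ∫⁻ p, ‖triForm (κ i) V₀ w₀ (w' i - w₀') p‖ₑ ∂(pairMeasure d) +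
          ∫⁻ p, ‖triForm (κ i - κ₀) V₀ w₀ w₀' p‖ₑ ∂(pairMeasure d) := by
        have m1 := (measurable_triForm (hκm i) (V i - V₀) (hw i) (hw' i)).enorm
        have m2 := (measurable_triForm (hκm i) V₀ ((hw i).sub hw₀) (hw' i)).enorm
        have m3 := (measurable_triForm (hκm i) V₀ hw₀ ((hw' i).sub hw₀')).enorm
        rw [lintegral_add_left (by fun_prop), lintegral_add_left (by fun_prop),
          lintegral_add_left (by fun_prop)]
    _ ≤ _ := by
        gcongr
        · refine (lintegral_triForm_le h1 _ (hw i) (hw' i)).trans ?_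
          gcongr
        · refine (lintegral_triForm_le h1 _ ((hw i).sub hw₀) (hw' i)).trans ?_
          gcongr
        · exact lintegral_triForm_le h1 _ hw₀ ((hw' i).sub hw₀')

end Forms

/-! ### Products of `L²`-convergent functions with multipliers converging pointwise -/

section Multiplication

variable {α ι : Type*} [MeasurableSpace α] {μ : Measure α} {l : Filter ι} [l.IsCountablyGenerated]

/-- Split into `ρ_i (w_i - w₀)`, small because the multipliers are uniformly bounded, and `(ρ_i -
ρ₀) w₀`, small by dominated convergence. Norm convergence of the multipliers is unavailable since
they depend on an unbounded frequency. -/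
lemma tendsto_eLpNorm_mul_sub {ρ : ι → α → ℂ} {ρ₀ : α → ℂ} {w : ι → α → ℂ} {w₀ : α → ℂ} {B : ℝ}
    (hρm : ∀ i, Measurable (ρ i)) (hρm₀ : Measurable ρ₀)
    (hρ : ∀ᶠ i in l, ∀ a, ‖ρ i a‖ ≤ B) (hρ₀ : ∀ a, ‖ρ₀ a‖ ≤ B)
    (hlim : ∀ a, Tendsto (fun i => ρ i a) l (𝓝 (ρ₀ a)))
    (hw : ∀ i, AEStronglyMeasurable (w i) μ) (hw₀ : AEStronglyMeasurable w₀ μ)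
    (hw2 : eLpNorm w₀ 2 μ < ⊤)
    (hwl : Tendsto (fun i => eLpNorm (w i - w₀) 2 μ) l (𝓝 0)) :
    Tendsto (fun i => eLpNorm (ρ i * w i - ρ₀ * w₀) 2 μ) l (𝓝 0) := by
  have hdct : Tendsto (fun i => eLpNorm ((ρ i - ρ₀) * w₀) 2 μ) l (𝓝 0) := by
    simp only [eLpNorm_two_eq]
    have h0 : Tendsto (fun i => ∫⁻ a, ‖((ρ i - ρ₀) * w₀) a‖ₑ ^ 2 ∂μ) l (𝓝 0) := by
      have := tendsto_lintegral_filter_of_dominated_convergence' (μ := μ) (l := l)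
        (F := fun i a => ‖((ρ i - ρ₀) * w₀) a‖ₑ ^ 2) (f := fun _ => 0)
        (fun a => ENNReal.ofReal (2 * B) ^ 2 * ‖w₀ a‖ₑ ^ 2)
        (Eventually.of_forall fun i =>
          ((((hρm i).sub hρm₀).aestronglyMeasurable.mul hw₀).enorm.pow_const 2)) ?_ ?_ ?_
      · simpa using this
      · filter_upwards [hρ] with i hi
        refine Eventually.of_forall fun a => ?_
        rw [Pi.mul_apply, enorm_mul, mul_pow]
        gcongr
        rw [← ofReal_norm]
        refine ENNReal.ofReal_le_ofReal ?_
        calc ‖(ρ i - ρ₀) a‖ ≤ ‖ρ i a‖ + ‖ρ₀ a‖ := norm_sub_le _ _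
          _ ≤ _ := by linarith [hi a, hρ₀ a]
      · rw [lintegral_const_mul' _ _ (by finiteness), ← eLpNorm_two_sq]
        finiteness
      · refine Eventually.of_forall fun a => ?_
        have h1 : Tendsto (fun i => ((ρ i - ρ₀) * w₀) a) l (𝓝 0) := by
          have : Tendsto (fun i => ρ i a - ρ₀ a) l (𝓝 0) := by
            simpa using (hlim a).sub_const (ρ₀ a)
          simpa using this.mul_const (w₀ a)
        simpa [Function.comp_def] using ((ENNReal.continuous_pow 2).tendsto (0 : ENNReal)).comp
          (by simpa using h1.enorm)
    simpa [Function.comp_def] using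
      ((ENNReal.continuous_rpow_const (y := 1 / 2)).tendsto 0).comp h0
  have hub : Tendsto (fun i => ENNReal.ofReal B * eLpNorm (w i - w₀) 2 μ +
      eLpNorm ((ρ i - ρ₀) * w₀) 2 μ) l (𝓝 0) := by
    simpa using (ENNReal.Tendsto.const_mul hwl (Or.inr ENNReal.ofReal_ne_top)).add hdct
  refine tendsto_of_tendsto_of_tendsto_of_le_of_le' tendsto_const_nhds hub
    (Eventually.of_forall fun _ => zero_le) ?_
  filter_upwards [hρ] with i hi
  calc eLpNorm (ρ i * w i - ρ₀ * w₀) 2 μ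
      = eLpNorm (ρ i * (w i - w₀) + (ρ i - ρ₀) * w₀) 2 μ := by
        congr 1; ring
    _ ≤ eLpNorm (ρ i * (w i - w₀)) 2 μ + eLpNorm ((ρ i - ρ₀) * w₀) 2 μ :=
        eLpNorm_add_le ((hρm i).aestronglyMeasurable.mul ((hw i).sub hw₀))
          (((hρm i).sub hρm₀).aestronglyMeasurable.mul hw₀) (by norm_num)
    _ ≤ _ := by
        gcongr
        refine eLpNorm_le_mul_eLpNorm_of_ae_le_mul (Eventually.of_forall fun a => ?_) 2
        rw [Pi.mul_apply, norm_mul]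
        gcongr
        exact hi a

lemma tendsto_integral_mul_norm_sq {ρ : ι → α → ℝ} {ρ₀ : α → ℝ} {w : ι → α → ℂ} {w₀ : α → ℂ}
    {B : ℝ} (hρm : ∀ i, Measurable (ρ i)) (hρm₀ : Measurable ρ₀)
    (hρ : ∀ᶠ i in l, ∀ a, ‖ρ i a‖ ≤ B) (hρ₀ : ∀ a, ‖ρ₀ a‖ ≤ B)
    (hlim : ∀ a, Tendsto (fun i => ρ i a) l (𝓝 (ρ₀ a)))
    (hw : ∀ i, AEStronglyMeasurable (w i) μ) (hw₀ : AEStronglyMeasurable w₀ μ)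
    (hw2 : eLpNorm w₀ 2 μ < ⊤)
    (hwl : Tendsto (fun i => eLpNorm (w i - w₀) 2 μ) l (𝓝 0)) :
    Tendsto (fun i => ∫ a, ρ i a * ‖w i a‖ ^ 2 ∂μ) l (𝓝 (∫ a, ρ₀ a * ‖w₀ a‖ ^ 2 ∂μ)) := by
  have hmul := tendsto_eLpNorm_mul_sub (ρ := fun i a => (ρ i a : ℂ)) (ρ₀ := fun a => (ρ₀ a : ℂ))
    (B := B) (fun i => Complex.measurable_ofReal.comp (hρm i))
    (Complex.measurable_ofReal.comp hρm₀) (by simpa using hρ) (by simpa using hρ₀)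
    (fun a => (Complex.continuous_ofReal.tendsto _).comp (hlim a)) hw hw₀ hw2 hwl
  have bw := tendsto_eLpNorm_of_sub hw hw₀ hwl
  have meas : ∀ i, AEStronglyMeasurable (fun a => ρ i a * ‖w i a‖ ^ 2) μ := fun i =>
    (hρm i).aestronglyMeasurable.mul ((hw i).norm.pow 2)
  have meas₀ : AEStronglyMeasurable (fun a => ρ₀ a * ‖w₀ a‖ ^ 2) μ :=
    hρm₀.aestronglyMeasurable.mul (hw₀.norm.pow 2)
  have int : ∀ i, (∀ a, ‖ρ i a‖ ≤ B) → eLpNorm (w i) 2 μ < ⊤ →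
      Integrable (fun a => ρ i a * ‖w i a‖ ^ 2) μ := by
    intro i h1 h2
    have h3 : Integrable (fun a => ‖w i a‖ ^ 2) μ := MemLp.integrable_norm_pow ⟨hw i, h2⟩ (by simp)
    exact h3.bdd_mul (hρm i).aestronglyMeasurable (Eventually.of_forall h1)
  set P : ι → α → ℂ := fun i => (fun a => (ρ i a : ℂ)) * w i with hP
  set P₀ : α → ℂ := (fun a => (ρ₀ a : ℂ)) * w₀ with hP₀
  have mP : ∀ i, AEStronglyMeasurable (P i) μ := fun i =>
    (Complex.measurable_ofReal.comp (hρm i)).aestronglyMeasurable.mul (hw i)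
  have mP₀ : AEStronglyMeasurable P₀ μ :=
    (Complex.measurable_ofReal.comp hρm₀).aestronglyMeasurable.mul hw₀
  have fP₀ : eLpNorm P₀ 2 μ < ⊤ := by
    refine (eLpNorm_le_mul_eLpNorm_of_ae_le_mul (g := w₀) (c := B)
      (Eventually.of_forall fun a => ?_) 2).trans_lt (ENNReal.mul_lt_top (by simp) hw2)
    rw [hP₀, Pi.mul_apply, norm_mul, Complex.norm_real]
    gcongr
    exact hρ₀ a
  refine tendsto_integral_of_L1 _ meas₀ ?_ ?_
  · filter_upwards [hρ, bw] with i h1 h2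
    exact int i h1 (h2.trans_lt (ENNReal.add_lt_top.2 ⟨hw2, by simp⟩))
  have hub : Tendsto (fun i => eLpNorm (P i - P₀) 2 μ * (eLpNorm w₀ 2 μ + 1) +
      eLpNorm P₀ 2 μ * eLpNorm (w i - w₀) 2 μ) l (𝓝 0) := by
    have t1 := ENNReal.Tendsto.mul_const (b := eLpNorm w₀ 2 μ + 1) hmul
      (Or.inr (by finiteness))
    have t2 := ENNReal.Tendsto.const_mul (a := eLpNorm P₀ 2 μ) hwl (Or.inr fP₀.ne)
    simpa using t1.add t2
  refine tendsto_of_tendsto_of_tendsto_of_le_of_le' tendsto_const_nhds hub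
    (Eventually.of_forall fun _ => zero_le) ?_
  filter_upwards [bw] with i h2
  calc ∫⁻ a, ‖ρ i a * ‖w i a‖ ^ 2 - ρ₀ a * ‖w₀ a‖ ^ 2‖ₑ ∂μ
      ≤ ∫⁻ a, (‖(P i - P₀) a‖ₑ * ‖w i a‖ₑ + ‖P₀ a‖ₑ * ‖(w i - w₀) a‖ₑ) ∂μ := by
        refine lintegral_mono fun a => ?_
        -- With `P = ρ w`, the difference is `(P_i - P₀) w̄_i + P₀ (w̄_i - w̄₀)`, bilinear in
        -- quantities that converge in `L²`.
        have e : ((ρ i a * ‖w i a‖ ^ 2 - ρ₀ a * ‖w₀ a‖ ^ 2 : ℝ) : ℂ) =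
            (P i - P₀) a * (starRingEnd ℂ) (w i a) +
              P₀ a * (starRingEnd ℂ) ((w i - w₀) a) := by
          simp only [hP, hP₀, Pi.sub_apply, Pi.mul_apply, map_sub]
          push_cast
          rw [← Complex.mul_conj', ← Complex.mul_conj']
          ring
        have e2 : ‖ρ i a * ‖w i a‖ ^ 2 - ρ₀ a * ‖w₀ a‖ ^ 2‖ₑ =
            ‖((ρ i a * ‖w i a‖ ^ 2 - ρ₀ a * ‖w₀ a‖ ^ 2 : ℝ) : ℂ)‖ₑ := by
          rw [← ofReal_norm, ← ofReal_norm, Complex.norm_real]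
        rw [e2, e]
        refine (enorm_add_le _ _).trans (le_of_eq ?_)
        simp only [enorm_mul, RCLike.enorm_conj]
    _ = ∫⁻ a, ‖(P i - P₀) a‖ₑ * ‖w i a‖ₑ ∂μ + ∫⁻ a, ‖P₀ a‖ₑ * ‖(w i - w₀) a‖ₑ ∂μ :=
        lintegral_add_left' (((mP i).sub mP₀).enorm.mul (hw i).enorm) _
    _ ≤ eLpNorm (P i - P₀) 2 μ * eLpNorm (w i) 2 μ +
          eLpNorm P₀ 2 μ * eLpNorm (w i - w₀) 2 μ :=
        add_le_add (lintegral_enorm_mul_le ((mP i).sub mP₀) (hw i))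
          (lintegral_enorm_mul_le mP₀ ((hw i).sub hw₀))
    _ ≤ _ := by gcongr

end Multiplication

end VlasovGevrey

namespace VlasovGevrey

/-! ### Fourier coefficients of periodic functions -/

section Torus

variable {d : ℕ}

/-- The closed fundamental cell `[0, 2π]^d`. -/
def closedCell (d : ℕ) : Set (Eucl d) := {x | ∀ i, x i ∈ Icc (0 : ℝ) (2 * Real.pi)}

lemma isCompact_closedCell : IsCompact (closedCell d) := by
  have h : IsCompact (Set.univ.pi fun _ : Fin d => Icc (0 : ℝ) (2 * Real.pi)) :=
    isCompact_univ_pi fun _ => isCompact_Icc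
  have h2 := h.image (PiLp.continuous_toLp 2 (fun _ : Fin d => ℝ))
  convert h2 using 1
  ext x
  simp only [closedCell, mem_ofPred_eq, mem_image, Set.mem_pi, mem_univ, true_imp_iff]
  constructor
  · exact fun h => ⟨x.ofLp, h, rfl⟩
  · rintro ⟨y, hy, rfl⟩; exact hy

lemma torusCell_subset_closedCell : torusCell d ⊆ closedCell d :=
  fun _ hx i => Ico_subset_Icc_self (hx i)

lemma torusCell_ae_eq_closedCell : (torusCell d : Set (Eucl d)) =ᵐ[volume] closedCell d := by
  have h := (Measure.univ_pi_Ico_ae_eq_Icc (μ := fun _ : Fin d => (volume : Measure ℝ))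
    (f := fun _ => (0 : ℝ)) (g := fun _ => 2 * Real.pi))
  have h2 := (PiLp.volume_preserving_ofLp (Fin d)).quasiMeasurePreserving.preimage_ae_eq h
  have e1 : torusCell d = WithLp.ofLp ⁻¹' Set.univ.pi fun _ => Ico (0 : ℝ) (2 * Real.pi) := by
    ext x; simp [torusCell]
  have e2 : closedCell d = WithLp.ofLp ⁻¹' Icc (fun _ => (0 : ℝ)) fun _ => 2 * Real.pi := by
    ext x; simp [closedCell, Pi.le_def, forall_and]
  rw [e1, e2]
  exact h2

lemma volume_torusCell_lt_top : volume (torusCell d) < ⊤ :=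
  (measure_mono torusCell_subset_closedCell).trans_lt isCompact_closedCell.measure_lt_top

lemma continuous_integrableOn_torusCell {E : Type*} [NormedAddCommGroup E] {g : Eucl d → E}
    (hg : Continuous g) : IntegrableOn g (torusCell d) :=
  (hg.continuousOn.integrableOn_compact isCompact_closedCell).mono_set torusCell_subset_closedCell

/-- The character `e^{i x·k}`. -/
noncomputable def character (k : Fin d → ℤ) (x : Eucl d) : ℂ :=
  Complex.exp (Complex.I * ((∑ i, x i * (k i : ℝ) : ℝ) : ℂ))

lemma continuous_character (k : Fin d → ℤ) : Continuous (character k) := by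
  unfold character; fun_prop

lemma norm_character (k : Fin d → ℤ) (x : Eucl d) : ‖character k x‖ = 1 := by
  unfold character; rw [mul_comm, Complex.norm_exp_ofReal_mul_I]

lemma character_neg (k : Fin d → ℤ) (x : Eucl d) :
    character (-k) x =
      Complex.exp (-Complex.I * ((∑ i, x i * (k i : ℝ) : ℝ) : ℂ)) := by
  unfold character; congr 1
  simp only [Pi.neg_apply, Int.cast_neg, mul_neg, Finset.sum_neg_distrib]
  push_cast; ring

lemma character_add (k l : Fin d → ℤ) (x : Eucl d) :
    character (k + l) x = character k x * character l x := by
  unfold character; rw [← Complex.exp_add]; congr 1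
  simp only [Pi.add_apply, Int.cast_add, mul_add, Finset.sum_add_distrib]
  push_cast; ring

lemma torusFourier_eq (g : Eucl d → ℝ) (k : Fin d → ℤ) :
    torusFourier g k = (((2 * Real.pi) ^ d)⁻¹ : ℂ) *
      ∫ x in torusCell d, character (-k) x * (g x : ℂ) := by
  simp only [torusFourier, character_neg]

lemma torusFourier_neg (g : Eucl d → ℝ) (k : Fin d → ℤ) :
    torusFourier g (-k) = (starRingEnd ℂ) (torusFourier g k) := by
  rw [torusFourier_eq, torusFourier_eq, map_mul, ← integral_conj]
  congr 1
  · simp only [map_inv₀, map_pow, map_mul, map_ofNat, Complex.conj_ofReal]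
  · refine integral_congr_ae (Eventually.of_forall fun x => ?_)
    simp only [map_mul, Complex.conj_ofReal]
    congr 1
    rw [neg_neg, character_neg, ← Complex.exp_conj, character]
    simp

lemma TorusPeriodic.add_intVec {F : Type*} {g : Eucl d → F} (hp : TorusPeriodic g)
    (k : Fin d → ℤ) (x : Eucl d) : g (x + (2 * Real.pi) • intVec k) = g x := by
  classical
  have key : ∀ S : Finset (Fin d), Function.Periodic g
      (∑ i ∈ S, (k i) • (EuclideanSpace.single i (2 * Real.pi) : Eucl d)) := by
    intro S
    induction S using Finset.induction_on with
    | empty => intro x; simp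
    | insert i S hi ih =>
      rw [Finset.sum_insert hi]
      exact Function.Periodic.add_period
        (Function.Periodic.zsmul (fun x => hp x i) (k i)) ih
  have := key Finset.univ x
  convert this using 3
  ext j
  simp [Finset.sum_apply, Pi.single_apply, mul_comm]

/-- The projection of Euclidean space onto the unit torus, after rescaling the period `2π`. -/
noncomputable def toUnitTorus (x : Eucl d) : UnitAddTorus (Fin d) :=
  fun i => ((x i / (2 * Real.pi) : ℝ) : UnitAddCircle)

lemma surjective_toUnitTorus : Function.Surjective (toUnitTorus (d := d)) := by
  intro θ
  choose y hy using fun i => QuotientAddGroup.mk_surjective (θ i)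
  refine ⟨WithLp.toLp 2 fun i => 2 * Real.pi * y i, ?_⟩
  funext i
  simp only [toUnitTorus]
  rw [mul_div_cancel_left₀ _ (by positivity)]
  exact hy i

lemma toUnitTorus_add (x y : Eucl d) : toUnitTorus (x + y) = toUnitTorus x + toUnitTorus y := by
  funext i
  simp [toUnitTorus, add_div]

lemma mFourier_toUnitTorus (k : Fin d → ℤ) (x : Eucl d) :
    UnitAddTorus.mFourier k (toUnitTorus x) = character k x := by
  simp only [UnitAddTorus.mFourier, ContinuousMap.coe_mk, toUnitTorus, fourier_coe_apply,
    character]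
  rw [← Complex.exp_sum]
  congr 1
  push_cast
  rw [Finset.mul_sum]
  refine Finset.sum_congr rfl fun i _ => ?_
  have : (Real.pi : ℂ) ≠ 0 := by exact_mod_cast Real.pi_ne_zero
  field_simp

open scoped Pointwise in
-- The factor `(2π)^{-d}` is the Jacobian of the dilation by `2π`, and the half-open cells `(0,1]^d`
-- and `[0,1)^d` differ by a null set. This gives access to Fourier theory on the unit torus.
lemma mFourierCoeff_eq_torusFourier {g : Eucl d → ℝ} {G : UnitAddTorus (Fin d) → ℂ}
    (h : ∀ x, G (toUnitTorus x) = g x) (k : Fin d → ℤ) :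
    UnitAddTorus.mFourierCoeff G k = torusFourier g k := by
  rw [UnitAddTorus.mFourierCoeff_eq_integral G k (fun _ => 0), torusFourier_eq]
  have hset : ({y : Fin d → ℝ | ∀ i, y i ∈ Ioc (0 : ℝ) (0 + 1)} : Set (Fin d → ℝ)) =ᵐ[volume]
      {y | ∀ i, y i ∈ Ico (0 : ℝ) 1} := by
    have h1 := (Measure.univ_pi_Ico_ae_eq_Icc (μ := fun _ : Fin d => (volume : Measure ℝ))
      (f := fun _ => (0 : ℝ)) (g := fun _ => 1))
    have h2 := (Measure.univ_pi_Ioc_ae_eq_Icc (μ := fun _ : Fin d => (volume : Measure ℝ))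
      (f := fun _ => (0 : ℝ)) (g := fun _ => 1))
    have e1 : {y : Fin d → ℝ | ∀ i, y i ∈ Ioc (0 : ℝ) (0 + 1)} =
        Set.univ.pi fun _ => Ioc (0 : ℝ) 1 := by ext y; simp
    have e2 : {y : Fin d → ℝ | ∀ i, y i ∈ Ico (0 : ℝ) 1} =
        Set.univ.pi fun _ => Ico (0 : ℝ) 1 := by ext y; simp
    rw [e1, e2]
    exact h2.trans h1.symm
  rw [setIntegral_congr_set hset]
  have hpre : ({y : Fin d → ℝ | ∀ i, y i ∈ Ico (0 : ℝ) 1} : Set (Fin d → ℝ)) =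
      (WithLp.toLp 2) ⁻¹' {x : Eucl d | ∀ i, x i ∈ Ico (0 : ℝ) 1} := rfl
  have hemb : MeasurableEmbedding (WithLp.toLp 2 : (Fin d → ℝ) → Eucl d) :=
    (MeasurableEquiv.toLp 2 (Fin d → ℝ)).measurableEmbedding
  have hint : ∀ y : Fin d → ℝ,
      UnitAddTorus.mFourier (-k) (fun i => (y i : UnitAddCircle)) • G (fun i => (y i : UnitAddCircle)) =
      (fun x : Eucl d => character (-k) ((2 * Real.pi) • x) * (g ((2 * Real.pi) • x) : ℂ))
        (WithLp.toLp 2 y) := by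
    intro y
    have e : (fun i => (y i : UnitAddCircle)) =
        toUnitTorus ((2 * Real.pi) • (WithLp.toLp 2 y : Eucl d)) := by
      funext i
      simp only [toUnitTorus, PiLp.smul_apply, smul_eq_mul]
      rw [mul_div_cancel_left₀ _ (by positivity)]
    rw [e, mFourier_toUnitTorus, h, smul_eq_mul]
  simp only [hint]
  rw [hpre, (PiLp.volume_preserving_toLp (Fin d)).setIntegral_preimage_emb hemb
    (fun x : Eucl d => character (-k) ((2 * Real.pi) • x) * (g ((2 * Real.pi) • x) : ℂ))]
  rw [Measure.setIntegral_comp_smul_of_pos (volume : Measure (Eucl d))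
    (fun x : Eucl d => character (-k) x * (g x : ℂ)) _ (by positivity : (0 : ℝ) < 2 * Real.pi)]
  have hcell : (2 * Real.pi) • {x : Eucl d | ∀ i, x i ∈ Ico (0 : ℝ) 1} = torusCell d := by
    ext x
    rw [Set.mem_smul_set_iff_inv_smul_mem₀ (by positivity)]
    simp only [mem_ofPred_eq, PiLp.smul_apply, smul_eq_mul, torusCell, mem_Ico]
    refine forall_congr' fun i => ?_
    rw [inv_mul_lt_iff₀ (by positivity), mul_one]
    refine and_congr_left fun _ => ?_
    constructor
    · intro h
      have := mul_nonneg (by positivity : (0 : ℝ) ≤ 2 * Real.pi) h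
      rwa [mul_inv_cancel_left₀ (by positivity)] at this
    · intro h; positivity
  rw [hcell, Complex.real_smul]
  congr 1
  simp

/-- A periodic function factors through the quotient map, which is open; the lift is defined by an
arbitrary choice of representatives and is continuous because its pull-back is. -/
lemma exists_unitTorus_lift {g : Eucl d → ℝ} (hg : Continuous g) (hp : TorusPeriodic g) :
    ∃ G : C(UnitAddTorus (Fin d), ℂ), ∀ x, G (toUnitTorus x) = g x := by
  classical
  have hq : IsOpenQuotientMap fun (y : Fin d → ℝ) (i : Fin d) => (y i : UnitAddCircle) :=
    IsOpenQuotientMap.piMap (f := fun (_ : Fin d) (y : ℝ) => (y : UnitAddCircle))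
      fun _ => QuotientAddGroup.isOpenQuotientMap_mk
  set F : (Fin d → ℝ) → ℂ := fun y => (g ((2 * Real.pi) • (WithLp.toLp 2 y : Eucl d)) : ℂ) with hF
  have hFc : Continuous F := by
    have : Continuous fun y : Fin d → ℝ => (WithLp.toLp 2 y : Eucl d) :=
      PiLp.continuous_toLp 2 (fun _ : Fin d => ℝ)
    fun_prop
  have hfac : ∀ a b : Fin d → ℝ, (fun i => (a i : UnitAddCircle)) = (fun i => (b i : UnitAddCircle)) →
      F a = F b := by
    intro a b hab
    have : ∀ i, ∃ n : ℤ, a i = b i + n := by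
      intro i
      have h0 : ((a i - b i : ℝ) : UnitAddCircle) = 0 := by
        rw [AddCircle.coe_sub, congrFun hab i, sub_self]
      obtain ⟨n, hn⟩ := (AddCircle.coe_eq_zero_iff (1 : ℝ)).1 h0
      refine ⟨n, ?_⟩
      have : (n : ℝ) = a i - b i := by simpa using hn
      linarith
    choose n hn using this
    have e : (2 * Real.pi) • (WithLp.toLp 2 a : Eucl d) =
        (2 * Real.pi) • (WithLp.toLp 2 b : Eucl d) + (2 * Real.pi) • intVec n := by
      ext i; simp [hn i, mul_add]
    simp only [hF]
    rw [e, hp.add_intVec]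
  refine ⟨⟨fun θ => F (Function.surjInv hq.surjective θ), ?_⟩, ?_⟩
  · rw [hq.isQuotientMap.continuous_iff]
    refine hFc.congr fun y => ?_
    exact hfac _ _ (Function.surjInv_eq hq.surjective _).symm
  · intro x
    change F (Function.surjInv hq.surjective (toUnitTorus x)) = g x
    have e : toUnitTorus x = fun i => (((fun j => x j / (2 * Real.pi)) i : ℝ) : UnitAddCircle) := rfl
    rw [e, hfac _ _ (Function.surjInv_eq hq.surjective _)]
    simp only [hF]
    congr 2
    ext i
    simp only [PiLp.smul_apply, smul_eq_mul]
    field_simp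

/-- On the torus this is invariance of Haar measure, which avoids rearranging pieces of a shifted
fundamental cell. -/
lemma torusFourier_translate {g : Eucl d → ℝ} (hg : Continuous g) (hp : TorusPeriodic g)
    (y : Eucl d) (k : Fin d → ℤ) :
    torusFourier (fun x => g (x + y)) k = character k y * torusFourier g k := by
  obtain ⟨G, hG⟩ := exists_unitTorus_lift hg hp
  have h1 : ∀ x, (fun θ => G (θ + toUnitTorus y)) (toUnitTorus x) = ((g (x + y) : ℝ) : ℂ) := by
    intro x
    simp only [← toUnitTorus_add, hG]
  rw [← mFourierCoeff_eq_torusFourier (G := fun θ => G (θ + toUnitTorus y)) h1, ← mFourierCoeff_eq_torusFourier hG]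
  let _ : MeasureSpace UnitAddCircle := ⟨AddCircle.haarAddCircle⟩
  have : Measure.IsAddHaarMeasure (volume : Measure UnitAddCircle) :=
    inferInstanceAs (Measure.IsAddHaarMeasure AddCircle.haarAddCircle)
  have h2 : ∀ θ, UnitAddTorus.mFourier (-k) θ • G (θ + toUnitTorus y) =
      (fun θ => character k y * (UnitAddTorus.mFourier (-k) θ • G θ)) (θ + toUnitTorus y) := by
    intro θ
    obtain ⟨x, rfl⟩ := surjective_toUnitTorus θ
    simp only [← toUnitTorus_add, mFourier_toUnitTorus, smul_eq_mul]
    have : character (-k) x = character k y * character (-k) (x + y) := by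
      simp only [character, ← Complex.exp_add]
      congr 1
      simp only [Pi.neg_apply, Int.cast_neg, mul_neg, Finset.sum_neg_distrib, PiLp.add_apply,
        add_mul, Finset.sum_add_distrib]
      push_cast; ring
    rw [this]; ring
  calc UnitAddTorus.mFourierCoeff (fun θ => G (θ + toUnitTorus y)) k
      = ∫ θ, UnitAddTorus.mFourier (-k) θ • G (θ + toUnitTorus y) := rfl
    _ = ∫ θ, (fun θ => character k y * (UnitAddTorus.mFourier (-k) θ • G θ))
          (θ + toUnitTorus y) := by simp only [h2]
    _ = ∫ θ, character k y * (UnitAddTorus.mFourier (-k) θ • G θ) :=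
        integral_add_right_eq_self
          (fun θ => character k y * (UnitAddTorus.mFourier (-k) θ • G θ)) (toUnitTorus y)
    _ = character k y * ∫ θ, UnitAddTorus.mFourier (-k) θ • G θ := integral_const_mul _ _
    _ = _ := rfl

lemma hasSum_torusFourier {g : Eucl d → ℝ} (hg : Continuous g) (hp : TorusPeriodic g)
    (hs : Summable (torusFourier g)) (x : Eucl d) :
    HasSum (fun k => torusFourier g k * character k x) (g x : ℂ) := by
  obtain ⟨G, hG⟩ := exists_unitTorus_lift hg hp
  have he : UnitAddTorus.mFourierCoeff G = torusFourier g :=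
    funext (mFourierCoeff_eq_torusFourier hG)
  have := UnitAddTorus.hasSum_mFourier_series_apply_of_summable (f := G) (by rw [he]; exact hs)
    (toUnitTorus x)
  simpa only [he, hG, mFourier_toUnitTorus, smul_eq_mul] using this

/-- The Fourier series of `g` is inserted under the integral. Only the coefficients of `g` have to
be summable, since `p` is bounded on the cell; later `g` is a component of `u` and `p` a velocity
derivative of `f`. -/
lemma hasSum_torusFourier_mul {g p : Eucl d → ℝ} (hg : Continuous g) (hgp : TorusPeriodic g)
    (hp : Continuous p) (hs : Summable (torusFourier g)) (k : Fin d → ℤ) :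
    HasSum (fun l => torusFourier g (k - l) * torusFourier p l)
      (torusFourier (fun x => g x * p x) k) := by
  have hc : Continuous fun x => (p x : ℂ) := Complex.continuous_ofReal.comp hp
  have hint : ∀ m, Integrable (fun x => character (-k) x *
      (torusFourier g m * character m x) * (p x : ℂ)) (volume.restrict (torusCell d)) := fun m =>
    continuous_integrableOn_torusCell
      (((continuous_character _).mul (continuous_const.mul (continuous_character _))).mul hc)
  have hsum : Summable fun m => ∫ x in torusCell d, ‖character (-k) x *
      (torusFourier g m * character m x) * (p x : ℂ)‖ := by
    simp only [norm_mul, norm_character, one_mul, mul_one]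
    simp only [integral_const_mul]
    exact hs.norm.mul_right _
  have h1 := hasSum_integral_of_summable_integral_norm hint hsum
  have h2 : ∀ x, ∑' m, character (-k) x * (torusFourier g m * character m x) * (p x : ℂ) =
      character (-k) x * ((g x * p x : ℝ) : ℂ) := by
    intro x
    rw [tsum_mul_right, tsum_mul_left, (hasSum_torusFourier hg hgp hs x).tsum_eq]
    push_cast; ring
  simp only [h2] at h1
  have h3 := h1.mul_left (((2 * Real.pi) ^ d)⁻¹ : ℂ)
  rw [← torusFourier_eq] at h3
  rw [← (Equiv.subLeft k).hasSum_iff]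
  refine h3.congr_fun ?_ |> fun h => h
  intro m
  simp only [Function.comp_apply, Equiv.subLeft_apply, sub_sub_cancel]
  rw [torusFourier_eq p, ← mul_assoc, mul_comm (torusFourier g m), mul_assoc, ← integral_const_mul]
  congr 1
  refine integral_congr_ae (Eventually.of_forall fun x => ?_)
  have : character (-(k - m)) x = character (-k) x * character m x := by
    rw [← character_add]; congr 1; ring
  simp only [this]; ring

lemma integrableOn_torusFourier_integrand {g : Eucl d → ℝ} (hg : Continuous g) (k : Fin d → ℤ) :
    IntegrableOn (fun x => character (-k) x * (g x : ℂ)) (torusCell d) :=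
  continuous_integrableOn_torusCell
    ((continuous_character _).mul (Complex.continuous_ofReal.comp hg))

lemma torusFourier_add {g h : Eucl d → ℝ} (hg : Continuous g) (hh : Continuous h)
    (k : Fin d → ℤ) : torusFourier (fun x => g x + h x) k = torusFourier g k + torusFourier h k := by
  simp only [torusFourier_eq]
  rw [← mul_add, ← integral_add (integrableOn_torusFourier_integrand hg k)
    (integrableOn_torusFourier_integrand hh k)]
  simp only [Complex.ofReal_add, mul_add]

lemma torusFourier_const_mul (c : ℝ) (g : Eucl d → ℝ) (k : Fin d → ℤ) :
    torusFourier (fun x => c * g x) k = c * torusFourier g k := by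
  simp only [torusFourier_eq]
  have : ∀ x, character (-k) x * ((c * g x : ℝ) : ℂ) = c * (character (-k) x * (g x : ℂ)) := by
    intro x; push_cast; ring
  simp only [this, integral_const_mul]
  ring

lemma torusFourier_sub {g h : Eucl d → ℝ} (hg : Continuous g) (hh : Continuous h)
    (k : Fin d → ℤ) : torusFourier (fun x => g x - h x) k = torusFourier g k - torusFourier h k := by
  have := torusFourier_add hg (hh.const_mul (-1)) k
  rw [torusFourier_const_mul] at this
  simpa [sub_eq_add_neg] using this

lemma torusFourier_sum {ι : Type*} (S : Finset ι) {g : ι → Eucl d → ℝ}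
    (hg : ∀ i, Continuous (g i)) (k : Fin d → ℤ) :
    torusFourier (fun x => ∑ i ∈ S, g i x) k = ∑ i ∈ S, torusFourier (g i) k := by
  classical
  induction S using Finset.induction_on with
  | empty => simp [torusFourier]
  | insert i S hi ih =>
    simp only [Finset.sum_insert hi]
    rw [torusFourier_add (hg i) (continuous_finsetSum _ fun j _ => hg j), ih]

lemma continuous_torusFourier {Z : Type*} [TopologicalSpace Z] [FirstCountableTopology Z]
    [LocallyCompactSpace Z] {g : Z → Eucl d → ℝ} (hg : Continuous (Function.uncurry g))
    (k : Fin d → ℤ) : Continuous fun z => torusFourier (g z) k := by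
  simp only [torusFourier_eq]
  refine continuous_const.mul ?_
  simp only [setIntegral_congr_set torusCell_ae_eq_closedCell]
  refine continuous_parametric_integral_of_continuous ?_ isCompact_closedCell
  have h1 : Continuous fun q : Z × Eucl d => g q.1 q.2 := hg
  have h2 := (continuous_character (-k)).comp (continuous_snd (X := Z) (Y := Eucl d))
  exact h2.mul (Complex.continuous_ofReal.comp h1)

/-- The fundamental theorem of calculus for fixed `x`, then Fubini on a compact box. It replaces
differentiation under the integral sign throughout. -/
lemma torusFourier_sub_eq_integral {γ γ' : ℝ → Eucl d → ℝ} {a b : ℝ}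
    (hd : ∀ x, ∀ r ∈ uIcc a b, HasDerivWithinAt (fun r => γ r x) (γ' r x) (uIcc a b) r)
    (hγ : ∀ r ∈ uIcc a b, Continuous (γ r)) (hc : Continuous (Function.uncurry γ'))
    (k : Fin d → ℤ) :
    torusFourier (γ b) k - torusFourier (γ a) k = ∫ r in a..b, torusFourier (γ' r) k := by
  have hγ'r : ∀ x, Continuous fun r => γ' r x := fun x =>
    hc.comp (by fun_prop : Continuous fun r : ℝ => (r, x))
  have ftc : ∀ x, γ b x - γ a x = ∫ r in a..b, γ' r x := by
    intro x
    refine (intervalIntegral.integral_eq_sub_of_hasDeriv_right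
      (fun r hr => (hd x r hr).continuousWithinAt) (fun r hr => ?_)
      ((hγ'r x).intervalIntegrable _ _)).symm
    exact ((hd x r (Ioo_subset_Icc_self hr)).hasDerivAt
      (Icc_mem_nhds hr.1 hr.2)).hasDerivWithinAt
  rw [← torusFourier_sub (hγ b right_mem_uIcc) (hγ a left_mem_uIcc)]
  simp only [ftc]
  simp only [torusFourier_eq]
  rw [intervalIntegral.integral_const_mul]
  congr 1
  have hF : Continuous fun q : ℝ × Eucl d => character (-k) q.2 * (γ' q.1 q.2 : ℂ) := by
    have h1 : Continuous fun q : ℝ × Eucl d => γ' q.1 q.2 := hc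
    exact ((continuous_character (-k)).comp continuous_snd).mul (Complex.continuous_ofReal.comp h1)
  have hswap : ∀ x, character (-k) x * ((∫ r in a..b, γ' r x : ℝ) : ℂ) =
      ∫ r in a..b, character (-k) x * (γ' r x : ℂ) := by
    intro x
    rw [intervalIntegral.integral_const_mul, intervalIntegral.integral_ofReal]
  have hI : Integrable (fun q : ℝ × Eucl d => character (-k) q.2 * (γ' q.1 q.2 : ℂ))
      ((volume.restrict (uIoc a b)).prod (volume.restrict (torusCell d))) := by
    rw [Measure.prod_restrict]
    have h1 : IntegrableOn (fun q : ℝ × Eucl d => character (-k) q.2 * (γ' q.1 q.2 : ℂ))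
        (uIcc a b ×ˢ closedCell d) (volume.prod volume) :=
      hF.continuousOn.integrableOn_compact (isCompact_uIcc.prod isCompact_closedCell)
    exact h1.mono_set (prod_mono uIoc_subset_uIcc torusCell_subset_closedCell)
  have hsw := intervalIntegral_integral_swap (a := a) (b := b)
    (μ := (volume : Measure (Eucl d)).restrict (torusCell d))
    (f := fun r x => character (-k) x * (γ' r x : ℂ)) hI
  rw [hsw]
  exact integral_congr_ae (Eventually.of_forall hswap)

lemma enorm_torusFourier_sq_le {g : Eucl d → ℝ} (hg : AEStronglyMeasurable g
    (volume.restrict (torusCell d))) (k : Fin d → ℤ) :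
    ‖torusFourier g k‖ₑ ^ 2 ≤ ENNReal.ofReal (((2 * Real.pi) ^ d)⁻¹ ^ 2) *
      volume (torusCell d) * ∫⁻ x in torusCell d, ‖g x‖ₑ ^ 2 := by
  have h1 : ‖torusFourier g k‖ₑ ≤ ENNReal.ofReal ((2 * Real.pi) ^ d)⁻¹ *
      ∫⁻ x in torusCell d, ‖g x‖ₑ := by
    rw [torusFourier_eq, enorm_mul]
    gcongr
    · rw [← ofReal_norm]
      refine ENNReal.ofReal_le_ofReal (le_of_eq ?_)
      rw [norm_inv, norm_pow, norm_mul, Complex.norm_real, Real.norm_eq_abs,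
        abs_of_pos Real.pi_pos]
      simp
    · refine (enorm_integral_le_lintegral_enorm _).trans (lintegral_mono fun x => ?_)
      rw [enorm_mul, ← ofReal_norm, norm_character, ← ofReal_norm, Complex.norm_real, ofReal_norm]
      simp
  have h2 : (∫⁻ x in torusCell d, ‖g x‖ₑ) ^ 2 ≤
      volume (torusCell d) * ∫⁻ x in torusCell d, ‖g x‖ₑ ^ 2 := by
    have := lintegral_mul_le_sqrt_mul_sqrt (volume.restrict (torusCell d))
      (f := fun _ => 1) (g := fun x => ‖g x‖ₑ) aemeasurable_const hg.enorm
    simp only [one_mul, one_pow, lintegral_const, Measure.restrict_apply MeasurableSet.univ,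
      univ_inter] at this
    calc _ ≤ _ := pow_le_pow_left₀ (zero_le) this 2
      _ = _ := by
        rw [mul_pow, ← ENNReal.rpow_natCast, ← ENNReal.rpow_mul, ← ENNReal.rpow_natCast (_ ^ _),
          ← ENNReal.rpow_mul]
        simp
  calc _ ≤ _ := pow_le_pow_left₀ (zero_le) h1 2
    _ = ENNReal.ofReal (((2 * Real.pi) ^ d)⁻¹ ^ 2) * (∫⁻ x in torusCell d, ‖g x‖ₑ) ^ 2 := by
      rw [mul_pow, ENNReal.ofReal_pow (by positivity)]
    _ ≤ _ := by rw [mul_assoc]; gcongr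

end Torus

end VlasovGevrey

/-! ### The Plancherel transform in velocity: duality and affine changes of variables -/

namespace VlasovGevrey

variable {d : ℕ}

/-- The affine homeomorphism `v ↦ c v + y`. -/
noncomputable def affineHomeo {c : ℝ} (hc : c ≠ 0) (y : Eucl d) : Eucl d ≃ₜ Eucl d :=
  (Homeomorph.smulOfNeZero c hc).trans (Homeomorph.addRight y)

theorem map_affineHomeo {c : ℝ} (hc : 0 < c) (y : Eucl d) :
    (volume : Measure (Eucl d)).map (affineHomeo hc.ne' y) =
      ENNReal.ofReal ((c ^ d)⁻¹) • volume := by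
  have h1 : (affineHomeo hc.ne' y : Eucl d → Eucl d) = (fun x => x + y) ∘ fun x => c • x := rfl
  rw [h1, ← Measure.map_map (by fun_prop) (by fun_prop),
    Measure.map_addHaar_smul _ hc.ne', Measure.map_smul, map_add_right_eq_self]
  have : (0 : ℝ) ≤ (c ^ d)⁻¹ := by positivity
  simp [abs_of_nonneg, this]

theorem lintegral_comp_affine {c : ℝ} (hc : 0 < c) (y : Eucl d) (g : Eucl d → ENNReal) :
    ∫⁻ v, g (c • v + y) = ENNReal.ofReal ((c ^ d)⁻¹) * ∫⁻ v, g v := by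
  have := (affineHomeo hc.ne' y).measurableEmbedding.lintegral_map (μ := volume) g
  rw [map_affineHomeo hc, lintegral_smul_measure, smul_eq_mul] at this
  rw [this]; rfl

theorem integral_comp_affine {c : ℝ} (hc : 0 < c) (y : Eucl d) (g : Eucl d → ℂ) :
    ∫ v, g (c • v + y) = ((c ^ d)⁻¹ : ℝ) * ∫ v, g v := by
  have := (affineHomeo hc.ne' y).measurableEmbedding.integral_map (μ := volume) g
  rw [map_affineHomeo hc, integral_smul_measure, ENNReal.toReal_ofReal (by positivity)] at this
  rw [Complex.real_smul] at this
  rw [this]; rfl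

theorem AEStronglyMeasurable.comp_affine {c : ℝ} (hc : 0 < c) (y : Eucl d) {h : Eucl d → ℂ}
    (hh : AEStronglyMeasurable h volume) :
    AEStronglyMeasurable (fun v => h (c • v + y)) volume := by
  have : AEStronglyMeasurable h ((volume : Measure (Eucl d)).map (affineHomeo hc.ne' y)) := by
    rw [map_affineHomeo hc]; exact hh.mono_ac (Measure.smul_absolutelyContinuous)
  exact this.comp_measurable (affineHomeo hc.ne' y).measurable

theorem MemLp.comp_affine {c : ℝ} (hc : 0 < c) (y : Eucl d) {h : Eucl d → ℂ}
    (hh : MemLp h 2 volume) : MemLp (fun v => h (c • v + y)) 2 volume := by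
  refine ⟨AEStronglyMeasurable.comp_affine hc y hh.1, ?_⟩
  have h2 := hh.2
  rw [eLpNorm_two_eq] at h2 ⊢
  rw [lintegral_comp_affine hc y (fun v => ‖h v‖ₑ ^ 2)]
  rw [ENNReal.rpow_lt_top_iff_of_pos (by norm_num)] at h2 ⊢
  exact ENNReal.mul_lt_top ENNReal.ofReal_lt_top h2

theorem MemLp.mul_of_norm_le_one {α : Type*} [MeasurableSpace α] {μ : Measure α} {f g : α → ℂ}
    (hf : MemLp f 2 μ) (hg : AEStronglyMeasurable g μ) (hb : ∀ v, ‖g v‖ ≤ 1) :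
    MemLp (fun v => g v * f v) 2 μ :=
  hf.mono (hg.mul hf.1) (ae_of_all _ fun v => by
    rw [norm_mul]; exact mul_le_of_le_one_left (norm_nonneg _) (hb v))

theorem continuous_exp_inner (b : Eucl d) :
    Continuous fun v => Complex.exp (Complex.I * ((inner ℝ b v : ℝ) : ℂ)) := by
  have : Continuous fun v : Eucl d => (inner ℝ b v : ℝ) := continuous_const.inner continuous_id
  fun_prop

theorem norm_exp_I_mul (r : ℝ) : ‖Complex.exp (Complex.I * (r : ℂ))‖ = 1 := by
  rw [mul_comm, Complex.norm_exp_ofReal_mul_I]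

/-- The transform `v ↦ ∫ e^{-i v·η} φ(η) dη`. -/
noncomputable def fourierInt (φ : Eucl d → ℂ) (v : Eucl d) : ℂ :=
  ∫ η, Complex.exp (-Complex.I * ((inner ℝ v η : ℝ) : ℂ)) * φ η

theorem velocityFourier_eq {h : Eucl d → ℂ} (hh : MemLp h 2 volume) (η : Eucl d) :
    velocityFourier h η =
      (𝓕 (hh.toLp h) : Lp ℂ 2 (volume : Measure (Eucl d))) ((2 * Real.pi)⁻¹ • η) := by
  simp [velocityFourier, hh]

theorem measurable_velocityFourier (h : Eucl d → ℂ) : Measurable (velocityFourier h) := by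
  by_cases hh : MemLp h 2 (volume : Measure (Eucl d))
  · have : velocityFourier h = fun η => _ := funext fun η => velocityFourier_eq hh η
    rw [this]
    exact (Lp.stronglyMeasurable _).measurable.comp (by fun_prop)
  · have : velocityFourier h = fun _ => 0 := by ext η; simp [velocityFourier, hh]
    rw [this]; exact measurable_const

theorem velocityFourier_congr {h h' : Eucl d → ℂ} (e : h =ᵐ[volume] h') :
    velocityFourier h = velocityFourier h' := by
  ext η
  by_cases hh : MemLp h 2 (volume : Measure (Eucl d))
  · have hh' := (memLp_congr_ae e).1 hh
    rw [velocityFourier_eq hh, velocityFourier_eq hh', (MemLp.toLp_eq_toLp_iff hh hh').2 e]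
  · have hh' : ¬ MemLp h' 2 volume := fun H => hh ((memLp_congr_ae e).2 H)
    simp [velocityFourier, hh, hh']

theorem lintegral_velocityFourier_sq {h : Eucl d → ℂ} (hh : MemLp h 2 volume) :
    ∫⁻ η, ‖velocityFourier h η‖ₑ ^ 2 = ENNReal.ofReal ((2 * Real.pi) ^ d) * ∫⁻ v, ‖h v‖ₑ ^ 2 := by
  simp_rw [velocityFourier_eq hh]
  have e := lintegral_comp_affine (d := d) (c := (2 * Real.pi)⁻¹) (by positivity) 0
    (fun ξ => ‖(𝓕 (hh.toLp h) : Lp ℂ 2 (volume : Measure (Eucl d))) ξ‖ₑ ^ 2)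
  simp only [add_zero] at e
  rw [e, ← eLpNorm_two_sq, ← eLpNorm_two_sq, inv_pow, inv_inv]
  congr 2
  rw [← Lp.enorm_def, ← ofReal_norm, Lp.norm_fourier_eq, ofReal_norm, Lp.enorm_def]
  exact eLpNorm_congr_ae hh.coeFn_toLp

theorem memLp_velocityFourier (h : Eucl d → ℂ) : MemLp (velocityFourier h) 2 volume := by
  refine ⟨(measurable_velocityFourier h).aestronglyMeasurable, ?_⟩
  by_cases hh : MemLp h 2 (volume : Measure (Eucl d))
  · rw [eLpNorm_two_eq, lintegral_velocityFourier_sq hh]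
    rw [ENNReal.rpow_lt_top_iff_of_pos (by norm_num)]
    have h2 := hh.2
    rw [eLpNorm_two_eq, ENNReal.rpow_lt_top_iff_of_pos (by norm_num)] at h2
    exact ENNReal.mul_lt_top ENNReal.ofReal_lt_top h2
  · have : velocityFourier h = fun _ => 0 := by ext η; simp [velocityFourier, hh]
    simp [this]

/-- The transform is only an `L²` class, so identities for it are proved by testing. This
multiplication formula is the one for tempered distributions, rescaled by `2π`. -/
theorem integral_mul_velocityFourier {h : Eucl d → ℂ} (hh : MemLp h 2 volume) {φ : Eucl d → ℂ}
    (hφ : ContDiff ℝ ∞ φ) (hc : HasCompactSupport φ) :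
    ∫ η, φ η * velocityFourier h η = ∫ v, fourierInt φ v * h v := by
  have hpi : (0 : ℝ) < 2 * Real.pi := by positivity
  set φ' : Eucl d → ℂ := fun ξ => φ ((2 * Real.pi) • ξ) with hφ'
  have hφ1 : ContDiff ℝ ∞ φ' := hφ.comp (contDiff_const_smul _)
  have hc1 : HasCompactSupport φ' := hc.comp_smul hpi.ne'
  set Φ := hc1.toSchwartzMap hφ1
  have hΦ : ∀ ξ, Φ ξ = φ' ξ := fun _ => rfl
  have key := congrArg (fun D => D Φ) (Lp.fourier_toTemperedDistribution_eq (hh.toLp h))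
  simp only [TemperedDistribution.fourier_apply, Lp.toTemperedDistribution_apply, smul_eq_mul] at key
  have e1 : ∫ η, φ η * velocityFourier h η = ((2 * Real.pi) ^ d : ℝ) *
      ∫ ξ, Φ ξ * (𝓕 (hh.toLp h) : Lp ℂ 2 (volume : Measure (Eucl d))) ξ := by
    have := integral_comp_affine (d := d) (inv_pos.2 hpi) 0
      (fun ξ => Φ ξ * (𝓕 (hh.toLp h) : Lp ℂ 2 (volume : Measure (Eucl d))) ξ)
    rw [inv_pow, inv_inv] at this
    rw [← this]
    congr 1 with η
    rw [velocityFourier_eq hh, hΦ, hφ', add_zero]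
    simp only [smul_smul, mul_inv_cancel₀ hpi.ne', one_smul]
  have e2 : ∀ v, (𝓕 Φ) v = (((2 * Real.pi) ^ d)⁻¹ : ℝ) * fourierInt φ v := by
    intro v
    rw [SchwartzMap.fourier_coe, Real.fourier_eq', fourierInt]
    have := integral_comp_affine (d := d) hpi 0
      (fun η => Complex.exp (-Complex.I * ((inner ℝ v η : ℝ) : ℂ)) * φ η)
    rw [← this]
    congr 1 with ξ
    rw [hΦ, hφ', smul_eq_mul, add_zero, real_inner_smul_right, real_inner_comm ξ v]
    congr 2
    push_cast; ring
  rw [e1, ← key, ← integral_const_mul]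
  refine integral_congr_ae ?_
  filter_upwards [hh.coeFn_toLp] with v hv
  rw [e2, hv, ← mul_assoc, ← mul_assoc, ← Complex.ofReal_mul, mul_inv_cancel₀ (by positivity)]
  simp

theorem velocityFourier_ae_eq_of_forall {h g : Eucl d → ℂ} (hh : MemLp h 2 volume)
    (hg : MemLp g 2 volume)
    (H : ∀ φ : Eucl d → ℂ, ContDiff ℝ ∞ φ → HasCompactSupport φ →
      ∫ η, φ η * g η = ∫ v, fourierInt φ v * h v) :
    velocityFourier h =ᵐ[volume] g := by
  refine ae_eq_of_integral_contDiff_smul_eq ((memLp_velocityFourier h).locallyIntegrable (by norm_num))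
    (hg.locallyIntegrable (by norm_num)) fun φ h1 h2 => ?_
  have h3 : ContDiff ℝ ∞ (fun η => (φ η : ℂ)) := Complex.ofRealCLM.contDiff.comp h1
  have h4 : HasCompactSupport (fun η => (φ η : ℂ)) := h2.comp_left Complex.ofReal_zero
  have a := integral_mul_velocityFourier hh h3 h4
  rw [← H _ h3 h4] at a
  simpa [Complex.real_smul] using a

/-- The affine map and the modulation are transferred to the test function, for which the formula is
an ordinary change of variables. Translations (`c = 1`, `b = 0`) and the action of the free flow on
a mode (`y = 0`) are special cases. -/
theorem velocityFourier_affine {h : Eucl d → ℂ} (hh : MemLp h 2 volume) {c : ℝ} (hc : 0 < c)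
    (b y : Eucl d) :
    velocityFourier (fun v => Complex.exp (Complex.I * ((inner ℝ b v : ℝ) : ℂ)) * h (c • v + y))
      =ᵐ[volume] fun η => ((c ^ d)⁻¹ : ℝ) *
        (Complex.exp (Complex.I * ((inner ℝ y (c⁻¹ • (η - b)) : ℝ) : ℂ)) *
          velocityFourier h (c⁻¹ • (η - b))) := by
  have eb : ∀ η : Eucl d, c⁻¹ • (η - b) = c⁻¹ • η + (-(c⁻¹ • b)) := fun η => by
    rw [smul_sub, sub_eq_add_neg]
  refine velocityFourier_ae_eq_of_forall ?_ ?_ fun φ hφ hs => ?_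
  · exact MemLp.mul_of_norm_le_one (MemLp.comp_affine hc y hh)
      (continuous_exp_inner b).aestronglyMeasurable fun v => (norm_exp_I_mul _).le
  · refine MemLp.const_mul (MemLp.mul_of_norm_le_one ?_
      ((continuous_exp_inner y).comp (by fun_prop : Continuous fun η : Eucl d => c⁻¹ • (η - b))).aestronglyMeasurable
      fun v => (norm_exp_I_mul _).le) _
    simp_rw [eb]
    exact MemLp.comp_affine (inv_pos.2 hc) _ (memLp_velocityFourier h)
  · set φ' : Eucl d → ℂ := fun ζ => φ (c • ζ + b) *
      Complex.exp (Complex.I * ((inner ℝ y ζ : ℝ) : ℂ)) with hφ'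
    have c1 : ContDiff ℝ ∞ φ' := by
      refine (hφ.comp ((contDiff_const_smul c).add contDiff_const)).mul ?_
      refine (contDiff_const.mul (Complex.ofRealCLM.contDiff.comp ?_)).cexp
      exact contDiff_const.inner ℝ contDiff_id
    have c2 : HasCompactSupport φ' := by
      refine HasCompactSupport.mul_right ?_
      exact hs.comp_homeomorph (affineHomeo hc.ne' b)
    have e1 : ∀ w, fourierInt φ' w = ((c ^ d)⁻¹ : ℝ) *
        (Complex.exp (Complex.I * ((inner ℝ b (c⁻¹ • (w - y)) : ℝ) : ℂ)) *
          fourierInt φ (c⁻¹ • (w - y))) := by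
      intro w
      rw [fourierInt, fourierInt, ← integral_const_mul (Complex.exp _)]
      rw [← integral_comp_affine hc b]
      congr 1 with ζ
      simp only [hφ']
      rw [← mul_assoc, ← mul_assoc, ← Complex.exp_add, mul_right_comm, ← Complex.exp_add]
      congr 2
      simp only [inner_add_right, real_inner_smul_left, real_inner_smul_right, inner_sub_left,
        inner_sub_right]
      rw [real_inner_comm b w, real_inner_comm b y]
      push_cast
      have hcc : (c : ℂ) ≠ 0 := by exact_mod_cast hc.ne'
      field_simp
      ring
    have e2 : ∫ ζ, φ' ζ * velocityFourier h ζ = ∫ η, φ η * (((c ^ d)⁻¹ : ℝ) *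
        (Complex.exp (Complex.I * ((inner ℝ y (c⁻¹ • (η - b)) : ℝ) : ℂ)) *
          velocityFourier h (c⁻¹ • (η - b)))) := by
      have e3 := integral_comp_affine hc b (fun η => φ η *
        (Complex.exp (Complex.I * ((inner ℝ y (c⁻¹ • (η - b)) : ℝ) : ℂ)) *
          velocityFourier h (c⁻¹ • (η - b))))
      rw [← integral_const_mul] at e3
      calc _ = _ := by
            refine Eq.trans ?_ e3
            congr 1 with ζ
            simp only [hφ', add_sub_cancel_right, smul_smul, inv_mul_cancel₀ hc.ne', one_smul]
            ring
        _ = _ := by congr 1 with η; ring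
    rw [← e2, integral_mul_velocityFourier hh c1 c2]
    have e4 := integral_comp_affine hc y (fun w => (Complex.exp (Complex.I * ((inner ℝ b (c⁻¹ • (w - y)) : ℝ) : ℂ)) *
          fourierInt φ (c⁻¹ • (w - y))) * h w)
    rw [← integral_const_mul] at e4
    calc _ = _ := by
          refine Eq.trans ?_ e4.symm
          congr 1 with w
          rw [e1]; ring
      _ = _ := by
          congr 1 with v
          simp only [add_sub_cancel_right, smul_smul, inv_mul_cancel₀ hc.ne', one_smul]
          ring

end VlasovGevrey

/-! ### The Plancherel transform of sums, series and derivatives -/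

namespace VlasovGevrey

variable {d : ℕ}

theorem ae_comp_affine {c : ℝ} (hc : 0 < c) (y : Eucl d) {P : Eucl d → Prop}
    (h : ∀ᵐ v, P v) : ∀ᵐ v : Eucl d, P (c • v + y) := by
  have h' : ∀ᵐ v ∂((volume : Measure (Eucl d)).map (affineHomeo hc.ne' y)), P v := by
    rw [map_affineHomeo hc]
    exact Measure.smul_absolutelyContinuous.ae_le h
  exact ae_of_ae_map (affineHomeo hc.ne' y).measurable.aemeasurable h'

theorem ae_comp_two_pi_inv {P : Eucl d → Prop} (h : ∀ᵐ v, P v) :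
    ∀ᵐ v : Eucl d, P ((2 * Real.pi)⁻¹ • v) := by
  have := ae_comp_affine (c := (2 * Real.pi)⁻¹) (by positivity) 0 h
  simpa using this

theorem velocityFourier_add {h g : Eucl d → ℂ} (hh : MemLp h 2 volume) (hg : MemLp g 2 volume) :
    velocityFourier (fun v => h v + g v) =ᵐ[volume]
      fun η => velocityFourier h η + velocityFourier g η := by
  have e : (hh.add hg).toLp = hh.toLp + hg.toLp := MemLp.toLp_add hh hg
  filter_upwards [ae_comp_two_pi_inv (Lp.coeFn_add (𝓕 (hh.toLp h)) (𝓕 (hg.toLp g)))] with η hη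
  have e2 : velocityFourier (fun v => h v + g v) η = _ := velocityFourier_eq (hh.add hg) η
  rw [velocityFourier_eq hh, velocityFourier_eq hg, e2]
  rw [← Pi.add_apply, ← hη, ← FourierTransform.fourier_add, ← e]

theorem velocityFourier_const_mul {h : Eucl d → ℂ} (hh : MemLp h 2 volume) (c : ℂ) :
    velocityFourier (fun v => c * h v) =ᵐ[volume] fun η => c * velocityFourier h η := by
  have e : (hh.const_mul c).toLp = c • hh.toLp := MemLp.toLp_const_smul c hh
  filter_upwards [ae_comp_two_pi_inv (Lp.coeFn_smul c (𝓕 (hh.toLp h)))] with η hη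
  rw [velocityFourier_eq hh, velocityFourier_eq (hh.const_mul c), e,
    FourierTransform.fourier_smul, hη]
  rfl

theorem velocityFourier_sub {h g : Eucl d → ℂ} (hh : MemLp h 2 volume) (hg : MemLp g 2 volume) :
    velocityFourier (fun v => h v - g v) =ᵐ[volume]
      fun η => velocityFourier h η - velocityFourier g η := by
  have e : (fun v => h v - g v) = fun v => h v + (-1 : ℂ) * g v := by ext; ring
  rw [e]
  filter_upwards [velocityFourier_add hh (hg.const_mul (-1)), velocityFourier_const_mul hg (-1)]
    with η h1 h2
  rw [h1, h2]; ring

theorem velocityFourier_sum {ι : Type*} (S : Finset ι) {h : ι → Eucl d → ℂ}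
    (hh : ∀ i ∈ S, MemLp (h i) 2 volume) :
    velocityFourier (fun v => ∑ i ∈ S, h i v) =ᵐ[volume]
      fun η => ∑ i ∈ S, velocityFourier (h i) η := by
  classical
  induction S using Finset.induction_on with
  | empty =>
    have := velocityFourier_const_mul (h := fun _ : Eucl d => 0) MemLp.zero' 0
    simpa using this
  | insert i S hi ih =>
    simp only [Finset.sum_insert hi]
    have hS : ∀ i ∈ S, MemLp (h i) 2 volume := fun j hj => hh j (Finset.mem_insert_of_mem hj)
    filter_upwards [velocityFourier_add (hh i (Finset.mem_insert_self _ _))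
      (memLp_finsetSum S hS), ih hS] with η h1 h2
    rw [h1, h2]

theorem exists_velocityFourier_eq {g : Eucl d → ℂ} (hg : MemLp g 2 volume) :
    ∃ G : Eucl d → ℂ, MemLp G 2 volume ∧ velocityFourier G =ᵐ[volume] g := by
  have hpi : (0 : ℝ) < 2 * Real.pi := by positivity
  have h1 : MemLp (fun ξ => g ((2 * Real.pi) • ξ)) 2 volume := by
    simpa using MemLp.comp_affine hpi 0 hg
  set G : Lp ℂ 2 (volume : Measure (Eucl d)) := 𝓕⁻ h1.toLp with hG
  refine ⟨G, Lp.memLp G, ?_⟩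
  filter_upwards [ae_comp_two_pi_inv h1.coeFn_toLp] with η hη
  rw [velocityFourier_eq (Lp.memLp G), Lp.toLp_coeFn, hG, FourierTransform.fourier_fourierInv_eq,
    hη, smul_smul, mul_inv_cancel₀ hpi.ne', one_smul]

/-- The series converges absolutely in `L²`, so the isometry may be applied termwise; absolute
convergence also gives convergence almost everywhere, on both sides, which identifies the `L²` sums
with the pointwise ones. -/
theorem ae_hasSum_velocityFourier {ι : Type*} [Countable ι] {h : ι → Eucl d → ℂ} {S : Eucl d → ℂ}
    (hh : ∀ i, MemLp (h i) 2 volume) (hsum : ∑' i, eLpNorm (h i) 2 volume ≠ ⊤)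
    (hS : ∀ v, HasSum (fun i => h i v) (S v)) :
    MemLp S 2 volume ∧
      ∀ᵐ η, HasSum (fun i => velocityFourier (h i) η) (velocityFourier S η) := by
  set F : ι → Lp ℂ 2 (volume : Measure (Eucl d)) := fun i => (hh i).toLp with hF
  have hn : ∀ i, ‖F i‖ₑ = eLpNorm (h i) 2 volume := fun i => by
    rw [Lp.enorm_def]; exact eLpNorm_congr_ae (hh i).coeFn_toLp
  have hsF : ∑' i, ‖F i‖ₑ ≠ ⊤ := by simpa [hn] using hsum
  have hsF' : ∑' i, ‖𝓕 (F i)‖ₑ ≠ ⊤ := by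
    convert hsF using 3 with i
    rw [← ofReal_norm, Lp.norm_fourier_eq, ofReal_norm]
  have e1 : (∑' i, F i : Lp ℂ 2 (volume : Measure (Eucl d))) =ᵐ[volume] S := by
    have a : ∀ᵐ v, ∀ i, F i v = h i v := ae_all_iff.2 fun i => (hh i).coeFn_toLp
    filter_upwards [Lp.hasSum_coeFn_tsum hsF, a] with v h1 h2
    simp only [h2] at h1
    exact h1.unique (hS v)
  have hSm : MemLp S 2 volume := (memLp_congr_ae e1).1 (Lp.memLp _)
  have e2 : hSm.toLp S = ∑' i, F i := by
    rw [← Lp.toLp_coeFn (∑' i, F i) (Lp.memLp _)]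
    exact ((MemLp.toLp_eq_toLp_iff _ _).2 e1).symm
  have e3 : 𝓕 (∑' i, F i) = ∑' i, 𝓕 (F i) :=
    (Lp.fourierTransformₗᵢ (Eucl d) ℂ).toContinuousLinearEquiv.map_tsum
  refine ⟨hSm, ?_⟩
  filter_upwards [ae_comp_two_pi_inv (Lp.hasSum_coeFn_tsum hsF')] with η hη
  rw [velocityFourier_eq hSm, e2, e3]
  simpa only [velocityFourier_eq (hh _)] using hη

theorem velocityFourier_translate {h : Eucl d → ℂ} (hh : MemLp h 2 volume) (y : Eucl d) :
    velocityFourier (fun v => h (v + y)) =ᵐ[volume]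
      fun η => Complex.exp (Complex.I * ((inner ℝ y η : ℝ) : ℂ)) * velocityFourier h η := by
  simpa using velocityFourier_affine hh one_pos 0 y

theorem eLpNorm_velocityFourier {h : Eucl d → ℂ} (hh : MemLp h 2 volume) :
    eLpNorm (velocityFourier h) 2 volume =
      ENNReal.ofReal ((2 * Real.pi) ^ d) ^ (1 / 2 : ℝ) * eLpNorm h 2 volume := by
  rw [eLpNorm_two_eq, lintegral_velocityFourier_sq hh, ENNReal.mul_rpow_of_nonneg _ _ (by norm_num),
    ← eLpNorm_two_eq]

theorem eLpNorm_le_velocityFourier {h : Eucl d → ℂ} (hh : MemLp h 2 volume) :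
    eLpNorm h 2 volume ≤ eLpNorm (velocityFourier h) 2 volume := by
  rw [eLpNorm_velocityFourier hh]
  refine le_mul_of_one_le_left' (ENNReal.one_le_rpow ?_ (by norm_num))
  rw [← ENNReal.ofReal_one]
  refine ENNReal.ofReal_le_ofReal (one_le_pow₀ ?_)
  linarith [Real.pi_gt_three]

/-- That the pointwise derivative lies in `L²` is part of the conclusion. The difference quotients
have transforms `q_n ĥ` with `|q_n| ≤ |e·η|`, so by domination they converge in `L²` to some `G`
whose transform is `i(e·η)ĥ`. A subsequence converges almost everywhere, and its limit is also the
classical derivative. -/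
theorem velocityFourier_of_hasDerivAt {h h' : Eucl d → ℂ} (hh : MemLp h 2 volume) (e : Eucl d)
    (hd : ∀ v, HasDerivAt (fun t : ℝ => h (v + t • e)) (h' v) 0)
    (hg : MemLp (fun η => Complex.I * ((inner ℝ e η : ℝ) : ℂ) * velocityFourier h η) 2 volume) :
    MemLp h' 2 volume ∧ velocityFourier h' =ᵐ[volume]
      fun η => Complex.I * ((inner ℝ e η : ℝ) : ℂ) * velocityFourier h η := by
  set g : Eucl d → ℂ := fun η => Complex.I * ((inner ℝ e η : ℝ) : ℂ) * velocityFourier h η with hgdef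
  obtain ⟨G, hG, hGg⟩ := exists_velocityFourier_eq hg
  set t : ℕ → ℝ := fun n => 1 / ((n : ℝ) + 1) with ht
  have t0 : ∀ n, 0 < t n := fun n => Nat.one_div_pos_of_nat
  have tlim : Tendsto t atTop (𝓝 0) := tendsto_one_div_add_atTop_nhds_zero_nat
  set x : Eucl d → ℝ := fun η => inner ℝ e η with hx
  have hxc : Continuous x := continuous_const.inner continuous_id
  have htr : ∀ n, MemLp (fun v => h (v + t n • e)) 2 volume := fun n => by
    simpa using MemLp.comp_affine one_pos (t n • e) hh
  set H : ℕ → Eucl d → ℂ := fun n v => ((t n)⁻¹ : ℝ) * (h (v + t n • e) - h v) with hH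
  have hHm : ∀ n, MemLp (H n) 2 volume := fun n => ((htr n).sub hh).const_mul _
  set q : ℕ → Eucl d → ℂ := fun n η =>
    ((t n)⁻¹ : ℝ) * (Complex.exp (Complex.I * ((t n * x η : ℝ) : ℂ)) - 1) with hq
  have hFH : ∀ n, velocityFourier (H n) =ᵐ[volume] fun η => q n η * velocityFourier h η := by
    intro n
    filter_upwards [velocityFourier_const_mul ((htr n).sub hh) ((t n)⁻¹ : ℝ),
      velocityFourier_sub (htr n) hh, velocityFourier_translate hh (t n • e)] with η h1 h2 h3
    refine h1.trans ?_
    have h2' : velocityFourier ((fun v => h (v + t n • e)) - h) η = _ := h2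
    rw [h2', h3, hq, real_inner_smul_left]
    ring
  have hqle : ∀ n η, ‖q n η‖ ≤ |x η| := by
    intro n η
    rw [hq, norm_mul, Complex.norm_real, norm_inv, Real.norm_of_nonneg (t0 n).le,
      inv_mul_le_iff₀ (t0 n)]
    refine (Real.norm_exp_I_mul_ofReal_sub_one_le).trans ?_
    rw [norm_mul, Real.norm_of_nonneg (t0 n).le, Real.norm_eq_abs]
  have hqlim : ∀ η, Tendsto (fun n => q n η) atTop (𝓝 (Complex.I * (x η : ℂ))) := by
    intro η
    have hder : HasDerivAt (fun r : ℝ => Complex.exp (Complex.I * ((r * x η : ℝ) : ℂ)))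
        (Complex.I * (x η : ℂ)) 0 := by
      have h1 : HasDerivAt (fun r : ℝ => Complex.I * ((r * x η : ℝ) : ℂ)) (Complex.I * (x η : ℂ)) 0 := by
        have h0 := ((hasDerivAt_id (0 : ℝ)).mul_const (x η)).ofReal_comp
        simpa using h0.const_mul Complex.I
      have h2 := h1.cexp
      simpa using h2
    have := hder.tendsto_slope_zero_right.comp
      (tendsto_nhdsWithin_iff.2 ⟨tlim, Eventually.of_forall fun n => t0 n⟩)
    refine this.congr fun n => ?_
    simp [hq, Function.comp]
  have key : Tendsto (fun n => eLpNorm (H n - G) 2 volume) atTop (𝓝 0) := by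
    have k1 := tendsto_eLpNorm_mul_sub (μ := (volume : Measure (Eucl d))) (l := atTop)
      -- Where `e·η = 0` both quotients are 0 by the convention for division by zero; this is
      -- harmless because `g` vanishes there.
      (ρ := fun n η => q n η / (Complex.I * (x η : ℂ)))
      (ρ₀ := fun η => (Complex.I * (x η : ℂ)) / (Complex.I * (x η : ℂ)))
      (w := fun _ => g) (w₀ := g) (B := 1) (fun n => by fun_prop) (by fun_prop)
      (Eventually.of_forall fun n η => ?_) (fun η => ?_) (fun η => (hqlim η).div_const _)
      (fun _ => hg.1) hg.1 hg.2 (by simp)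
    · refine tendsto_of_tendsto_of_tendsto_of_le_of_le tendsto_const_nhds k1 (fun _ => zero_le)
        fun n => ?_
      refine (eLpNorm_le_velocityFourier ((hHm n).sub hG)).trans (le_of_eq (eLpNorm_congr_ae ?_))
      filter_upwards [velocityFourier_sub (hHm n) hG, hFH n, hGg] with η h1 h2 h3
      have h1' : velocityFourier (H n - G) η = velocityFourier (H n) η - velocityFourier G η := h1
      rw [h1', h2, h3]
      simp only [Pi.sub_apply, Pi.mul_apply, hgdef]
      by_cases hz : x η = 0
      · have hqz : q n η = 0 := by
          have := hqle n η; rw [hz, abs_zero] at this; exact norm_le_zero_iff.1 this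
        have hz' : (inner ℝ e η : ℝ) = 0 := hz
        simp [hqz, hz']
      · have hz' : Complex.I * (x η : ℂ) ≠ 0 := by simp [hz]
        have e1 : Complex.I * ((inner ℝ e η : ℝ) : ℂ) = Complex.I * (x η : ℂ) := rfl
        rw [e1, div_self hz', one_mul, div_mul_eq_mul_div, mul_left_comm,
          mul_div_cancel_left₀ _ hz']
    · rw [norm_div]
      refine div_le_one_of_le₀ ((hqle n η).trans ?_) (norm_nonneg _)
      simp
    · rw [norm_div]; exact div_self_le_one _
  have hlim : ∀ v, Tendsto (fun n => H n v) atTop (𝓝 (h' v)) := by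
    intro v
    have := (hd v).tendsto_slope_zero_right.comp
      (tendsto_nhdsWithin_iff.2 ⟨tlim, Eventually.of_forall fun n => t0 n⟩)
    refine this.congr fun n => ?_
    simp [hH, Function.comp]
  obtain ⟨ns, hns, hae⟩ := (tendstoInMeasure_of_tendsto_eLpNorm (by norm_num)
    (fun n => (hHm n).1) hG.1 key).exists_seq_tendsto_ae
  have hGh : G =ᵐ[volume] h' := by
    filter_upwards [hae] with v hv
    exact tendsto_nhds_unique hv ((hlim v).comp hns.tendsto_atTop)
  refine ⟨(memLp_congr_ae hGh).1 hG, ?_⟩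
  rw [← velocityFourier_congr hGh]
  exact hGg

end VlasovGevrey

namespace VlasovGevrey

/-! ### Calculus in `L²` along differentiable curves -/

section Abstract

variable {α : Type*} [MeasurableSpace α] {μ : Measure α}

theorem integrable_norm_sq {w : α → ℂ} (hw : MemLp w 2 μ) : Integrable (fun a => ‖w a‖ ^ 2) μ :=
  (memLp_two_iff_integrable_sq_norm hw.1).1 hw

theorem integral_norm_sq_eq {w : α → ℂ} (hw : MemLp w 2 μ) :
    ∫ a, ‖w a‖ ^ 2 ∂μ = (eLpNorm w 2 μ).toReal ^ 2 := by
  rw [← ENNReal.toReal_pow, eLpNorm_two_sq,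
    integral_eq_lintegral_of_nonneg_ae (f := fun a => ‖w a‖ ^ 2)
      (ae_of_all _ fun a => sq_nonneg ‖w a‖) (hw.1.norm.pow 2)]
  congr 1
  refine lintegral_congr fun a => ?_
  rw [← ofReal_norm, ENNReal.ofReal_pow (norm_nonneg _)]

/-- In `L²`, almost everywhere convergence and convergence of the norms imply convergence. -/
theorem tendsto_eLpNorm_sub_of_ae_of_norm {ι : Type*} {l : Filter ι} [l.IsCountablyGenerated]
    {w : ι → α → ℂ} {w₀ : α → ℂ} (hw : ∀ᶠ i in l, MemLp (w i) 2 μ) (hw₀ : MemLp w₀ 2 μ)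
    (hae : ∀ᵐ a ∂μ, Tendsto (fun i => w i a) l (𝓝 (w₀ a)))
    (hnorm : Tendsto (fun i => eLpNorm (w i) 2 μ) l (𝓝 (eLpNorm w₀ 2 μ))) :
    Tendsto (fun i => eLpNorm (w i - w₀) 2 μ) l (𝓝 0) := by
  have hN : Tendsto (fun i => (eLpNorm (w i) 2 μ).toReal) l (𝓝 (eLpNorm w₀ 2 μ).toReal) :=
    (ENNReal.tendsto_toReal hw₀.2.ne).comp hnorm
  set A : ι → α → ℝ := fun i a => 2 * ‖w i a‖ ^ 2 + 2 * ‖w₀ a‖ ^ 2 with hA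
  set Bf : ι → α → ℝ := fun i a => ‖w i a - w₀ a‖ ^ 2 with hB
  -- The parallelogram inequality makes `2|w|² + 2|w₀|² - |w - w₀|²` nonnegative. Cutting it at its
  -- limit `4|w₀|²` supplies a dominating function, so dominated convergence can serve in place of
  -- Fatou's lemma.
  set m : ι → α → ℝ := fun i a => min (A i a - Bf i a) (4 * ‖w₀ a‖ ^ 2) with hm
  have hAB : ∀ i a, 0 ≤ A i a - Bf i a := by
    intro i a
    have h1 := norm_sub_le (w i a) (w₀ a)
    have h2 := norm_nonneg (w i a - w₀ a)
    simp only [hA, hB]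
    nlinarith [sq_nonneg (‖w i a‖ - ‖w₀ a‖)]
  have i0 := integrable_norm_sq hw₀
  have hmint : Tendsto (fun i => ∫ a, m i a ∂μ) l (𝓝 (∫ a, 4 * ‖w₀ a‖ ^ 2 ∂μ)) := by
    refine tendsto_integral_filter_of_dominated_convergence (fun a => 4 * ‖w₀ a‖ ^ 2) ?_ ?_
      (i0.const_mul 4) ?_
    · filter_upwards [hw] with i hi
      exact ((((hi.1.norm.pow 2).const_mul 2).add ((hw₀.1.norm.pow 2).const_mul 2)).sub
        ((hi.1.sub hw₀.1).norm.pow 2)).inf ((hw₀.1.norm.pow 2).const_mul 4)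
    · refine Eventually.of_forall fun i => ae_of_all _ fun a => ?_
      rw [Real.norm_of_nonneg (le_min (hAB i a) (by positivity))]
      exact min_le_right _ _
    · filter_upwards [hae] with a ha
      have h1 : Tendsto (fun i => min (A i a - Bf i a) (4 * ‖w₀ a‖ ^ 2)) l
          (𝓝 (min ((2 * ‖w₀ a‖ ^ 2 + 2 * ‖w₀ a‖ ^ 2) - ‖w₀ a - w₀ a‖ ^ 2) (4 * ‖w₀ a‖ ^ 2))) :=
        (((((ha.norm.pow 2).const_mul 2).add_const _).sub
          ((ha.sub_const _).norm.pow 2))).min tendsto_const_nhds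
      convert h1 using 2
      have : 2 * ‖w₀ a‖ ^ 2 + 2 * ‖w₀ a‖ ^ 2 = 4 * ‖w₀ a‖ ^ 2 := by ring
      simp [this]
  have hle : ∀ᶠ i in l, (eLpNorm (w i - w₀) 2 μ).toReal ^ 2 ≤
      2 * (eLpNorm (w i) 2 μ).toReal ^ 2 + 2 * (eLpNorm w₀ 2 μ).toReal ^ 2 - ∫ a, m i a ∂μ := by
    filter_upwards [hw] with i hi
    have h1 := integrable_norm_sq hi
    have h2 := integrable_norm_sq (hi.sub hw₀)
    have hAi : Integrable (A i) μ := (h1.const_mul 2).add (i0.const_mul 2)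
    have hmi : Integrable (m i) μ := (hAi.sub h2).inf (i0.const_mul 4)
    rw [← integral_norm_sq_eq hi, ← integral_norm_sq_eq hw₀, ← integral_norm_sq_eq (hi.sub hw₀),
      ← integral_const_mul, ← integral_const_mul,
      ← integral_add (h1.const_mul 2) (i0.const_mul 2), ← integral_sub hAi hmi]
    refine integral_mono h2 (hAi.sub hmi) fun a => ?_
    have : m i a ≤ A i a - Bf i a := min_le_left _ _
    simp only [Pi.sub_apply]
    simp only [hA, hB] at this
    linarith
  have hz : Tendsto (fun i => (eLpNorm (w i - w₀) 2 μ).toReal ^ 2) l (𝓝 0) := by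
    refine tendsto_of_tendsto_of_tendsto_of_le_of_le' tendsto_const_nhds
      ?_ (Eventually.of_forall fun i => by positivity) hle
    have := (((hN.pow 2).const_mul 2).add_const (2 * (eLpNorm w₀ 2 μ).toReal ^ 2)).sub hmint
    convert this using 2
    rw [integral_const_mul, integral_norm_sq_eq hw₀]; ring
  have hz' : Tendsto (fun i => (eLpNorm (w i - w₀) 2 μ).toReal) l (𝓝 0) := by
    have := hz.sqrt
    simpa [Real.sqrt_sq] using this
  have := ENNReal.tendsto_ofReal hz'
  rw [ENNReal.ofReal_zero] at this
  refine this.congr' ?_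
  filter_upwards [hw] with i hi
  exact ENNReal.ofReal_toReal (hi.sub hw₀).2.ne

/-- Converts an integral identity valid for each `v` into differentiability in `L²`: Cauchy-Schwarz
in `r`, then Tonelli, the length of the interval entering once from each. -/
theorem eLpNorm_sub_sub_le [SFinite μ] {F₀ F₁ S₀ : α → ℂ} {S : ℝ → α → ℂ} {a b : ℝ} {B : ENNReal}
    (hF : ∀ v, F₁ v - F₀ v = ∫ r in a..b, S r v)
    (hint : ∀ v, IntervalIntegrable (fun r => S r v) volume a b)
    (hm : Measurable fun p : ℝ × α => S p.1 p.2) (hm₀ : Measurable S₀)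
    (hB : ∀ r ∈ uIcc a b, eLpNorm (S r - S₀) 2 μ ≤ B) :
    eLpNorm (fun v => F₁ v - F₀ v - ((b - a : ℝ) : ℂ) * S₀ v) 2 μ ≤
      ENNReal.ofReal |b - a| * B := by
  have hms : Measurable fun p : ℝ × α => ‖S p.1 p.2 - S₀ p.2‖ₑ ^ 2 := by fun_prop
  have hvol : volume (uIoc a b) = ENNReal.ofReal |b - a| := by
    rw [uIoc, Real.volume_Ioc]
    congr 1
    exact max_sub_min_eq_abs' a b |>.trans (abs_sub_comm a b)
  have hpt : ∀ v, ‖F₁ v - F₀ v - ((b - a : ℝ) : ℂ) * S₀ v‖ₑ ^ 2 ≤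
      ENNReal.ofReal |b - a| * ∫⁻ r in uIoc a b, ‖S r v - S₀ v‖ₑ ^ 2 := by
    intro v
    have e1 : F₁ v - F₀ v - ((b - a : ℝ) : ℂ) * S₀ v = ∫ r in a..b, (S r v - S₀ v) := by
      rw [intervalIntegral.integral_sub (hint v) intervalIntegrable_const, hF,
        intervalIntegral.integral_const, Complex.real_smul]
    have e2 : ‖F₁ v - F₀ v - ((b - a : ℝ) : ℂ) * S₀ v‖ₑ ≤ ∫⁻ r in uIoc a b, ‖S r v - S₀ v‖ₑ := by
      rw [e1]
      have : ‖∫ r in a..b, (S r v - S₀ v)‖ₑ = ‖∫ r in uIoc a b, (S r v - S₀ v)‖ₑ := by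
        rw [← ofReal_norm, ← ofReal_norm, intervalIntegral.norm_intervalIntegral_eq]
      rw [this]
      exact enorm_integral_le_lintegral_enorm _
    have hmv : Measurable fun r => ‖S r v - S₀ v‖ₑ := by
      have : Measurable fun r => S r v := hm.comp (measurable_id.prodMk measurable_const)
      fun_prop
    have e3 := lintegral_mul_le_sqrt_mul_sqrt (volume.restrict (uIoc a b))
      (f := fun r => ‖S r v - S₀ v‖ₑ) (g := fun _ => 1) hmv.aemeasurable aemeasurable_const
    simp only [mul_one, one_pow, lintegral_const, one_mul, Measure.restrict_apply_univ, hvol] at e3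
    calc _ ≤ ((∫⁻ r in uIoc a b, ‖S r v - S₀ v‖ₑ ^ 2) ^ (1 / 2 : ℝ) *
        (ENNReal.ofReal |b - a|) ^ (1 / 2 : ℝ)) ^ 2 := by gcongr; exact e2.trans e3
      _ = _ := by
        rw [← ENNReal.mul_rpow_of_nonneg _ _ (by norm_num), ← ENNReal.rpow_natCast,
          ← ENNReal.rpow_mul]
        norm_num [mul_comm]
  rw [← ENNReal.pow_le_pow_left_iff (n := 2) (by norm_num), eLpNorm_two_sq]
  calc _ ≤ ∫⁻ v, ENNReal.ofReal |b - a| * (∫⁻ r in uIoc a b, ‖S r v - S₀ v‖ₑ ^ 2) ∂μ :=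
        lintegral_mono hpt
    _ = ENNReal.ofReal |b - a| * ∫⁻ r in uIoc a b, (∫⁻ v, ‖S r v - S₀ v‖ₑ ^ 2 ∂μ) := by
        rw [lintegral_const_mul' _ _ ENNReal.ofReal_ne_top]
        congr 1
        exact lintegral_lintegral_swap (f := fun v r => ‖S r v - S₀ v‖ₑ ^ 2)
          (hms.comp measurable_swap).aemeasurable
    _ ≤ ENNReal.ofReal |b - a| * ∫⁻ r in uIoc a b, B ^ 2 := by
        refine mul_le_mul' le_rfl (setLIntegral_mono' measurableSet_uIoc fun r hr => ?_)
        have := hB r (uIoc_subset_uIcc hr)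
        calc _ = eLpNorm (S r - S₀) 2 μ ^ 2 := by rw [eLpNorm_two_sq]; rfl
          _ ≤ _ := by gcongr
    _ = _ := by rw [setLIntegral_const, hvol]; ring

theorem integral_norm_mul_norm_le {F G : α → ℂ} (hF : MemLp F 2 μ) (hG : MemLp G 2 μ) :
    ∫ a, ‖F a‖ * ‖G a‖ ∂μ ≤ (eLpNorm F 2 μ).toReal * (eLpNorm G 2 μ).toReal := by
  have hprod : Integrable (fun a => ‖F a‖ * ‖G a‖) μ := hF.norm.integrable_mul hG.norm
  rw [integral_eq_lintegral_of_nonneg_ae (ae_of_all _ fun a => by positivity) hprod.1,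
    ← ENNReal.toReal_mul]
  refine ENNReal.toReal_mono (ENNReal.mul_ne_top hF.2.ne hG.2.ne) ?_
  rw [eLpNorm_two_eq, eLpNorm_two_eq]
  refine le_trans (le_of_eq ?_) (lintegral_mul_le_sqrt_mul_sqrt μ hF.1.enorm hG.1.enorm)
  refine lintegral_congr fun a => ?_
  rw [ENNReal.ofReal_mul (norm_nonneg _), ofReal_norm, ofReal_norm]

theorem abs_integral_mul_norm_sq_sub_le {m : α → ℝ} {B : ℝ} (hm : AEStronglyMeasurable m μ)
    (hB : ∀ a, |m a| ≤ B) {F G : α → ℂ} (hF : MemLp F 2 μ) (hG : MemLp G 2 μ) :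
    |∫ a, m a * ‖F a‖ ^ 2 ∂μ - ∫ a, m a * ‖G a‖ ^ 2 ∂μ| ≤
      B * (eLpNorm (F - G) 2 μ).toReal *
        ((eLpNorm (F - G) 2 μ).toReal + 2 * (eLpNorm G 2 μ).toReal) := by
  have hiF : Integrable (fun a => m a * ‖F a‖ ^ 2) μ :=
    (integrable_norm_sq hF).bdd_mul hm (ae_of_all _ hB)
  have hiG : Integrable (fun a => m a * ‖G a‖ ^ 2) μ :=
    (integrable_norm_sq hG).bdd_mul hm (ae_of_all _ hB)
  rcases isEmpty_or_nonempty α with he | ⟨⟨a₀⟩⟩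
  · simp [Measure.eq_zero_of_isEmpty μ]
  have hB0 : 0 ≤ B := (abs_nonneg _).trans (hB a₀)
  have hFG := hF.sub hG
  have hprod : Integrable (fun a => ‖(F - G) a‖ * ‖G a‖) μ := hFG.norm.integrable_mul hG.norm
  rw [← integral_sub hiF hiG]
  have hcs := integral_norm_mul_norm_le hFG hG
  calc |∫ a, (m a * ‖F a‖ ^ 2 - m a * ‖G a‖ ^ 2) ∂μ|
      ≤ ∫ a, B * (‖(F - G) a‖ ^ 2 + 2 * (‖(F - G) a‖ * ‖G a‖)) ∂μ := by
        rw [← Real.norm_eq_abs]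
        refine norm_integral_le_of_norm_le (((integrable_norm_sq hFG).add (hprod.const_mul 2)).const_mul B)
          (ae_of_all _ fun a => ?_)
        rw [← mul_sub, norm_mul]
        refine mul_le_mul (hB a) ?_ (norm_nonneg _) hB0
        rw [Real.norm_eq_abs, Pi.sub_apply, abs_le]
        have h1 : ‖F a‖ ≤ ‖F a - G a‖ + ‖G a‖ := by simpa using norm_add_le (F a - G a) (G a)
        have h2 : ‖G a‖ ≤ ‖F a - G a‖ + ‖F a‖ := by
          rw [norm_sub_rev]; simpa using norm_add_le (G a - F a) (F a)
        have h3 := norm_nonneg (F a - G a)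
        have h4 := norm_nonneg (F a)
        have h5 := norm_nonneg (G a)
        constructor
        · rcases le_total ‖F a‖ ‖G a‖ with h | h <;> nlinarith
        · nlinarith
    _ = B * ((eLpNorm (F - G) 2 μ).toReal ^ 2 + 2 * ∫ a, ‖(F - G) a‖ * ‖G a‖ ∂μ) := by
        rw [integral_const_mul, integral_add (integrable_norm_sq hFG) (hprod.const_mul 2),
          integral_const_mul, integral_norm_sq_eq hFG]
    _ ≤ B * ((eLpNorm (F - G) 2 μ).toReal ^ 2 +
          2 * ((eLpNorm (F - G) 2 μ).toReal * (eLpNorm G 2 μ).toReal)) := by gcongr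
    _ = _ := by ring

/-- Differentiation of a weighted `L²` norm along an `L²`-differentiable curve. -/
theorem hasDerivWithinAt_integral_mul_norm_sq {I : Set ℝ} {t₀ : ℝ} {m : ℝ → α → ℝ} {m' : α → ℝ}
    {F : ℝ → α → ℂ} {S₀ : α → ℂ} {B : ℝ}
    (hm : ∀ τ, Measurable (m τ)) (hB : ∀ᶠ τ in 𝓝[I] t₀, ∀ a, |m τ a| ≤ B)
    (hB₀ : ∀ a, |m t₀ a| ≤ B)
    (hLip : ∀ᶠ τ in 𝓝[I] t₀, ∀ a, |m τ a - m t₀ a| ≤ B * |τ - t₀|)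
    (hm' : ∀ a, HasDerivWithinAt (fun τ => m τ a) (m' a) I t₀)
    (hF : ∀ᶠ τ in 𝓝[I] t₀, MemLp (F τ) 2 μ) (hF₀ : MemLp (F t₀) 2 μ) (hS : MemLp S₀ 2 μ)
    (hd : ∀ η : ℝ, 0 < η → ∀ᶠ τ in 𝓝[I] t₀,
      eLpNorm (fun a => F τ a - F t₀ a - ((τ - t₀ : ℝ) : ℂ) * S₀ a) 2 μ ≤
        ENNReal.ofReal (η * |τ - t₀|)) :
    HasDerivWithinAt (fun τ => ∫ a, m τ a * ‖F τ a‖ ^ 2 ∂μ)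
      (∫ a, (m' a * ‖F t₀ a‖ ^ 2 +
        m t₀ a * (2 * ((starRingEnd ℂ) (F t₀ a) * S₀ a).re)) ∂μ) I t₀ := by
  -- `G` is the tangent line to the curve at `t₀`. Replacing `F` by `G` changes the weighted norm by
  -- `o(τ - t₀)`; for the explicit `G` the difference quotients are dominated and converge
  -- pointwise.
  set G : ℝ → α → ℂ := fun τ a => F t₀ a + ((τ - t₀ : ℝ) : ℂ) * S₀ a with hG
  have hGm : ∀ τ, MemLp (G τ) 2 μ := fun τ => hF₀.add (hS.const_mul _)
  have hG0 : G t₀ = F t₀ := by ext a; simp [hG]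
  rcases isEmpty_or_nonempty α with he | ⟨⟨a₀⟩⟩
  · simp [Measure.eq_zero_of_isEmpty μ, hasDerivWithinAt_const]
  have hB0 : 0 ≤ B := (abs_nonneg _).trans (hB₀ a₀)
  have hclose : ∀ᶠ τ in 𝓝[I] t₀, |τ - t₀| ≤ 1 := by
    refine nhdsWithin_le_nhds ?_
    filter_upwards [Metric.closedBall_mem_nhds t₀ one_pos] with τ hτ
    rwa [Metric.mem_closedBall, Real.dist_eq] at hτ
  have part1 : HasDerivWithinAt (fun τ => ∫ a, m τ a * ‖F τ a‖ ^ 2 ∂μ - ∫ a, m τ a * ‖G τ a‖ ^ 2 ∂μ)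
      0 I t₀ := by
    rw [hasDerivWithinAt_iff_isLittleO]
    simp only [hG0, sub_self, smul_zero, sub_zero]
    rw [Asymptotics.isLittleO_iff]
    intro c hc
    set L : ℝ := (eLpNorm (F t₀) 2 μ).toReal + (eLpNorm S₀ 2 μ).toReal with hL
    have hL0 : 0 ≤ L := by positivity
    -- The minimum with 1 lets the quadratic error be bounded by a linear one; the `+ 1` in the
    -- denominator guards against `B = 0`.
    set η : ℝ := min 1 (c / (B * (1 + 2 * L) + 1)) with hη
    have hden : 0 < B * (1 + 2 * L) + 1 := by positivity
    have hη0 : 0 < η := lt_min one_pos (div_pos hc hden)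
    filter_upwards [hB, hF, hd η hη0, hclose] with τ h1 h2 h3 h4
    have e0 : F τ - G τ = fun a => F τ a - F t₀ a - ((τ - t₀ : ℝ) : ℂ) * S₀ a := by
      ext a; simp [hG]; ring
    have e1 := abs_integral_mul_norm_sq_sub_le (μ := μ) (hm τ).aestronglyMeasurable h1 h2 (hGm τ)
    have e2 : (eLpNorm (F τ - G τ) 2 μ).toReal ≤ η * |τ - t₀| := by
      rw [e0]
      exact ENNReal.toReal_le_of_le_ofReal (by positivity) h3
    have e3 : (eLpNorm (G τ) 2 μ).toReal ≤ L := by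
      have a1 : eLpNorm (G τ) 2 μ ≤ eLpNorm (F t₀) 2 μ + eLpNorm S₀ 2 μ := by
        refine (eLpNorm_add_le hF₀.1 (hS.const_mul _).1 (by norm_num)).trans ?_
        gcongr
        refine eLpNorm_mono fun a => ?_
        rw [norm_mul, Complex.norm_real]
        exact mul_le_of_le_one_left (norm_nonneg _) h4
      rw [hL, ← ENNReal.toReal_add hF₀.2.ne hS.2.ne]
      exact ENNReal.toReal_mono (ENNReal.add_ne_top.2 ⟨hF₀.2.ne, hS.2.ne⟩) a1
    have e4 : η * |τ - t₀| ≤ 1 := mul_le_one₀ (min_le_left _ _) (abs_nonneg _) h4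
    rw [Real.norm_eq_abs, Real.norm_eq_abs]
    refine e1.trans ?_
    have hηc : η * (B * (1 + 2 * L)) ≤ c := by
      have : η ≤ c / (B * (1 + 2 * L) + 1) := min_le_right _ _
      rw [le_div_iff₀ hden] at this
      nlinarith
    calc _ ≤ B * (η * |τ - t₀|) * (1 + 2 * L) := by
          gcongr
          exact e2.trans e4
      _ = η * (B * (1 + 2 * L)) * |τ - t₀| := by ring
      _ ≤ _ := by gcongr
  have part2 : HasDerivWithinAt (fun τ => ∫ a, m τ a * ‖G τ a‖ ^ 2 ∂μ)
      (∫ a, (m' a * ‖F t₀ a‖ ^ 2 +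
        m t₀ a * (2 * ((starRingEnd ℂ) (F t₀ a) * S₀ a).re)) ∂μ) I t₀ := by
    have hGd : ∀ a, HasDerivWithinAt (fun τ => ‖G τ a‖ ^ 2)
        (2 * ((starRingEnd ℂ) (F t₀ a) * S₀ a).re) I t₀ := by
      intro a
      have h1 : HasDerivWithinAt (fun τ : ℝ => G τ a) (S₀ a) I t₀ := by
        have h0 := (((hasDerivAt_id t₀).sub_const t₀).ofReal_comp.mul_const (S₀ a)).const_add (F t₀ a)
        simp only [id_eq, Complex.ofReal_one, one_mul] at h0
        exact h0.hasDerivWithinAt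
      have h2 := h1.norm_sq
      rw [hG0] at h2
      convert h2 using 2
      rw [Complex.inner]
      ring_nf
    rw [hasDerivWithinAt_iff_tendsto_slope]
    have hle : 𝓝[I \ {t₀}] t₀ ≤ 𝓝[I] t₀ := nhdsWithin_mono _ sdiff_subset
    have hslope : ∀ᶠ τ in 𝓝[I \ {t₀}] t₀,
        ∫ a, slope (fun τ => m τ a * ‖G τ a‖ ^ 2) t₀ τ ∂μ =
          slope (fun τ => ∫ a, m τ a * ‖G τ a‖ ^ 2 ∂μ) t₀ τ := by
      filter_upwards [hle hB] with τ h1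
      simp only [slope_def_field]
      rw [integral_div, integral_sub]
      · exact (integrable_norm_sq (hGm τ)).bdd_mul (hm τ).aestronglyMeasurable (ae_of_all _ h1)
      · exact (integrable_norm_sq (hGm t₀)).bdd_mul (hm t₀).aestronglyMeasurable (ae_of_all _ hB₀)
    refine Tendsto.congr' hslope ?_
    refine tendsto_integral_filter_of_dominated_convergence
      (fun a => 8 * B * (‖F t₀ a‖ ^ 2 + ‖S₀ a‖ ^ 2)) ?_ ?_
      (((integrable_norm_sq hF₀).add (integrable_norm_sq hS)).const_mul _) ?_
    · refine Eventually.of_forall fun τ => ?_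
      simp only [slope_def_field]
      simp only [div_eq_mul_inv]
      refine AEStronglyMeasurable.mul_const ?_ _
      exact ((hm τ).aestronglyMeasurable.mul ((hGm τ).1.norm.pow 2)).sub
        ((hm t₀).aestronglyMeasurable.mul ((hGm t₀).1.norm.pow 2))
    · filter_upwards [hle hB, hle hLip, hle hclose, self_mem_nhdsWithin] with τ h1 h2 h3 h4
      refine ae_of_all _ fun a => ?_
      have hτ : 0 < |τ - t₀| := abs_pos.2 (sub_ne_zero.2 h4.2)
      simp only [slope_def_field]
      rw [norm_div, Real.norm_eq_abs, Real.norm_eq_abs, div_le_iff₀ hτ, hG0]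
      set x := ‖F t₀ a‖
      set y := ‖S₀ a‖
      have hx : 0 ≤ x := norm_nonneg _
      have hy : 0 ≤ y := norm_nonneg _
      have g1 : ‖G τ a‖ ≤ x + |τ - t₀| * y := by
        refine (norm_add_le _ _).trans ?_
        rw [norm_mul, Complex.norm_real, Real.norm_eq_abs]
      have g2 : x ≤ ‖G τ a‖ + |τ - t₀| * y := by
        have : F t₀ a = G τ a - ((τ - t₀ : ℝ) : ℂ) * S₀ a := by simp [hG]
        calc x = ‖G τ a - ((τ - t₀ : ℝ) : ℂ) * S₀ a‖ := by rw [← this]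
          _ ≤ _ := (norm_sub_le _ _).trans (by rw [norm_mul, Complex.norm_real, Real.norm_eq_abs])
      have g0 := norm_nonneg (G τ a)
      set δ := |τ - t₀|
      have g3 : ‖G τ a‖ ≤ x + y := g1.trans (by nlinarith)
      have g4 : |‖G τ a‖ ^ 2 - x ^ 2| ≤ δ * y * (2 * x + y) := by
        rw [sq_sub_sq, abs_mul, abs_of_nonneg (by positivity), mul_comm]
        refine mul_le_mul ?_ (by linarith) (by positivity) (by positivity)
        rw [abs_le]; constructor <;> linarith
      have e : m τ a * ‖G τ a‖ ^ 2 - m t₀ a * x ^ 2 =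
          (m τ a - m t₀ a) * ‖G τ a‖ ^ 2 + m t₀ a * (‖G τ a‖ ^ 2 - x ^ 2) := by ring
      rw [e]
      calc _ ≤ |m τ a - m t₀ a| * ‖G τ a‖ ^ 2 + |m t₀ a| * |‖G τ a‖ ^ 2 - x ^ 2| := by
            refine (abs_add_le _ _).trans (le_of_eq ?_)
            rw [abs_mul, abs_mul, abs_of_nonneg (sq_nonneg ‖G τ a‖)]
        _ ≤ (B * δ) * (x + y) ^ 2 + B * (δ * y * (2 * x + y)) := by
            gcongr
            · exact h2 a
            · exact hB₀ a
        _ = (B * δ) * ((x + y) ^ 2 + y * (2 * x + y)) := by ring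
        _ ≤ (B * δ) * (8 * (x ^ 2 + y ^ 2)) := by
            gcongr
            nlinarith [sq_nonneg (x - y)]
        _ = _ := by ring
    · refine ae_of_all _ fun a => ?_
      have h1 := (hm' a).mul (hGd a)
      have h2 := (hasDerivWithinAt_iff_tendsto_slope).1 h1
      rw [hG0] at h2
      exact h2
  have h := part1.add part2
  rw [zero_add] at h
  refine h.congr (fun τ _ => ?_) ?_ <;> simp

end Abstract

end VlasovGevrey

/-! ### Fourier modes of `v^α f` and of its velocity derivatives -/

namespace VlasovGevrey

variable {d : ℕ}

/-- The `k`-th Fourier coefficient in `x` of `v^α g`, as a function of `v`. -/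
noncomputable def vMode (α : Fin d → ℕ) (g : Eucl d → Eucl d → ℝ) (k : Fin d → ℤ) (v : Eucl d) : ℂ :=
  torusFourier (fun x => vPowMul α g x v) k

theorem phaseFourier_vPowMul (α : Fin d → ℕ) (g : Eucl d → Eucl d → ℝ) (k : Fin d → ℤ) :
    phaseFourier (vPowMul α g) k = velocityFourier (vMode α g k) := rfl

theorem measurable_phaseFourier (α : Fin d → ℕ) (g : Eucl d → Eucl d → ℝ) (k : Fin d → ℤ) :
    Measurable (phaseFourier (vPowMul α g) k) :=
  measurable_velocityFourier _

/-- The `j`-th unit vector. -/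
noncomputable abbrev unitVec (j : Fin d) : Eucl d := EuclideanSpace.single j 1

theorem inner_unitVec (j : Fin d) (η : Eucl d) : inner ℝ (unitVec j) η = η j := by
  simp [unitVec, EuclideanSpace.inner_single_left]

theorem abs_apply_le_norm (η : Eucl d) (j : Fin d) : |η j| ≤ ‖η‖ := by
  rw [← Real.norm_eq_abs]; exact PiLp.norm_apply_le η j

/-- The multi-index `α - e_j` (equal to `α` if `α_j = 0`). -/
def lower (α : Fin d → ℕ) (j : Fin d) : Fin d → ℕ := Function.update α j (α j - 1)

theorem lower_mem_multiIndices {M : ℕ} {α : Fin d → ℕ} (hα : α ∈ multiIndices d M) (j : Fin d) :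
    lower α j ∈ multiIndices d M := by
  simp only [multiIndices, Finset.mem_filter, Fintype.mem_piFinset, Finset.mem_range] at hα ⊢
  have hle : ∀ i, lower α j i ≤ α i := by
    intro i
    by_cases h : i = j
    · subst h; simp [lower]
    · simp [lower, h]
  exact ⟨fun i => (hle i).trans_lt (hα.1 i), (Finset.sum_le_sum fun i _ => hle i).trans hα.2⟩

/-- If `α_j = 0` the coefficient `α_j` annihilates the right-hand side, so the truncated subtraction
in `lower` is harmless. -/
theorem hasDerivAt_prod_pow (α : Fin d → ℕ) (j : Fin d) (w : Eucl d) :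
    HasDerivAt (fun t : ℝ => ∏ i, (w + t • unitVec j) i ^ α i) (α j * ∏ i, w i ^ lower α j i) 0 := by
  have e : (fun t : ℝ => ∏ i, (w + t • unitVec j) i ^ α i) =
      fun t => (w j + t) ^ α j * ∏ i ∈ Finset.univ.erase j, w i ^ α i := by
    ext t
    rw [← Finset.mul_prod_erase _ _ (Finset.mem_univ j)]
    congr 1
    · simp
    · refine Finset.prod_congr rfl fun i hi => ?_
      simp [(Finset.ne_of_mem_erase hi)]
  have e2 : ∏ i, w i ^ lower α j i = w j ^ (α j - 1) * ∏ i ∈ Finset.univ.erase j, w i ^ α i := by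
    rw [← Finset.mul_prod_erase _ _ (Finset.mem_univ j)]
    congr 1
    · simp [lower]
    · refine Finset.prod_congr rfl fun i hi => ?_
      simp [lower, (Finset.ne_of_mem_erase hi)]
  rw [e, e2]
  have h0 := (((hasDerivAt_id (0 : ℝ)).const_add (w j)).pow (α j)).mul_const
    (∏ i ∈ Finset.univ.erase j, w i ^ α i)
  refine h0.congr_deriv ?_
  simp only [id_eq, add_zero]
  ring

theorem continuous_prod_pow (α : Fin d → ℕ) : Continuous fun v : Eucl d => ∏ i, v i ^ α i := by
  fun_prop

/-- The `k`-th Fourier coefficient in `x` of `v^α ∂_{v_j} g`. -/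
noncomputable def vDerivMode (α : Fin d → ℕ) (j : Fin d) (g : Eucl d → Eucl d → ℝ)
    (k : Fin d → ℤ) (v : Eucl d) : ℂ :=
  torusFourier (fun x => (∏ i, v i ^ α i) * fderiv ℝ (g x) v (unitVec j)) k

/-- The velocity Fourier transform of `vDerivMode`. -/
noncomputable def derivSymbol (α : Fin d → ℕ) (j : Fin d) (g : Eucl d → Eucl d → ℝ)
    (k : Fin d → ℤ) (η : Eucl d) : ℂ :=
  Complex.I * ((η j : ℝ) : ℂ) * phaseFourier (vPowMul α g) k η -
    (α j : ℂ) * phaseFourier (vPowMul (lower α j) g) k η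

theorem memLp_torusFourier {g : Eucl d → Eucl d → ℝ} (hc : Continuous (Function.uncurry g))
    (hg : MemLp (fun p : Eucl d × Eucl d => g p.1 p.2) 2
      ((volume.restrict (torusCell d)).prod volume)) (k : Fin d → ℤ) :
    MemLp (fun v => torusFourier (fun x => g x v) k) 2 volume := by
  have hc' : Continuous (Function.uncurry fun v x => g x v) :=
    hc.comp (by fun_prop : Continuous fun p : Eucl d × Eucl d => (p.2, p.1))
  refine ⟨(continuous_torusFourier hc' k).aestronglyMeasurable, ?_⟩
  have hgm : Measurable fun p : Eucl d × Eucl d => ‖g p.1 p.2‖ₑ ^ 2 :=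
    (hc.measurable.enorm).pow_const 2
  have h2 := hg.2
  rw [eLpNorm_two_eq, ENNReal.rpow_lt_top_iff_of_pos (by norm_num)] at h2 ⊢
  rw [lintegral_prod_symm' _ hgm] at h2
  calc _ ≤ ∫⁻ v, ENNReal.ofReal (((2 * Real.pi) ^ d)⁻¹ ^ 2) *
      volume (torusCell d) * ∫⁻ x in torusCell d, ‖g x v‖ₑ ^ 2 :=
        lintegral_mono fun v => enorm_torusFourier_sq_le
          (hc.comp (by fun_prop : Continuous fun x : Eucl d => (x, v))).aestronglyMeasurable k
    _ = ENNReal.ofReal (((2 * Real.pi) ^ d)⁻¹ ^ 2) *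
      volume (torusCell d) * ∫⁻ v, ∫⁻ x in torusCell d, ‖g x v‖ₑ ^ 2 :=
        lintegral_const_mul' _ _ (ENNReal.mul_ne_top ENNReal.ofReal_ne_top
          volume_torusCell_lt_top.ne)
    _ < ⊤ := ENNReal.mul_lt_top (ENNReal.mul_lt_top ENNReal.ofReal_lt_top volume_torusCell_lt_top) h2

theorem IsKinGevrey.continuous_uncurry {lam σ s : ℝ} {M : ℕ} {g : Eucl d → Eucl d → ℝ}
    (hg : IsKinGevrey lam σ M s g) : Continuous (Function.uncurry g) :=
  hg.smooth.continuous

theorem continuous_vPowMul {g : Eucl d → Eucl d → ℝ} (hc : Continuous (Function.uncurry g))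
    (α : Fin d → ℕ) : Continuous (Function.uncurry (vPowMul α g)) :=
  ((continuous_prod_pow α).comp continuous_snd).mul hc

theorem IsKinGevrey.memLp_vMode {lam σ s : ℝ} {M : ℕ} {g : Eucl d → Eucl d → ℝ}
    (hg : IsKinGevrey lam σ M s g) {α : Fin d → ℕ} (hα : α ∈ multiIndices d M) (k : Fin d → ℤ) :
    MemLp (vMode α g k) 2 volume :=
  memLp_torusFourier (continuous_vPowMul hg.continuous_uncurry α) (hg.memLp α hα) k

theorem IsKinGevrey.lintegral_kinMode_lt_top {lam σ s : ℝ} {M : ℕ} {g : Eucl d → Eucl d → ℝ}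
    (hg : IsKinGevrey lam σ M s g) {α : Fin d → ℕ} (hα : α ∈ multiIndices d M) :
    ∑' k, ∫⁻ η, ‖kinMode lam σ s α g k η‖ₑ ^ 2 < ⊤ :=
  (ENNReal.sum_lt_top.1 hg.finite) α hα

theorem one_le_exp_of_nonneg {lam ξ s : ℝ} (hl : 0 ≤ lam) (hξ : 0 ≤ ξ) :
    1 ≤ Real.exp (lam * ξ ^ s) :=
  Real.one_le_exp (mul_nonneg hl (Real.rpow_nonneg hξ _))

theorem bracket_le_gevreyMul {lam σ s : ℝ} (hl : 0 ≤ lam) (hσ : 1 ≤ σ) (k : Fin d → ℤ)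
    (η : Eucl d) : bracket k η ≤ gevreyMul lam σ s k η := by
  have h1 := one_le_bracket k η
  calc bracket k η = bracket k η ^ (1 : ℝ) := (Real.rpow_one _).symm
    _ ≤ bracket k η ^ σ := Real.rpow_le_rpow_of_exponent_le h1 hσ
    _ ≤ _ := le_mul_of_one_le_right (by positivity) (one_le_exp_of_nonneg hl (by positivity))

theorem gevreyMul_pos (lam σ s : ℝ) (k : Fin d → ℤ) (η : Eucl d) : 0 < gevreyMul lam σ s k η := by
  have := bracket_pos k η
  unfold gevreyMul; positivity

theorem IsKinGevrey.memLp_mul_phaseFourier {lam σ s : ℝ} {M : ℕ} {g : Eucl d → Eucl d → ℝ}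
    (hg : IsKinGevrey lam σ M s g) (hl : 0 ≤ lam) (hσ : 1 ≤ σ) {α : Fin d → ℕ}
    (hα : α ∈ multiIndices d M) (k : Fin d → ℤ) (j : Fin d) :
    MemLp (fun η : Eucl d => Complex.I * ((η j : ℝ) : ℂ) * phaseFourier (vPowMul α g) k η) 2
      volume := by
  have hk : MemLp (kinMode lam σ s α g k) 2 volume := by
    refine ⟨?_, ?_⟩
    · have h1 : Continuous fun η : Eucl d => (gevreyMul lam σ s k η : ℂ) := by
        unfold gevreyMul
        have hb := continuous_bracket (d := d) k
        have hne : ∀ η : Eucl d, bracket k η ≠ 0 := fun η => (bracket_pos k η).ne'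
        exact Complex.continuous_ofReal.comp ((hb.rpow_const fun η => Or.inl (hne η)).mul
          (Real.continuous_exp.comp (continuous_const.mul (hb.rpow_const fun η => Or.inl (hne η)))))
      exact (h1.measurable.mul (measurable_phaseFourier α g k)).aestronglyMeasurable
    · rw [eLpNorm_two_eq, ENNReal.rpow_lt_top_iff_of_pos (by norm_num)]
      exact (ENNReal.le_tsum k).trans_lt (hg.lintegral_kinMode_lt_top hα)
  refine hk.mono ?_ (ae_of_all _ fun η => ?_)
  · have := measurable_phaseFourier α g k
    exact Measurable.aestronglyMeasurable (by fun_prop)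
  · rw [kinMode, norm_mul, norm_mul, norm_mul, Complex.norm_I, one_mul, Complex.norm_real,
      Complex.norm_real, Real.norm_of_nonneg (gevreyMul_pos _ _ _ _ _).le]
    gcongr
    exact (abs_apply_le_norm η j).trans ((norm_le_bracket k η).trans (bracket_le_gevreyMul hl hσ k η))

theorem continuous_fderiv_unitVec {g : Eucl d → Eucl d → ℝ}
    (hg : ContDiff ℝ ∞ fun p : Eucl d × Eucl d => g p.1 p.2) (j : Fin d) :
    Continuous fun p : Eucl d × Eucl d => fderiv ℝ (g p.1) p.2 (unitVec j) := by
  have h : ContDiff ℝ 0 fun p : Eucl d × Eucl d => fderiv ℝ (g p.1) p.2 := by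
    refine ContDiff.fderiv (n := 0) (m := 1) (f := fun p : Eucl d × Eucl d => g p.1) ?_ contDiff_snd (by norm_num)
    exact (hg.of_le (by exact_mod_cast le_top)).comp
      ((contDiff_fst.comp contDiff_fst).prodMk contDiff_snd)
  exact h.continuous.clm_apply continuous_const

theorem hasDerivAt_vPowMul {g : Eucl d → Eucl d → ℝ}
    (hg : ContDiff ℝ ∞ fun p : Eucl d × Eucl d => g p.1 p.2) (α : Fin d → ℕ) (j : Fin d)
    (x w : Eucl d) :
    HasDerivAt (fun t : ℝ => vPowMul α g x (w + t • unitVec j))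
      ((∏ i, w i ^ α i) * fderiv ℝ (g x) w (unitVec j) + α j * vPowMul (lower α j) g x w) 0 := by
  have hd : DifferentiableAt ℝ (g x) w := by
    have : ContDiff ℝ ∞ (g x) := hg.comp (contDiff_const.prodMk contDiff_id)
    exact this.differentiable (by simp) w
  have h1 : HasDerivAt (fun t : ℝ => g x (w + t • unitVec j)) (fderiv ℝ (g x) w (unitVec j)) 0 := by
    have hl : HasDerivAt (fun t : ℝ => w + t • unitVec j) (unitVec j) 0 := by
      simpa using ((hasDerivAt_id (0 : ℝ)).smul_const (unitVec j)).const_add w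
    have hd' : HasFDerivAt (g x) (fderiv ℝ (g x) w) (w + (0 : ℝ) • unitVec j) := by
      simpa using hd.hasFDerivAt
    exact hd'.comp_hasDerivAt 0 hl
  have := (hasDerivAt_prod_pow α j w).mul h1
  refine this.congr_deriv ?_
  simp only [vPowMul, zero_smul, add_zero]; ring

/-- Along the line in direction `e_j` the mode is the integral of a continuous function, by
`torusFourier_sub_eq_integral`; no domination argument is required. -/
theorem hasDerivAt_vMode {g : Eucl d → Eucl d → ℝ}
    (hg : ContDiff ℝ ∞ fun p : Eucl d × Eucl d => g p.1 p.2) (α : Fin d → ℕ) (j : Fin d)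
    (k : Fin d → ℤ) (v : Eucl d) :
    HasDerivAt (fun t : ℝ => vMode α g k (v + t • unitVec j))
      (vDerivMode α j g k v + α j * vMode (lower α j) g k v) 0 := by
  have hgc : Continuous (Function.uncurry g) := hg.continuous
  have hlow := continuous_vPowMul hgc (lower α j)
  have hpc := continuous_vPowMul hgc α
  set D : Eucl d → Eucl d → ℝ := fun x w =>
    (∏ i, w i ^ α i) * fderiv ℝ (g x) w (unitVec j) + α j * vPowMul (lower α j) g x w with hD
  have hDc : Continuous (Function.uncurry D) :=
    (((continuous_prod_pow α).comp continuous_snd).mul (continuous_fderiv_unitVec hg j)).add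
      (continuous_const.mul hlow)
  have hshift : Continuous fun p : ℝ × Eucl d => (p.2, v + p.1 • unitVec j) := by fun_prop
  have hγ' : Continuous (Function.uncurry fun (r : ℝ) x => D x (v + r • unitVec j)) :=
    hDc.comp hshift
  have key : ∀ t : ℝ, vMode α g k (v + t • unitVec j) - vMode α g k v =
      ∫ r in (0 : ℝ)..t, torusFourier (fun x => D x (v + r • unitVec j)) k := by
    intro t
    have := torusFourier_sub_eq_integral (a := 0) (b := t)
      (γ := fun r x => vPowMul α g x (v + r • unitVec j))
      (γ' := fun r x => D x (v + r • unitVec j)) (fun x r _ => ?_) (fun r _ => ?_) hγ' k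
    · simpa [vMode] using this
    · have h0 := hasDerivAt_vPowMul hg α j x (v + r • unitVec j)
      have h1 : HasDerivAt (fun q : ℝ => q - r) 1 r := (hasDerivAt_id r).sub_const r
      have h2 := HasDerivAt.comp (h₂ := fun t : ℝ => vPowMul α g x (v + r • unitVec j + t • unitVec j))
        (h := fun q : ℝ => q - r) (h₂' := D x (v + r • unitVec j)) r (by rw [sub_self]; exact h0) h1
      rw [mul_one] at h2
      refine HasDerivAt.hasDerivWithinAt ?_
      refine h2.congr_of_eventuallyEq (Eventually.of_forall fun q => ?_)
      simp only [Function.comp_apply]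
      rw [add_assoc, ← add_smul, add_sub_cancel]
    · exact hpc.comp (by fun_prop : Continuous fun x : Eucl d => (x, v + r • unitVec j))
  have hcont : Continuous fun r : ℝ => torusFourier (fun x => D x (v + r • unitVec j)) k :=
    continuous_torusFourier hγ' k
  have hder := (hcont.integral_hasStrictDerivAt 0 0).hasDerivAt.const_add (vMode α g k v)
  have e1 : torusFourier (fun x => D x (v + (0 : ℝ) • unitVec j)) k =
      vDerivMode α j g k v + α j * vMode (lower α j) g k v := by
    simp only [zero_smul, add_zero, hD]
    rw [torusFourier_add, torusFourier_const_mul (α j : ℝ)]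
    · simp only [vDerivMode, vMode, Complex.ofReal_natCast]
    · exact continuous_const.mul ((continuous_fderiv_unitVec hg j).comp
        (by fun_prop : Continuous fun x : Eucl d => (x, v)))
    · exact continuous_const.mul (hlow.comp (by fun_prop : Continuous fun x : Eucl d => (x, v)))
  rw [← e1]
  refine hder.congr_of_eventuallyEq (Eventually.of_forall fun t => ?_)
  simp only
  rw [← key t]; ring

/-- Since `v^α ∂_j g = ∂_j(v^α g) - α_j v^{α - e_j} g`, moments of order at most `M` suffice. Square
integrability of the left side is deduced from the frequency weight, which dominates `η_j`. -/
theorem IsKinGevrey.velocityFourier_vDerivMode {lam σ s : ℝ} {M : ℕ} {g : Eucl d → Eucl d → ℝ}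
    (hg : IsKinGevrey lam σ M s g) (hl : 0 ≤ lam) (hσ : 1 ≤ σ) {α : Fin d → ℕ}
    (hα : α ∈ multiIndices d M) (k : Fin d → ℤ) (j : Fin d) :
    MemLp (vDerivMode α j g k) 2 volume ∧
      velocityFourier (vDerivMode α j g k) =ᵐ[volume] derivSymbol α j g k := by
  have h := velocityFourier_of_hasDerivAt (hg.memLp_vMode hα k) (unitVec j)
    (hasDerivAt_vMode hg.smooth α j k) (by
      simpa only [inner_unitVec, phaseFourier_vPowMul] using hg.memLp_mul_phaseFourier hl hσ hα k j)
  have hlow := (hg.memLp_vMode (lower_mem_multiIndices hα j) k).const_mul (α j : ℂ)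
  have e : vDerivMode α j g k = fun v =>
      (vDerivMode α j g k v + α j * vMode (lower α j) g k v) - α j * vMode (lower α j) g k v := by
    ext v; ring
  have hm : MemLp (vDerivMode α j g k) 2 volume := by
    rw [e]; exact h.1.sub hlow
  refine ⟨hm, ?_⟩
  rw [e]
  filter_upwards [velocityFourier_sub h.1 hlow, h.2,
    velocityFourier_const_mul (hg.memLp_vMode (lower_mem_multiIndices hα j) k) (α j : ℂ)]
    with η h1 h2 h3
  rw [h1, h2, h3, inner_unitVec]
  rfl

end VlasovGevrey

/-! ### Continuity in time of the modes as `L²` functions of the frequency -/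

namespace VlasovGevrey

variable {d : ℕ}

/-- `kinMode` as a function on `ℤ^d × ℝ^d`. -/
noncomputable def kinFun (lam σ s : ℝ) (α : Fin d → ℕ) (g : Eucl d → Eucl d → ℝ)
    (p : (Fin d → ℤ) × Eucl d) : ℂ := kinMode lam σ s α g p.1 p.2

/-- `derivSymbol` as a function on `ℤ^d × ℝ^d`. -/
noncomputable def derivFun (α : Fin d → ℕ) (j : Fin d) (g : Eucl d → Eucl d → ℝ)
    (p : (Fin d → ℤ) × Eucl d) : ℂ := derivSymbol α j g p.1 p.2

theorem measurable_of_slices {E : Type*} [MeasurableSpace E] {F : (Fin d → ℤ) × Eucl d → E}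
    (h : ∀ k, Measurable fun η => F (k, η)) : Measurable F :=
  measurable_from_prod_countable_right h

theorem continuous_gevreyMul (lam σ s : ℝ) (k : Fin d → ℤ) : Continuous (gevreyMul lam σ s k) := by
  unfold gevreyMul
  have hb := continuous_bracket (d := d) k
  have hne : ∀ η : Eucl d, bracket k η ≠ 0 := fun η => (bracket_pos k η).ne'
  exact (hb.rpow_const fun η => Or.inl (hne η)).mul
    (Real.continuous_exp.comp (continuous_const.mul (hb.rpow_const fun η => Or.inl (hne η))))

theorem measurable_phaseFun (α : Fin d → ℕ) (g : Eucl d → Eucl d → ℝ) :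
    Measurable fun p : (Fin d → ℤ) × Eucl d => phaseFourier (vPowMul α g) p.1 p.2 :=
  measurable_of_slices fun k => measurable_phaseFourier α g k

theorem measurable_gevreyFun (lam σ s : ℝ) :
    Measurable fun p : (Fin d → ℤ) × Eucl d => gevreyMul lam σ s p.1 p.2 :=
  measurable_of_slices fun k => (continuous_gevreyMul lam σ s k).measurable

theorem measurable_kinFun (lam σ s : ℝ) (α : Fin d → ℕ) (g : Eucl d → Eucl d → ℝ) :
    Measurable (kinFun lam σ s α g) :=
  (Complex.measurable_ofReal.comp (measurable_gevreyFun lam σ s)).mul (measurable_phaseFun α g)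

theorem measurable_derivFun (α : Fin d → ℕ) (j : Fin d) (g : Eucl d → Eucl d → ℝ) :
    Measurable (derivFun α j g) := by
  have h1 := measurable_phaseFun α g
  have h2 := measurable_phaseFun (lower α j) g
  unfold derivFun derivSymbol
  fun_prop

theorem eLpNorm_kinFun (lam σ s : ℝ) (α : Fin d → ℕ) (g : Eucl d → Eucl d → ℝ) :
    eLpNorm (kinFun lam σ s α g) 2 (modeMeasure d) =
      (∑' k, ∫⁻ η, ‖kinMode lam σ s α g k η‖ₑ ^ 2) ^ (1 / 2 : ℝ) := by
  rw [eLpNorm_two_eq, lintegral_modeMeasure ((measurable_kinFun lam σ s α g).enorm.pow_const 2)]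
  rfl

theorem IsKinGevrey.eLpNorm_kinFun_lt_top {lam σ s : ℝ} {M : ℕ} {g : Eucl d → Eucl d → ℝ}
    (hg : IsKinGevrey lam σ M s g) {α : Fin d → ℕ} (hα : α ∈ multiIndices d M) :
    eLpNorm (kinFun lam σ s α g) 2 (modeMeasure d) < ⊤ := by
  rw [eLpNorm_kinFun, ENNReal.rpow_lt_top_iff_of_pos (by norm_num)]
  exact hg.lintegral_kinMode_lt_top hα

theorem tendsto_rpow_half_zero {ι : Type*} {l : Filter ι} {x : ι → ENNReal}
    (h : Tendsto x l (𝓝 0)) : Tendsto (fun i => x i ^ (1 / 2 : ℝ)) l (𝓝 0) := by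
  have := h.ennrpow_const (1 / 2 : ℝ)
  simpa using this

theorem IsKinGevreyCurve.tendsto_kinFun {I : Set ℝ} {lam : ℝ → ℝ} {σ s : ℝ} {M : ℕ}
    {f : ℝ → Eucl d → Eucl d → ℝ} (hf : IsKinGevreyCurve I lam σ M s f) {t₀ : ℝ} (ht : t₀ ∈ I)
    {α : Fin d → ℕ} (hα : α ∈ multiIndices d M) :
    Tendsto (fun τ => eLpNorm (kinFun (lam τ) σ s α (f τ) - kinFun (lam t₀) σ s α (f t₀)) 2
      (modeMeasure d)) (𝓝[I] t₀) (𝓝 0) := by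
  have h := tendsto_rpow_half_zero (hf.continuous t₀ ht)
  refine tendsto_of_tendsto_of_tendsto_of_le_of_le tendsto_const_nhds h (fun _ => zero_le) fun τ => ?_
  rw [eLpNorm_two_eq, lintegral_modeMeasure
    (((measurable_kinFun _ σ s α _).sub (measurable_kinFun _ σ s α _)).enorm.pow_const 2)]
  refine ENNReal.rpow_le_rpow ?_ (by norm_num)
  exact Finset.single_le_sum (f := fun α => ∑' k : Fin d → ℤ, ∫⁻ η : Eucl d,
      ‖kinMode (lam τ) σ s α (f τ) k η - kinMode (lam t₀) σ s α (f t₀) k η‖ₑ ^ 2)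
    (fun _ _ => zero_le) hα

/-- `fluidMode` as a function of the frequency. -/
noncomputable def fluidFun (lam σ s : ℝ) (U : Eucl d → Eucl d) (j : Fin d) (k : Fin d → ℤ) : ℂ :=
  fluidMode lam σ s U k j

theorem eLpNorm_count_two {E : Type*} [NormedAddCommGroup E] (V : (Fin d → ℤ) → E) :
    eLpNorm V 2 Measure.count = (∑' k, ‖V k‖ₑ ^ 2) ^ (1 / 2 : ℝ) := by
  rw [eLpNorm_two_eq, lintegral_count]

theorem IsFluidGevrey.eLpNorm_fluidFun_lt_top {lam σ s : ℝ} {U : Eucl d → Eucl d}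
    (hU : IsFluidGevrey lam σ s U) (j : Fin d) :
    eLpNorm (fluidFun lam σ s U j) 2 Measure.count < ⊤ := by
  rw [eLpNorm_count_two, ENNReal.rpow_lt_top_iff_of_pos (by norm_num)]
  refine lt_of_le_of_lt (ENNReal.tsum_le_tsum fun k => ?_) hU.finite
  exact Finset.single_le_sum (f := fun j => ‖fluidMode lam σ s U k j‖ₑ ^ 2)
    (fun _ _ => zero_le) (Finset.mem_univ j)

theorem IsFluidGevreyCurve.tendsto_fluidFun {I : Set ℝ} {lam : ℝ → ℝ} {σ s : ℝ}
    {u : ℝ → Eucl d → Eucl d} (hu : IsFluidGevreyCurve I lam σ s u) {t₀ : ℝ} (ht : t₀ ∈ I)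
    (j : Fin d) :
    Tendsto (fun τ => eLpNorm (fluidFun (lam τ) σ s (u τ) j - fluidFun (lam t₀) σ s (u t₀) j) 2
      Measure.count) (𝓝[I] t₀) (𝓝 0) := by
  have h := tendsto_rpow_half_zero (hu.continuous t₀ ht)
  refine tendsto_of_tendsto_of_tendsto_of_le_of_le tendsto_const_nhds h (fun _ => zero_le) fun τ => ?_
  rw [eLpNorm_count_two]
  refine ENNReal.rpow_le_rpow (ENNReal.tsum_le_tsum fun k => ?_) (by norm_num)
  exact Finset.single_le_sum
    (f := fun j => ‖fluidMode (lam τ) σ s (u τ) k j - fluidMode (lam t₀) σ s (u t₀) k j‖ₑ ^ 2)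
    (fun _ _ => zero_le) (Finset.mem_univ j)

theorem gevreyMul_ne_zero (lam σ s : ℝ) (k : Fin d → ℤ) (η : Eucl d) :
    (gevreyMul lam σ s k η : ℂ) ≠ 0 :=
  Complex.ofReal_ne_zero.2 (gevreyMul_pos lam σ s k η).ne'

theorem one_le_gevreyMul {lam σ s : ℝ} (hl : 0 ≤ lam) (hσ : 0 ≤ σ) (k : Fin d → ℤ) (η : Eucl d) :
    1 ≤ gevreyMul lam σ s k η :=
  one_le_mul_of_one_le_of_one_le (Real.one_le_rpow (one_le_bracket k η) hσ)
    (one_le_exp_of_nonneg hl (bracket_pos k η).le)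

theorem continuous_gevreyMul_lam (σ s : ℝ) (k : Fin d → ℤ) (η : Eucl d) :
    Continuous fun lam => gevreyMul lam σ s k η := by
  unfold gevreyMul; fun_prop

/-- The derivative symbol is written as bounded multipliers applied to the functions whose
continuity in `L²` is assumed; boundedness holds because the multiplier dominates `⟨k,η⟩` for `σ ≥
1`. -/
theorem derivFun_eq (lam σ s : ℝ) (α : Fin d → ℕ) (j : Fin d) (g : Eucl d → Eucl d → ℝ) :
    derivFun α j g =
      (fun p : (Fin d → ℤ) × Eucl d => Complex.I * ((p.2 j : ℝ) : ℂ) / gevreyMul lam σ s p.1 p.2) *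
          kinFun lam σ s α g -
        (fun p : (Fin d → ℤ) × Eucl d => (α j : ℂ) / gevreyMul lam σ s p.1 p.2) *
          kinFun lam σ s (lower α j) g := by
  ext p
  simp only [derivFun, derivSymbol, kinFun, kinMode, Pi.sub_apply, Pi.mul_apply]
  have := gevreyMul_ne_zero lam σ s p.1 p.2
  field_simp

theorem norm_coord_div_gevreyMul_le {lam σ s : ℝ} (hl : 0 ≤ lam) (hσ : 1 ≤ σ) (j : Fin d)
    (p : (Fin d → ℤ) × Eucl d) :
    ‖Complex.I * ((p.2 j : ℝ) : ℂ) / gevreyMul lam σ s p.1 p.2‖ ≤ 1 := by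
  rw [norm_div, norm_mul, Complex.norm_I, one_mul, Complex.norm_real, Complex.norm_real]
  refine div_le_one_of_le₀ ?_ (norm_nonneg _)
  rw [Real.norm_of_nonneg (gevreyMul_pos lam σ s p.1 p.2).le]
  exact (abs_apply_le_norm p.2 j).trans ((norm_le_bracket p.1 p.2).trans
    (bracket_le_gevreyMul hl hσ _ _))

theorem norm_const_div_gevreyMul_le {lam σ s : ℝ} (hl : 0 ≤ lam) (hσ : 0 ≤ σ) (n : ℕ)
    (p : (Fin d → ℤ) × Eucl d) :
    ‖(n : ℂ) / gevreyMul lam σ s p.1 p.2‖ ≤ n := by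
  rw [norm_div, Complex.norm_natCast, Complex.norm_real,
    Real.norm_of_nonneg (gevreyMul_pos lam σ s p.1 p.2).le]
  exact div_le_self (by positivity) (one_le_gevreyMul hl hσ _ _)

theorem measurable_coord_div (lam σ s : ℝ) (j : Fin d) :
    Measurable fun p : (Fin d → ℤ) × Eucl d =>
      Complex.I * ((p.2 j : ℝ) : ℂ) / gevreyMul lam σ s p.1 p.2 := by
  have := measurable_gevreyFun (d := d) lam σ s
  fun_prop

theorem measurable_const_div (lam σ s : ℝ) (n : ℕ) :
    Measurable fun p : (Fin d → ℤ) × Eucl d => (n : ℂ) / gevreyMul lam σ s p.1 p.2 := by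
  have := measurable_gevreyFun (d := d) lam σ s
  fun_prop

theorem eLpNorm_mul_lt_top {α : Type*} [MeasurableSpace α] {μ : Measure α} {ρ w : α → ℂ} {B : ℝ}
    (hB : ∀ a, ‖ρ a‖ ≤ B) (hw : eLpNorm w 2 μ < ⊤) : eLpNorm (ρ * w) 2 μ < ⊤ := by
  refine lt_of_le_of_lt (eLpNorm_le_mul_eLpNorm_of_ae_le_mul (c := B) (g := w)
    (ae_of_all _ fun a => ?_) 2) (ENNReal.mul_lt_top ENNReal.ofReal_lt_top hw)
  rw [Pi.mul_apply, norm_mul]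
  gcongr; exact hB a

theorem IsKinGevrey.eLpNorm_derivFun_lt_top {lam σ s : ℝ} {M : ℕ} {g : Eucl d → Eucl d → ℝ}
    (hg : IsKinGevrey lam σ M s g) (hl : 0 ≤ lam) (hσ : 1 ≤ σ) {α : Fin d → ℕ}
    (hα : α ∈ multiIndices d M) (j : Fin d) :
    eLpNorm (derivFun α j g) 2 (modeMeasure d) < ⊤ := by
  rw [derivFun_eq lam σ s]
  refine lt_of_le_of_lt (eLpNorm_sub_le ?_ ?_ (by norm_num)) (ENNReal.add_lt_top.2 ⟨?_, ?_⟩)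
  · exact ((measurable_coord_div lam σ s j).mul (measurable_kinFun _ _ _ _ _)).aestronglyMeasurable
  · exact ((measurable_const_div lam σ s _).mul (measurable_kinFun _ _ _ _ _)).aestronglyMeasurable
  · exact eLpNorm_mul_lt_top (norm_coord_div_gevreyMul_le hl hσ j) (hg.eLpNorm_kinFun_lt_top hα)
  · exact eLpNorm_mul_lt_top (norm_const_div_gevreyMul_le hl (by linarith) _)
      (hg.eLpNorm_kinFun_lt_top (lower_mem_multiIndices hα j))

theorem IsKinGevreyCurve.tendsto_derivFun {I : Set ℝ} {lam : ℝ → ℝ} {σ s : ℝ} {M : ℕ}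
    {f : ℝ → Eucl d → Eucl d → ℝ} (hf : IsKinGevreyCurve I lam σ M s f) (hσ : 1 ≤ σ) {t₀ : ℝ}
    (ht : t₀ ∈ I) (hl : ∀ t ∈ I, 0 ≤ lam t) (hlc : ContinuousWithinAt lam I t₀)
    {α : Fin d → ℕ} (hα : α ∈ multiIndices d M) (j : Fin d) :
    Tendsto (fun τ => eLpNorm (derivFun α j (f τ) - derivFun α j (f t₀)) 2
      (modeMeasure d)) (𝓝[I] t₀) (𝓝 0) := by
  have hgl : ∀ p : (Fin d → ℤ) × Eucl d, Tendsto (fun τ => (gevreyMul (lam τ) σ s p.1 p.2 : ℂ))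
      (𝓝[I] t₀) (𝓝 (gevreyMul (lam t₀) σ s p.1 p.2 : ℂ)) := fun p =>
    (Complex.continuous_ofReal.tendsto _).comp
      (((continuous_gevreyMul_lam σ s p.1 p.2).tendsto _).comp hlc)
  have h1 := tendsto_eLpNorm_mul_sub (μ := modeMeasure d) (l := 𝓝[I] t₀)
    (ρ := fun τ (p : (Fin d → ℤ) × Eucl d) =>
      Complex.I * ((p.2 j : ℝ) : ℂ) / gevreyMul (lam τ) σ s p.1 p.2)
    (B := 1) (fun τ => measurable_coord_div (lam τ) σ s j) (measurable_coord_div (lam t₀) σ s j)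
    (by filter_upwards [self_mem_nhdsWithin] with τ hτ
        exact norm_coord_div_gevreyMul_le (hl τ hτ) hσ j)
    (norm_coord_div_gevreyMul_le (hl t₀ ht) hσ j)
    (fun p => tendsto_const_nhds.div (hgl p) (gevreyMul_ne_zero _ _ _ _ _))
    (fun τ => (measurable_kinFun (lam τ) σ s α (f τ)).aestronglyMeasurable)
    (measurable_kinFun (lam t₀) σ s α (f t₀)).aestronglyMeasurable
    ((hf.mem t₀ ht).eLpNorm_kinFun_lt_top hα) (hf.tendsto_kinFun ht hα)
  have h2 := tendsto_eLpNorm_mul_sub (μ := modeMeasure d) (l := 𝓝[I] t₀)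
    (ρ := fun τ (p : (Fin d → ℤ) × Eucl d) => (α j : ℂ) / gevreyMul (lam τ) σ s p.1 p.2)
    (B := α j) (fun τ => measurable_const_div (lam τ) σ s (α j))
    (measurable_const_div (lam t₀) σ s (α j))
    (by filter_upwards [self_mem_nhdsWithin] with τ hτ
        exact norm_const_div_gevreyMul_le (hl τ hτ) (by linarith) _)
    (norm_const_div_gevreyMul_le (hl t₀ ht) (by linarith) _)
    (fun p => tendsto_const_nhds.div (hgl p) (gevreyMul_ne_zero _ _ _ _ _))
    (fun τ => (measurable_kinFun (lam τ) σ s (lower α j) (f τ)).aestronglyMeasurable)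
    (measurable_kinFun (lam t₀) σ s (lower α j) (f t₀)).aestronglyMeasurable
    ((hf.mem t₀ ht).eLpNorm_kinFun_lt_top (lower_mem_multiIndices hα j))
    (hf.tendsto_kinFun ht (lower_mem_multiIndices hα j))
  have h3 := h1.add h2
  rw [add_zero] at h3
  refine tendsto_of_tendsto_of_tendsto_of_le_of_le tendsto_const_nhds h3 (fun _ => zero_le) fun τ => ?_
  have hm1 : ∀ τ, AEStronglyMeasurable ((fun p : (Fin d → ℤ) × Eucl d =>
      Complex.I * ((p.2 j : ℝ) : ℂ) / gevreyMul (lam τ) σ s p.1 p.2) *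
        kinFun (lam τ) σ s α (f τ)) (modeMeasure d) := fun τ =>
    ((measurable_coord_div (lam τ) σ s j).mul (measurable_kinFun _ _ _ _ _)).aestronglyMeasurable
  have hm2 : ∀ τ, AEStronglyMeasurable ((fun p : (Fin d → ℤ) × Eucl d =>
      (α j : ℂ) / gevreyMul (lam τ) σ s p.1 p.2) *
        kinFun (lam τ) σ s (lower α j) (f τ)) (modeMeasure d) := fun τ =>
    ((measurable_const_div (lam τ) σ s _).mul (measurable_kinFun _ _ _ _ _)).aestronglyMeasurable
  rw [derivFun_eq (lam τ) σ s, derivFun_eq (lam t₀) σ s, sub_sub_sub_comm]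
  exact eLpNorm_sub_le ((hm1 τ).sub (hm1 t₀)) ((hm2 τ).sub (hm2 t₀)) (by norm_num)

/-! ### Modes of the velocity field and of the product `u_j ∂_{v_j} f` -/

/-- The `j`-th component of `û`. -/
noncomputable def velCoeff (U : Eucl d → Eucl d) (j : Fin d) (k : Fin d → ℤ) : ℂ :=
  torusFourier (fun x => U x j) k

theorem velCoeff_eq (lam σ s : ℝ) (U : Eucl d → Eucl d) (j : Fin d) :
    velCoeff U j = (fun k => (1 : ℂ) / gevreyMul lam σ s k 0) * fluidFun lam σ s U j := by
  ext k
  have := gevreyMul_ne_zero lam σ s k 0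
  simp only [velCoeff, fluidFun, fluidMode, Pi.mul_apply]
  field_simp

theorem norm_one_div_gevreyMul_le {lam σ s : ℝ} (hl : 0 ≤ lam) (hσ : 0 ≤ σ) (k : Fin d → ℤ) :
    ‖(1 : ℂ) / gevreyMul lam σ s k 0‖ ≤ 1 := by
  simpa using norm_const_div_gevreyMul_le (s := s) hl hσ 1 (k, (0 : Eucl d))

theorem IsFluidGevrey.eLpNorm_velCoeff_lt_top {lam σ s : ℝ} {U : Eucl d → Eucl d}
    (hU : IsFluidGevrey lam σ s U) (hl : 0 ≤ lam) (hσ : 0 ≤ σ) (j : Fin d) :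
    eLpNorm (velCoeff U j) 2 Measure.count < ⊤ := by
  rw [velCoeff_eq lam σ s]
  exact eLpNorm_mul_lt_top (norm_one_div_gevreyMul_le hl hσ) (hU.eLpNorm_fluidFun_lt_top j)

theorem IsFluidGevreyCurve.tendsto_velCoeff {I : Set ℝ} {lam : ℝ → ℝ} {σ s : ℝ}
    {u : ℝ → Eucl d → Eucl d} (hu : IsFluidGevreyCurve I lam σ s u) (hσ : 0 ≤ σ) {t₀ : ℝ}
    (ht : t₀ ∈ I) (hl : ∀ t ∈ I, 0 ≤ lam t) (hlc : ContinuousWithinAt lam I t₀) (j : Fin d) :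
    Tendsto (fun τ => eLpNorm (velCoeff (u τ) j - velCoeff (u t₀) j) 2 Measure.count)
      (𝓝[I] t₀) (𝓝 0) := by
  have h1 := tendsto_eLpNorm_mul_sub (μ := Measure.count) (l := 𝓝[I] t₀)
    (ρ := fun τ (k : Fin d → ℤ) => (1 : ℂ) / gevreyMul (lam τ) σ s k 0)
    (B := 1) (fun τ => Measurable.of_discrete) Measurable.of_discrete
    (by filter_upwards [self_mem_nhdsWithin] with τ hτ
        exact norm_one_div_gevreyMul_le (hl τ hτ) hσ)
    (norm_one_div_gevreyMul_le (hl t₀ ht) hσ)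
    (fun k => tendsto_const_nhds.div ((Complex.continuous_ofReal.tendsto _).comp
      (((continuous_gevreyMul_lam σ s k 0).tendsto _).comp hlc)) (gevreyMul_ne_zero _ _ _ _ _))
    (fun τ => Measurable.of_discrete.aestronglyMeasurable)
    Measurable.of_discrete.aestronglyMeasurable
    ((hu.mem t₀ ht).eLpNorm_fluidFun_lt_top j) (hu.tendsto_fluidFun ht j)
  refine h1.congr fun τ => ?_
  rw [velCoeff_eq (lam τ) σ s, velCoeff_eq (lam t₀) σ s]

/-- Sobolev embedding: the coefficient is at most `⟨k⟩^{-σ}` times a square summable sequence, and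
the first factor is square summable as `2σ > d`. -/
theorem IsFluidGevrey.summable_velCoeff {lam σ s : ℝ} {U : Eucl d → Eucl d}
    (hU : IsFluidGevrey lam σ s U) (hl : 0 ≤ lam) (hσ : (d : ℝ) / 2 < σ) (j : Fin d) :
    Summable (velCoeff U j) := by
  have h1 := summable_bracket_rpow (d := d) (q := 2 * σ) (by linarith)
  have h2 : Summable fun k => ‖fluidFun lam σ s U j k‖ ^ 2 := by
    have h := hU.eLpNorm_fluidFun_lt_top j
    rw [eLpNorm_count_two, ENNReal.rpow_lt_top_iff_of_pos (by norm_num)] at h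
    have := ENNReal.summable_toReal h.ne
    refine this.congr fun k => ?_
    rw [ENNReal.toReal_pow, toReal_enorm]
  refine Summable.of_norm_bounded (h1.add h2) fun k => ?_
  have hb := bracket_pos k (0 : Eucl d)
  have e1 : ‖velCoeff U j k‖ ≤ bracket k 0 ^ (-σ) * ‖fluidFun lam σ s U j k‖ := by
    rw [fluidFun, fluidMode, norm_mul, Complex.norm_real,
      Real.norm_of_nonneg (gevreyMul_pos lam σ s k 0).le, ← mul_assoc]
    refine le_mul_of_one_le_left (norm_nonneg _) ?_
    rw [gevreyMul, ← mul_assoc, ← Real.rpow_add hb, neg_add_cancel, Real.rpow_zero, one_mul]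
    exact one_le_exp_of_nonneg hl hb.le
  have e2 : bracket k (0 : Eucl d) ^ (-(2 * σ)) = (bracket k 0 ^ (-σ)) ^ 2 := by
    rw [← Real.rpow_natCast, ← Real.rpow_mul hb.le]; congr 1; push_cast; ring
  rw [e2]
  nlinarith [sq_nonneg (bracket k (0 : Eucl d) ^ (-σ) - ‖fluidFun lam σ s U j k‖),
    sq_nonneg (bracket k (0 : Eucl d) ^ (-σ)), sq_nonneg ‖fluidFun lam σ s U j k‖]

theorem tsum_sub_left_sq (a : (Fin d → ℤ) → ENNReal) (k : Fin d → ℤ) :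
    ∑' l, a (k - l) ^ 2 = ∑' l, a l ^ 2 :=
  (Equiv.subLeft k).tsum_eq (fun l => a l ^ 2)

theorem eLpNorm_const_mul_two {β : Type*} [MeasurableSpace β] {μ : Measure β} (c : ℂ) (h : β → ℂ) :
    eLpNorm (fun v => c * h v) 2 μ = ‖c‖ₑ * eLpNorm h 2 μ :=
  eLpNorm_const_smul c h 2 μ

/-- A single output frequency `k` is considered, so Cauchy-Schwarz in `l` is enough and no decay is
needed. -/
theorem lintegral_conv_sq_le (a : (Fin d → ℤ) → ENNReal) {b : (Fin d → ℤ) × Eucl d → ENNReal}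
    (hb : Measurable b) (k : Fin d → ℤ) :
    ∫⁻ η, (∑' l, a (k - l) * b (l, η)) ^ 2 ≤
      (∑' l, a l ^ 2) * ∫⁻ p, b p ^ 2 ∂(modeMeasure d) := by
  have hbl : ∀ l, Measurable fun η => b (l, η) := fun l => hb.comp (by fun_prop)
  have hpt : ∀ η, (∑' l, a (k - l) * b (l, η)) ^ 2 ≤ (∑' l, a l ^ 2) * ∑' l, b (l, η) ^ 2 := by
    intro η
    have h := tsum_mul_le_sqrt_mul_sqrt (fun l => a (k - l)) (fun l => b (l, η))
    rw [tsum_sub_left_sq] at h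
    calc _ ≤ ((∑' l, a l ^ 2) ^ (1 / 2 : ℝ) * (∑' l, b (l, η) ^ 2) ^ (1 / 2 : ℝ)) ^ 2 := by gcongr
      _ = _ := by
        rw [← ENNReal.mul_rpow_of_nonneg _ _ (by norm_num), ← ENNReal.rpow_natCast,
          ← ENNReal.rpow_mul]
        norm_num
  calc _ ≤ ∫⁻ η, (∑' l, a l ^ 2) * ∑' l, b (l, η) ^ 2 := lintegral_mono hpt
    _ = (∑' l, a l ^ 2) * ∫⁻ η, ∑' l, b (l, η) ^ 2 :=
        lintegral_const_mul _ (Measurable.tsum fun l => (hbl l).pow_const 2)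
    _ = _ := by
      rw [lintegral_modeMeasure (hb.pow_const 2),
        lintegral_tsum fun l => ((hbl l).pow_const 2).aemeasurable]

/-- The `k`-th Fourier coefficient in `x` of `v^α U_j ∂_{v_j} g`. -/
noncomputable def convMode (α : Fin d → ℕ) (j : Fin d) (g : Eucl d → Eucl d → ℝ)
    (U : Eucl d → Eucl d) (k : Fin d → ℤ) (v : Eucl d) : ℂ :=
  torusFourier (fun x => U x j * ((∏ i, v i ^ α i) * fderiv ℝ (g x) v (unitVec j))) k

/-- For fixed `v` the product has the convolution series of its factors. The `L²` norms of the terms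
are summable by Cauchy-Schwarz, so the velocity transform passes under the sum; this places the
nonlinear term in `L²` with its expected symbol. -/
theorem memLp_convMode {lam σ s : ℝ} {M : ℕ} {g : Eucl d → Eucl d → ℝ} {U : Eucl d → Eucl d}
    (hg : IsKinGevrey lam σ M s g) (hU : IsFluidGevrey lam σ s U) (hl : 0 ≤ lam) (hσ : 1 ≤ σ)
    (hσd : (d : ℝ) / 2 < σ) {α : Fin d → ℕ} (hα : α ∈ multiIndices d M) (j : Fin d)
    (k : Fin d → ℤ) :
    MemLp (convMode α j g U k) 2 volume ∧
      ∀ᵐ η, HasSum (fun l => velCoeff U j (k - l) * derivSymbol α j g l η)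
        (velocityFourier (convMode α j g U k) η) := by
  have hD := fun l => hg.velocityFourier_vDerivMode hl hσ hα l j
  have hmem : ∀ l, MemLp (fun v => velCoeff U j (k - l) * vDerivMode α j g l v) 2 volume :=
    fun l => (hD l).1.const_mul _
  have hUc : Continuous fun x => U x j := by
    have := hU.smooth.continuous; fun_prop
  have hUp : TorusPeriodic fun x => U x j := fun x i => by
    simp only [hU.periodic x i]
  have hpt : ∀ v, HasSum (fun l => velCoeff U j (k - l) * vDerivMode α j g l v)
      (convMode α j g U k v) := fun v =>
    hasSum_torusFourier_mul hUc hUp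
      (continuous_const.mul ((continuous_fderiv_unitVec hg.smooth j).comp
        (by fun_prop : Continuous fun x : Eucl d => (x, v)))) (hU.summable_velCoeff hl hσd j) k
  have hsum : ∑' l, eLpNorm (fun v => velCoeff U j (k - l) * vDerivMode α j g l v) 2 volume ≠ ⊤ := by
    have e : ∀ l, eLpNorm (fun v => velCoeff U j (k - l) * vDerivMode α j g l v) 2 volume ≤
        ‖velCoeff U j (k - l)‖ₑ * eLpNorm (derivSymbol α j g l) 2 volume := by
      intro l
      rw [eLpNorm_const_mul_two]
      gcongr
      exact (eLpNorm_le_velocityFourier (hD l).1).trans (le_of_eq (eLpNorm_congr_ae (hD l).2))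
    refine ne_top_of_le_ne_top ?_ ((ENNReal.tsum_le_tsum e).trans
      (tsum_mul_le_sqrt_mul_sqrt (fun l => ‖velCoeff U j (k - l)‖ₑ) _))
    refine ENNReal.mul_ne_top ?_ ?_
    · rw [tsum_sub_left_sq (fun l => ‖velCoeff U j l‖ₑ) k, ← eLpNorm_count_two]
      exact (hU.eLpNorm_velCoeff_lt_top hl (by linarith) j).ne
    · have h := hg.eLpNorm_derivFun_lt_top hl hσ hα j
      rw [eLpNorm_two_eq, lintegral_modeMeasure ((measurable_derivFun α j g).enorm.pow_const 2)] at h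
      simp only [eLpNorm_two_sq]
      exact h.ne
  obtain ⟨h1, h2⟩ := ae_hasSum_velocityFourier hmem hsum hpt
  refine ⟨h1, ?_⟩
  have h3 : ∀ᵐ η, ∀ l, velocityFourier (fun v => velCoeff U j (k - l) * vDerivMode α j g l v) η =
      velCoeff U j (k - l) * derivSymbol α j g l η := by
    refine ae_all_iff.2 fun l => ?_
    filter_upwards [velocityFourier_const_mul (hD l).1 (velCoeff U j (k - l)), (hD l).2] with η a b
    rw [a, b]
  filter_upwards [h2, h3] with η a b
  simpa only [b] using a

theorem sq_add_le_two_mul (x y : ENNReal) : (x + y) ^ 2 ≤ 2 * x ^ 2 + 2 * y ^ 2 := by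
  have := ENNReal.rpow_add_le_mul_rpow_add_rpow x y (p := 2) (by norm_num)
  norm_num at this
  rw [← mul_add]; exact this

theorem lintegral_convMode_sub_sq_le {lam lam' σ s : ℝ} {M : ℕ} {g g' : Eucl d → Eucl d → ℝ}
    {U U' : Eucl d → Eucl d}
    (hg : IsKinGevrey lam σ M s g) (hU : IsFluidGevrey lam σ s U) (hl : 0 ≤ lam)
    (hg' : IsKinGevrey lam' σ M s g') (hU' : IsFluidGevrey lam' σ s U') (hl' : 0 ≤ lam')
    (hσ : 1 ≤ σ) (hσd : (d : ℝ) / 2 < σ) {α : Fin d → ℕ} (hα : α ∈ multiIndices d M) (j : Fin d)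
    (k : Fin d → ℤ) :
    eLpNorm (convMode α j g U k - convMode α j g' U' k) 2 volume ^ 2 ≤
      2 * (eLpNorm (velCoeff U j - velCoeff U' j) 2 Measure.count ^ 2 *
          eLpNorm (derivFun α j g) 2 (modeMeasure d) ^ 2) +
        2 * (eLpNorm (velCoeff U' j) 2 Measure.count ^ 2 *
          eLpNorm (derivFun α j g - derivFun α j g') 2 (modeMeasure d) ^ 2) := by
  obtain ⟨m1, s1⟩ := memLp_convMode hg hU hl hσ hσd hα j k
  obtain ⟨m2, s2⟩ := memLp_convMode hg' hU' hl' hσ hσd hα j k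
  have hd1 := measurable_derivFun α j g
  have hd2 := measurable_derivFun α j g'
  set a := fun l => ‖(velCoeff U j - velCoeff U' j) l‖ₑ with ha
  set a' := fun l => ‖velCoeff U' j l‖ₑ with ha'
  set b := fun p => ‖derivFun α j g p‖ₑ with hb
  set b' := fun p => ‖(derivFun α j g - derivFun α j g') p‖ₑ with hb'
  have hbm : Measurable b := hd1.enorm
  have hbm' : Measurable b' := (hd1.sub hd2).enorm
  calc eLpNorm (convMode α j g U k - convMode α j g' U' k) 2 volume ^ 2
      ≤ eLpNorm (velocityFourier (convMode α j g U k - convMode α j g' U' k)) 2 volume ^ 2 := by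
        gcongr; exact eLpNorm_le_velocityFourier (m1.sub m2)
    _ = ∫⁻ η, ‖velocityFourier (convMode α j g U k - convMode α j g' U' k) η‖ₑ ^ 2 :=
        eLpNorm_two_sq _ _
    _ ≤ ∫⁻ η, (2 * (∑' l, a (k - l) * b (l, η)) ^ 2 + 2 * (∑' l, a' (k - l) * b' (l, η)) ^ 2) := by
        refine lintegral_mono_ae ?_
        filter_upwards [velocityFourier_sub m1 m2, s1, s2] with η h0 h1 h2
        refine le_trans ?_ (sq_add_le_two_mul _ _)
        have h0' : velocityFourier (convMode α j g U k - convMode α j g' U' k) η = _ := h0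
        rw [h0', ← (h1.sub h2).tsum_eq, ← ENNReal.tsum_add]
        gcongr
        refine (enorm_tsum_le_tsum_enorm).trans (ENNReal.tsum_le_tsum fun l => ?_)
        have e : velCoeff U j (k - l) * derivSymbol α j g l η -
            velCoeff U' j (k - l) * derivSymbol α j g' l η =
            (velCoeff U j - velCoeff U' j) (k - l) * derivFun α j g (l, η) +
              velCoeff U' j (k - l) * (derivFun α j g - derivFun α j g') (l, η) := by
          simp only [Pi.sub_apply, derivFun]; ring
        rw [e]
        refine (enorm_add_le _ _).trans ?_
        rw [enorm_mul, enorm_mul]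
    _ = 2 * (∫⁻ η, (∑' l, a (k - l) * b (l, η)) ^ 2) +
          2 * ∫⁻ η, (∑' l, a' (k - l) * b' (l, η)) ^ 2 := by
        have hmb : ∀ (a : (Fin d → ℤ) → ENNReal) (b : (Fin d → ℤ) × Eucl d → ENNReal), Measurable b →
            Measurable fun η => (∑' l, a (k - l) * b (l, η)) ^ 2 := fun a b h =>
          (Measurable.tsum fun l => (h.comp (by fun_prop : Measurable fun η : Eucl d =>
            (l, η))).const_mul _).pow_const 2
        rw [lintegral_add_left ((hmb a b hbm).const_mul 2), lintegral_const_mul _ (hmb a b hbm),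
          lintegral_const_mul _ (hmb a' b' hbm')]
    _ ≤ _ := by
        simp only [eLpNorm_two_sq, lintegral_count]
        gcongr
        · exact lintegral_conv_sq_le a hbm k
        · exact lintegral_conv_sq_le a' hbm' k

theorem tendsto_convMode {I : Set ℝ} {lam : ℝ → ℝ} {σ s : ℝ} {M : ℕ}
    {f : ℝ → Eucl d → Eucl d → ℝ} {u : ℝ → Eucl d → Eucl d}
    (hf : IsKinGevreyCurve I lam σ M s f) (hu : IsFluidGevreyCurve I lam σ s u) (hσ : 1 ≤ σ)
    (hσd : (d : ℝ) / 2 < σ) {t₀ : ℝ} (ht : t₀ ∈ I) (hl : ∀ t ∈ I, 0 ≤ lam t)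
    (hlc : ContinuousWithinAt lam I t₀) {α : Fin d → ℕ} (hα : α ∈ multiIndices d M) (j : Fin d)
    (k : Fin d → ℤ) :
    Tendsto (fun τ => eLpNorm (convMode α j (f τ) (u τ) k - convMode α j (f t₀) (u t₀) k) 2 volume)
      (𝓝[I] t₀) (𝓝 0) := by
  have hV := hu.tendsto_velCoeff (by linarith) ht hl hlc j
  have hW := hf.tendsto_derivFun hσ ht hl hlc hα j
  have hWb := tendsto_eLpNorm_of_sub
    (fun τ => (measurable_derivFun α j (f τ)).aestronglyMeasurable)
    (measurable_derivFun α j (f t₀)).aestronglyMeasurable hW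
  have hW0 := (hf.mem t₀ ht).eLpNorm_derivFun_lt_top (hl t₀ ht) hσ hα j
  have hV0 := (hu.mem t₀ ht).eLpNorm_velCoeff_lt_top (hl t₀ ht) (by linarith) j
  set L := eLpNorm (derivFun α j (f t₀)) 2 (modeMeasure d) + 1 with hL
  have hLt : L ≠ ⊤ := ENNReal.add_ne_top.2 ⟨hW0.ne, by simp⟩
  have hlim : Tendsto (fun τ => 2 * (eLpNorm (velCoeff (u τ) j - velCoeff (u t₀) j) 2
        Measure.count ^ 2 * L ^ 2) + 2 * (eLpNorm (velCoeff (u t₀) j) 2 Measure.count ^ 2 *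
          eLpNorm (derivFun α j (f τ) - derivFun α j (f t₀)) 2 (modeMeasure d) ^ 2))
      (𝓝[I] t₀) (𝓝 0) := by
    have a1 := ENNReal.Tendsto.const_mul (a := 2) (ENNReal.Tendsto.mul_const (b := L ^ 2)
      (ENNReal.Tendsto.pow (n := 2) hV) (Or.inr (ENNReal.pow_ne_top hLt))) (Or.inr (by simp))
    have a2 := ENNReal.Tendsto.const_mul (a := 2) (ENNReal.Tendsto.const_mul
      (a := eLpNorm (velCoeff (u t₀) j) 2 Measure.count ^ 2) (ENNReal.Tendsto.pow (n := 2) hW)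
      (Or.inr (ENNReal.pow_ne_top hV0.ne))) (Or.inr (by simp))
    simpa using a1.add a2
  have hsq : Tendsto (fun τ => eLpNorm (convMode α j (f τ) (u τ) k - convMode α j (f t₀) (u t₀) k) 2
      volume ^ 2) (𝓝[I] t₀) (𝓝 0) := by
    refine tendsto_of_tendsto_of_tendsto_of_le_of_le' tendsto_const_nhds hlim
      (Eventually.of_forall fun _ => zero_le) ?_
    filter_upwards [self_mem_nhdsWithin, hWb] with τ hτ hb
    refine (lintegral_convMode_sub_sq_le (hf.mem τ hτ) (hu.mem τ hτ) (hl τ hτ) (hf.mem t₀ ht)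
      (hu.mem t₀ ht) (hl t₀ ht) hσ hσd hα j k).trans ?_
    gcongr
  have := tendsto_rpow_half_zero hsq
  refine this.congr fun τ => ?_
  rw [← ENNReal.rpow_natCast, ← ENNReal.rpow_mul]
  norm_num

end VlasovGevrey

/-! ### The source term and the free characteristics -/

namespace VlasovGevrey

variable {d : ℕ}

theorem IsKinGevreyCurve.tendsto_phaseFun {I : Set ℝ} {lam : ℝ → ℝ} {σ s : ℝ} {M : ℕ}
    {f : ℝ → Eucl d → Eucl d → ℝ} (hf : IsKinGevreyCurve I lam σ M s f) (hσ : 1 ≤ σ) {t₀ : ℝ}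
    (ht : t₀ ∈ I) (hl : ∀ t ∈ I, 0 ≤ lam t) (hlc : ContinuousWithinAt lam I t₀)
    {α : Fin d → ℕ} (hα : α ∈ multiIndices d M) :
    Tendsto (fun τ => eLpNorm (fun p : (Fin d → ℤ) × Eucl d =>
      phaseFourier (vPowMul α (f τ)) p.1 p.2 - phaseFourier (vPowMul α (f t₀)) p.1 p.2) 2
      (modeMeasure d)) (𝓝[I] t₀) (𝓝 0) := by
  have hgl : ∀ p : (Fin d → ℤ) × Eucl d, Tendsto (fun τ => (gevreyMul (lam τ) σ s p.1 p.2 : ℂ))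
      (𝓝[I] t₀) (𝓝 (gevreyMul (lam t₀) σ s p.1 p.2 : ℂ)) := fun p =>
    (Complex.continuous_ofReal.tendsto _).comp
      (((continuous_gevreyMul_lam σ s p.1 p.2).tendsto _).comp hlc)
  have h2 := tendsto_eLpNorm_mul_sub (μ := modeMeasure d) (l := 𝓝[I] t₀)
    (ρ := fun τ (p : (Fin d → ℤ) × Eucl d) => ((1 : ℕ) : ℂ) / gevreyMul (lam τ) σ s p.1 p.2)
    (B := (1 : ℕ)) (fun τ => measurable_const_div (lam τ) σ s 1)
    (measurable_const_div (lam t₀) σ s 1)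
    (by filter_upwards [self_mem_nhdsWithin] with τ hτ
        exact norm_const_div_gevreyMul_le (hl τ hτ) (by linarith) _)
    (norm_const_div_gevreyMul_le (hl t₀ ht) (by linarith) _)
    (fun p => tendsto_const_nhds.div (hgl p) (gevreyMul_ne_zero _ _ _ _ _))
    (fun τ => (measurable_kinFun (lam τ) σ s α (f τ)).aestronglyMeasurable)
    (measurable_kinFun (lam t₀) σ s α (f t₀)).aestronglyMeasurable
    ((hf.mem t₀ ht).eLpNorm_kinFun_lt_top hα) (hf.tendsto_kinFun ht hα)
  refine h2.congr fun τ => ?_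
  congr 1
  ext p
  simp only [Pi.sub_apply, Pi.mul_apply, kinFun, kinMode, Nat.cast_one]
  have a1 := gevreyMul_ne_zero (lam τ) σ s p.1 p.2
  have a2 := gevreyMul_ne_zero (lam t₀) σ s p.1 p.2
  field_simp

theorem eLpNorm_slice_le {E : Type*} [NormedAddCommGroup E] [MeasurableSpace E] [BorelSpace E]
    {F : (Fin d → ℤ) × Eucl d → E} (hF : Measurable F) (k : Fin d → ℤ) :
    eLpNorm (fun η => F (k, η)) 2 volume ≤ eLpNorm F 2 (modeMeasure d) := by
  rw [eLpNorm_two_eq, eLpNorm_two_eq, lintegral_modeMeasure (hF.enorm.pow_const 2)]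
  exact ENNReal.rpow_le_rpow (ENNReal.le_tsum (f := fun k => ∫⁻ η, ‖F (k, η)‖ₑ ^ 2) k) (by norm_num)

theorem tendsto_vMode {I : Set ℝ} {lam : ℝ → ℝ} {σ s : ℝ} {M : ℕ}
    {f : ℝ → Eucl d → Eucl d → ℝ} (hf : IsKinGevreyCurve I lam σ M s f) (hσ : 1 ≤ σ) {t₀ : ℝ}
    (ht : t₀ ∈ I) (hl : ∀ t ∈ I, 0 ≤ lam t) (hlc : ContinuousWithinAt lam I t₀)
    {α : Fin d → ℕ} (hα : α ∈ multiIndices d M) (k : Fin d → ℤ) :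
    Tendsto (fun τ => eLpNorm (vMode α (f τ) k - vMode α (f t₀) k) 2 volume) (𝓝[I] t₀) (𝓝 0) := by
  refine tendsto_of_tendsto_of_tendsto_of_le_of_le' tendsto_const_nhds
    (hf.tendsto_phaseFun hσ ht hl hlc hα) (Eventually.of_forall fun _ => zero_le) ?_
  filter_upwards [self_mem_nhdsWithin] with τ hτ
  have m1 := (hf.mem τ hτ).memLp_vMode hα k
  have m2 := (hf.mem t₀ ht).memLp_vMode hα k
  refine (eLpNorm_le_velocityFourier (m1.sub m2)).trans ?_
  have e : velocityFourier (vMode α (f τ) k - vMode α (f t₀) k) =ᵐ[volume] fun η =>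
      phaseFourier (vPowMul α (f τ)) k η - phaseFourier (vPowMul α (f t₀)) k η :=
    velocityFourier_sub m1 m2
  rw [eLpNorm_congr_ae e]
  exact eLpNorm_slice_le (F := fun p : (Fin d → ℤ) × Eucl d =>
      phaseFourier (vPowMul α (f τ)) p.1 p.2 - phaseFourier (vPowMul α (f t₀)) p.1 p.2)
    ((measurable_phaseFun α (f τ)).sub (measurable_phaseFun α (f t₀))) k

/-- The `k`-th Fourier coefficient of `v^α ((d - |α|) g - U·∇_v g)`. -/
noncomputable def sourceMode (α : Fin d → ℕ) (g : Eucl d → Eucl d → ℝ) (U : Eucl d → Eucl d)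
    (k : Fin d → ℤ) (v : Eucl d) : ℂ :=
  ((d : ℂ) - (∑ i, α i : ℕ)) * vMode α g k v - ∑ j, convMode α j g U k v

theorem memLp_sourceMode {lam σ s : ℝ} {M : ℕ} {g : Eucl d → Eucl d → ℝ} {U : Eucl d → Eucl d}
    (hg : IsKinGevrey lam σ M s g) (hU : IsFluidGevrey lam σ s U) (hl : 0 ≤ lam) (hσ : 1 ≤ σ)
    (hσd : (d : ℝ) / 2 < σ) {α : Fin d → ℕ} (hα : α ∈ multiIndices d M) (k : Fin d → ℤ) :
    MemLp (sourceMode α g U k) 2 volume :=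
  ((hg.memLp_vMode hα k).const_mul _).sub
    (memLp_finsetSum _ fun j _ => (memLp_convMode hg hU hl hσ hσd hα j k).1)

theorem tendsto_sourceMode {I : Set ℝ} {lam : ℝ → ℝ} {σ s : ℝ} {M : ℕ}
    {f : ℝ → Eucl d → Eucl d → ℝ} {u : ℝ → Eucl d → Eucl d}
    (hf : IsKinGevreyCurve I lam σ M s f) (hu : IsFluidGevreyCurve I lam σ s u) (hσ : 1 ≤ σ)
    (hσd : (d : ℝ) / 2 < σ) {t₀ : ℝ} (ht : t₀ ∈ I) (hl : ∀ t ∈ I, 0 ≤ lam t)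
    (hlc : ContinuousWithinAt lam I t₀) {α : Fin d → ℕ} (hα : α ∈ multiIndices d M)
    (k : Fin d → ℤ) :
    Tendsto (fun τ => eLpNorm (sourceMode α (f τ) (u τ) k - sourceMode α (f t₀) (u t₀) k) 2 volume)
      (𝓝[I] t₀) (𝓝 0) := by
  set c : ℂ := (d : ℂ) - (∑ i, α i : ℕ) with hc
  have h1 := ENNReal.Tendsto.const_mul (a := ‖c‖ₑ) (tendsto_vMode hf hσ ht hl hlc hα k)
    (Or.inr (by simp))
  have h2 := tendsto_finsetSum (Finset.univ : Finset (Fin d)) fun j _ =>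
    tendsto_convMode hf hu hσ hσd ht hl hlc hα j k
  have h3 := h1.add h2
  simp only [mul_zero, Finset.sum_const_zero, add_zero] at h3
  refine tendsto_of_tendsto_of_tendsto_of_le_of_le' tendsto_const_nhds h3
    (Eventually.of_forall fun _ => zero_le) ?_
  filter_upwards [self_mem_nhdsWithin] with τ hτ
  have mv := ((hf.mem τ hτ).memLp_vMode hα k).sub ((hf.mem t₀ ht).memLp_vMode hα k)
  have mc := fun j => (memLp_convMode (hf.mem τ hτ) (hu.mem τ hτ) (hl τ hτ) hσ hσd hα j k).1.sub
    (memLp_convMode (hf.mem t₀ ht) (hu.mem t₀ ht) (hl t₀ ht) hσ hσd hα j k).1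
  have e : sourceMode α (f τ) (u τ) k - sourceMode α (f t₀) (u t₀) k =
      (fun v => c * (vMode α (f τ) k - vMode α (f t₀) k) v) -
        ∑ j, (convMode α j (f τ) (u τ) k - convMode α j (f t₀) (u t₀) k) := by
    ext v
    simp only [sourceMode, Pi.sub_apply, Finset.sum_apply, Finset.sum_sub_distrib]
    ring
  rw [e]
  refine (eLpNorm_sub_le (mv.const_mul c).1
    (Finset.aestronglyMeasurable_sum _ fun j _ => (mc j).1) (by norm_num)).trans ?_
  rw [eLpNorm_const_mul_two]
  gcongr
  exact eLpNorm_sum_le (fun j _ => (mc j).1) (by norm_num)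

section Characteristics

variable {I : Set ℝ} {u : ℝ → Eucl d → Eucl d} {f : ℝ → Eucl d → Eucl d → ℝ}

/-- The derivative of `f` along the free characteristics `(1, v, -v)`. -/
noncomputable def transportDeriv (I : Set ℝ) (f : ℝ → Eucl d → Eucl d → ℝ)
    (p : ℝ × Eucl d × Eucl d) : ℝ :=
  fderivWithin ℝ (fun p : ℝ × Eucl d × Eucl d => f p.1 p.2.1 p.2.2) (I ×ˢ univ) p
    (1, p.2.2, -p.2.2)

theorem IsVlasovSolution.hasFDerivWithinAt (h : IsVlasovSolution I u f) {t : ℝ} (ht : t ∈ I)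
    (x v : Eucl d) :
    HasFDerivWithinAt (fun p : ℝ × Eucl d × Eucl d => f p.1 p.2.1 p.2.2)
      (fderivWithin ℝ (fun p : ℝ × Eucl d × Eucl d => f p.1 p.2.1 p.2.2) (I ×ˢ univ) (t, x, v))
      (I ×ˢ univ) (t, x, v) :=
  (h.contDiffOn.differentiableOn (by simp) (t, x, v) ⟨ht, mem_univ _⟩).hasFDerivWithinAt

theorem sum_apply_mul_unitVec (L : Eucl d →L[ℝ] ℝ) (v : Eucl d) :
    ∑ j, v j * L (unitVec j) = L v := by
  have hv : v = ∑ j, v j • unitVec j := by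
    ext i
    simp [unitVec, Finset.sum_apply, Pi.single_apply]
  conv_rhs => rw [hv]
  rw [map_sum]
  simp

/-- The divergence of `-v f` contributes `-d f - v·∇_v f`. Only `u·∇_v f` is moved to the right-hand
side, so that the characteristics remain explicit and independent of `u`. -/
theorem IsVlasovSolution.transportDeriv_eq (h : IsVlasovSolution I u f)
    (hI : UniqueDiffOn ℝ I) {t : ℝ} (ht : t ∈ I) (x v : Eucl d) :
    transportDeriv I f (t, x, v) =
      d * f t x v - ∑ j, u t x j * fderiv ℝ (f t x) v (unitVec j) := by
  set L := fderivWithin ℝ (fun p : ℝ × Eucl d × Eucl d => f p.1 p.2.1 p.2.2) (I ×ˢ univ) (t, x, v)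
    with hL
  have hd := h.hasFDerivWithinAt ht x v
  have A : derivWithin (fun τ => f τ x v) I t = L (1, 0, 0) := by
    have hc : HasDerivWithinAt (fun τ : ℝ => ((τ, x, v) : ℝ × Eucl d × Eucl d)) (1, 0, 0) I t :=
      ((hasDerivAt_id t).prodMk (hasDerivAt_const t (x, v))).hasDerivWithinAt
    have := hd.comp_hasDerivWithinAt t hc (fun τ hτ => mk_mem_prod hτ (mem_univ _))
    exact this.derivWithin (hI t ht)
  have B : ∀ y, fderiv ℝ (fun y => f t y v) x y = L (0, y, 0) := by
    intro y
    have hc : HasFDerivWithinAt (fun y : Eucl d => ((t, y, v) : ℝ × Eucl d × Eucl d))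
        ((0 : Eucl d →L[ℝ] ℝ).prod ((ContinuousLinearMap.id ℝ (Eucl d)).prod 0)) univ x :=
      ((hasFDerivAt_const t x).prodMk ((hasFDerivAt_id x).prodMk
        (hasFDerivAt_const v x))).hasFDerivWithinAt
    have := hd.comp x hc (fun τ _ => mk_mem_prod ht (mem_univ _))
    rw [hasFDerivWithinAt_univ] at this
    have e := congrArg (fun K => K y) this.fderiv
    simpa [Function.comp_def] using e
  have C : ∀ y, fderiv ℝ (f t x) v y = L (0, 0, y) := by
    intro y
    have hc : HasFDerivWithinAt (fun y : Eucl d => ((t, x, y) : ℝ × Eucl d × Eucl d))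
        ((0 : Eucl d →L[ℝ] ℝ).prod ((0 : Eucl d →L[ℝ] Eucl d).prod
          (ContinuousLinearMap.id ℝ (Eucl d)))) univ v :=
      ((hasFDerivAt_const t v).prodMk ((hasFDerivAt_const x v).prodMk
        (hasFDerivAt_id v))).hasFDerivWithinAt
    have := hd.comp v hc (fun τ _ => mk_mem_prod ht (mem_univ _))
    rw [hasFDerivWithinAt_univ] at this
    have e := congrArg (fun K => K y) this.fderiv
    simpa [Function.comp_def] using e
  have hdiff : DifferentiableAt ℝ (f t x) v := by
    have hc : HasFDerivWithinAt (fun y : Eucl d => ((t, x, y) : ℝ × Eucl d × Eucl d))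
        ((0 : Eucl d →L[ℝ] ℝ).prod ((0 : Eucl d →L[ℝ] Eucl d).prod
          (ContinuousLinearMap.id ℝ (Eucl d)))) univ v :=
      ((hasFDerivAt_const t v).prodMk ((hasFDerivAt_const x v).prodMk
        (hasFDerivAt_id v))).hasFDerivWithinAt
    have := hd.comp v hc (fun τ _ => mk_mem_prod ht (mem_univ _))
    rw [hasFDerivWithinAt_univ] at this
    exact this.differentiableAt
  have D : ∀ j, fderiv ℝ (fun w : Eucl d => (u t x j - w j) * f t x w) v (unitVec j) =
      (u t x j - v j) * fderiv ℝ (f t x) v (unitVec j) - f t x v := by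
    intro j
    have hp : HasFDerivAt (fun w : Eucl d => w j) (EuclideanSpace.proj j : Eucl d →L[ℝ] ℝ) v :=
      (EuclideanSpace.proj j : Eucl d →L[ℝ] ℝ).hasFDerivAt
    have := ((hp.const_sub (u t x j)).mul hdiff.hasFDerivAt).fderiv
    have e := congrArg (fun K => K (unitVec j)) this
    refine Eq.trans e ?_
    simp [unitVec]
    ring
  have E := h.equation t ht x v
  rw [A, B, Finset.sum_congr rfl (fun j _ => D j), Finset.sum_sub_distrib] at E
  have F : L (1, v, -v) = L (1, 0, 0) + L (0, v, 0) - L (0, 0, v) := by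
    rw [← map_add, ← map_sub]; simp
  have G : ∑ j, (u t x j - v j) * fderiv ℝ (f t x) v (unitVec j) =
      ∑ j, u t x j * fderiv ℝ (f t x) v (unitVec j) - L (0, 0, v) := by
    rw [← C v, ← sum_apply_mul_unitVec, ← Finset.sum_sub_distrib]
    exact Finset.sum_congr rfl fun j _ => by ring
  rw [G] at E
  simp only [Finset.sum_const, Finset.card_univ, Fintype.card_fin, nsmul_eq_mul] at E
  simp only [transportDeriv]
  rw [F]; linarith

/-- The derivative of `v^α f` along the free characteristics. -/
noncomputable def source (I : Set ℝ) (f : ℝ → Eucl d → Eucl d → ℝ) (α : Fin d → ℕ)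
    (p : ℝ × Eucl d × Eucl d) : ℝ :=
  (∏ i, p.2.2 i ^ α i) * transportDeriv I f p -
    (∑ i, α i : ℕ) * ((∏ i, p.2.2 i ^ α i) * f p.1 p.2.1 p.2.2)

theorem IsVlasovSolution.continuousOn_source (h : IsVlasovSolution I u f)
    (hI : UniqueDiffOn ℝ I) (α : Fin d → ℕ) : ContinuousOn (source I f α) (I ×ˢ univ) := by
  have hU : UniqueDiffOn ℝ (I ×ˢ (univ : Set (Eucl d × Eucl d))) := hI.prod uniqueDiffOn_univ
  have h1 := h.contDiffOn.continuousOn_fderivWithin hU (by simp)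
  have h2 : ContinuousOn (transportDeriv I f) (I ×ˢ univ) :=
    h1.clm_apply (by fun_prop)
  have h3 : Continuous fun p : ℝ × Eucl d × Eucl d => ∏ i, p.2.2 i ^ α i :=
    (continuous_prod_pow α).comp (continuous_snd.comp continuous_snd)
  exact (h3.continuousOn.mul h2).sub
    (continuousOn_const.mul (h3.continuousOn.mul h.contDiffOn.continuousOn))

/-- The curve solves `x' = v`, `v' = -v` with data `(x, v)` at `t₀`. Along it the monomial `v^α`
scales like `e^{-|α|(r - t₀)}`, which is the origin of the term with `|α|` in the source. -/
theorem IsVlasovSolution.hasDerivWithinAt_characteristic (h : IsVlasovSolution I u f)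
    (α : Fin d → ℕ) (t₀ : ℝ) {r : ℝ} (hr : r ∈ I) (x v : Eucl d) :
    HasDerivWithinAt (fun r => vPowMul α (f r) (x + (1 - Real.exp (-(r - t₀))) • v)
        (Real.exp (-(r - t₀)) • v))
      (source I f α (r, x + (1 - Real.exp (-(r - t₀))) • v, Real.exp (-(r - t₀)) • v)) I r := by
  set c : ℝ → ℝ := fun r => Real.exp (-(r - t₀)) with hc
  have hcd : HasDerivAt c (-c r) r := by
    have := (((hasDerivAt_id r).sub_const t₀).neg).exp
    simpa [hc] using this
  have hV : HasDerivAt (fun r => c r • v) (-(c r • v)) r := by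
    simpa using hcd.smul_const v
  have hX : HasDerivAt (fun r => x + (1 - c r) • v) (c r • v) r := by
    simpa using (((hcd.const_sub 1).smul_const v).const_add x)
  have hq : HasDerivWithinAt (fun r => ((r, x + (1 - c r) • v, c r • v) : ℝ × Eucl d × Eucl d))
      (1, c r • v, -(c r • v)) I r :=
    ((hasDerivAt_id r).prodMk (hX.prodMk hV)).hasDerivWithinAt
  have hf := (h.hasFDerivWithinAt hr (x + (1 - c r) • v) (c r • v)).comp_hasDerivWithinAt r hq
    (fun τ hτ => mk_mem_prod hτ (mem_univ _))
  have eprod : ∀ q, ∏ i, (c q • v) i ^ α i = c q ^ (∑ i, α i) * ∏ i, v i ^ α i := by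
    intro q
    rw [← Finset.prod_pow_eq_pow_sum, ← Finset.prod_mul_distrib]
    exact Finset.prod_congr rfl fun i _ => by simp [mul_pow]
  have hp : HasDerivWithinAt (fun q => ∏ i, (c q • v) i ^ α i)
      (-(∑ i, α i : ℕ) * ∏ i, (c r • v) i ^ α i) I r := by
    simp only [eprod]
    have := ((hcd.pow (∑ i, α i)).mul_const (∏ i, v i ^ α i)).hasDerivWithinAt (s := I)
    refine this.congr_deriv ?_
    rcases Nat.eq_zero_or_pos (∑ i, α i) with h0 | h0
    · simp [h0]
    · obtain ⟨n, hn⟩ := Nat.exists_eq_succ_of_ne_zero h0.ne'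
      rw [hn]; simp only [Nat.succ_eq_add_one, Nat.add_sub_cancel, pow_succ]; ring
  refine (hp.mul hf).congr_deriv ?_
  simp only [source, transportDeriv, Function.comp]
  ring

theorem torusFourier_source (h : IsVlasovSolution I u f) (hI : UniqueDiffOn ℝ I) {t : ℝ}
    (ht : t ∈ I) (hs : ContDiff ℝ ∞ fun p : Eucl d × Eucl d => f t p.1 p.2)
    (hu : Continuous (u t)) (α : Fin d → ℕ) (k : Fin d → ℤ) (v : Eucl d) :
    torusFourier (fun x => source I f α (t, x, v)) k = sourceMode α (f t) (u t) k v := by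
  have hfc : Continuous (Function.uncurry (f t)) := hs.continuous
  have hslice : Continuous fun x : Eucl d => (x, v) := by fun_prop
  have c1 : Continuous fun x => vPowMul α (f t) x v := (continuous_vPowMul hfc α).comp hslice
  have c2 : ∀ j, Continuous fun x => u t x j * ((∏ i, v i ^ α i) * fderiv ℝ (f t x) v (unitVec j)) :=
    fun j => (by fun_prop : Continuous fun x => u t x j).mul
      (continuous_const.mul ((continuous_fderiv_unitVec hs j).comp hslice))
  have e : (fun x => source I f α (t, x, v)) = fun x =>
      ((d : ℝ) - (∑ i, α i : ℕ)) * vPowMul α (f t) x v -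
        ∑ j, u t x j * ((∏ i, v i ^ α i) * fderiv ℝ (f t x) v (unitVec j)) := by
    ext x
    simp only [source, h.transportDeriv_eq hI ht, vPowMul]
    have : ∑ j, u t x j * ((∏ i, v i ^ α i) * fderiv ℝ (f t x) v (unitVec j)) =
        (∏ i, v i ^ α i) * ∑ j, u t x j * fderiv ℝ (f t x) v (unitVec j) := by
      rw [Finset.mul_sum]; exact Finset.sum_congr rfl fun j _ => by ring
    rw [this]; ring
  have c3 : Continuous fun x => ((d : ℝ) - (∑ i, α i : ℕ)) * vPowMul α (f t) x v :=
    continuous_const.mul c1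
  rw [e, torusFourier_sub c3 (continuous_finsetSum _ fun j _ => c2 j),
    torusFourier_const_mul, torusFourier_sum _ c2]
  simp only [sourceMode, vMode, convMode]
  push_cast
  rfl

theorem continuous_source_slice (h : IsVlasovSolution I u f) (hI : UniqueDiffOn ℝ I) {t : ℝ}
    (ht : t ∈ I) (α : Fin d → ℕ) (v : Eucl d) :
    Continuous fun x => source I f α (t, x, v) :=
  (h.continuousOn_source hI α).comp_continuous (by fun_prop) fun _ => ⟨ht, mem_univ _⟩

theorem periodic_source (h : IsVlasovSolution I u f) (hI : UniqueDiffOn ℝ I) {t : ℝ}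
    (ht : t ∈ I) (hp : ∀ v, TorusPeriodic fun x => f t x v) (hu : TorusPeriodic (u t))
    (α : Fin d → ℕ) (v : Eucl d) :
    TorusPeriodic fun x => source I f α (t, x, v) := by
  intro x i
  have e : f t (x + EuclideanSpace.single i (2 * Real.pi)) = f t x := funext fun w => hp w x i
  simp only [source, h.transportDeriv_eq hI ht, e, hu x i]

end Characteristics

end VlasovGevrey

/-! ### Differentiability in `L²` of the modes transported by the free flow -/

namespace VlasovGevrey

variable {d : ℕ}

/-- The contraction factor `e^{-(r - t₀)}` of the free velocity characteristics. -/
noncomputable def contraction (t₀ r : ℝ) : ℝ := Real.exp (-(r - t₀))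

theorem contraction_pos (t₀ r : ℝ) : 0 < contraction t₀ r := Real.exp_pos _

@[simp] theorem contraction_self (t₀ : ℝ) : contraction t₀ t₀ = 1 := by simp [contraction]

theorem continuous_contraction (t₀ : ℝ) : Continuous (contraction t₀) := by
  unfold contraction; fun_prop

/-- The transport of a mode along the free characteristics between the times `t₀` and `r`. -/
noncomputable def flowMode (t₀ r : ℝ) (k : Fin d → ℤ) (h : Eucl d → ℂ) (v : Eucl d) : ℂ :=
  character k ((1 - contraction t₀ r) • v) * h (contraction t₀ r • v)

theorem flowMode_self (t₀ : ℝ) (k : Fin d → ℤ) (h : Eucl d → ℂ) : flowMode t₀ t₀ k h = h := by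
  ext v
  simp [flowMode, character]

theorem memLp_flowMode (t₀ r : ℝ) (k : Fin d → ℤ) {h : Eucl d → ℂ} (hh : MemLp h 2 volume) :
    MemLp (flowMode t₀ r k h) 2 volume := by
  have h1 : MemLp (fun v => h (contraction t₀ r • v)) 2 volume := by
    simpa using MemLp.comp_affine (contraction_pos t₀ r) 0 hh
  exact MemLp.mul_of_norm_le_one h1 ((continuous_character k).comp (by fun_prop)).aestronglyMeasurable
    fun v => (norm_character _ _).le

theorem eLpNorm_flowMode (t₀ r : ℝ) (k : Fin d → ℤ) (h : Eucl d → ℂ) :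
    eLpNorm (flowMode t₀ r k h) 2 volume =
      ENNReal.ofReal ((contraction t₀ r ^ d)⁻¹) ^ (1 / 2 : ℝ) * eLpNorm h 2 volume := by
  have e : ∀ v, ‖flowMode t₀ r k h v‖ₑ ^ 2 = ‖h (contraction t₀ r • v + 0)‖ₑ ^ 2 := by
    intro v
    have : ‖character k ((1 - contraction t₀ r) • v)‖ₑ = 1 := by
      rw [← ofReal_norm, norm_character, ENNReal.ofReal_one]
    rw [flowMode, enorm_mul, this, one_mul, add_zero]
  rw [eLpNorm_two_eq, eLpNorm_two_eq, ← ENNReal.mul_rpow_of_nonneg _ _ (by norm_num)]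
  simp_rw [e]
  rw [lintegral_comp_affine (contraction_pos t₀ r) 0 (fun v => ‖h v‖ₑ ^ 2)]

theorem character_eq_inner (k : Fin d → ℤ) (x : Eucl d) :
    character k x = Complex.exp (Complex.I * ((inner ℝ (intVec k) x : ℝ) : ℂ)) := by
  unfold character
  congr 3

theorem velocityFourier_flowMode (t₀ r : ℝ) (k : Fin d → ℤ) {h : Eucl d → ℂ}
    (hh : MemLp h 2 volume) :
    velocityFourier (flowMode t₀ r k h) =ᵐ[volume] fun η =>
      ((contraction t₀ r ^ d)⁻¹ : ℝ) *
        velocityFourier h ((contraction t₀ r)⁻¹ • (η - (1 - contraction t₀ r) • intVec k)) := by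
  have h1 := velocityFourier_affine hh (contraction_pos t₀ r)
    ((1 - contraction t₀ r) • intVec k) 0
  have e : flowMode t₀ r k h = fun v => Complex.exp (Complex.I *
      ((inner ℝ ((1 - contraction t₀ r) • intVec k) v : ℝ) : ℂ)) *
        h (contraction t₀ r • v + 0) := by
    ext v
    rw [flowMode, character_eq_inner, real_inner_smul_left, real_inner_smul_right, add_zero]
  rw [e]
  filter_upwards [h1] with η hη
  rw [hη]
  simp

variable {T : ℝ} {u : ℝ → Eucl d → Eucl d} {f : ℝ → Eucl d → Eucl d → ℝ} {lam : ℝ → ℝ}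
  {σ s : ℝ} {M : ℕ}

theorem uIcc_subset_of_Icc {a b c e : ℝ} (ha : a ∈ Icc c e) (hb : b ∈ Icc c e) :
    uIcc a b ⊆ Icc c e := (ordConnected_Icc.uIcc_subset ha hb)

theorem flowMode_eq_torusFourier {g : Eucl d → ℝ} (hg : Continuous g) (hp : TorusPeriodic g)
    (k : Fin d → ℤ) (y : Eucl d) :
    character k y * torusFourier g k = torusFourier (fun x => g (x + y)) k :=
  (torusFourier_translate hg hp y k).symm

/-- The projection of the real line onto `[0, T']`. -/
noncomputable def clampTime (T' r : ℝ) : ℝ := max 0 (min r T')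

theorem continuous_clampTime (T' : ℝ) : Continuous (clampTime T') := by
  unfold clampTime; fun_prop

theorem clamp_mem {T T' : ℝ} (h0 : 0 ≤ T') (hT : T' < T) (r : ℝ) : clampTime T' r ∈ Ico 0 T :=
  ⟨le_max_left _ _, max_lt (h0.trans_lt hT) ((min_le_right _ _).trans_lt hT)⟩

theorem clamp_eq {T' r : ℝ} (hr : r ∈ Icc 0 T') : clampTime T' r = r := by
  rw [clampTime, min_eq_left hr.2, max_eq_right hr.1]

attribute [irreducible] clampTime

/-- The vector field of the transported modes, frozen outside `[0, T']`. -/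
noncomputable def flowSource (T T' : ℝ) (f : ℝ → Eucl d → Eucl d → ℝ) (α : Fin d → ℕ) (t₀ : ℝ)
    (k : Fin d → ℤ) (r : ℝ) (v : Eucl d) : ℂ :=
  torusFourier (fun x => source (Ico 0 T) f α (clampTime T' r,
    x + (1 - contraction t₀ (clampTime T' r)) • v, contraction t₀ (clampTime T' r) • v)) k

theorem uniqueDiffOn_Ico_zero (T : ℝ) : UniqueDiffOn ℝ (Ico (0 : ℝ) T) := uniqueDiffOn_Ico 0 T

theorem continuous_flowSource_aux (hsol : IsVlasovSolution (Ico 0 T) u f) {T' : ℝ} (h0 : 0 ≤ T')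
    (hT : T' < T) (α : Fin d → ℕ) (t₀ : ℝ) :
    Continuous fun p : (ℝ × Eucl d) × Eucl d => source (Ico 0 T) f α (clampTime T' p.1.1,
      p.2 + (1 - contraction t₀ (clampTime T' p.1.1)) • p.1.2,
      contraction t₀ (clampTime T' p.1.1) • p.1.2) := by
  have hc := continuous_contraction t₀
  refine (hsol.continuousOn_source (uniqueDiffOn_Ico_zero T) α).comp_continuous ?_
    fun p => mk_mem_prod (clamp_mem h0 hT p.1.1) (mem_univ _)
  have h1 : Continuous fun p : (ℝ × Eucl d) × Eucl d => clampTime T' p.1.1 :=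
    (continuous_clampTime T').comp (by fun_prop)
  have h2 : Continuous fun p : (ℝ × Eucl d) × Eucl d => contraction t₀ (clampTime T' p.1.1) :=
    hc.comp h1
  fun_prop

theorem continuous_flowSource (hsol : IsVlasovSolution (Ico 0 T) u f) {T' : ℝ} (h0 : 0 ≤ T')
    (hT : T' < T) (α : Fin d → ℕ) (t₀ : ℝ) (k : Fin d → ℤ) :
    Continuous fun p : ℝ × Eucl d => flowSource T T' f α t₀ k p.1 p.2 :=
  continuous_torusFourier (continuous_flowSource_aux hsol h0 hT α t₀) k

/-- Along the characteristic, the displacement in `x` does not depend on `x`, so on a single mode it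
acts as multiplication by a character. -/
theorem flowSource_eq (hsol : IsVlasovSolution (Ico 0 T) u f)
    (hf : IsKinGevreyCurve (Ico 0 T) lam σ M s f) (hu : IsFluidGevreyCurve (Ico 0 T) lam σ s u)
    {T' : ℝ} (hT : T' < T) (α : Fin d → ℕ) (t₀ : ℝ) (k : Fin d → ℤ) {r : ℝ}
    (hr : r ∈ Icc 0 T') :
    flowSource T T' f α t₀ k r = flowMode t₀ r k (sourceMode α (f r) (u r) k) := by
  have hrI : r ∈ Ico 0 T := ⟨hr.1, hr.2.trans_lt hT⟩
  have hI := uniqueDiffOn_Ico_zero T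
  ext v
  rw [flowSource, clamp_eq hr, flowMode, ← torusFourier_source hsol hI hrI (hf.mem r hrI).smooth
    (hu.mem r hrI).smooth.continuous α k, flowMode_eq_torusFourier
    (continuous_source_slice hsol hI hrI α _)
    (periodic_source hsol hI hrI (hf.mem r hrI).periodic (hu.mem r hrI).periodic α _)]

/-- Duhamel's formula for a fixed velocity: the `C¹` solution is integrated along the
characteristics before taking the Fourier coefficient. -/
theorem flowMode_vMode_sub_eq (hsol : IsVlasovSolution (Ico 0 T) u f)
    (hf : IsKinGevreyCurve (Ico 0 T) lam σ M s f)
    {T' : ℝ} (h0 : 0 ≤ T') (hT : T' < T) (α : Fin d → ℕ) {t₀ τ : ℝ} (ht₀ : t₀ ∈ Icc 0 T')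
    (hτ : τ ∈ Icc 0 T') (k : Fin d → ℤ) (v : Eucl d) :
    flowMode t₀ τ k (vMode α (f τ) k) v - vMode α (f t₀) k v =
      ∫ r in t₀..τ, flowSource T T' f α t₀ k r v := by
  have hsub := uIcc_subset_of_Icc ht₀ hτ
  have hII : ∀ r ∈ uIcc t₀ τ, r ∈ Ico 0 T := fun r hr => ⟨(hsub hr).1, (hsub hr).2.trans_lt hT⟩
  have hvc : ∀ r ∈ uIcc t₀ τ, Continuous (Function.uncurry (vPowMul α (f r))) := fun r hr =>
    continuous_vPowMul (hf.mem r (hII r hr)).continuous_uncurry α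
  have key := torusFourier_sub_eq_integral (a := t₀) (b := τ)
    (γ := fun r x => vPowMul α (f r) (x + (1 - contraction t₀ r) • v) (contraction t₀ r • v))
    (γ' := fun r x => source (Ico 0 T) f α (clampTime T' r,
      x + (1 - contraction t₀ (clampTime T' r)) • v, contraction t₀ (clampTime T' r) • v))
    (fun x r hr => ?_) (fun r hr => ?_) ?_ k
  · have e : ∀ r ∈ uIcc t₀ τ, flowMode t₀ r k (vMode α (f r) k) v = torusFourier
        (fun x => vPowMul α (f r) (x + (1 - contraction t₀ r) • v) (contraction t₀ r • v)) k := by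
      intro r hr
      rw [flowMode, vMode, flowMode_eq_torusFourier]
      · exact (hvc r hr).comp (by fun_prop : Continuous fun x : Eucl d => (x, contraction t₀ r • v))
      · intro x i
        simp only [vPowMul]
        have e : f r (x + EuclideanSpace.single i (2 * Real.pi)) (contraction t₀ r • v) =
            f r x (contraction t₀ r • v) := (hf.mem r (hII r hr)).periodic _ x i
        rw [e]
    rw [← e τ right_mem_uIcc, ← e t₀ left_mem_uIcc, flowMode_self] at key
    exact key
  · rw [clamp_eq (hsub hr)]
    exact (hsol.hasDerivWithinAt_characteristic α t₀ (hII r hr) x v).mono hII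
  · exact (hvc r hr).comp (by fun_prop : Continuous fun x : Eucl d =>
      (x + (1 - contraction t₀ r) • v, contraction t₀ r • v))
  · have h := Continuous.comp (continuous_flowSource_aux hsol h0 hT α t₀)
      (f := fun p : ℝ × Eucl d => ((p.1, v), p.2)) (by fun_prop)
    simp only [Function.comp_def] at h
    exact h

/-- Both the flow and the source vary with `r`. Joint continuity of the source gives convergence at
every `v`. The norms converge because the flow multiplies them by a Jacobian tending to 1 and the
source is continuous in `L²`. Pointwise and norm convergence together yield strong convergence. -/
theorem tendsto_flowMode_sourceMode (hsol : IsVlasovSolution (Ico 0 T) u f)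
    (hf : IsKinGevreyCurve (Ico 0 T) lam σ M s f) (hu : IsFluidGevreyCurve (Ico 0 T) lam σ s u)
    (hσ : 1 ≤ σ) (hσd : (d : ℝ) / 2 < σ) (hl : ∀ t ∈ Ico 0 T, 0 ≤ lam t)
    (hlc : ContinuousOn lam (Ico 0 T)) {α : Fin d → ℕ} (hα : α ∈ multiIndices d M)
    {t₀ : ℝ} (ht₀ : t₀ ∈ Ico 0 T) (k : Fin d → ℤ) :
    Tendsto (fun r => eLpNorm (flowMode t₀ r k (sourceMode α (f r) (u r) k) -
      sourceMode α (f t₀) (u t₀) k) 2 volume) (𝓝[Ico 0 T] t₀) (𝓝 0) := by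
  have hm : ∀ r ∈ Ico 0 T, MemLp (sourceMode α (f r) (u r) k) 2 volume := fun r hr =>
    memLp_sourceMode (hf.mem r hr) (hu.mem r hr) (hl r hr) hσ hσd hα k
  -- Times are frozen outside `[0, T']` with `t₀ < T' < T`, so that the integrand is continuous on
  -- the whole line while agreeing with the true one near `t₀`.
  obtain ⟨T', h1, h2⟩ := exists_between ht₀.2
  have h0 : 0 ≤ T' := ht₀.1.trans h1.le
  have hnear : ∀ᶠ r in 𝓝[Ico 0 T] t₀, r ∈ Icc 0 T' := by
    filter_upwards [self_mem_nhdsWithin, nhdsWithin_le_nhds (Iio_mem_nhds h1)] with r hr hr'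
    exact ⟨hr.1, le_of_lt hr'⟩
  refine tendsto_eLpNorm_sub_of_ae_of_norm ?_ (hm t₀ ht₀) (ae_of_all _ fun v => ?_) ?_
  · filter_upwards [self_mem_nhdsWithin] with r hr
    exact memLp_flowMode t₀ r k (hm r hr)
  · have hc := Continuous.comp (continuous_flowSource hsol h0 h2 α t₀ k)
      (f := fun r : ℝ => (r, v)) (by fun_prop)
    simp only [Function.comp_def] at hc
    have e0 : flowSource T T' f α t₀ k t₀ v = sourceMode α (f t₀) (u t₀) k v := by
      rw [flowSource_eq hsol hf hu h2 α t₀ k ⟨ht₀.1, h1.le⟩, flowMode_self]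
    rw [← e0]
    refine ((hc.tendsto t₀).mono_left nhdsWithin_le_nhds).congr' ?_
    filter_upwards [hnear] with r hr
    rw [flowSource_eq hsol hf hu h2 α t₀ k hr]
  · have hn : Tendsto (fun r => eLpNorm (sourceMode α (f r) (u r) k) 2 volume) (𝓝[Ico 0 T] t₀)
        (𝓝 (eLpNorm (sourceMode α (f t₀) (u t₀) k) 2 volume)) := by
      have hd := tendsto_sourceMode hf hu hσ hσd ht₀ hl (hlc t₀ ht₀) hα k
      have up := hd.const_add (eLpNorm (sourceMode α (f t₀) (u t₀) k) 2 volume)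
      have lo := ENNReal.Tendsto.sub (tendsto_const_nhds
        (x := eLpNorm (sourceMode α (f t₀) (u t₀) k) 2 volume) (f := 𝓝[Ico 0 T] t₀)) hd
        (Or.inl (hm t₀ ht₀).2.ne)
      rw [add_zero] at up
      rw [tsub_zero] at lo
      refine tendsto_of_tendsto_of_tendsto_of_le_of_le' lo up ?_ ?_
      · filter_upwards [self_mem_nhdsWithin] with r hr
        rw [tsub_le_iff_right]
        have := eLpNorm_add_le (hm r hr).1 ((hm t₀ ht₀).sub (hm r hr)).1 (p := 2) (by norm_num)
        rw [add_sub_cancel, eLpNorm_sub_comm] at this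
        exact this
      · filter_upwards [self_mem_nhdsWithin] with r hr
        have := eLpNorm_add_le (hm t₀ ht₀).1 ((hm r hr).sub (hm t₀ ht₀)).1 (p := 2) (by norm_num)
        rwa [add_sub_cancel] at this
    simp only [eLpNorm_flowMode]
    have hcc : Tendsto (fun r => ENNReal.ofReal ((contraction t₀ r ^ d)⁻¹) ^ (1 / 2 : ℝ))
        (𝓝[Ico 0 T] t₀) (𝓝 1) := by
      have hc1 : Continuous fun r => (contraction t₀ r ^ d)⁻¹ :=
        ((continuous_contraction t₀).pow d).inv₀ fun r => (pow_pos (contraction_pos t₀ r) d).ne'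
      have := ((ENNReal.tendsto_ofReal (hc1.tendsto t₀)).mono_left
        (nhdsWithin_le_nhds (s := Ico 0 T))).ennrpow_const (1 / 2 : ℝ)
      simpa using this
    have := ENNReal.Tendsto.mul hcc (Or.inl one_ne_zero) hn (Or.inr (by simp))
    simpa using this

/-- The transported modes are `L²`-differentiable in time. -/
theorem eventually_flowMode_sub_le (hsol : IsVlasovSolution (Ico 0 T) u f)
    (hf : IsKinGevreyCurve (Ico 0 T) lam σ M s f) (hu : IsFluidGevreyCurve (Ico 0 T) lam σ s u)
    (hσ : 1 ≤ σ) (hσd : (d : ℝ) / 2 < σ) (hl : ∀ t ∈ Ico 0 T, 0 ≤ lam t)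
    (hlc : ContinuousOn lam (Ico 0 T)) {α : Fin d → ℕ} (hα : α ∈ multiIndices d M)
    {t₀ : ℝ} (ht₀ : t₀ ∈ Ico 0 T) (k : Fin d → ℤ) {η : ℝ} (hη : 0 < η) :
    ∀ᶠ τ in 𝓝[Ico 0 T] t₀,
      eLpNorm (fun v => flowMode t₀ τ k (vMode α (f τ) k) v - vMode α (f t₀) k v -
        ((τ - t₀ : ℝ) : ℂ) * sourceMode α (f t₀) (u t₀) k v) 2 volume ≤
          ENNReal.ofReal (η * |τ - t₀|) := by
  obtain ⟨T', h1, h2⟩ := exists_between ht₀.2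
  have h0 : 0 ≤ T' := ht₀.1.trans h1.le
  have hlim := tendsto_flowMode_sourceMode hsol hf hu hσ hσd hl hlc hα ht₀ k
  have hev : ∀ᶠ r in 𝓝[Ico 0 T] t₀, eLpNorm (flowMode t₀ r k (sourceMode α (f r) (u r) k) -
      sourceMode α (f t₀) (u t₀) k) 2 volume ≤ ENNReal.ofReal η :=
    hlim.eventually_le_const (ENNReal.ofReal_pos.2 hη)
  obtain ⟨ε, hε, hball⟩ := Metric.mem_nhdsWithin_iff.1 hev
  have hcont := continuous_flowSource hsol h0 h2 α t₀ k
  have hs0 : Measurable (sourceMode α (f t₀) (u t₀) k) := by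
    have e0 : sourceMode α (f t₀) (u t₀) k = flowSource T T' f α t₀ k t₀ := by
      rw [flowSource_eq hsol hf hu h2 α t₀ k ⟨ht₀.1, h1.le⟩, flowMode_self]
    rw [e0]
    exact (hcont.comp (by fun_prop : Continuous fun v : Eucl d => (t₀, v))).measurable
  filter_upwards [self_mem_nhdsWithin, nhdsWithin_le_nhds (Iio_mem_nhds h1),
    nhdsWithin_le_nhds (Metric.ball_mem_nhds t₀ hε)] with τ hτ hτ' hτε
  have ht₀' : t₀ ∈ Icc 0 T' := ⟨ht₀.1, h1.le⟩
  have hτ'' : τ ∈ Icc 0 T' := ⟨hτ.1, le_of_lt hτ'⟩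
  have hsub := uIcc_subset_of_Icc ht₀' hτ''
  rw [mul_comm, ENNReal.ofReal_mul (abs_nonneg _)]
  refine eLpNorm_sub_sub_le (S := flowSource T T' f α t₀ k)
    (fun v => flowMode_vMode_sub_eq hsol hf h0 h2 α ht₀' hτ'' k v) (fun v => ?_)
    hcont.measurable hs0 fun r hr => ?_
  · exact (hcont.comp (by fun_prop : Continuous fun r : ℝ => (r, v))).intervalIntegrable _ _
  · rw [flowSource_eq hsol hf hu h2 α t₀ k (hsub hr)]
    refine hball ⟨?_, (hsub hr).1, (hsub hr).2.trans_lt h2⟩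
    exact (convex_ball t₀ ε).ordConnected.uIcc_subset (Metric.mem_ball_self hε) hτε hr

end VlasovGevrey

/-! ### The truncated weight transported by the free flow -/

namespace VlasovGevrey

variable {d : ℕ}

theorem contDiff_cutoff : ContDiff ℝ 1 cutoff := by
  rw [contDiff_one_iff_deriv]
  refine ⟨fun y => (hasDerivAt_cutoff y).differentiableAt, ?_⟩
  have : deriv cutoff = fun y => -(2 * max 0 (1 - y)) := funext fun y => (hasDerivAt_cutoff y).deriv
  rw [this]; fun_prop

theorem contDiff_bracket (k : Fin d → ℤ) : ContDiff ℝ 1 (bracket (d := d) k) := by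
  unfold bracket
  refine ContDiff.sqrt (contDiff_const.add (contDiff_norm_sq ℝ)) fun η => ?_
  have : 0 ≤ ∑ i, (k i : ℝ) ^ 2 := by positivity
  positivity

/-- The point `k + e^{τ - t₀} (η - k)` reached by the free characteristics in frequency. -/
noncomputable def flowPoint (t₀ τ : ℝ) (k : Fin d → ℤ) (η : Eucl d) : Eucl d :=
  (contraction t₀ τ)⁻¹ • (η - (1 - contraction t₀ τ) • intVec k)

theorem flowPoint_self (t₀ : ℝ) (k : Fin d → ℤ) (η : Eucl d) : flowPoint t₀ t₀ k η = η := by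
  simp [flowPoint]

theorem contDiff_contraction (t₀ : ℝ) : ContDiff ℝ 1 (contraction t₀) := by
  unfold contraction; fun_prop

theorem contDiff_flowPoint (t₀ : ℝ) (k : Fin d → ℤ) :
    ContDiff ℝ 1 fun p : ℝ × Eucl d => flowPoint t₀ p.1 k p.2 := by
  unfold flowPoint
  have hc : ContDiff ℝ 1 fun p : ℝ × Eucl d => contraction t₀ p.1 :=
    (contDiff_contraction t₀).comp contDiff_fst
  exact (hc.inv fun p => (contraction_pos _ _).ne').smul
    (contDiff_snd.sub ((contDiff_const.sub hc).smul contDiff_const))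

theorem hasDerivAt_contraction_self (t₀ : ℝ) : HasDerivAt (contraction t₀) (-1) t₀ := by
  have h : HasDerivAt (contraction t₀) _ t₀ := (((hasDerivAt_id t₀).sub_const t₀).neg).exp
  exact h.congr_deriv (by simp)

theorem flowPoint_eq (t₀ τ : ℝ) (k : Fin d → ℤ) (η : Eucl d) :
    flowPoint t₀ τ k η = intVec k + (contraction t₀ τ)⁻¹ • (η - intVec k) := by
  have h := (contraction_pos t₀ τ).ne'
  rw [flowPoint]
  have e : η - (1 - contraction t₀ τ) • intVec k =
      (η - intVec k) + contraction t₀ τ • intVec k := by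
    rw [sub_smul, one_smul]; abel
  rw [e, smul_add, smul_smul, inv_mul_cancel₀ h, one_smul, add_comm]

theorem hasDerivAt_flowPoint (t₀ : ℝ) (k : Fin d → ℤ) (η : Eucl d) :
    HasDerivAt (fun τ => flowPoint t₀ τ k η) (η - intVec k) t₀ := by
  simp only [flowPoint_eq]
  have h := ((hasDerivAt_contraction_self t₀).inv (contraction_pos t₀ t₀).ne').smul_const
    (η - intVec k)
  simpa using h.const_add (intVec k)

theorem hasDerivAt_bracket_flowPoint (t₀ : ℝ) (k : Fin d → ℤ) (η : Eucl d) :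
    HasDerivAt (fun τ => bracket k (flowPoint t₀ τ k η))
      (inner ℝ η (η - intVec k) / bracket k η) t₀ := by
  have h1 := (hasDerivAt_flowPoint t₀ k η).norm_sq
  have h2 := (h1.const_add (1 + ∑ i, (k i : ℝ) ^ 2)).sqrt (by
    have : 0 ≤ ∑ i, (k i : ℝ) ^ 2 := by positivity
    positivity)
  rw [flowPoint_self] at h2
  refine h2.congr_deriv ?_
  have : bracket k η = Real.sqrt (1 + ∑ i, (k i : ℝ) ^ 2 + ‖η‖ ^ 2) := rfl
  rw [← this]
  have := bracket_pos k η
  field_simp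

/-- The squared weight transported along the free characteristics. -/
noncomputable def flowWeight (σ s ε t₀ : ℝ) (k : Fin d → ℤ) (τ μ : ℝ) (η : Eucl d) : ℝ :=
  contraction t₀ τ ^ d * cutWeight μ σ s ε (bracket k (flowPoint t₀ τ k η)) ^ 2

theorem contDiff_flowWeight (σ s ε t₀ : ℝ) (k : Fin d → ℤ) :
    ContDiff ℝ 1 fun p : ℝ × ℝ × Eucl d => flowWeight σ s ε t₀ k p.1 p.2.1 p.2.2 := by
  unfold flowWeight cutWeight weight
  have hc : ContDiff ℝ 1 fun p : ℝ × ℝ × Eucl d => contraction t₀ p.1 :=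
    (contDiff_contraction t₀).comp contDiff_fst
  have hb : ContDiff ℝ 1 fun p : ℝ × ℝ × Eucl d => bracket k (flowPoint t₀ p.1 k p.2.2) :=
    (contDiff_bracket k).comp ((contDiff_flowPoint t₀ k).comp
      (contDiff_fst.prodMk (contDiff_snd.comp contDiff_snd)))
  have hne : ∀ p : ℝ × ℝ × Eucl d, bracket k (flowPoint t₀ p.1 k p.2.2) ≠ 0 := fun p =>
    (bracket_pos _ _).ne'
  have hμ : ContDiff ℝ 1 fun p : ℝ × ℝ × Eucl d => p.2.1 := contDiff_fst.comp contDiff_snd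
  refine (hc.pow d).mul (ContDiff.pow (ContDiff.mul (ContDiff.mul ?_ ?_) ?_) 2)
  · exact hb.rpow_const_of_ne hne
  · exact (hμ.mul (hb.rpow_const_of_ne hne)).exp
  · exact contDiff_cutoff.comp (contDiff_const.mul (hb.pow 2))

theorem cutWeight_eq_zero {lam σ s ε ξ : ℝ} (h : 1 ≤ ε * ξ ^ 2) : cutWeight lam σ s ε ξ = 0 := by
  rw [cutWeight, cutoff_eq_zero h, mul_zero]

/-- The truncated weight vanishes once the bracket reaches `ε^{-1/2}`, and for `|τ - t₀| ≤ 1` the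
flow shrinks `η - k` by at most a factor `e`; hence the radius. -/
theorem exists_flowWeight_eq_zero {σ s ε : ℝ} (hε : 0 < ε) (t₀ : ℝ) (k : Fin d → ℤ) :
    ∃ R : ℝ, ∀ τ μ : ℝ, |τ - t₀| ≤ 1 → ∀ η : Eucl d, R < ‖η‖ → flowWeight σ s ε t₀ k τ μ η = 0 := by
  refine ⟨‖intVec k‖ + Real.exp 1 * ((Real.sqrt ε)⁻¹ + ‖intVec k‖), fun τ μ hτ η hη => ?_⟩
  have hse : 0 < Real.sqrt ε := Real.sqrt_pos.2 hε
  have h1 : Real.exp (-1) ≤ (contraction t₀ τ)⁻¹ := by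
    rw [contraction, ← Real.exp_neg, neg_neg]
    exact Real.exp_le_exp.2 (abs_le.1 hτ).1
  have h2 : ‖η‖ - ‖intVec k‖ ≤ ‖η - intVec k‖ := norm_sub_norm_le _ _
  have h3 : Real.exp (-1) * (‖η‖ - ‖intVec k‖) - ‖intVec k‖ ≤ ‖flowPoint t₀ τ k η‖ := by
    rw [flowPoint_eq]
    have a1 := norm_sub_le (intVec k + (contraction t₀ τ)⁻¹ • (η - intVec k)) (intVec k)
    rw [add_sub_cancel_left, norm_smul, Real.norm_of_nonneg (inv_pos.2 (contraction_pos _ _)).le] at a1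
    have a2 : Real.exp (-1) * (‖η‖ - ‖intVec k‖) ≤ (contraction t₀ τ)⁻¹ * ‖η - intVec k‖ := by
      refine mul_le_mul h1 h2 ?_ (inv_pos.2 (contraction_pos _ _)).le
      have : 0 ≤ Real.exp 1 * ((Real.sqrt ε)⁻¹ + ‖intVec k‖) := by positivity
      linarith
    linarith
  have h4 : (Real.sqrt ε)⁻¹ + ‖intVec k‖ ≤ Real.exp (-1) * (‖η‖ - ‖intVec k‖) := by
    rw [Real.exp_neg, ← div_eq_inv_mul, le_div_iff₀ (Real.exp_pos 1)]
    linarith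
  have h5 : (Real.sqrt ε)⁻¹ ≤ bracket k (flowPoint t₀ τ k η) :=
    le_trans (by linarith) (norm_le_bracket k _)
  have h6 : 1 ≤ ε * bracket k (flowPoint t₀ τ k η) ^ 2 := by
    calc (1 : ℝ) = ε * ((Real.sqrt ε)⁻¹) ^ 2 := by
          rw [inv_pow, Real.sq_sqrt hε.le, mul_inv_cancel₀ hε.ne']
      _ ≤ _ := by gcongr
  rw [flowWeight, cutWeight_eq_zero h6]
  ring

/-- Uniform bound and Lipschitz estimate for the transported weight. -/
theorem exists_flowWeight_bound {σ s ε : ℝ} (hε : 0 < ε) (t₀ μ₀ : ℝ) (k : Fin d → ℤ) :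
    ∃ B : ℝ, 0 ≤ B ∧ ∀ τ μ : ℝ, |τ - t₀| ≤ 1 → |μ - μ₀| ≤ 1 → ∀ η : Eucl d,
      |flowWeight σ s ε t₀ k τ μ η| ≤ B ∧
      |flowWeight σ s ε t₀ k τ μ η - flowWeight σ s ε t₀ k t₀ μ₀ η| ≤
        B * (|τ - t₀| + |μ - μ₀|) := by
  obtain ⟨R, hR⟩ := exists_flowWeight_eq_zero (σ := σ) (s := s) hε t₀ k
  -- On this compact convex set a `C¹` function is bounded and Lipschitz; for `η` outside the ball
  -- both values vanish.
  set K : Set (ℝ × ℝ × Eucl d) :=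
    Metric.closedBall t₀ 1 ×ˢ Metric.closedBall μ₀ 1 ×ˢ Metric.closedBall 0 R with hK
  have hKc : IsCompact K := (isCompact_closedBall _ _).prod
    ((isCompact_closedBall _ _).prod (isCompact_closedBall _ _))
  have hKx : Convex ℝ K := (convex_closedBall _ _).prod
    ((convex_closedBall _ _).prod (convex_closedBall _ _))
  have hG := contDiff_flowWeight (d := d) σ s ε t₀ k
  obtain ⟨L, hL⟩ := hG.contDiffOn.exists_lipschitzOnWith (s := K) one_ne_zero hKx hKc
  obtain ⟨B₀, hB₀⟩ := hKc.exists_bound_of_continuousOn hG.continuous.continuousOn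
  refine ⟨max 0 B₀ + L, by positivity, fun τ μ hτ hμ η => ?_⟩
  by_cases hη : ‖η‖ ≤ R
  · have m1 : ((τ, μ, η) : ℝ × ℝ × Eucl d) ∈ K :=
      ⟨by simpa [Real.dist_eq] using hτ, by simpa [Real.dist_eq] using hμ, by simpa using hη⟩
    have m2 : ((t₀, μ₀, η) : ℝ × ℝ × Eucl d) ∈ K := ⟨by simp, by simp, by simpa using hη⟩
    constructor
    · have := hB₀ _ m1
      rw [Real.norm_eq_abs] at this
      exact this.trans ((le_max_right 0 B₀).trans (le_add_of_nonneg_right L.2))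
    · have h1 := hL.dist_le_mul _ m1 _ m2
      rw [Real.dist_eq] at h1
      refine h1.trans ?_
      have h2 : dist ((τ, μ, η) : ℝ × ℝ × Eucl d) (t₀, μ₀, η) ≤ |τ - t₀| + |μ - μ₀| := by
        rw [Prod.dist_eq, Prod.dist_eq]
        simp only [dist_self, Real.dist_eq]
        refine max_le (le_add_of_nonneg_right (abs_nonneg _))
          (max_le (le_add_of_nonneg_left (abs_nonneg _)) (by positivity))
      refine mul_le_mul (le_add_of_nonneg_left (le_max_left _ _)) h2 dist_nonneg (by positivity)
  · rw [not_le] at hη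
    rw [hR τ μ hτ η hη, hR t₀ μ₀ (by simp) η hη]
    simp only [abs_zero, sub_zero]
    constructor <;> positivity

/-- The derivative at `t₀` of the transported weight. -/
noncomputable def weightRate (lam lam' σ s ε : ℝ) (k : Fin d → ℤ) (η : Eucl d) : ℝ :=
  -d * cutWeight lam σ s ε (bracket k η) ^ 2 +
    2 * lam' * (bracket k η ^ s * cutWeight lam σ s ε (bracket k η) ^ 2) +
    2 * cutWeight lam σ s ε (bracket k η) * (weight lam σ s (bracket k η) *
      cutRate lam σ s ε (bracket k η) * (inner ℝ η (η - intVec k) / bracket k η ^ 2))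

theorem hasDerivWithinAt_flowWeight {I : Set ℝ} {lam : ℝ → ℝ} {lam' t₀ : ℝ}
    (hlam : HasDerivWithinAt lam lam' I t₀) (σ s ε : ℝ) (k : Fin d → ℤ) (η : Eucl d) :
    HasDerivWithinAt (fun τ => flowWeight σ s ε t₀ k τ (lam τ) η)
      (weightRate (lam t₀) lam' σ s ε k η) I t₀ := by
  set ξ : ℝ → ℝ := fun τ => bracket k (flowPoint t₀ τ k η) with hξ
  have hξ0 : ξ t₀ = bracket k η := by simp [hξ, flowPoint_self]
  have hξd : HasDerivAt ξ (inner ℝ η (η - intVec k) / bracket k η) t₀ :=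
    hasDerivAt_bracket_flowPoint t₀ k η
  have hpos := bracket_pos k η
  -- The dependence on the radius is isolated in the factor `e^{(λ(τ) - λ(t₀))ξ^s}`, equal to 1 at
  -- `t₀`, so the one-sided derivative of `λ` and the motion of the bracket are handled separately.
  have e : (fun τ => flowWeight σ s ε t₀ k τ (lam τ) η) = fun τ => contraction t₀ τ ^ d *
      (cutWeight (lam t₀) σ s ε (ξ τ) * Real.exp ((lam τ - lam t₀) * ξ τ ^ s)) ^ 2 := by
    ext τ
    simp only [flowWeight, cutWeight, weight, hξ]
    have hexp : ∀ x : ℝ, Real.exp (lam τ * x) =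
        Real.exp (lam t₀ * x) * Real.exp ((lam τ - lam t₀) * x) := fun x => by
      rw [← Real.exp_add]; ring_nf
    rw [hexp]
    ring
  have h1 : HasDerivAt (fun τ => cutWeight (lam t₀) σ s ε (ξ τ))
      (weight (lam t₀) σ s (bracket k η) * cutRate (lam t₀) σ s ε (bracket k η) / bracket k η *
        (inner ℝ η (η - intVec k) / bracket k η)) t₀ := by
    have := hasDerivAt_cutWeight (lam t₀) σ s ε (ξ := ξ t₀) (by rw [hξ0]; exact hpos)
    have h := this.comp t₀ hξd
    rw [hξ0] at h
    exact h
  have hpow : HasDerivAt (fun τ => ξ τ ^ s)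
      (inner ℝ η (η - intVec k) / bracket k η * s * ξ t₀ ^ (s - 1)) t₀ :=
    hξd.rpow_const (Or.inl (by rw [hξ0]; exact hpos.ne'))
  have h2 : HasDerivWithinAt (fun τ => Real.exp ((lam τ - lam t₀) * ξ τ ^ s))
      (lam' * bracket k η ^ s) I t₀ := by
    have := ((hlam.sub_const (lam t₀)).mul hpow.hasDerivWithinAt).exp
    refine this.congr_deriv ?_
    simp [hξ0]
  have h3 := ((hasDerivAt_contraction_self t₀).pow d).hasDerivWithinAt (s := I)
  have h4 := h3.mul ((h1.hasDerivWithinAt.mul h2).pow 2)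
  rw [e]
  refine h4.congr_deriv ?_
  simp only [Pi.mul_apply, Pi.pow_apply, contraction_self, one_pow, hξ0, sub_self, zero_mul, Real.exp_zero, mul_one, one_mul,
    weightRate]
  field_simp
  ring

end VlasovGevrey

/-! ### The derivative of the truncated energy of a single mode -/

namespace VlasovGevrey

variable {d : ℕ} {T : ℝ} {u : ℝ → Eucl d → Eucl d} {f : ℝ → Eucl d → Eucl d → ℝ} {lam : ℝ → ℝ}
  {σ₁ σ s ε : ℝ} {M : ℕ}

theorem integral_comp_affine_real {c : ℝ} (hc : 0 < c) (y : Eucl d) (g : Eucl d → ℝ) :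
    ∫ v, g (c • v + y) = (c ^ d)⁻¹ * ∫ v, g v := by
  have := (affineHomeo hc.ne' y).measurableEmbedding.integral_map (μ := volume) g
  rw [map_affineHomeo hc, integral_smul_measure, ENNReal.toReal_ofReal (by positivity),
    smul_eq_mul] at this
  rw [this]; rfl

/-- Changing variables along the flow moves it from the mode to the weight. The energy can then be
differentiated although `f̂` is not assumed differentiable in `η`; the power of the contraction
factor in `flowWeight` is the net Jacobian. -/
theorem integral_flowWeight_mul (t₀ τ : ℝ) (μ : ℝ) (k : Fin d → ℤ) {h : Eucl d → ℂ}
    (hh : MemLp h 2 volume) :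
    ∫ η, flowWeight σ s ε t₀ k τ μ η * ‖velocityFourier (flowMode t₀ τ k h) η‖ ^ 2 =
      ∫ η, cutWeight μ σ s ε (bracket k η) ^ 2 * ‖velocityFourier h η‖ ^ 2 := by
  set c := contraction t₀ τ with hc
  have hc0 : 0 < c := contraction_pos t₀ τ
  set y : Eucl d := -(c⁻¹ • (1 - c) • intVec k)
  have hz : ∀ η, flowPoint t₀ τ k η = c⁻¹ • η + y := fun η => by
    rw [flowPoint, smul_sub, sub_eq_add_neg]
  have key := integral_comp_affine_real (inv_pos.2 hc0) y
    (fun η => cutWeight μ σ s ε (bracket k η) ^ 2 * ‖velocityFourier h η‖ ^ 2)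
  rw [inv_pow, inv_inv] at key
  calc _ = ∫ η, (c ^ d)⁻¹ * (cutWeight μ σ s ε (bracket k (c⁻¹ • η + y)) ^ 2 *
        ‖velocityFourier h (c⁻¹ • η + y)‖ ^ 2) := by
        refine integral_congr_ae ?_
        filter_upwards [velocityFourier_flowMode t₀ τ k hh] with η hη
        have e : (contraction t₀ τ)⁻¹ • (η - (1 - contraction t₀ τ) • intVec k) = c⁻¹ • η + y :=
          hz η
        rw [hη, e, flowWeight, hz, norm_mul, Complex.norm_real,
          Real.norm_of_nonneg (by positivity : (0 : ℝ) ≤ (contraction t₀ τ ^ d)⁻¹)]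
        rw [← hc, mul_pow, inv_pow]
        have := (pow_pos hc0 d).ne'
        field_simp
    _ = _ := by
        rw [integral_const_mul, key, ← mul_assoc, inv_mul_cancel₀ (pow_pos hc0 d).ne', one_mul]

theorem eventually_abs_sub_le {I : Set ℝ} {lam' t₀ : ℝ} (h : HasDerivWithinAt lam lam' I t₀) :
    ∀ᶠ τ in 𝓝[I] t₀, |lam τ - lam t₀| ≤ (|lam'| + 1) * |τ - t₀| := by
  have h1 := hasDerivWithinAt_iff_isLittleO.1 h
  filter_upwards [h1.def one_pos] with τ hτ
  rw [Real.norm_eq_abs, Real.norm_eq_abs, one_mul, smul_eq_mul] at hτ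
  have := abs_sub_abs_le_abs_sub (lam τ - lam t₀) ((τ - t₀) * lam')
  rw [abs_mul] at this
  nlinarith

/-- The energy is an integral of the transported weight against the square of the transported mode.
The weight is bounded and Lipschitz uniformly in `η`, the mode is differentiable in `L²`, and the
product rule for weighted norms applies. -/
theorem hasDerivWithinAt_modeEnergy (hsol : IsVlasovSolution (Ico 0 T) u f)
    (hf : IsKinGevreyCurve (Ico 0 T) lam σ₁ M s f) (hu : IsFluidGevreyCurve (Ico 0 T) lam σ₁ s u)
    (hσ : 1 ≤ σ₁) (hσd : (d : ℝ) / 2 < σ₁) (hl : ∀ t ∈ Ico 0 T, 0 ≤ lam t)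
    (hlc : ContinuousOn lam (Ico 0 T)) {α : Fin d → ℕ} (hα : α ∈ multiIndices d M)
    {t₀ lam' : ℝ} (ht₀ : t₀ ∈ Ico 0 T) (hlam : HasDerivWithinAt lam lam' (Ico 0 T) t₀)
    (hε : 0 < ε) (k : Fin d → ℤ) :
    HasDerivWithinAt (fun τ => ∫ η, cutWeight (lam τ) σ s ε (bracket k η) ^ 2 *
        ‖phaseFourier (vPowMul α (f τ)) k η‖ ^ 2)
      (∫ η, (weightRate (lam t₀) lam' σ s ε k η * ‖phaseFourier (vPowMul α (f t₀)) k η‖ ^ 2 +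
        cutWeight (lam t₀) σ s ε (bracket k η) ^ 2 *
          (2 * ((starRingEnd ℂ) (phaseFourier (vPowMul α (f t₀)) k η) *
            velocityFourier (sourceMode α (f t₀) (u t₀) k) η).re))) (Ico 0 T) t₀ := by
  have hm : ∀ r ∈ Ico 0 T, MemLp (vMode α (f r) k) 2 volume := fun r hr =>
    (hf.mem r hr).memLp_vMode hα k
  have hm0 := hm t₀ ht₀
  have hS := memLp_sourceMode (hf.mem t₀ ht₀) (hu.mem t₀ ht₀) (hl t₀ ht₀) hσ hσd hα k
  obtain ⟨B, hB0, hB⟩ := exists_flowWeight_bound (σ := σ) (s := s) hε t₀ (lam t₀) k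
  have hclose : ∀ᶠ τ in 𝓝[Ico 0 T] t₀, |τ - t₀| ≤ 1 := by
    refine nhdsWithin_le_nhds ?_
    filter_upwards [Metric.closedBall_mem_nhds t₀ one_pos] with τ hτ
    rwa [Metric.mem_closedBall, Real.dist_eq] at hτ
  have hlclose : ∀ᶠ τ in 𝓝[Ico 0 T] t₀, |lam τ - lam t₀| ≤ 1 := by
    filter_upwards [(hlc t₀ ht₀) (Metric.closedBall_mem_nhds (lam t₀) one_pos)] with τ hτ
    simpa [Real.dist_eq] using hτ
  have hLip := eventually_abs_sub_le hlam
  set B' := B * (1 + (|lam'| + 1)) with hB'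
  have hBB : B ≤ B' := le_mul_of_one_le_right hB0 (by linarith [abs_nonneg lam'])
  -- The Plancherel constant: the tolerance `η` in frequency is obtained from the tolerance `η / κ`
  -- in velocity.
  set κ : ℝ := ((2 * Real.pi) ^ d) ^ (1 / 2 : ℝ) with hκ
  have hκ0 : 0 < κ := by positivity
  have hKκ : ENNReal.ofReal ((2 * Real.pi) ^ d) ^ (1 / 2 : ℝ) = ENNReal.ofReal κ :=
    ENNReal.ofReal_rpow_of_pos (by positivity)
  have key := hasDerivWithinAt_integral_mul_norm_sq (μ := (volume : Measure (Eucl d)))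
    (I := Ico 0 T) (t₀ := t₀)
    (m := fun τ η => flowWeight σ s ε t₀ k τ (lam τ) η)
    (m' := weightRate (lam t₀) lam' σ s ε k)
    (F := fun τ => velocityFourier (flowMode t₀ τ k (vMode α (f τ) k)))
    (S₀ := velocityFourier (sourceMode α (f t₀) (u t₀) k)) (B := B')
    (fun τ => ?_) ?_ (fun η => ((hB t₀ (lam t₀) (by simp) (by simp) η).1).trans hBB) ?_
    (fun η => hasDerivWithinAt_flowWeight hlam σ s ε k η)
    (Eventually.of_forall fun τ => memLp_velocityFourier _) (memLp_velocityFourier _)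
    (memLp_velocityFourier _) (fun η hη => ?_)
  · simp only [flowMode_self] at key
    have e0 : ∀ η, flowWeight σ s ε t₀ k t₀ (lam t₀) η =
        cutWeight (lam t₀) σ s ε (bracket k η) ^ 2 := fun η => by
      rw [flowWeight, contraction_self, one_pow, one_mul, flowPoint_self]
    simp only [e0] at key
    refine key.congr (fun τ hτ => ?_) ?_
    · rw [phaseFourier_vPowMul, ← integral_flowWeight_mul t₀ τ (lam τ) k (hm τ hτ)]
    · rw [phaseFourier_vPowMul, ← integral_flowWeight_mul t₀ t₀ (lam t₀) k hm0]
  · exact ((contDiff_flowWeight σ s ε t₀ k).continuous.comp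
      (by fun_prop : Continuous fun η : Eucl d => (τ, lam τ, η))).measurable
  · filter_upwards [hclose, hlclose] with τ h1 h2 η
    exact ((hB τ (lam τ) h1 h2 η).1).trans hBB
  · filter_upwards [hclose, hlclose, hLip] with τ h1 h2 h3 η
    refine ((hB τ (lam τ) h1 h2 η).2).trans ?_
    rw [hB', mul_assoc]
    refine mul_le_mul_of_nonneg_left ?_ hB0
    linarith
  · filter_upwards [eventually_flowMode_sub_le hsol hf hu hσ hσd hl hlc hα ht₀ k
      (div_pos hη hκ0), self_mem_nhdsWithin] with τ h1 hτ
    have mF := memLp_flowMode t₀ τ k (hm τ hτ)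
    have mS := hS.const_mul ((τ - t₀ : ℝ) : ℂ)
    have e : velocityFourier (fun v => flowMode t₀ τ k (vMode α (f τ) k) v - vMode α (f t₀) k v -
        ((τ - t₀ : ℝ) : ℂ) * sourceMode α (f t₀) (u t₀) k v) =ᵐ[volume] fun η =>
        velocityFourier (flowMode t₀ τ k (vMode α (f τ) k)) η -
          velocityFourier (flowMode t₀ t₀ k (vMode α (f t₀) k)) η -
          ((τ - t₀ : ℝ) : ℂ) * velocityFourier (sourceMode α (f t₀) (u t₀) k) η := by
      filter_upwards [velocityFourier_sub (mF.sub hm0) mS, velocityFourier_sub mF hm0,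
        velocityFourier_const_mul hS ((τ - t₀ : ℝ) : ℂ)] with η a1 a2 a3
      rw [flowMode_self]
      refine a1.trans ?_
      have a2' : velocityFourier (flowMode t₀ τ k (vMode α (f τ) k) - vMode α (f t₀) k) η = _ := a2
      rw [a2', a3]
    have e5 : eLpNorm (velocityFourier fun v => flowMode t₀ τ k (vMode α (f τ) k) v -
        vMode α (f t₀) k v - ((τ - t₀ : ℝ) : ℂ) * sourceMode α (f t₀) (u t₀) k v) 2 volume = _ :=
      eLpNorm_velocityFourier ((mF.sub hm0).sub mS)
    rw [← eLpNorm_congr_ae e, e5, hKκ]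
    calc _ ≤ ENNReal.ofReal κ * ENNReal.ofReal (η / κ * |τ - t₀|) := by
          gcongr
      _ = _ := by
          rw [← ENNReal.ofReal_mul hκ0.le]
          congr 1
          field_simp

/-- The quadratic part of the energy derivative, for a multi-index of length `N`. -/
noncomputable def energyRate (lam lam' σ s ε : ℝ) (N : ℕ) (k : Fin d → ℤ) (η : Eucl d) : ℝ :=
  (d - 2 * N) * cutWeight lam σ s ε (bracket k η) ^ 2 +
    2 * lam' * (bracket k η ^ s * cutWeight lam σ s ε (bracket k η) ^ 2) +
    2 * cutWeight lam σ s ε (bracket k η) * (weight lam σ s (bracket k η) *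
      cutRate lam σ s ε (bracket k η) * (inner ℝ η (η - intVec k) / bracket k η ^ 2))

theorem velocityFourier_sourceMode {lam : ℝ} {g : Eucl d → Eucl d → ℝ} {U : Eucl d → Eucl d}
    (hg : IsKinGevrey lam σ₁ M s g) (hU : IsFluidGevrey lam σ₁ s U) (hl : 0 ≤ lam) (hσ : 1 ≤ σ₁)
    (hσd : (d : ℝ) / 2 < σ₁) {α : Fin d → ℕ} (hα : α ∈ multiIndices d M) (k : Fin d → ℤ) :
    velocityFourier (sourceMode α g U k) =ᵐ[volume] fun η =>
      ((d : ℂ) - (∑ i, α i : ℕ)) * phaseFourier (vPowMul α g) k η -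
        ∑ j, velocityFourier (convMode α j g U k) η := by
  have mv := hg.memLp_vMode hα k
  have mc := fun j => (memLp_convMode hg hU hl hσ hσd hα j k).1
  filter_upwards [velocityFourier_sub (mv.const_mul ((d : ℂ) - (∑ i, α i : ℕ)))
    (memLp_finsetSum Finset.univ fun j _ => mc j),
    velocityFourier_const_mul mv ((d : ℂ) - (∑ i, α i : ℕ)),
    velocityFourier_sum Finset.univ fun j _ => mc j] with η h1 h2 h3
  have h1' : velocityFourier (sourceMode α g U k) η = _ := h1
  rw [h1', h2, h3]
  rfl

/-- The Jacobian contributes `-d`, twice the source coefficient contributes `2(d - |α|)`, which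
together give the `d - 2|α|` of `energyRate`. -/
theorem modeEnergy_integrand_eq {lam lam' : ℝ} {g : Eucl d → Eucl d → ℝ} {U : Eucl d → Eucl d}
    (hg : IsKinGevrey lam σ₁ M s g) (hU : IsFluidGevrey lam σ₁ s U) (hl : 0 ≤ lam) (hσ : 1 ≤ σ₁)
    (hσd : (d : ℝ) / 2 < σ₁) {α : Fin d → ℕ} (hα : α ∈ multiIndices d M) (k : Fin d → ℤ) :
    ∀ᵐ η, weightRate lam lam' σ s ε k η * ‖phaseFourier (vPowMul α g) k η‖ ^ 2 +
        cutWeight lam σ s ε (bracket k η) ^ 2 *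
          (2 * ((starRingEnd ℂ) (phaseFourier (vPowMul α g) k η) *
            velocityFourier (sourceMode α g U k) η).re) =
      energyRate lam lam' σ s ε (∑ i, α i) k η * ‖phaseFourier (vPowMul α g) k η‖ ^ 2 -
        ∑ j, 2 * ((cutWeight lam σ s ε (bracket k η) ^ 2 : ℝ) *
          (velocityFourier (convMode α j g U k) η *
            (starRingEnd ℂ) (phaseFourier (vPowMul α g) k η))).re := by
  filter_upwards [velocityFourier_sourceMode hg hU hl hσ hσd hα k] with η hη
  set z := phaseFourier (vPowMul α g) k η
  set A := cutWeight lam σ s ε (bracket k η)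
  have e1 : ((starRingEnd ℂ) z * velocityFourier (sourceMode α g U k) η).re =
      ((d : ℝ) - (∑ i, α i : ℕ)) * ‖z‖ ^ 2 -
        ∑ j, (velocityFourier (convMode α j g U k) η * (starRingEnd ℂ) z).re := by
    rw [hη, mul_sub, Complex.sub_re, Finset.mul_sum, Complex.re_sum]
    congr 1
    · have : (starRingEnd ℂ) z * (((d : ℂ) - (∑ i, α i : ℕ)) * z) =
          ((((d : ℝ) - (∑ i, α i : ℕ)) * ‖z‖ ^ 2 : ℝ) : ℂ) := by
        rw [mul_left_comm, Complex.conj_mul']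
        push_cast; ring
      rw [this, Complex.ofReal_re]
    · exact Finset.sum_congr rfl fun j _ => by rw [mul_comm]
  have e2 : ∑ j, 2 * ((A ^ 2 : ℝ) * (velocityFourier (convMode α j g U k) η *
      (starRingEnd ℂ) z)).re = 2 * A ^ 2 *
      ∑ j, (velocityFourier (convMode α j g U k) η * (starRingEnd ℂ) z).re := by
    rw [Finset.mul_sum]
    refine Finset.sum_congr rfl fun j _ => ?_
    rw [Complex.re_ofReal_mul]; ring
  rw [e1, e2, weightRate, energyRate]
  ring

end VlasovGevrey

/-! ### Sums over the lattice as integrals, and the exchange of two frequencies -/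

namespace VlasovGevrey

theorem integrable_slice {ι β E : Type*} [MeasurableSpace ι] [Countable ι]
    [MeasurableSingletonClass ι] [MeasurableSpace β]
    {ν : Measure β} [SFinite ν] [NormedAddCommGroup E] {F : ι × β → E}
    (hF : Integrable F (Measure.count.prod ν)) (i : ι) : Integrable (fun b => F (i, b)) ν :=
  Measure.ae_count_iff.1 hF.prod_right_ae i

section CountProduct

variable {ι β E : Type*} [Countable ι] [MeasurableSpace ι] [MeasurableSingletonClass ι]
  [MeasurableSpace β] {ν : Measure β} [SFinite ν] [NormedAddCommGroup E] [NormedSpace ℝ E]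
  [CompleteSpace E] {F : ι × β → E}

theorem integral_count_prod (hF : Integrable F (Measure.count.prod ν)) {S : Finset ι}
    (hS : ∀ i ∉ S, ∀ b, F (i, b) = 0) :
    ∫ p, F p ∂(Measure.count.prod ν) = ∑ i ∈ S, ∫ b, F (i, b) ∂ν := by
  rw [integral_prod _ hF, integral_countable hF.integral_prod_left]
  simp only [measureReal_def, Measure.count_singleton, ENNReal.toReal_one, one_smul]
  refine tsum_eq_sum fun i hi => ?_
  simp [hS i hi]

theorem integral_count_prod_symm (hF : Integrable F (Measure.count.prod ν)) :
    ∫ p, F p ∂(Measure.count.prod ν) = ∫ b, ∑' i, F (i, b) ∂ν := by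
  rw [integral_prod_symm _ hF]
  refine integral_congr_ae ?_
  filter_upwards [hF.prod_left_ae] with b hb
  rw [integral_countable hb]
  simp [measureReal_def]

theorem integrable_tsum_of_count_prod (hF : Integrable F (Measure.count.prod ν)) :
    Integrable (fun b => ∑' i, F (i, b)) ν := by
  refine hF.integral_prod_right.congr ?_
  filter_upwards [hF.prod_left_ae] with b hb
  rw [integral_countable hb]
  simp [measureReal_def]

end CountProduct

variable {d : ℕ}

/-- The exchange of the two frequencies. -/
def swapPair (p : (Fin d → ℤ) × (Fin d → ℤ) × Eucl d) : (Fin d → ℤ) × (Fin d → ℤ) × Eucl d :=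
  (p.2.1, p.1, p.2.2)

theorem measurePreserving_swapPair :
    MeasurePreserving (swapPair (d := d)) (pairMeasure d) (pairMeasure d) := by
  have h1 := (measurePreserving_prodAssoc (Measure.count : Measure (Fin d → ℤ))
    (Measure.count : Measure (Fin d → ℤ)) (volume : Measure (Eucl d)))
  have h2 : MeasurePreserving (Prod.map Prod.swap id)
      (((Measure.count : Measure (Fin d → ℤ)).prod (Measure.count : Measure (Fin d → ℤ))).prod
        (volume : Measure (Eucl d))) _ :=
    (Measure.measurePreserving_swap (μ := (Measure.count : Measure (Fin d → ℤ)))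
      (ν := (Measure.count : Measure (Fin d → ℤ)))).prod (MeasurePreserving.id volume)
  exact h1.comp (h2.comp (h1.symm _))

theorem integral_swapPair {E : Type*} [NormedAddCommGroup E] [NormedSpace ℝ E]
    (F : (Fin d → ℤ) × (Fin d → ℤ) × Eucl d → E) :
    ∫ p, F (swapPair p) ∂(pairMeasure d) = ∫ p, F p ∂(pairMeasure d) := by
  refine measurePreserving_swapPair.integral_comp' (f := ⟨⟨swapPair, swapPair, fun _ => rfl,
    fun _ => rfl⟩, ?_, ?_⟩) F
  all_goals exact measurePreserving_swapPair.measurable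

/-- Normalization of a trilinear symbol by the three multipliers. -/
noncomputable def normKer (lam σ s : ℝ) (m : (Fin d → ℤ) × (Fin d → ℤ) × Eucl d → ℂ)
    (p : (Fin d → ℤ) × (Fin d → ℤ) × Eucl d) : ℂ :=
  m p / (gevreyMul lam σ s (p.1 - p.2.1) 0 * gevreyMul lam σ s p.2.1 p.2.2 *
    gevreyMul lam σ s p.1 p.2.2)

/-- The multipliers in the kernel and in the three functions cancel. A product of bare Fourier
coefficients is thus written through functions known to be in `L²`. -/
theorem triForm_normKer (lam σ s : ℝ) (m : (Fin d → ℤ) × (Fin d → ℤ) × Eucl d → ℂ)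
    (U : Eucl d → Eucl d) (j : Fin d) (α β : Fin d → ℕ) (g : Eucl d → Eucl d → ℝ)
    (p : (Fin d → ℤ) × (Fin d → ℤ) × Eucl d) :
    triForm (normKer lam σ s m) (fluidFun lam σ s U j) (kinFun lam σ s α g) (kinFun lam σ s β g) p =
      m p * velCoeff U j (p.1 - p.2.1) * phaseFourier (vPowMul α g) p.2.1 p.2.2 *
        (starRingEnd ℂ) (phaseFourier (vPowMul β g) p.1 p.2.2) := by
  have h1 := gevreyMul_ne_zero lam σ s (p.1 - p.2.1) 0
  have h2 := gevreyMul_ne_zero lam σ s p.2.1 p.2.2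
  have h3 := gevreyMul_ne_zero lam σ s p.1 p.2.2
  simp only [triForm, normKer, fluidFun, fluidMode, kinFun, kinMode, velCoeff, map_mul,
    Complex.conj_ofReal]
  field_simp

theorem measurable_comp_snd {E : Type*} [MeasurableSpace E] {G : (Fin d → ℤ) × Eucl d → E}
    (hG : Measurable G) :
    Measurable fun p : (Fin d → ℤ) × (Fin d → ℤ) × Eucl d => G p.2 :=
  hG.comp measurable_snd

theorem measurable_comp_fst_snd {E : Type*} [MeasurableSpace E] {G : (Fin d → ℤ) × Eucl d → E}
    (hG : Measurable G) :
    Measurable fun p : (Fin d → ℤ) × (Fin d → ℤ) × Eucl d => G (p.1, p.2.2) :=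
  hG.comp (measurable_fst.prodMk (measurable_snd.comp measurable_snd))

theorem measurable_normKer (lam σ s : ℝ) {m : (Fin d → ℤ) × (Fin d → ℤ) × Eucl d → ℂ}
    (hm : Measurable m) : Measurable (normKer lam σ s m) := by
  have h : Measurable fun p : (Fin d → ℤ) × Eucl d => (gevreyMul lam σ s p.1 p.2 : ℂ) :=
    Complex.measurable_ofReal.comp (measurable_gevreyFun lam σ s)
  exact hm.div (((measurable_comp_fst_sub fun k => (gevreyMul lam σ s k 0 : ℂ)).mul
    (measurable_comp_snd h)).mul (measurable_comp_fst_snd h))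

theorem norm_normKer (lam σ s : ℝ) (m : (Fin d → ℤ) × (Fin d → ℤ) × Eucl d → ℂ)
    (p : (Fin d → ℤ) × (Fin d → ℤ) × Eucl d) :
    ‖normKer lam σ s m p‖ = ‖m p‖ / (gevreyMul lam σ s (p.1 - p.2.1) 0 *
      gevreyMul lam σ s p.2.1 p.2.2 * gevreyMul lam σ s p.1 p.2.2) := by
  have h1 := gevreyMul_pos lam σ s (p.1 - p.2.1) (0 : Eucl d)
  have h2 := gevreyMul_pos lam σ s p.2.1 p.2.2
  have h3 := gevreyMul_pos lam σ s p.1 p.2.2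
  rw [normKer, norm_div, norm_mul, norm_mul, Complex.norm_real, Complex.norm_real,
    Complex.norm_real, Real.norm_of_nonneg h1.le, Real.norm_of_nonneg h2.le,
    Real.norm_of_nonneg h3.le]

theorem velCoeff_neg (U : Eucl d → Eucl d) (j : Fin d) (k : Fin d → ℤ) :
    velCoeff U j (-k) = (starRingEnd ℂ) (velCoeff U j k) := torusFourier_neg _ k

/-- A trilinear form with an odd imaginary symbol, symmetric in the two frequencies, has vanishing
real part. -/
theorem re_integral_triForm_eq_zero (lam σ s : ℝ)
    {m : (Fin d → ℤ) × (Fin d → ℤ) × Eucl d → ℂ}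
    (hm : ∀ p, m (swapPair p) = -(starRingEnd ℂ) (m p))
    (U : Eucl d → Eucl d) (j : Fin d) (α : Fin d → ℕ) (g : Eucl d → Eucl d → ℝ) :
    (∫ p, triForm (normKer lam σ s m) (fluidFun lam σ s U j) (kinFun lam σ s α g)
      (kinFun lam σ s α g) p ∂(pairMeasure d)).re = 0 := by
  set F := triForm (normKer lam σ s m) (fluidFun lam σ s U j) (kinFun lam σ s α g)
    (kinFun lam σ s α g) with hF
  -- Since `u` is real, exchanging `k` and `l` conjugates `û_{k-l}`; the two modes of `g` exchange
  -- roles as well. The integrand is therefore minus its conjugate after a measure preserving change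
  -- of variables.
  have h1 : ∀ p, F (swapPair p) = -(starRingEnd ℂ) (F p) := by
    intro p
    rw [hF, triForm_normKer, triForm_normKer, hm]
    simp only [swapPair, map_mul, Complex.conj_conj]
    rw [← velCoeff_neg, neg_sub]
    ring
  have h2 := integral_swapPair F
  simp only [h1] at h2
  rw [integral_neg, integral_conj] at h2
  have h3 := congrArg Complex.re h2
  rw [Complex.neg_re, Complex.conj_re] at h3
  linarith

end VlasovGevrey

/-! ### The symbols of the transport term and their symmetrization -/

namespace VlasovGevrey

variable {d : ℕ}

/-- The truncated weight as a function on `ℤ^d × ℝ^d`. -/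
noncomputable def cutFun (lam σ s ε : ℝ) (p : (Fin d → ℤ) × Eucl d) : ℝ :=
  cutWeight lam σ s ε (bracket p.1 p.2)

theorem continuous_cutWeight_bracket (lam σ s ε : ℝ) (k : Fin d → ℤ) :
    Continuous fun η : Eucl d => cutWeight lam σ s ε (bracket k η) := by
  have h := continuous_gevreyMul lam σ s k
  have hb := continuous_bracket (d := d) k
  have hc := continuous_cutoff
  unfold cutWeight
  exact h.mul (hc.comp (continuous_const.mul (hb.pow 2)))

theorem measurable_cutFun (lam σ s ε : ℝ) : Measurable (cutFun (d := d) lam σ s ε) :=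
  measurable_of_slices fun k => (continuous_cutWeight_bracket lam σ s ε k).measurable

theorem cutFun_nonneg (lam σ s ε : ℝ) (p : (Fin d → ℤ) × Eucl d) : 0 ≤ cutFun lam σ s ε p :=
  cutWeight_nonneg (bracket_pos _ _)

theorem gevreyMul_le_gevreyMul {lam σ σ' s : ℝ} (h : σ ≤ σ') (k : Fin d → ℤ) (η : Eucl d) :
    gevreyMul lam σ s k η ≤ gevreyMul lam σ' s k η := by
  unfold gevreyMul
  gcongr
  exact one_le_bracket k η

theorem cutFun_le {lam σ σ' s ε : ℝ} (hε : 0 ≤ ε) (h : σ ≤ σ') (p : (Fin d → ℤ) × Eucl d) :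
    cutFun lam σ s ε p ≤ gevreyMul lam σ' s p.1 p.2 :=
  (cutWeight_le hε (bracket_pos _ _)).trans (gevreyMul_le_gevreyMul h p.1 p.2)

theorem exists_cutFun_le {lam σ s ε : ℝ} (hl : 0 ≤ lam) (hσ : 0 ≤ σ) (hs : 0 ≤ s) (hε : 0 < ε) :
    ∃ C : ℝ, 0 ≤ C ∧ ∀ p : (Fin d → ℤ) × Eucl d, cutFun lam σ s ε p ≤ C := by
  refine ⟨weight lam σ s (1 / ε + 1), (weight_pos (by positivity)).le, fun p => ?_⟩
  have hb := one_le_bracket p.1 p.2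
  rcases le_total 1 (ε * bracket p.1 p.2 ^ 2) with h | h
  · rw [cutFun, cutWeight_eq_zero h]
    exact (weight_pos (by positivity)).le
  · refine (cutWeight_le hε.le (bracket_pos _ _)).trans ?_
    have h1 : bracket p.1 p.2 ≤ 1 / ε + 1 := by
      have : bracket p.1 p.2 ≤ 1 / ε := by
        rw [le_div_iff₀ hε]; nlinarith
      linarith
    have := bracket_pos p.1 p.2
    unfold weight
    gcongr

/-- Only finitely many lattice frequencies survive the truncation, so the energy can be
differentiated mode by mode. -/
theorem exists_finset_cutFun_eq_zero {ε : ℝ} (hε : 0 < ε) :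
    ∃ S : Finset (Fin d → ℤ), ∀ k ∉ S, ∀ η : Eucl d, 1 ≤ ε * bracket k η ^ 2 := by
  -- Any exponent above `d` would do; summability is used only to see that the bracket tends to
  -- infinity.
  have h := (summable_bracket_rpow (d := d) (q := d + 1) (by linarith)).tendsto_cofinite_zero
  have hpos : 0 < ((1 / ε) ^ (1 / 2 : ℝ)) ^ (-(d + 1 : ℝ)) := by positivity
  have h2 := h.eventually (gt_mem_nhds hpos)
  rw [eventually_cofinite] at h2
  refine ⟨h2.toFinset, fun k hk η => ?_⟩
  simp only [Finite.mem_toFinset, mem_ofPred_eq, not_not] at hk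
  have hb := bracket_pos k (0 : Eucl d)
  have h3 : (1 / ε) ^ (1 / 2 : ℝ) ≤ bracket k 0 := by
    by_contra hlt
    rw [not_le] at hlt
    exact absurd hk (not_lt.2 (Real.rpow_le_rpow_of_nonpos hb hlt.le (by
      have : (0 : ℝ) ≤ d := Nat.cast_nonneg d
      linarith)))
  have h4 := h3.trans (bracket_zero_le k η)
  have h5 : ((1 / ε) ^ (1 / 2 : ℝ)) ^ 2 = 1 / ε := by
    rw [← Real.rpow_natCast, ← Real.rpow_mul (by positivity)]; norm_num
  have h6 : 1 / ε ≤ bracket k η ^ 2 := by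
    rw [← h5]; gcongr
  rw [div_le_iff₀ hε] at h6
  linarith

/-- The symbol of the transport term, before symmetrization. -/
noncomputable def fullSymbol (lam σ s ε : ℝ) (j : Fin d) (p : (Fin d → ℤ) × (Fin d → ℤ) × Eucl d) :
    ℂ := Complex.I * ((p.2.2 j * cutFun lam σ s ε (p.1, p.2.2) ^ 2 : ℝ) : ℂ)

/-- The symmetric part of `fullSymbol`. -/
noncomputable def symmSymbol (lam σ s ε : ℝ) (j : Fin d) (p : (Fin d → ℤ) × (Fin d → ℤ) × Eucl d) :
    ℂ := Complex.I * ((p.2.2 j * (cutFun lam σ s ε (p.1, p.2.2) * cutFun lam σ s ε p.2) : ℝ) : ℂ)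

/-- The commutator part of `fullSymbol`. -/
noncomputable def commSymbol (lam σ s ε : ℝ) (j : Fin d) (p : (Fin d → ℤ) × (Fin d → ℤ) × Eucl d) :
    ℂ := Complex.I * ((p.2.2 j * (cutFun lam σ s ε (p.1, p.2.2) *
      (cutFun lam σ s ε (p.1, p.2.2) - cutFun lam σ s ε p.2)) : ℝ) : ℂ)

/-- The symbol of the lower order term created by a derivative falling on `v^α`. -/
noncomputable def lowSymbol (lam σ s ε : ℝ) (n : ℕ) (p : (Fin d → ℤ) × (Fin d → ℤ) × Eucl d) :
    ℂ := ((n * cutFun lam σ s ε (p.1, p.2.2) ^ 2 : ℝ) : ℂ)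

theorem measurable_symbols (lam σ s ε : ℝ) (j : Fin d) (n : ℕ) :
    Measurable (fullSymbol (d := d) lam σ s ε j) ∧ Measurable (symmSymbol (d := d) lam σ s ε j) ∧
      Measurable (commSymbol (d := d) lam σ s ε j) ∧
      Measurable (lowSymbol (d := d) lam σ s ε n) := by
  have h1 := measurable_comp_fst_snd (measurable_cutFun (d := d) lam σ s ε)
  have h2 := measurable_comp_snd (measurable_cutFun (d := d) lam σ s ε)
  have h3 : Measurable fun p : (Fin d → ℤ) × (Fin d → ℤ) × Eucl d => p.2.2 j := by fun_prop
  exact ⟨(Complex.measurable_ofReal.comp (h3.mul (h1.pow_const 2))).const_mul _,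
    (Complex.measurable_ofReal.comp (h3.mul (h1.mul h2))).const_mul _,
    (Complex.measurable_ofReal.comp (h3.mul (h1.mul (h1.sub h2)))).const_mul _,
    Complex.measurable_ofReal.comp ((h1.pow_const 2).const_mul _)⟩

theorem inv_gevreyMul_le_decay {lam σ s r : ℝ} (hl : 0 ≤ lam) (hr : r ≤ σ) (k l : Fin d → ℤ) :
    1 / gevreyMul lam σ s (k - l) (0 : Eucl d) ≤ decay r k l := by
  have hb := one_le_bracket (k - l) (0 : Eucl d)
  have hb0 := bracket_pos (k - l) (0 : Eucl d)
  have hb1 := bracket_pos l (0 : Eucl d)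
  have h1 : bracket (k - l) (0 : Eucl d) ^ r ≤ gevreyMul lam σ s (k - l) 0 := by
    unfold gevreyMul
    calc bracket (k - l) (0 : Eucl d) ^ r ≤ bracket (k - l) (0 : Eucl d) ^ σ * 1 := by
          rw [mul_one]; exact Real.rpow_le_rpow_of_exponent_le hb hr
      _ ≤ _ := by gcongr; exact one_le_exp_of_nonneg hl hb0.le
  have h2 : 1 / gevreyMul lam σ s (k - l) (0 : Eucl d) ≤ bracket (k - l) (0 : Eucl d) ^ (-r) := by
    rw [Real.rpow_neg hb0.le, one_div]
    gcongr
  unfold decay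
  have : 0 ≤ bracket l (0 : Eucl d) ^ (-r) := by positivity
  linarith

/-- For a positive truncation parameter the normalized symbols decay in the velocity frequency. -/
theorem norm_normKer_le_of_bound {lam σ s r C : ℝ} (hl : 0 ≤ lam) (hr : r ≤ σ)
    {m : (Fin d → ℤ) × (Fin d → ℤ) × Eucl d → ℂ}
    (hm : ∀ p, ‖m p‖ ≤ C * (gevreyMul lam σ s p.2.1 p.2.2 * gevreyMul lam σ s p.1 p.2.2))
    (hC : 0 ≤ C) (p : (Fin d → ℤ) × (Fin d → ℤ) × Eucl d) :
    ‖normKer lam σ s m p‖ ≤ C * decay r p.1 p.2.1 := by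
  have h1 := gevreyMul_pos lam σ s (p.1 - p.2.1) (0 : Eucl d)
  have h2 := gevreyMul_pos lam σ s p.2.1 p.2.2
  have h3 := gevreyMul_pos lam σ s p.1 p.2.2
  rw [norm_normKer]
  calc _ ≤ C * (gevreyMul lam σ s p.2.1 p.2.2 * gevreyMul lam σ s p.1 p.2.2) /
        (gevreyMul lam σ s (p.1 - p.2.1) 0 * gevreyMul lam σ s p.2.1 p.2.2 *
          gevreyMul lam σ s p.1 p.2.2) := by gcongr; exact hm p
    _ = C * (1 / gevreyMul lam σ s (p.1 - p.2.1) 0) := by field_simp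
    _ ≤ _ := by gcongr; exact inv_gevreyMul_le_decay hl hr p.1 p.2.1

/-- The constant depends on `ε`: one factor of the truncated weight is bounded by it, and `η_j` is
absorbed by a multiplier. These bounds make the full and symmetric parts separately integrable,
which justifies splitting them before `ε` tends to 0. -/
theorem exists_symbol_bound {lam σ σ₁ s ε : ℝ} (hl : 0 ≤ lam) (hσ : 0 ≤ σ) (hσ₁ : σ ≤ σ₁)
    (h1 : 1 ≤ σ₁) (hs : 0 ≤ s) (hε : 0 < ε) (j : Fin d) (n : ℕ) :
    ∃ C : ℝ, 0 ≤ C ∧ ∀ p : (Fin d → ℤ) × (Fin d → ℤ) × Eucl d,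
      ‖fullSymbol lam σ s ε j p‖ ≤ C * (gevreyMul lam σ₁ s p.2.1 p.2.2 *
        gevreyMul lam σ₁ s p.1 p.2.2) ∧
      ‖symmSymbol lam σ s ε j p‖ ≤ C * (gevreyMul lam σ₁ s p.2.1 p.2.2 *
        gevreyMul lam σ₁ s p.1 p.2.2) ∧
      ‖lowSymbol lam σ s ε n p‖ ≤ C * (gevreyMul lam σ₁ s p.2.1 p.2.2 *
        gevreyMul lam σ₁ s p.1 p.2.2) := by
  obtain ⟨C, hC0, hC⟩ := exists_cutFun_le (d := d) hl hσ hs hε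
  refine ⟨C + n * C, by positivity, fun p => ?_⟩
  have hb0 := gevreyMul_pos lam σ₁ s p.2.1 p.2.2
  have hb1 := one_le_gevreyMul (s := s) hl (zero_le_one.trans h1) p.2.1 p.2.2
  have ha0 := gevreyMul_pos lam σ₁ s p.1 p.2.2
  have hbA := cutFun_le (lam := lam) (s := s) hε.le hσ₁ p.2
  have haA := cutFun_le (lam := lam) (s := s) hε.le hσ₁ (p.1, p.2.2)
  have hbn := cutFun_nonneg lam σ s ε p.2
  have han := cutFun_nonneg lam σ s ε (p.1, p.2.2)
  have haC := hC (p.1, p.2.2)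
  have hη0 := abs_nonneg (p.2.2 j)
  have hηb : |p.2.2 j| ≤ gevreyMul lam σ₁ s p.2.1 p.2.2 :=
    (abs_apply_le_norm _ j).trans ((norm_le_bracket p.2.1 _).trans (bracket_le_gevreyMul hl h1 _ _))
  have hηa : |p.2.2 j| ≤ gevreyMul lam σ₁ s p.1 p.2.2 :=
    (abs_apply_le_norm _ j).trans ((norm_le_bracket p.1 _).trans (bracket_le_gevreyMul hl h1 _ _))
  simp only at haA
  set a := gevreyMul lam σ₁ s p.1 p.2.2
  set b := gevreyMul lam σ₁ s p.2.1 p.2.2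
  set A := cutFun lam σ s ε (p.1, p.2.2)
  set A' := cutFun lam σ s ε p.2
  have hle : C * (b * a) ≤ (C + n * C) * (b * a) := by
    gcongr
    have : (0 : ℝ) ≤ n * C := by positivity
    linarith
  refine ⟨?_, ?_, ?_⟩
  · refine le_trans ?_ hle
    rw [fullSymbol, norm_mul, Complex.norm_I, one_mul, Complex.norm_real, Real.norm_eq_abs, abs_mul,
      abs_of_nonneg (sq_nonneg A)]
    calc |p.2.2 j| * A ^ 2 = A * (|p.2.2 j| * A) := by ring
      _ ≤ _ := by gcongr
  · refine le_trans ?_ hle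
    rw [symmSymbol, norm_mul, Complex.norm_I, one_mul, Complex.norm_real, Real.norm_eq_abs, abs_mul,
      abs_of_nonneg (mul_nonneg han hbn)]
    calc |p.2.2 j| * (A * A') = A * (A' * |p.2.2 j|) := by ring
      _ ≤ _ := by gcongr
  · rw [lowSymbol, Complex.norm_real, Real.norm_of_nonneg (by positivity)]
    calc (n : ℝ) * A ^ 2 = n * A * (1 * A) := by ring
      _ ≤ (n * C) * (b * a) := by gcongr
      _ ≤ _ := by
        gcongr; linarith

theorem symmSymbol_swapPair (lam σ s ε : ℝ) (j : Fin d) (p : (Fin d → ℤ) × (Fin d → ℤ) × Eucl d) :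
    symmSymbol lam σ s ε j (swapPair p) = -(starRingEnd ℂ) (symmSymbol lam σ s ε j p) := by
  simp only [symmSymbol, swapPair, map_mul, Complex.conj_I, Complex.conj_ofReal, neg_mul, neg_neg]
  rw [mul_comm (cutFun lam σ s ε (p.2.1, p.2.2))]

theorem fullSymbol_eq (lam σ s ε : ℝ) (j : Fin d) (p : (Fin d → ℤ) × (Fin d → ℤ) × Eucl d) :
    fullSymbol lam σ s ε j p = symmSymbol lam σ s ε j p + commSymbol lam σ s ε j p := by
  simp only [fullSymbol, symmSymbol, commSymbol]
  push_cast; ring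

/-- The trilinear form of the transport term tested with the `j`-th velocity component. -/
noncomputable def commForm (lam σ σ₁ s ε : ℝ) (α : Fin d → ℕ) (g : Eucl d → Eucl d → ℝ)
    (U : Eucl d → Eucl d) (j : Fin d) : ℂ :=
  ∫ p, triForm (normKer lam σ₁ s (commSymbol lam σ s ε j)) (fluidFun lam σ₁ s U j)
    (kinFun lam σ₁ s α g) (kinFun lam σ₁ s α g) p ∂(pairMeasure d)

/-- The trilinear form of the lower order term. -/
noncomputable def lowForm (lam σ σ₁ s ε : ℝ) (α : Fin d → ℕ) (g : Eucl d → Eucl d → ℝ)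
    (U : Eucl d → Eucl d) (j : Fin d) : ℂ :=
  ∫ p, triForm (normKer lam σ₁ s (lowSymbol lam σ s ε (α j))) (fluidFun lam σ₁ s U j)
    (kinFun lam σ₁ s (lower α j) g) (kinFun lam σ₁ s α g) p ∂(pairMeasure d)

/-- The integrand of the transport term. -/
noncomputable def transportForm (lam σ s ε : ℝ) (α : Fin d → ℕ) (g : Eucl d → Eucl d → ℝ)
    (U : Eucl d → Eucl d) (j : Fin d) (p : (Fin d → ℤ) × (Fin d → ℤ) × Eucl d) : ℂ :=
  (cutFun lam σ s ε (p.1, p.2.2) ^ 2 : ℝ) * (velCoeff U j (p.1 - p.2.1) *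
    derivSymbol α j g p.2.1 p.2.2 * (starRingEnd ℂ) (phaseFourier (vPowMul α g) p.1 p.2.2))

/-- The derivative in velocity yields the full symbol minus the lower order one. The symmetric part
of the full symbol has zero real part, so only the commutator remains of it. -/
theorem integrable_transportForm {lam σ σ₁ s ε r : ℝ} {M : ℕ} {g : Eucl d → Eucl d → ℝ}
    {U : Eucl d → Eucl d} (hg : IsKinGevrey lam σ₁ M s g) (hU : IsFluidGevrey lam σ₁ s U)
    (hl : 0 ≤ lam) (hσ : 0 ≤ σ) (hσ₁ : σ ≤ σ₁) (h1 : 1 ≤ σ₁) (hs : 0 ≤ s) (hε : 0 < ε)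
    (hrd : (d : ℝ) / 2 < r) (hr : r ≤ σ₁) {α : Fin d → ℕ} (hα : α ∈ multiIndices d M) (j : Fin d) :
    Integrable (transportForm lam σ s ε α g U j) (pairMeasure d) ∧
      (∫ p, transportForm lam σ s ε α g U j p ∂(pairMeasure d)).re =
        (commForm lam σ σ₁ s ε α g U j).re - (lowForm lam σ σ₁ s ε α g U j).re := by
  obtain ⟨C, hC0, hC⟩ := exists_symbol_bound hl hσ hσ₁ h1 hs hε j (α j)
  obtain ⟨m1, m2, m3, m4⟩ := measurable_symbols lam σ s ε j (α j)
  have hw := measurable_kinFun lam σ₁ s α g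
  have hw' := measurable_kinFun lam σ₁ s (lower α j) g
  have hV2 := hU.eLpNorm_fluidFun_lt_top j
  have hw2 := hg.eLpNorm_kinFun_lt_top hα
  have hw2' := hg.eLpNorm_kinFun_lt_top (lower_mem_multiIndices hα j)
  have i1 := integrable_triForm hrd (measurable_normKer lam σ₁ s m1)
    (norm_normKer_le_of_bound hl hr (fun p => (hC p).1) hC0) hw hw hV2 hw2 hw2
  have i2 := integrable_triForm hrd (measurable_normKer lam σ₁ s m2)
    (norm_normKer_le_of_bound hl hr (fun p => (hC p).2.1) hC0) hw hw hV2 hw2 hw2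
  have i4 := integrable_triForm hrd (measurable_normKer lam σ₁ s m4)
    (norm_normKer_le_of_bound hl hr (fun p => (hC p).2.2) hC0) hw' hw hV2 hw2' hw2
  have e : ∀ p, transportForm lam σ s ε α g U j p =
      triForm (normKer lam σ₁ s (fullSymbol lam σ s ε j)) (fluidFun lam σ₁ s U j)
        (kinFun lam σ₁ s α g) (kinFun lam σ₁ s α g) p -
      triForm (normKer lam σ₁ s (lowSymbol lam σ s ε (α j))) (fluidFun lam σ₁ s U j)
        (kinFun lam σ₁ s (lower α j) g) (kinFun lam σ₁ s α g) p := by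
    intro p
    rw [triForm_normKer, triForm_normKer, transportForm, derivSymbol, fullSymbol, lowSymbol]
    push_cast; ring
  have e' : ∀ p, triForm (normKer lam σ₁ s (commSymbol lam σ s ε j)) (fluidFun lam σ₁ s U j)
        (kinFun lam σ₁ s α g) (kinFun lam σ₁ s α g) p =
      triForm (normKer lam σ₁ s (fullSymbol lam σ s ε j)) (fluidFun lam σ₁ s U j)
        (kinFun lam σ₁ s α g) (kinFun lam σ₁ s α g) p -
      triForm (normKer lam σ₁ s (symmSymbol lam σ s ε j)) (fluidFun lam σ₁ s U j)
        (kinFun lam σ₁ s α g) (kinFun lam σ₁ s α g) p := by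
    intro p
    rw [triForm_normKer, triForm_normKer, triForm_normKer, fullSymbol_eq]
    ring
  constructor
  · exact (i1.sub i4).congr (ae_of_all _ fun p => (e p).symm)
  · rw [commForm, lowForm]
    simp only [e, e']
    rw [integral_sub i1 i4, integral_sub i1 i2, Complex.sub_re, Complex.sub_re,
      re_integral_triForm_eq_zero lam σ₁ s (symmSymbol_swapPair lam σ s ε j), sub_zero]

end VlasovGevrey

/-! ### The derivative of the truncated energy -/

namespace VlasovGevrey

variable {d : ℕ}

theorem measurable_energyRate (lam lam' σ s ε : ℝ) (N : ℕ) :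
    Measurable fun p : (Fin d → ℤ) × Eucl d => energyRate lam lam' σ s ε N p.1 p.2 := by
  refine measurable_of_slices fun k => Continuous.measurable ?_
  have h1 := continuous_cutWeight_bracket lam σ s ε k
  have hb := continuous_bracket (d := d) k
  have hne : ∀ η : Eucl d, bracket k η ≠ 0 := fun η => (bracket_pos k η).ne'
  have h2 : Continuous fun η : Eucl d => weight lam σ s (bracket k η) := continuous_gevreyMul lam σ s k
  have hs := hb.rpow_const (p := s) fun η => Or.inl (hne η)
  have hc := continuous_cutoff
  have h3 : Continuous fun η : Eucl d => cutRate lam σ s ε (bracket k η) := by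
    unfold cutRate
    have hcc := hc.comp (continuous_const.mul (hb.pow 2) : Continuous fun η : Eucl d =>
      ε * bracket k η ^ 2)
    exact ((continuous_const.add (continuous_const.mul hs)).mul hcc).sub
      ((continuous_const.mul (continuous_const.mul (hb.pow 2))).mul
        (continuous_const.max (continuous_const.sub (continuous_const.mul (hb.pow 2)))))
  have h4 : Continuous fun η : Eucl d => (inner ℝ η (η - intVec k) : ℝ) / bracket k η ^ 2 :=
    (continuous_id.inner (continuous_id.sub continuous_const)).div (hb.pow 2)
      fun η => pow_ne_zero 2 (hne η)
  unfold energyRate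
  exact ((continuous_const.mul (h1.pow 2)).add (continuous_const.mul (hs.mul (h1.pow 2)))).add
    ((continuous_const.mul h1).mul ((h2.mul h3).mul h4))

theorem gevreyMul_add_half_sq (lam σ s : ℝ) (k : Fin d → ℤ) (η : Eucl d) :
    gevreyMul lam (σ + s / 2) s k η ^ 2 = bracket k η ^ s * gevreyMul lam σ s k η ^ 2 := by
  have h := bracket_pos k η
  rw [gevreyMul, gevreyMul, Real.rpow_add h]
  have : bracket k η ^ s = (bracket k η ^ (s / 2)) ^ 2 := by
    rw [← Real.rpow_natCast, ← Real.rpow_mul h.le]; congr 1; push_cast; ring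
  rw [this]; ring

/-- The part of `energyRate` that does not contain the derivative of the radius. -/
theorem abs_energyRate_sub_le {lam lam' σ s ε : ℝ} (hl : 0 ≤ lam) (hσ : 0 ≤ σ)
    (hs : s ∈ Ioc (0 : ℝ) 1) (hε : 0 ≤ ε) (N : ℕ) (k : Fin d → ℤ) (η : Eucl d) :
    |energyRate lam lam' σ s ε N k η -
        2 * lam' * (bracket k η ^ s * cutWeight lam σ s ε (bracket k η) ^ 2)| ≤
      (d + 2 * N + 4 * (σ + 1)) * gevreyMul lam σ s k η ^ 2 +
        4 * lam * gevreyMul lam (σ + s / 2) s k η ^ 2 := by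
  have hb := bracket_pos k η
  have hA0 := cutWeight_nonneg (lam := lam) (σ := σ) (s := s) (ε := ε) hb
  have hA := cutWeight_le (lam := lam) (σ := σ) (s := s) hε hb
  have hR := abs_cutRate_le hl hσ hs hε hb
  have hW := weight_pos (lam := lam) (σ := σ) (s := s) hb
  -- Under the free flow the bracket moves at relative speed at most 2, so a loss arises only
  -- through `λξ^s` in the logarithmic derivative of the weight.
  have hin : |inner ℝ η (η - intVec k) / bracket k η ^ 2| ≤ 2 := by
    rw [abs_div, abs_of_nonneg (sq_nonneg (bracket k η)), div_le_iff₀ (by positivity)]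
    refine (abs_real_inner_le_norm _ _).trans ?_
    have h1 := norm_le_bracket k η
    have h2 := norm_intVec_le_bracket k η
    have h3 := norm_sub_le η (intVec k)
    calc ‖η‖ * ‖η - intVec k‖ ≤ bracket k η * (bracket k η + bracket k η) := by
          gcongr; linarith
      _ = _ := by ring
  rw [gevreyMul_add_half_sq, gevreyMul_eq_weight]
  set ξ := bracket k η
  set A := cutWeight lam σ s ε ξ
  set W := weight lam σ s ξ
  set R := cutRate lam σ s ε ξ
  set θ := inner ℝ η (η - intVec k) / ξ ^ 2
  have hsub : energyRate lam lam' σ s ε N k η - 2 * lam' * (ξ ^ s * A ^ 2) =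
      (d - 2 * N) * A ^ 2 + 2 * A * (W * R * θ) := by
    simp only [energyRate]; ring
  have hAA : A ^ 2 ≤ W ^ 2 := by gcongr
  have hAW : A * W ≤ W ^ 2 := by rw [sq]; gcongr
  have e1 : |((d : ℝ) - 2 * N) * A ^ 2| ≤ (d + 2 * N) * W ^ 2 := by
    rw [abs_mul, abs_of_nonneg (sq_nonneg A)]
    have hn : |(d : ℝ) - 2 * N| ≤ d + 2 * N := by
      rw [abs_le]
      have : (0 : ℝ) ≤ d := Nat.cast_nonneg d
      have : (0 : ℝ) ≤ N := Nat.cast_nonneg N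
      constructor <;> linarith
    gcongr
  have hX : 0 ≤ σ + 1 + lam * ξ ^ s := by positivity
  have e2 : |2 * A * (W * R * θ)| ≤ 2 * (W ^ 2 * ((σ + 1 + lam * ξ ^ s) * 2)) := by
    have : |2 * A * (W * R * θ)| = 2 * (A * W * (|R| * |θ|)) := by
      rw [abs_mul, abs_mul, abs_mul, abs_mul, abs_two, abs_of_nonneg hA0, abs_of_nonneg hW.le]
      ring
    rw [this]
    gcongr
  rw [hsub]
  refine (abs_add_le _ _).trans ?_
  calc _ ≤ (d + 2 * N) * W ^ 2 + 2 * (W ^ 2 * ((σ + 1 + lam * ξ ^ s) * 2)) := add_le_add e1 e2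
    _ = _ := by ring

theorem abs_energyRate_le {lam lam' σ s ε : ℝ} (hl : 0 ≤ lam) (hσ : 0 ≤ σ)
    (hs : s ∈ Ioc (0 : ℝ) 1) (hε : 0 ≤ ε) (N : ℕ) (k : Fin d → ℤ) (η : Eucl d) :
    |energyRate lam lam' σ s ε N k η| ≤
      (d + 2 * N + 4 * (σ + 1) + 4 * lam + 2 * |lam'|) * gevreyMul lam (σ + s / 2) s k η ^ 2 := by
  have hb := bracket_pos k η
  have h := abs_energyRate_sub_le (lam' := lam') hl hσ hs hε N k η
  have hA0 := cutWeight_nonneg (lam := lam) (σ := σ) (s := s) (ε := ε) hb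
  have hA : cutWeight lam σ s ε (bracket k η) ≤ gevreyMul lam σ s k η :=
    cutWeight_le (lam := lam) (σ := σ) (s := s) hε hb
  have h2 : |2 * lam' * (bracket k η ^ s * cutWeight lam σ s ε (bracket k η) ^ 2)| ≤
      2 * |lam'| * gevreyMul lam (σ + s / 2) s k η ^ 2 := by
    rw [gevreyMul_add_half_sq, abs_mul, abs_mul, abs_two, abs_of_nonneg (by positivity :
      0 ≤ bracket k η ^ s * cutWeight lam σ s ε (bracket k η) ^ 2)]
    gcongr
  have h3 : gevreyMul lam σ s k η ^ 2 ≤ gevreyMul lam (σ + s / 2) s k η ^ 2 := by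
    have := gevreyMul_pos lam σ s k η
    gcongr
    exact gevreyMul_le_gevreyMul (by linarith [hs.1]) k η
  have h4 : (d + 2 * N + 4 * (σ + 1)) * gevreyMul lam σ s k η ^ 2 ≤
      (d + 2 * N + 4 * (σ + 1)) * gevreyMul lam (σ + s / 2) s k η ^ 2 := by gcongr
  have h5 := abs_add_le (energyRate lam lam' σ s ε N k η -
    2 * lam' * (bracket k η ^ s * cutWeight lam σ s ε (bracket k η) ^ 2))
    (2 * lam' * (bracket k η ^ s * cutWeight lam σ s ε (bracket k η) ^ 2))
  rw [sub_add_cancel] at h5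
  linarith

/-- The quadratic part of the energy derivative. -/
noncomputable def quadForm (lam lam' σ σ₁ s ε : ℝ) (α : Fin d → ℕ) (g : Eucl d → Eucl d → ℝ) : ℝ :=
  ∫ p, energyRate lam lam' σ s ε (∑ i, α i) p.1 p.2 / gevreyMul lam σ₁ s p.1 p.2 ^ 2 *
    ‖kinFun lam σ₁ s α g p‖ ^ 2 ∂(modeMeasure d)

/-- The energy at truncation `ε`. -/
noncomputable def energy (lam σ s ε : ℝ) (α : Fin d → ℕ) (g : Eucl d → Eucl d → ℝ) : ℝ :=
  ∫ p, cutFun lam σ s ε p ^ 2 * ‖phaseFourier (vPowMul α g) p.1 p.2‖ ^ 2 ∂(modeMeasure d)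

/-- The derivative of the energy along a solution of the Vlasov equation. -/
noncomputable def energyDeriv (lam lam' σ σ₁ s ε : ℝ) (α : Fin d → ℕ) (g : Eucl d → Eucl d → ℝ)
    (U : Eucl d → Eucl d) : ℝ :=
  quadForm lam lam' σ σ₁ s ε α g -
    ∑ j, 2 * ((commForm lam σ σ₁ s ε α g U j).re - (lowForm lam σ σ₁ s ε α g U j).re)

theorem norm_kinFun_sq (lam σ s : ℝ) (α : Fin d → ℕ) (g : Eucl d → Eucl d → ℝ)
    (p : (Fin d → ℤ) × Eucl d) :
    ‖kinFun lam σ s α g p‖ ^ 2 =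
      gevreyMul lam σ s p.1 p.2 ^ 2 * ‖phaseFourier (vPowMul α g) p.1 p.2‖ ^ 2 := by
  rw [kinFun, kinMode, norm_mul, Complex.norm_real,
    Real.norm_of_nonneg (gevreyMul_pos lam σ s p.1 p.2).le, mul_pow]

theorem IsKinGevrey.memLp_kinFun {lam σ s : ℝ} {M : ℕ} {g : Eucl d → Eucl d → ℝ}
    (hg : IsKinGevrey lam σ M s g) {α : Fin d → ℕ} (hα : α ∈ multiIndices d M) :
    MemLp (kinFun lam σ s α g) 2 (modeMeasure d) :=
  ⟨(measurable_kinFun lam σ s α g).aestronglyMeasurable, hg.eLpNorm_kinFun_lt_top hα⟩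

theorem integrable_mul_phase_sq {lam σ s B : ℝ} {M : ℕ} {g : Eucl d → Eucl d → ℝ}
    (hg : IsKinGevrey lam σ M s g) {α : Fin d → ℕ} (hα : α ∈ multiIndices d M)
    {ρ : (Fin d → ℤ) × Eucl d → ℝ} (hρ : Measurable ρ)
    (hB : ∀ p, |ρ p| ≤ B * gevreyMul lam σ s p.1 p.2 ^ 2) :
    Integrable (fun p => ρ p * ‖phaseFourier (vPowMul α g) p.1 p.2‖ ^ 2) (modeMeasure d) := by
  refine Integrable.mono' ((integrable_norm_sq (hg.memLp_kinFun hα)).const_mul B)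
    (hρ.mul ((measurable_phaseFun α g).norm.pow_const 2)).aestronglyMeasurable
    (ae_of_all _ fun p => ?_)
  rw [Real.norm_eq_abs, abs_mul, abs_of_nonneg (sq_nonneg ‖phaseFourier (vPowMul α g) p.1 p.2‖),
    norm_kinFun_sq, ← mul_assoc]
  gcongr
  exact hB p

variable {T : ℝ} {u : ℝ → Eucl d → Eucl d} {f : ℝ → Eucl d → Eucl d → ℝ} {lam : ℝ → ℝ}
  {σ s ε : ℝ} {M : ℕ}

/-- The truncation reduces the energy to a finite sum of modes, each already differentiated. It
remains to collect the convolution sums into integrals over triples `(k, l, η)`, where the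
symmetrization is available. -/
theorem hasDerivWithinAt_energy (hsol : IsVlasovSolution (Ico 0 T) u f)
    (hs : s ∈ Ioc (0 : ℝ) 1)
    (hf : IsKinGevreyCurve (Ico 0 T) lam (σ + s / 2) M s f)
    (hu : IsFluidGevreyCurve (Ico 0 T) lam (σ + s / 2) s u)
    (hσ : 1 ≤ σ) (hσd : (d : ℝ) / 2 < σ) (hl : ∀ t ∈ Ico 0 T, 0 ≤ lam t)
    (hlc : ContinuousOn lam (Ico 0 T)) {α : Fin d → ℕ} (hα : α ∈ multiIndices d M)
    {t₀ lam' : ℝ} (ht₀ : t₀ ∈ Ico 0 T) (hlam : HasDerivWithinAt lam lam' (Ico 0 T) t₀)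
    (hε : 0 < ε) :
    HasDerivWithinAt (fun τ => energy (lam τ) σ s ε α (f τ))
      (energyDeriv (lam t₀) lam' σ (σ + s / 2) s ε α (f t₀) (u t₀)) (Ico 0 T) t₀ := by
  have hs0 := hs.1
  obtain ⟨S, hS⟩ := exists_finset_cutFun_eq_zero (d := d) hε
  have hz : ∀ (μ : ℝ), ∀ k ∉ S, ∀ η : Eucl d, cutWeight μ σ s ε (bracket k η) = 0 :=
    fun μ k hk η => cutWeight_eq_zero (hS k hk η)
  have hE : ∀ τ ∈ Ico 0 T, energy (lam τ) σ s ε α (f τ) =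
      ∑ k ∈ S, ∫ η, cutWeight (lam τ) σ s ε (bracket k η) ^ 2 *
        ‖phaseFourier (vPowMul α (f τ)) k η‖ ^ 2 := by
    intro τ hτ
    refine integral_count_prod (integrable_mul_phase_sq (B := 1) (hf.mem τ hτ) hα
      ((measurable_cutFun _ _ _ _).pow_const 2) fun p => ?_) fun k hk η => ?_
    · rw [abs_of_nonneg (sq_nonneg _), one_mul]
      have := cutFun_nonneg (lam τ) σ s ε p
      gcongr
      exact cutFun_le hε.le (by linarith) p
    · simp only [cutFun, hz _ k hk η]; ring
  have hsum := HasDerivWithinAt.fun_sum (u := S) fun k _ =>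
    hasDerivWithinAt_modeEnergy (σ := σ) hsol hf hu (by linarith) (by linarith) hl hlc hα ht₀ hlam hε k
  refine (hsum.congr hE (hE t₀ ht₀)).congr_deriv ?_
  have hg := hf.mem t₀ ht₀
  have hU := hu.mem t₀ ht₀
  have hl₀ := hl t₀ ht₀
  generalize f t₀ = g at *
  generalize u t₀ = U at *
  generalize lam t₀ = μ at *
  have hT := fun j => integrable_transportForm (σ := σ) (ε := ε) (r := σ) hg hU hl₀ (by linarith)
    (by linarith) (by linarith) hs0.le hε hσd (by linarith) hα j
  have hR : Integrable (fun p : (Fin d → ℤ) × Eucl d => energyRate μ lam' σ s ε (∑ i, α i) p.1 p.2 *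
      ‖phaseFourier (vPowMul α g) p.1 p.2‖ ^ 2) (modeMeasure d) :=
    integrable_mul_phase_sq hg hα (measurable_energyRate _ _ _ _ _ _) fun p =>
      abs_energyRate_le hl₀ (by linarith) hs hε.le _ p.1 p.2
  -- For fixed `k`, integrability over `(l, η)` permits exchanging the integral with the convolution
  -- series, which converges for almost every `η`.
  have hmode : ∀ k, ∫ η, (weightRate μ lam' σ s ε k η * ‖phaseFourier (vPowMul α g) k η‖ ^ 2 +
        cutWeight μ σ s ε (bracket k η) ^ 2 *
          (2 * ((starRingEnd ℂ) (phaseFourier (vPowMul α g) k η) *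
            velocityFourier (sourceMode α g U k) η).re)) =
      (∫ η, energyRate μ lam' σ s ε (∑ i, α i) k η * ‖phaseFourier (vPowMul α g) k η‖ ^ 2) -
        ∑ j, 2 * (∫ q, transportForm μ σ s ε α g U j (k, q) ∂(modeMeasure d)).re := by
    intro k
    have hint : ∀ j, Integrable fun η => ∑' l, transportForm μ σ s ε α g U j (k, l, η) := fun j =>
      integrable_tsum_of_count_prod (integrable_slice (hT j).1 k)
    have hint' : ∀ j, Integrable fun η => 2 * (∑' l, transportForm μ σ s ε α g U j (k, l, η)).re :=
      fun j => (hint j).re.const_mul 2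
    have hae : ∀ᵐ η : Eucl d, ∀ j, HasSum (fun l => velCoeff U j (k - l) * derivSymbol α j g l η)
        (velocityFourier (convMode α j g U k) η) :=
      ae_all_iff.2 fun j => (memLp_convMode hg hU hl₀ (by linarith) (by linarith) hα j k).2
    have e1 : ∀ j, (∫ q, transportForm μ σ s ε α g U j (k, q) ∂(modeMeasure d)).re =
        ∫ η, (∑' l, transportForm μ σ s ε α g U j (k, l, η)).re := fun j => by
      rw [integral_count_prod_symm (integrable_slice (hT j).1 k)]
      exact (integral_re (hint j)).symm
    simp only [e1, ← integral_const_mul]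
    have hRk : Integrable fun η => energyRate μ lam' σ s ε (∑ i, α i) k η *
        ‖phaseFourier (vPowMul α g) k η‖ ^ 2 := integrable_slice hR k
    rw [← integral_finsetSum _ fun j _ => hint' j, ← integral_sub hRk
      (integrable_finsetSum _ fun j _ => hint' j)]
    refine integral_congr_ae ?_
    filter_upwards [modeEnergy_integrand_eq (σ := σ) (ε := ε) (lam' := lam') hg hU hl₀ (by linarith)
      (by linarith) hα k, hae] with η h1 h2
    rw [h1]
    congr 1
    refine Finset.sum_congr rfl fun j _ => ?_
    rw [(((h2 j).mul_right ((starRingEnd ℂ) (phaseFourier (vPowMul α g) k η))).mul_left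
      ((cutWeight μ σ s ε (bracket k η) ^ 2 : ℝ) : ℂ)).tsum_eq.symm]
    rfl
  rw [Finset.sum_congr rfl fun k _ => hmode k, Finset.sum_sub_distrib, energyDeriv]
  congr 1
  · rw [quadForm, ← integral_count_prod hR fun k hk η => ?_]
    · refine integral_congr_ae (ae_of_all _ fun p => ?_)
      simp only
      rw [norm_kinFun_sq]
      have := (gevreyMul_pos μ (σ + s / 2) s p.1 p.2).ne'
      generalize gevreyMul μ (σ + s / 2) s p.1 p.2 = G at *
      field_simp
    · simp only [energyRate, hz _ k hk η]; ring
  · rw [Finset.sum_comm]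
    refine Finset.sum_congr rfl fun j _ => ?_
    rw [← Finset.mul_sum, ← (hT j).2, integral_count_prod (hT j).1 fun k hk q => ?_, Complex.re_sum]
    simp only [transportForm, cutFun, hz _ k hk]
    simp

end VlasovGevrey

/-! ### Removal of the truncation -/

namespace VlasovGevrey

variable {d : ℕ}

/-- Differentiation of a pointwise limit whose derivatives converge continuously at `t₀`. -/
theorem hasDerivWithinAt_of_tendsto {I : Set ℝ} (hI : Convex ℝ I) {t₀ q : ℝ} (ht₀ : t₀ ∈ I)
    {E Q : ℕ → ℝ → ℝ} {N : ℝ → ℝ} (hE : ∀ n, ∀ τ ∈ I, HasDerivWithinAt (E n) (Q n τ) I τ)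
    (hN : ∀ τ ∈ I, Tendsto (fun n => E n τ) atTop (𝓝 (N τ)))
    (hQ : Tendsto (fun i : ℕ × ℝ => Q i.1 i.2) (atTop ×ˢ 𝓝[I] t₀) (𝓝 q)) :
    HasDerivWithinAt N q I t₀ := by
  rw [hasDerivWithinAt_iff_isLittleO, Asymptotics.isLittleO_iff]
  intro η hη
  have h1 := hQ (Metric.closedBall_mem_nhds q hη)
  rw [mem_map, mem_prod_iff] at h1
  obtain ⟨S, hS, V, hV, hSV⟩ := h1
  obtain ⟨δ, hδ, hball⟩ := Metric.mem_nhdsWithin_iff.1 hV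
  have hconv : Convex ℝ (Metric.ball t₀ δ ∩ I) := (convex_ball t₀ δ).inter hI
  have hmem : Metric.ball t₀ δ ∩ I ∈ 𝓝[I] t₀ := by
    rw [inter_comm]; exact inter_mem_nhdsWithin I (Metric.ball_mem_nhds t₀ hδ)
  filter_upwards [hmem] with τ hτ
  -- Mean value inequality for `E_n(r) - q r`, whose derivative is at most `η` near `t₀` uniformly
  -- for large `n`; the estimate survives the limit in `n`.
  have hest : ∀ᶠ n in atTop, ‖E n τ - q * τ - (E n t₀ - q * t₀)‖ ≤ η * ‖τ - t₀‖ := by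
    filter_upwards [hS] with n hn
    refine hconv.norm_image_sub_le_of_norm_hasDerivWithin_le
      (f := fun r => E n r - q * r) (f' := fun r => Q n r - q) (fun r hr => ?_) (fun r hr => ?_)
      ⟨Metric.mem_ball_self hδ, ht₀⟩ hτ
    · have := ((hE n r hr.2).mono inter_subset_right).sub
        (((hasDerivAt_id r).const_mul q).hasDerivWithinAt (s := Metric.ball t₀ δ ∩ I))
      exact this.congr_deriv (by rw [mul_one])
    · have : (n, r) ∈ S ×ˢ V := mk_mem_prod hn (hball hr)
      have h := hSV this
      rwa [mem_preimage, Metric.mem_closedBall, dist_eq_norm] at h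
  have hlim : Tendsto (fun n => ‖E n τ - q * τ - (E n t₀ - q * t₀)‖) atTop
      (𝓝 ‖N τ - q * τ - (N t₀ - q * t₀)‖) :=
    (((hN τ hτ.2).sub_const _).sub ((hN t₀ ht₀).sub_const _)).norm
  have h := le_of_tendsto hlim hest
  have e : N τ - N t₀ - (τ - t₀) • q = N τ - q * τ - (N t₀ - q * t₀) := by
    rw [smul_eq_mul]; ring
  rwa [e]

theorem continuous_cutWeight_param (σ s ξ : ℝ) :
    Continuous fun q : ℝ × ℝ => cutWeight q.1 σ s q.2 ξ := by
  unfold cutWeight weight cutoff; fun_prop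

theorem continuous_energyRate_param (σ s : ℝ) (N : ℕ) (k : Fin d → ℤ) (η : Eucl d) :
    Continuous fun q : ℝ × ℝ × ℝ => energyRate q.1 q.2.1 σ s q.2.2 N k η := by
  unfold energyRate cutRate cutWeight weight cutoff; fun_prop

/-- The common bound of the two symbols. -/
noncomputable def symbolMajorant (lam σ s : ℝ) (p : (Fin d → ℤ) × (Fin d → ℤ) × Eucl d) : ℝ :=
  gevreyMul lam σ s p.1 p.2.2 *
    majorant lam σ s (bracket p.1 p.2.2) (bracket p.2.1 p.2.2) (bracket (p.1 - p.2.1) (0 : Eucl d))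

theorem symbolMajorant_nonneg {lam : ℝ} (hl : 0 ≤ lam) (σ s : ℝ)
    (p : (Fin d → ℤ) × (Fin d → ℤ) × Eucl d) : 0 ≤ symbolMajorant lam σ s p :=
  mul_nonneg (gevreyMul_pos _ _ _ _ _).le
    (majorant_nonneg hl (one_le_bracket _ _) (one_le_bracket _ _) (one_le_bracket _ _))

theorem symbolMajorant_le {lam s : ℝ} (hl : 0 ≤ lam) (hs : s ∈ Ioc (0 : ℝ) 1) (σ : ℝ)
    (p : (Fin d → ℤ) × (Fin d → ℤ) × Eucl d) :
    symbolMajorant lam σ s p ≤ (1 + 2 * lam + 2 * lam ^ 2) *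
      (gevreyMul lam (σ + s / 2) s (p.1 - p.2.1) 0 * gevreyMul lam (σ + s / 2) s p.2.1 p.2.2 *
        gevreyMul lam (σ + s / 2) s p.1 p.2.2) := by
  have h := majorant_le (σ := σ) hl hs (one_le_bracket p.1 p.2.2) (one_le_bracket p.2.1 p.2.2)
    (one_le_bracket (p.1 - p.2.1) (0 : Eucl d))
  have hW := (gevreyMul_pos lam σ s p.1 p.2.2).le
  have e : gevreyMul lam (σ + s / 2) s p.1 p.2.2 =
      bracket p.1 p.2.2 ^ (s / 2) * gevreyMul lam σ s p.1 p.2.2 :=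
    weight_add (bracket_pos _ _)
  rw [symbolMajorant, e]
  refine (mul_le_mul_of_nonneg_left h hW).trans (le_of_eq ?_)
  simp only [gevreyMul_eq_weight]
  ring

theorem bracket_decay_le {r : ℝ} (hr : 0 ≤ r) (k l : Fin d → ℤ) (η : Eucl d) :
    bracket (k - l) (0 : Eucl d) ^ (-r) + bracket l η ^ (-r) ≤ decay r k l := by
  have := Real.rpow_le_rpow_of_nonpos (bracket_pos l (0 : Eucl d)) (bracket_zero_le l η)
    (neg_nonpos.2 hr)
  unfold decay
  linarith

section Bounds

variable {lam σ s r ε : ℝ} (hl : 0 ≤ lam) (hs : s ∈ Ioc (0 : ℝ) 1) (hr : 0 ≤ r)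
  (hσ : σ = r + (2 + s / 2)) (hε : 0 ≤ ε)

include hl hs hr hσ hε

/-- As `|η_j|` lies below both `⟨k,η⟩` and `⟨l,η⟩`, it is admissible as `m` in
`abs_cutWeight_sub_le`. The bound does not involve `ε`. -/
theorem norm_commSymbol_le (j : Fin d) (p : (Fin d → ℤ) × (Fin d → ℤ) × Eucl d) :
    ‖commSymbol lam σ s ε j p‖ ≤
      (σ + 10) * 2 ^ σ * decay r p.1 p.2.1 * symbolMajorant lam σ s p := by
  have hm := majorant_nonneg (σ := σ) (s := s) hl (one_le_bracket p.1 p.2.2)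
    (one_le_bracket p.2.1 p.2.2) (one_le_bracket (p.1 - p.2.1) (0 : Eucl d))
  have hA := cutFun_le (lam := lam) (s := s) hε (le_refl σ) (p.1, p.2.2)
  have hA0 := cutFun_nonneg lam σ s ε (p.1, p.2.2)
  have hj := abs_apply_le_norm p.2.2 j
  have hd := abs_cutWeight_sub_le hl hs hr hσ (one_le_bracket p.1 p.2.2)
    (one_le_bracket p.2.1 p.2.2) (one_le_bracket (p.1 - p.2.1) (0 : Eucl d)) hε
    (hj.trans (norm_le_bracket _ _)) (hj.trans (norm_le_bracket _ _))
    (bracket_le_add _ _ _) (bracket_le_add' _ _ _) (bracket_sub_le_add _ _ _)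
  have hdec := bracket_decay_le hr p.1 p.2.1 p.2.2
  have hσ0 : 0 ≤ σ := by have := hs.1; rw [hσ]; linarith
  rw [commSymbol, norm_mul, Complex.norm_I, one_mul, Complex.norm_real, Real.norm_eq_abs, abs_mul,
    abs_mul, abs_of_nonneg hA0, symbolMajorant]
  calc _ = cutFun lam σ s ε (p.1, p.2.2) * (|p.2.2 j| *
        |cutWeight lam σ s ε (bracket p.1 p.2.2) - cutWeight lam σ s ε (bracket p.2.1 p.2.2)|) := by
        rw [mul_left_comm]; rfl
    _ ≤ gevreyMul lam σ s p.1 p.2.2 * ((σ + 10) * 2 ^ σ * (decay r p.1 p.2.1 * _)) := by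
        refine mul_le_mul hA (hd.trans ?_) (by positivity) (gevreyMul_pos _ _ _ _ _).le
        exact mul_le_mul_of_nonneg_left (mul_le_mul_of_nonneg_right hdec hm) (by positivity)
    _ = _ := by ring

theorem norm_lowSymbol_le (n : ℕ) (p : (Fin d → ℤ) × (Fin d → ℤ) × Eucl d) :
    ‖lowSymbol lam σ s ε n p‖ ≤
      n * ((σ + 10) * 2 ^ σ) * decay r p.1 p.2.1 * symbolMajorant lam σ s p := by
  have hm := majorant_nonneg (σ := σ) (s := s) hl (one_le_bracket p.1 p.2.2)
    (one_le_bracket p.2.1 p.2.2) (one_le_bracket (p.1 - p.2.1) (0 : Eucl d))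
  have hA := cutFun_le (lam := lam) (s := s) hε (le_refl σ) (p.1, p.2.2)
  have hA0 := cutFun_nonneg lam σ s ε (p.1, p.2.2)
  have hd := weight_le_majorant hl hs hr hσ (one_le_bracket p.1 p.2.2)
    (one_le_bracket p.2.1 p.2.2) (one_le_bracket (p.1 - p.2.1) (0 : Eucl d))
    (bracket_le_add _ _ _) (bracket_sub_le_add _ _ _)
  have hdec := bracket_decay_le hr p.1 p.2.1 p.2.2
  have hσ0 : 0 ≤ σ := by have := hs.1; rw [hσ]; linarith
  rw [lowSymbol, Complex.norm_real, Real.norm_of_nonneg (by positivity), symbolMajorant]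
  calc _ ≤ (n : ℝ) * (gevreyMul lam σ s p.1 p.2.2 * gevreyMul lam σ s p.1 p.2.2) := by
        have := (gevreyMul_pos lam σ s p.1 p.2.2).le
        rw [sq]; gcongr
    _ ≤ n * (gevreyMul lam σ s p.1 p.2.2 * ((σ + 10) * 2 ^ σ * (decay r p.1 p.2.1 * _))) := by
        refine mul_le_mul_of_nonneg_left (mul_le_mul_of_nonneg_left (hd.trans ?_)
          (gevreyMul_pos _ _ _ _ _).le) (by positivity)
        exact mul_le_mul_of_nonneg_left (mul_le_mul_of_nonneg_right hdec hm) (by positivity)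
    _ = _ := by ring

end Bounds

theorem norm_normKer_le {lam s r C : ℝ} (hl : 0 ≤ lam) (hs : s ∈ Ioc (0 : ℝ) 1) {σ : ℝ}
    (hC : 0 ≤ C) {m : (Fin d → ℤ) × (Fin d → ℤ) × Eucl d → ℂ}
    {p : (Fin d → ℤ) × (Fin d → ℤ) × Eucl d}
    (hm : ‖m p‖ ≤ C * decay r p.1 p.2.1 * symbolMajorant lam σ s p) :
    ‖normKer lam (σ + s / 2) s m p‖ ≤ C * (1 + 2 * lam + 2 * lam ^ 2) * decay r p.1 p.2.1 := by
  have h1 := gevreyMul_pos lam (σ + s / 2) s (p.1 - p.2.1) (0 : Eucl d)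
  have h2 := gevreyMul_pos lam (σ + s / 2) s p.2.1 p.2.2
  have h3 := gevreyMul_pos lam (σ + s / 2) s p.1 p.2.2
  have hd := decay_pos r p.1 p.2.1
  rw [norm_normKer, div_le_iff₀ (by positivity)]
  refine hm.trans ((mul_le_mul_of_nonneg_left (symbolMajorant_le hl hs σ p)
    (by positivity)).trans (le_of_eq ?_))
  ring

section Limit

variable {ι : Type*} {l : Filter ι} {μ μ' e : ι → ℝ} {μ₀ μ₀' e₀ : ℝ}
  {g : ι → Eucl d → Eucl d → ℝ} {g₀ : Eucl d → Eucl d → ℝ} {U : ι → Eucl d → Eucl d}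
  {U₀ : Eucl d → Eucl d} {σ s r : ℝ} {M : ℕ} {α : Fin d → ℕ}

theorem tendsto_quadForm [l.IsCountablyGenerated] (hs : s ∈ Ioc (0 : ℝ) 1) (hσ : 0 ≤ σ)
    (hμ : Tendsto μ l (𝓝 μ₀)) (hμ' : Tendsto μ' l (𝓝 μ₀')) (he : Tendsto e l (𝓝 e₀))
    (hμ0 : ∀ᶠ i in l, 0 ≤ μ i) (hμ₀ : 0 ≤ μ₀) (he0 : ∀ i, 0 ≤ e i) (he₀ : 0 ≤ e₀)
    (hg₀ : IsKinGevrey μ₀ (σ + s / 2) M s g₀) (hα : α ∈ multiIndices d M)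
    (hg : Tendsto (fun i => eLpNorm (kinFun (μ i) (σ + s / 2) s α (g i) -
      kinFun μ₀ (σ + s / 2) s α g₀) 2 (modeMeasure d)) l (𝓝 0)) :
    Tendsto (fun i => quadForm (μ i) (μ' i) σ (σ + s / 2) s (e i) α (g i)) l
      (𝓝 (quadForm μ₀ μ₀' σ (σ + s / 2) s e₀ α g₀)) := by
  set N := ∑ i, α i
  set B : ℝ := d + 2 * N + 4 * (σ + 1) + 4 * (μ₀ + 1) + 2 * (|μ₀'| + 1) with hB
  have hmeas : ∀ a b c : ℝ, Measurable fun p : (Fin d → ℤ) × Eucl d =>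
      energyRate a b σ s c N p.1 p.2 / gevreyMul a (σ + s / 2) s p.1 p.2 ^ 2 := fun a b c =>
    (measurable_energyRate a b σ s c N).div ((measurable_gevreyFun a _ s).pow_const 2)
  have hbd : ∀ a b c : ℝ, 0 ≤ a → a ≤ μ₀ + 1 → |b| ≤ |μ₀'| + 1 → 0 ≤ c →
      ∀ p : (Fin d → ℤ) × Eucl d,
      ‖energyRate a b σ s c N p.1 p.2 / gevreyMul a (σ + s / 2) s p.1 p.2 ^ 2‖ ≤ B := by
    intro a b c ha ha' hb hc p
    have hG := gevreyMul_pos a (σ + s / 2) s p.1 p.2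
    rw [norm_div, Real.norm_eq_abs, Real.norm_of_nonneg (sq_nonneg _), div_le_iff₀ (by positivity)]
    refine (abs_energyRate_le ha hσ hs hc N p.1 p.2).trans ?_
    rw [hB]
    gcongr
  refine tendsto_integral_mul_norm_sq (B := B) (fun i => hmeas _ _ _) (hmeas _ _ _) ?_
    (hbd _ _ _ hμ₀ (by linarith) (by linarith) he₀) (fun p => ?_)
    (fun i => (measurable_kinFun _ _ _ _ _).aestronglyMeasurable)
    (measurable_kinFun _ _ _ _ _).aestronglyMeasurable (hg₀.eLpNorm_kinFun_lt_top hα) hg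
  · filter_upwards [hμ0, hμ.eventually (Iic_mem_nhds (lt_add_one μ₀)),
      hμ'.abs.eventually (Iic_mem_nhds (lt_add_one |μ₀'|))] with i h1 h2 h3
    exact hbd _ _ _ h1 h2 h3 (he0 i)
  · have h1 := ((continuous_energyRate_param σ s N p.1 p.2).tendsto (μ₀, μ₀', e₀)).comp
      (hμ.prodMk_nhds (hμ'.prodMk_nhds he))
    simp only [Function.comp_def] at h1
    have h2 : Tendsto (fun i => gevreyMul (μ i) (σ + s / 2) s p.1 p.2) l
        (𝓝 (gevreyMul μ₀ (σ + s / 2) s p.1 p.2)) :=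
      ((continuous_gevreyMul_lam _ s p.1 p.2).tendsto _).comp hμ
    exact h1.div (h2.pow 2) (pow_ne_zero 2 (gevreyMul_pos _ _ _ _ _).ne')

theorem tendsto_cutFun (σ s : ℝ) (hμ : Tendsto μ l (𝓝 μ₀)) (he : Tendsto e l (𝓝 e₀))
    (p : (Fin d → ℤ) × Eucl d) :
    Tendsto (fun i => cutFun (μ i) σ s (e i) p) l (𝓝 (cutFun μ₀ σ s e₀ p)) :=
  ((continuous_cutWeight_param σ s (bracket p.1 p.2)).tendsto (μ₀, e₀)).comp (hμ.prodMk_nhds he)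

theorem tendsto_normKer {m : ι → (Fin d → ℤ) × (Fin d → ℤ) × Eucl d → ℂ}
    {m₀ : (Fin d → ℤ) × (Fin d → ℤ) × Eucl d → ℂ} (σ s : ℝ) (hμ : Tendsto μ l (𝓝 μ₀))
    {p : (Fin d → ℤ) × (Fin d → ℤ) × Eucl d} (hm : Tendsto (fun i => m i p) l (𝓝 (m₀ p))) :
    Tendsto (fun i => normKer (μ i) σ s (m i) p) l (𝓝 (normKer μ₀ σ s m₀ p)) := by
  have h : ∀ (k : Fin d → ℤ) (η : Eucl d), Tendsto (fun i => (gevreyMul (μ i) σ s k η : ℂ)) l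
      (𝓝 (gevreyMul μ₀ σ s k η : ℂ)) := fun k η =>
    (Complex.continuous_ofReal.tendsto _).comp (((continuous_gevreyMul_lam σ s k η).tendsto _).comp hμ)
  exact hm.div (((h _ _).mul (h _ _)).mul (h _ _)) (mul_ne_zero (mul_ne_zero
    (gevreyMul_ne_zero _ _ _ _ _) (gevreyMul_ne_zero _ _ _ _ _)) (gevreyMul_ne_zero _ _ _ _ _))

/-- The kernels, normalized by the multipliers with exponent `σ + s/2`, are bounded by the decay
uniformly in the truncation and for radii near the limit. The abstract filter allows time and
truncation to vary together. -/
theorem tendsto_forms [l.IsCountablyGenerated] (hs : s ∈ Ioc (0 : ℝ) 1) (hrd : (d : ℝ) / 2 < r)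
    (hσ : σ = r + (2 + s / 2))
    (hμ : Tendsto μ l (𝓝 μ₀)) (he : Tendsto e l (𝓝 e₀))
    (hμ0 : ∀ᶠ i in l, 0 ≤ μ i) (hμ₀ : 0 ≤ μ₀) (he0 : ∀ i, 0 ≤ e i) (he₀ : 0 ≤ e₀)
    (hg₀ : IsKinGevrey μ₀ (σ + s / 2) M s g₀) (hU₀ : IsFluidGevrey μ₀ (σ + s / 2) s U₀)
    (hα : α ∈ multiIndices d M)
    (hg : ∀ β ∈ multiIndices d M, Tendsto (fun i => eLpNorm (kinFun (μ i) (σ + s / 2) s β (g i) -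
      kinFun μ₀ (σ + s / 2) s β g₀) 2 (modeMeasure d)) l (𝓝 0)) (j : Fin d)
    (hU : Tendsto (fun i => eLpNorm (fluidFun (μ i) (σ + s / 2) s (U i) j -
      fluidFun μ₀ (σ + s / 2) s U₀ j) 2 Measure.count) l (𝓝 0)) :
    Tendsto (fun i => commForm (μ i) σ (σ + s / 2) s (e i) α (g i) (U i) j) l
        (𝓝 (commForm μ₀ σ (σ + s / 2) s e₀ α g₀ U₀ j)) ∧
      Tendsto (fun i => lowForm (μ i) σ (σ + s / 2) s (e i) α (g i) (U i) j) l
        (𝓝 (lowForm μ₀ σ (σ + s / 2) s e₀ α g₀ U₀ j)) := by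
  have hr : 0 ≤ r := le_trans (by positivity) hrd.le
  have hσ0 : 0 ≤ σ := by have := hs.1; rw [hσ]; linarith
  set K : ℝ := (σ + 10) * 2 ^ σ with hK
  have hK0 : 0 ≤ K := by positivity
  set P : ℝ := 1 + 2 * (μ₀ + 1) + 2 * (μ₀ + 1) ^ 2 with hP
  have hPle : ∀ a, 0 ≤ a → a ≤ μ₀ + 1 → 1 + 2 * a + 2 * a ^ 2 ≤ P := by
    intro a h1 h2
    rw [hP]; gcongr
  have hmem : ∀ᶠ i in l, 0 ≤ μ i ∧ μ i ≤ μ₀ + 1 := hμ0.and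
    (hμ.eventually (Iic_mem_nhds (lt_add_one μ₀)))
  have b1 : ∀ a c : ℝ, 0 ≤ a → a ≤ μ₀ + 1 → 0 ≤ c → ∀ p : (Fin d → ℤ) × (Fin d → ℤ) × Eucl d,
      ‖normKer a (σ + s / 2) s (commSymbol a σ s c j) p‖ ≤ K * P * decay r p.1 p.2.1 := by
    intro a c h1 h2 h3 p
    refine (norm_normKer_le h1 hs hK0 (norm_commSymbol_le h1 hs hr hσ h3 j p)).trans ?_
    have := decay_pos r p.1 p.2.1
    gcongr; exact hPle a h1 h2
  have b2 : ∀ a c : ℝ, 0 ≤ a → a ≤ μ₀ + 1 → 0 ≤ c → ∀ p : (Fin d → ℤ) × (Fin d → ℤ) × Eucl d,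
      ‖normKer a (σ + s / 2) s (lowSymbol a σ s c (α j)) p‖ ≤
        α j * K * P * decay r p.1 p.2.1 := by
    intro a c h1 h2 h3 p
    refine (norm_normKer_le h1 hs (by positivity) (norm_lowSymbol_le h1 hs hr hσ h3 (α j) p)).trans ?_
    have := decay_pos r p.1 p.2.1
    gcongr; exact hPle a h1 h2
  have hl1 := lower_mem_multiIndices hα j
  have hU₂ := hU₀.eLpNorm_fluidFun_lt_top j
  have hw₂ := hg₀.eLpNorm_kinFun_lt_top hα
  have hw₂' := hg₀.eLpNorm_kinFun_lt_top hl1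
  have hcut := fun p => tendsto_cutFun (d := d) σ s hμ he p
  constructor
  · refine tendsto_integral_triForm (B := K * P) hrd
      (fun i => measurable_normKer _ _ _ (measurable_symbols _ _ _ _ j 0).2.2.1)
      (measurable_normKer _ _ _ (measurable_symbols _ _ _ _ j 0).2.2.1)
      (hmem.mono fun i hi => b1 _ _ hi.1 hi.2 (he0 i)) (b1 _ _ hμ₀ (by linarith) he₀)
      (fun p => tendsto_normKer _ _ hμ ?_)
      (fun i => measurable_kinFun _ _ _ _ _) (measurable_kinFun _ _ _ _ _)
      (fun i => measurable_kinFun _ _ _ _ _) (measurable_kinFun _ _ _ _ _)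
      hU₂ hw₂ hw₂ hU (hg α hα) (hg α hα)
    exact ((Complex.continuous_ofReal.tendsto _).comp (((hcut (p.1, p.2.2)).mul
      ((hcut (p.1, p.2.2)).sub (hcut p.2))).const_mul _)).const_mul _
  · refine tendsto_integral_triForm (B := α j * K * P) hrd
      (fun i => measurable_normKer _ _ _ (measurable_symbols _ _ _ _ j (α j)).2.2.2)
      (measurable_normKer _ _ _ (measurable_symbols _ _ _ _ j (α j)).2.2.2)
      (hmem.mono fun i hi => b2 _ _ hi.1 hi.2 (he0 i)) (b2 _ _ hμ₀ (by linarith) he₀)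
      (fun p => tendsto_normKer _ _ hμ ?_)
      (fun i => measurable_kinFun _ _ _ _ _) (measurable_kinFun _ _ _ _ _)
      (fun i => measurable_kinFun _ _ _ _ _) (measurable_kinFun _ _ _ _ _)
      hU₂ hw₂' hw₂ hU (hg _ hl1) (hg α hα)
    exact (Complex.continuous_ofReal.tendsto _).comp (((hcut (p.1, p.2.2)).pow 2).const_mul _)

end Limit

theorem tendsto_energy {lam σ s : ℝ} {M : ℕ} {g : Eucl d → Eucl d → ℝ}
    (hg : IsKinGevrey lam σ M s g) {α : Fin d → ℕ} (hα : α ∈ multiIndices d M) {e : ℕ → ℝ}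
    (he : Tendsto e atTop (𝓝 0)) (he0 : ∀ n, 0 ≤ e n) :
    Tendsto (fun n => energy lam σ s (e n) α g) atTop
      (𝓝 ((eLpNorm (kinFun lam σ s α g) 2 (modeMeasure d)).toReal ^ 2)) := by
  have hm := hg.memLp_kinFun hα
  rw [← integral_norm_sq_eq hm]
  refine tendsto_integral_of_dominated_convergence (fun p => ‖kinFun lam σ s α g p‖ ^ 2)
    (fun n => ?_) (integrable_norm_sq hm) (fun n => ae_of_all _ fun p => ?_)
    (ae_of_all _ fun p => ?_)
  · exact (((measurable_cutFun _ _ _ _).pow_const 2).mul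
      ((measurable_phaseFun α g).norm.pow_const 2)).aestronglyMeasurable
  · rw [Real.norm_of_nonneg (by positivity), norm_kinFun_sq]
    have := cutFun_nonneg lam σ s (e n) p
    gcongr
    exact cutFun_le (he0 n) le_rfl p
  · rw [norm_kinFun_sq]
    have h := tendsto_cutFun σ s (tendsto_const_nhds (x := lam)) he p
    rw [cutFun, cutWeight_zero, ← gevreyMul_eq_weight] at h
    exact (h.pow 2).mul_const _

variable {T : ℝ} {u : ℝ → Eucl d → Eucl d} {f : ℝ → Eucl d → Eucl d → ℝ} {lam : ℝ → ℝ}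
  {σ s r : ℝ} {M : ℕ}

theorem kinNormSq_mono {lam lam' σ σ' s s' : ℝ}
    (h : ∀ (k : Fin d → ℤ) (η : Eucl d), gevreyMul lam σ s k η ≤ gevreyMul lam' σ' s' k η) (M : ℕ)
    (g : Eucl d → Eucl d → ℝ) : kinNormSq lam σ M s g ≤ kinNormSq lam' σ' M s' g := by
  unfold kinNormSq
  gcongr with α _ k η
  rw [enorm_le_iff_norm_le, kinMode, kinMode, norm_mul, norm_mul, Complex.norm_real,
    Complex.norm_real, Real.norm_of_nonneg (gevreyMul_pos _ _ _ _ _).le,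
    Real.norm_of_nonneg (gevreyMul_pos _ _ _ _ _).le]
  gcongr
  exact h k η

theorem IsKinGevrey.mono {lam lam' σ σ' s s' : ℝ} {M : ℕ} {g : Eucl d → Eucl d → ℝ}
    (hg : IsKinGevrey lam' σ' M s' g)
    (h : ∀ (k : Fin d → ℤ) (η : Eucl d), gevreyMul lam σ s k η ≤ gevreyMul lam' σ' s' k η) :
    IsKinGevrey lam σ M s g :=
  ⟨hg.smooth, hg.periodic, hg.memLp, (kinNormSq_mono h M g).trans_lt hg.finite⟩

theorem IsFluidGevrey.mono {lam lam' σ σ' s s' : ℝ} {U : Eucl d → Eucl d}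
    (hU : IsFluidGevrey lam' σ' s' U)
    (h : ∀ (k : Fin d → ℤ) (η : Eucl d), gevreyMul lam σ s k η ≤ gevreyMul lam' σ' s' k η) :
    IsFluidGevrey lam σ s U := by
  refine ⟨hU.smooth, hU.periodic, lt_of_le_of_lt ?_ hU.finite⟩
  unfold fluidNormSq
  gcongr with k j
  rw [enorm_le_iff_norm_le, fluidMode, fluidMode, norm_mul, norm_mul, Complex.norm_real,
    Complex.norm_real, Real.norm_of_nonneg (gevreyMul_pos _ _ _ _ _).le,
    Real.norm_of_nonneg (gevreyMul_pos _ _ _ _ _).le]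
  gcongr
  exact h k 0

/-- The truncation parameter is `1/(n+1)`. The derivatives of the truncated energies converge as `n
→ ∞` and `τ → t₀` jointly, thanks to continuity in time of the norms with exponent `σ + s/2`. -/
theorem hasDerivWithinAt_eLpNorm_kinFun_sq (hsol : IsVlasovSolution (Ico 0 T) u f)
    (hs : s ∈ Ioc (0 : ℝ) 1) (hrd : (d : ℝ) / 2 < r) (hσ : σ = r + (2 + s / 2))
    (hf : IsKinGevreyCurve (Ico 0 T) lam (σ + s / 2) M s f)
    (hu : IsFluidGevreyCurve (Ico 0 T) lam (σ + s / 2) s u)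
    (hlam : ContDiffOn ℝ ∞ lam (Ico 0 T)) (hl : ∀ t ∈ Ico 0 T, 0 ≤ lam t)
    {α : Fin d → ℕ} (hα : α ∈ multiIndices d M) {t₀ : ℝ} (ht₀ : t₀ ∈ Ico 0 T) :
    HasDerivWithinAt
      (fun τ => (eLpNorm (kinFun (lam τ) σ s α (f τ)) 2 (modeMeasure d)).toReal ^ 2)
      (energyDeriv (lam t₀) (derivWithin lam (Ico 0 T) t₀) σ (σ + s / 2) s 0 α (f t₀) (u t₀))
      (Ico 0 T) t₀ := by
  have hs0 := hs.1
  have hd0 : (0 : ℝ) ≤ d := Nat.cast_nonneg d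
  have hr : 0 ≤ r := le_trans (by positivity) hrd.le
  have hdiff := hlam.differentiableOn (by simp)
  have hder : ∀ τ ∈ Ico 0 T, HasDerivWithinAt lam (derivWithin lam (Ico 0 T) τ) (Ico 0 T) τ :=
    fun τ hτ => (hdiff τ hτ).hasDerivWithinAt
  have hderc := hlam.continuousOn_derivWithin (uniqueDiffOn_Ico 0 T) (by simp)
  have hT2 : Tendsto (fun i : ℕ × ℝ => i.2) (atTop ×ˢ 𝓝[Ico 0 T] t₀) (𝓝[Ico 0 T] t₀) :=
    tendsto_snd
  have he : Tendsto (fun n : ℕ => 1 / ((n : ℝ) + 1)) atTop (𝓝 0) :=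
    tendsto_one_div_add_atTop_nhds_zero_nat
  have he2 : Tendsto (fun i : ℕ × ℝ => 1 / ((i.1 : ℝ) + 1)) (atTop ×ˢ 𝓝[Ico 0 T] t₀) (𝓝 0) :=
    he.comp tendsto_fst
  have hmem : ∀ᶠ i : ℕ × ℝ in atTop ×ˢ 𝓝[Ico 0 T] t₀, 0 ≤ lam i.2 :=
    hT2.eventually (eventually_mem_nhdsWithin.mono hl)
  have hμ := (hlam.continuousOn t₀ ht₀).tendsto.comp hT2
  have hμ' := (hderc t₀ ht₀).tendsto.comp hT2
  have hg := fun β (hβ : β ∈ multiIndices d M) => (hf.tendsto_kinFun ht₀ hβ).comp hT2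
  have hU := fun j => (hu.tendsto_fluidFun ht₀ j).comp hT2
  refine hasDerivWithinAt_of_tendsto (convex_Ico 0 T) ht₀
    (E := fun n τ => energy (lam τ) σ s (1 / ((n : ℝ) + 1)) α (f τ))
    (Q := fun n τ => energyDeriv (lam τ) (derivWithin lam (Ico 0 T) τ) σ (σ + s / 2) s
      (1 / ((n : ℝ) + 1)) α (f τ) (u τ))
    (fun n τ hτ => hasDerivWithinAt_energy hsol hs hf hu (by linarith) (by linarith) hl
      hlam.continuousOn hα hτ (hder τ hτ) (by positivity))
    (fun τ hτ => tendsto_energy ((hf.mem τ hτ).mono (gevreyMul_le_gevreyMul (by linarith))) hα he fun n => by positivity) ?_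
  refine Tendsto.sub ?_ (tendsto_finsetSum _ fun j _ => Tendsto.const_mul _ ?_)
  · exact tendsto_quadForm (g := fun i : ℕ × ℝ => f i.2) hs (by linarith) hμ hμ' he2 hmem
      (hl t₀ ht₀) (fun i => by positivity) le_rfl (hf.mem t₀ ht₀) hα (hg α hα)
  · have h := tendsto_forms (g := fun i : ℕ × ℝ => f i.2) (U := fun i : ℕ × ℝ => u i.2) hs hrd hσ
      hμ he2 hmem (hl t₀ ht₀) (fun i => by positivity) le_rfl (hf.mem t₀ ht₀) (hu.mem t₀ ht₀) hα
      hg j (hU j)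
    exact ((Complex.continuous_re.tendsto _).comp h.1).sub
      ((Complex.continuous_re.tendsto _).comp h.2)

end VlasovGevrey

/-! ### The quantitative energy estimate -/

namespace VlasovGevrey

variable {d : ℕ}

theorem gevreyMul_zero_le {lam : ℝ} (hl : 0 ≤ lam) (σ s s' : ℝ) (k : Fin d → ℤ) (η : Eucl d) :
    gevreyMul 0 σ s' k η ≤ gevreyMul lam σ s k η := by
  have hb := bracket_pos k η
  unfold gevreyMul
  rw [zero_mul, Real.exp_zero]
  gcongr
  exact one_le_exp_of_nonneg hl hb.le

/-- The `L²` norm of one component of the Gevrey norm of a kinetic density. -/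
noncomputable def modeNorm (lam σ s : ℝ) (α : Fin d → ℕ) (g : Eucl d → Eucl d → ℝ) : ℝ :=
  (eLpNorm (kinFun lam σ s α g) 2 (modeMeasure d)).toReal

theorem IsKinGevrey.kinNorm_sq {lam σ s : ℝ} {M : ℕ} {g : Eucl d → Eucl d → ℝ}
    (hg : IsKinGevrey lam σ M s g) :
    kinNorm lam σ M s g ^ 2 = ∑ α ∈ multiIndices d M, modeNorm lam σ s α g ^ 2 := by
  rw [kinNorm, Real.sq_sqrt ENNReal.toReal_nonneg, kinNormSq,
    ENNReal.toReal_sum fun α hα => (hg.lintegral_kinMode_lt_top hα).ne]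
  refine Finset.sum_congr rfl fun α hα => ?_
  rw [modeNorm, ← ENNReal.toReal_pow, eLpNorm_kinFun, ← ENNReal.rpow_natCast, ← ENNReal.rpow_mul]
  norm_num

theorem IsKinGevrey.modeNorm_le {lam σ s : ℝ} {M : ℕ} {g : Eucl d → Eucl d → ℝ}
    (hg : IsKinGevrey lam σ M s g) {α : Fin d → ℕ} (hα : α ∈ multiIndices d M) :
    modeNorm lam σ s α g ≤ kinNorm lam σ M s g := by
  refine (abs_le_of_sq_le_sq' (b := kinNorm lam σ M s g) ?_ (Real.sqrt_nonneg _)).2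
  rw [hg.kinNorm_sq]
  exact Finset.single_le_sum (f := fun α => modeNorm lam σ s α g ^ 2) (fun _ _ => sq_nonneg _) hα

theorem IsFluidGevrey.norm_fluidFun_le {lam σ s : ℝ} {U : Eucl d → Eucl d}
    (hU : IsFluidGevrey lam σ s U) (j : Fin d) :
    (eLpNorm (fluidFun lam σ s U j) 2 Measure.count).toReal ≤ fluidNorm lam σ s U := by
  refine Real.le_sqrt_of_sq_le ?_
  rw [← ENNReal.toReal_pow]
  refine ENNReal.toReal_mono hU.finite.ne ?_
  rw [eLpNorm_two_sq, lintegral_count]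
  refine ENNReal.tsum_le_tsum fun k => ?_
  exact Finset.single_le_sum (f := fun j => ‖fluidMode lam σ s U k j‖ₑ ^ 2)
    (fun _ _ => zero_le) (Finset.mem_univ j)

theorem norm_triForm_decay {C r lam σ s lam' σ' s' lam'' σ'' s'' : ℝ} (hC : 0 ≤ C)
    (U : Eucl d → Eucl d) (j : Fin d) (β α : Fin d → ℕ) (g : Eucl d → Eucl d → ℝ)
    (p : (Fin d → ℤ) × (Fin d → ℤ) × Eucl d) :
    ‖triForm (fun p => ((C * decay r p.1 p.2.1 : ℝ) : ℂ)) (fluidFun lam σ s U j)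
        (kinFun lam' σ' s' β g) (kinFun lam'' σ'' s'' α g) p‖ =
      C * decay r p.1 p.2.1 * (gevreyMul lam σ s (p.1 - p.2.1) 0 * gevreyMul lam' σ' s' p.2.1 p.2.2 *
        gevreyMul lam'' σ'' s'' p.1 p.2.2) * (‖velCoeff U j (p.1 - p.2.1)‖ *
          ‖phaseFourier (vPowMul β g) p.2.1 p.2.2‖ * ‖phaseFourier (vPowMul α g) p.1 p.2.2‖) := by
  have hd := decay_pos r p.1 p.2.1
  simp only [triForm, fluidFun, fluidMode, kinFun, kinMode, velCoeff, norm_mul, Complex.norm_real,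
    RCLike.norm_conj, Real.norm_of_nonneg (gevreyMul_pos _ _ _ _ _).le, Real.norm_of_nonneg hC,
    Real.norm_of_nonneg hd.le]
  ring

theorem integral_decay_triForm_le {C r lam σ s lam' σ' s' lam'' σ'' s'' : ℝ} {M : ℕ}
    (hrd : (d : ℝ) / 2 < r) (hC : 0 ≤ C) {U : Eucl d → Eucl d} {g : Eucl d → Eucl d → ℝ}
    (hU : IsFluidGevrey lam σ s U) (hg : IsKinGevrey lam' σ' M s' g)
    (hg' : IsKinGevrey lam'' σ'' M s'' g) (j : Fin d) {β α : Fin d → ℕ}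
    (hβ : β ∈ multiIndices d M) (hα : α ∈ multiIndices d M) :
    Integrable (fun p => ‖triForm (fun p => ((C * decay r p.1 p.2.1 : ℝ) : ℂ))
        (fluidFun lam σ s U j) (kinFun lam' σ' s' β g) (kinFun lam'' σ'' s'' α g) p‖)
        (pairMeasure d) ∧
      ∫ p, ‖triForm (fun p => ((C * decay r p.1 p.2.1 : ℝ) : ℂ)) (fluidFun lam σ s U j)
        (kinFun lam' σ' s' β g) (kinFun lam'' σ'' s'' α g) p‖ ∂(pairMeasure d) ≤
      C * (convConst d r).toReal * (fluidNorm lam σ s U * kinNorm lam' σ' M s' g *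
        kinNorm lam'' σ'' M s'' g) := by
  have hκ : ∀ p : (Fin d → ℤ) × (Fin d → ℤ) × Eucl d,
      ‖((C * decay r p.1 p.2.1 : ℝ) : ℂ)‖ ≤ C * decay r p.1 p.2.1 := fun p => by
    have := decay_pos r p.1 p.2.1
    rw [Complex.norm_real, Real.norm_of_nonneg (by positivity)]
  have hκm : Measurable fun p : (Fin d → ℤ) × (Fin d → ℤ) × Eucl d =>
      ((C * decay r p.1 p.2.1 : ℝ) : ℂ) := measurable_comp_pair fun k l => ((C * decay r k l : ℝ) : ℂ)
  have m1 := measurable_kinFun lam' σ' s' β g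
  have m2 := measurable_kinFun lam'' σ'' s'' α g
  refine ⟨(integrable_triForm hrd hκm hκ m1 m2 (hU.eLpNorm_fluidFun_lt_top j)
    (hg.eLpNorm_kinFun_lt_top hβ) (hg'.eLpNorm_kinFun_lt_top hα)).norm, ?_⟩
  refine (integral_triForm_le hrd hC hκ m1 m2 (hU.eLpNorm_fluidFun_lt_top j)
    (hg.eLpNorm_kinFun_lt_top hβ) (hg'.eLpNorm_kinFun_lt_top hα)).trans ?_
  have h1 := hU.norm_fluidFun_le j
  have h2 := hg.modeNorm_le hβ
  have h3 := hg'.modeNorm_le hα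
  have : 0 ≤ kinNorm lam' σ' M s' g := Real.sqrt_nonneg _
  have : 0 ≤ fluidNorm lam σ s U := Real.sqrt_nonneg _
  rw [modeNorm] at h2 h3
  calc _ = C * (convConst d r).toReal * ((eLpNorm (fluidFun lam σ s U j) 2 Measure.count).toReal *
        (eLpNorm (kinFun lam' σ' s' β g) 2 (modeMeasure d)).toReal *
        (eLpNorm (kinFun lam'' σ'' s'' α g) 2 (modeMeasure d)).toReal) := by ring
    _ ≤ _ := by gcongr

/-- The right-hand side of the trilinear estimate. -/
noncomputable def triBound (lam σ s : ℝ) (M : ℕ) (g : Eucl d → Eucl d → ℝ) (U : Eucl d → Eucl d) :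
    ℝ :=
  fluidNorm 0 σ 1 U * kinNorm lam σ M s g * kinNorm lam σ M s g +
    lam * (fluidNorm 0 σ 1 U * kinNorm lam (σ + s / 2) M s g * kinNorm lam (σ + s / 2) M s g) +
    lam ^ 2 * (fluidNorm lam σ s U * kinNorm lam (σ + s / 2) M s g *
      kinNorm lam (σ + s / 2) M s g) +
    lam ^ 2 * (fluidNorm lam (σ + s / 2) s U * kinNorm lam σ M s g *
      kinNorm lam (σ + s / 2) M s g) +
    lam * (fluidNorm lam (σ + s / 2) s U * kinNorm 0 σ M 1 g * kinNorm lam (σ + s / 2) M s g)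

/-- Each of the five terms of the majorant is a product of one weight in `k - l`, one in `(l, η)`
and a power of `⟨k,η⟩`. Together with the remaining multiplier at `(k, η)` it calls for one specific
choice of three norms in the convolution estimate. -/
theorem norm_integral_triForm_le {C r lam σ s : ℝ} {M : ℕ} (hrd : (d : ℝ) / 2 < r) (hC : 0 ≤ C)
    (hl : 0 ≤ lam) (hs : s ∈ Ioc (0 : ℝ) 1)
    {U : Eucl d → Eucl d} {g : Eucl d → Eucl d → ℝ}
    (hU : IsFluidGevrey lam (σ + s / 2) s U) (hg : IsKinGevrey lam (σ + s / 2) M s g)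
    (j : Fin d) {β α : Fin d → ℕ}
    (hβ : β ∈ multiIndices d M) (hα : α ∈ multiIndices d M)
    {m : (Fin d → ℤ) × (Fin d → ℤ) × Eucl d → ℂ}
    (hm : ∀ p, ‖m p‖ ≤ C * decay r p.1 p.2.1 * symbolMajorant lam σ s p) :
    ‖∫ p, triForm (normKer lam (σ + s / 2) s m) (fluidFun lam (σ + s / 2) s U j)
      (kinFun lam (σ + s / 2) s β g) (kinFun lam (σ + s / 2) s α g) p ∂(pairMeasure d)‖ ≤
      C * (convConst d r).toReal * triBound lam σ s M g U := by
  have hσs : σ ≤ σ + s / 2 := by linarith [hs.1]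
  have hg0 := hg.mono (gevreyMul_le_gevreyMul hσs)
  have hgS : IsKinGevrey 0 σ M 1 g := hg0.mono (gevreyMul_zero_le hl σ s 1)
  have hU0 := hU.mono (gevreyMul_le_gevreyMul hσs)
  have hUS : IsFluidGevrey 0 σ 1 U := hU0.mono (gevreyMul_zero_le hl σ s 1)
  obtain ⟨i1, b1⟩ := integral_decay_triForm_le hrd hC hUS hg0 hg0 j hβ hα
  obtain ⟨i2, b2⟩ := integral_decay_triForm_le hrd hC hUS hg hg j hβ hα
  obtain ⟨i3, b3⟩ := integral_decay_triForm_le hrd hC hU0 hg hg j hβ hα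
  obtain ⟨i4, b4⟩ := integral_decay_triForm_le hrd hC hU hg0 hg j hβ hα
  obtain ⟨i5, b5⟩ := integral_decay_triForm_le hrd hC hU hgS hg j hβ hα
  have hint := (((i1.add (i2.const_mul lam)).add (i3.const_mul (lam ^ 2))).add
    (i4.const_mul (lam ^ 2))).add (i5.const_mul lam)
  refine (norm_integral_le_of_norm_le hint (ae_of_all _ fun p => ?_)).trans ?_
  · simp only [Pi.add_apply]
    rw [norm_triForm_decay hC, norm_triForm_decay hC, norm_triForm_decay hC, norm_triForm_decay hC,
      norm_triForm_decay hC, triForm_normKer, norm_mul, norm_mul, norm_mul, RCLike.norm_conj]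
    have e : gevreyMul lam (σ + s / 2) s p.1 p.2.2 =
        bracket p.1 p.2.2 ^ (s / 2) * gevreyMul lam σ s p.1 p.2.2 := weight_add (bracket_pos _ _)
    calc _ = ‖m p‖ * (‖velCoeff U j (p.1 - p.2.1)‖ * ‖phaseFourier (vPowMul β g) p.2.1 p.2.2‖ *
          ‖phaseFourier (vPowMul α g) p.1 p.2.2‖) := by ring
      _ ≤ C * decay r p.1 p.2.1 * symbolMajorant lam σ s p * (‖velCoeff U j (p.1 - p.2.1)‖ *
          ‖phaseFourier (vPowMul β g) p.2.1 p.2.2‖ * ‖phaseFourier (vPowMul α g) p.1 p.2.2‖) := by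
          gcongr; exact hm p
      _ = _ := by
          rw [symbolMajorant, majorant, e]
          simp only [gevreyMul_eq_weight, weight_zero]
          ring
  · rw [integral_add' (((i1.add (i2.const_mul lam)).add (i3.const_mul (lam ^ 2))).add
      (i4.const_mul (lam ^ 2))) (i5.const_mul lam), integral_add' ((i1.add (i2.const_mul lam)).add
      (i3.const_mul (lam ^ 2))) (i4.const_mul (lam ^ 2)), integral_add' (i1.add (i2.const_mul lam))
      (i3.const_mul (lam ^ 2)), integral_add' i1 (i2.const_mul lam), integral_const_mul,
      integral_const_mul, integral_const_mul, integral_const_mul]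
    have c2 := mul_le_mul_of_nonneg_left b2 hl
    have c3 := mul_le_mul_of_nonneg_left b3 (sq_nonneg lam)
    have c4 := mul_le_mul_of_nonneg_left b4 (sq_nonneg lam)
    have c5 := mul_le_mul_of_nonneg_left b5 hl
    rw [triBound]
    linarith

/-- Interpolation between the Sobolev norm and the Gevrey norm with additional regularity. -/
theorem IsKinGevrey.kinNorm_sq_le {lam σ s : ℝ} {M : ℕ} (hl : 0 ≤ lam) (hs : 0 ≤ s)
    {g : Eucl d → Eucl d → ℝ} (hg : IsKinGevrey lam (σ + s / 2) M s g) :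
    kinNorm lam σ M s g ^ 2 ≤ kinNorm 0 σ M 1 g * kinNorm lam σ M s g +
      lam * kinNorm lam (σ + s / 2) M s g ^ 2 := by
  have hg0 := hg.mono (gevreyMul_le_gevreyMul (by linarith : σ ≤ σ + s / 2))
  have hgS : IsKinGevrey 0 σ M 1 g := hg0.mono (gevreyMul_zero_le hl σ s 1)
  have hmode : ∀ α ∈ multiIndices d M, modeNorm lam σ s α g ^ 2 ≤
      modeNorm 0 σ 1 α g * modeNorm lam σ s α g + lam * modeNorm lam (σ + s / 2) s α g ^ 2 := by
    intro α hα
    have m1 := hg0.memLp_kinFun hα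
    have m2 := hg.memLp_kinFun hα
    have m3 := hgS.memLp_kinFun hα
    have hprod : Integrable (fun p => ‖kinFun 0 σ 1 α g p‖ * ‖kinFun lam σ s α g p‖)
      (modeMeasure d) := m3.norm.integrable_mul m1.norm
    simp only [modeNorm]
    refine le_trans ?_ (add_le_add_left (integral_norm_mul_norm_le m3 m1) _)
    rw [← integral_norm_sq_eq m1, ← integral_norm_sq_eq m2, ← integral_const_mul,
      ← integral_add hprod ((integrable_norm_sq m2).const_mul lam)]
    refine integral_mono (integrable_norm_sq m1)
      (hprod.add ((integrable_norm_sq m2).const_mul lam)) fun p => ?_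
    simp only
    rw [norm_kinFun_sq, norm_kinFun_sq, gevreyMul_add_half_sq, kinFun, kinFun, kinMode, kinMode,
      norm_mul, norm_mul, Complex.norm_real, Complex.norm_real,
      Real.norm_of_nonneg (gevreyMul_pos _ _ _ _ _).le,
      Real.norm_of_nonneg (gevreyMul_pos _ _ _ _ _).le]
    have hW := gevreyMul_pos lam σ s p.1 p.2
    have hb := bracket_pos p.1 p.2
    -- Only one of the two factors of the squared weight is expanded by `e^y ≤ 1 + y e^y`; the other
    -- keeps its exponential.
    have h1 : gevreyMul lam σ s p.1 p.2 ≤ gevreyMul 0 σ 1 p.1 p.2 +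
        lam * bracket p.1 p.2 ^ s * gevreyMul lam σ s p.1 p.2 := by
      have := exp_le_one_add_mul_exp (y := lam * bracket p.1 p.2 ^ s)
      have := mul_le_mul_of_nonneg_left this (by positivity : 0 ≤ bracket p.1 p.2 ^ σ)
      unfold gevreyMul
      rw [zero_mul, Real.exp_zero]
      linarith
    have h2 := mul_le_mul_of_nonneg_right (mul_le_mul_of_nonneg_right h1 hW.le)
      (sq_nonneg ‖phaseFourier (vPowMul α g) p.1 p.2‖)
    linarith
  calc kinNorm lam σ M s g ^ 2 = ∑ α ∈ multiIndices d M, modeNorm lam σ s α g ^ 2 := hg0.kinNorm_sq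
    _ ≤ ∑ α ∈ multiIndices d M, (modeNorm 0 σ 1 α g * modeNorm lam σ s α g +
          lam * modeNorm lam (σ + s / 2) s α g ^ 2) := Finset.sum_le_sum hmode
    _ = ∑ α ∈ multiIndices d M, modeNorm 0 σ 1 α g * modeNorm lam σ s α g +
          lam * kinNorm lam (σ + s / 2) M s g ^ 2 := by
        rw [Finset.sum_add_distrib, ← Finset.mul_sum, hg.kinNorm_sq]
    _ ≤ _ := by
        gcongr
        refine (Real.sum_mul_le_sqrt_mul_sqrt _ _ _).trans (le_of_eq ?_)
        rw [← hgS.kinNorm_sq, ← hg0.kinNorm_sq, Real.sqrt_sq (x := kinNorm _ _ _ _ _) (Real.sqrt_nonneg _),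
          Real.sqrt_sq (x := kinNorm _ _ _ _ _) (Real.sqrt_nonneg _)]

theorem quadForm_le {lam lam' σ s : ℝ} {M : ℕ} (hl : 0 ≤ lam) (hσ : 0 ≤ σ)
    (hs : s ∈ Ioc (0 : ℝ) 1) {g : Eucl d → Eucl d → ℝ}
    (hg : IsKinGevrey lam (σ + s / 2) M s g) {α : Fin d → ℕ} (hα : α ∈ multiIndices d M) :
    quadForm lam lam' σ (σ + s / 2) s 0 α g ≤
      (2 * lam' + 4 * lam) * modeNorm lam (σ + s / 2) s α g ^ 2 +
        (d + 2 * M + 4 * (σ + 1)) * modeNorm lam σ s α g ^ 2 := by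
  have hg0 := hg.mono (gevreyMul_le_gevreyMul (by linarith [hs.1] : σ ≤ σ + s / 2))
  have m1 := hg0.memLp_kinFun hα
  have m2 := hg.memLp_kinFun hα
  have hN : ((∑ i, α i : ℕ) : ℝ) ≤ M := by
    exact_mod_cast (Finset.mem_filter.1 hα).2
  have hpt : ∀ p : (Fin d → ℤ) × Eucl d,
      energyRate lam lam' σ s 0 (∑ i, α i) p.1 p.2 / gevreyMul lam (σ + s / 2) s p.1 p.2 ^ 2 *
        ‖kinFun lam (σ + s / 2) s α g p‖ ^ 2 =
      energyRate lam lam' σ s 0 (∑ i, α i) p.1 p.2 *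
        ‖phaseFourier (vPowMul α g) p.1 p.2‖ ^ 2 := fun p => by
    rw [norm_kinFun_sq]
    have := (gevreyMul_pos lam (σ + s / 2) s p.1 p.2).ne'
    generalize gevreyMul lam (σ + s / 2) s p.1 p.2 = G at *
    field_simp
  simp only [modeNorm]
  rw [quadForm, ← integral_norm_sq_eq m1, ← integral_norm_sq_eq m2, ← integral_const_mul,
    ← integral_const_mul, ← integral_add ((integrable_norm_sq m2).const_mul _)
      ((integrable_norm_sq m1).const_mul _)]
  simp only [hpt]
  refine integral_mono (integrable_mul_phase_sq hg hα (measurable_energyRate _ _ _ _ _ _)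
    fun p => abs_energyRate_le hl hσ hs le_rfl _ p.1 p.2)
    (((integrable_norm_sq m2).const_mul _).add ((integrable_norm_sq m1).const_mul _)) fun p => ?_
  simp only
  have h1 := (abs_le.1 (abs_energyRate_sub_le (lam' := lam') (ε := 0) hl hσ hs le_rfl (∑ i, α i)
    p.1 p.2)).2
  rw [cutWeight_zero, ← gevreyMul_eq_weight, ← gevreyMul_add_half_sq] at h1
  have h2 : (d + 2 * (∑ i, α i : ℕ) + 4 * (σ + 1)) * gevreyMul lam σ s p.1 p.2 ^ 2 ≤
      (d + 2 * M + 4 * (σ + 1)) * gevreyMul lam σ s p.1 p.2 ^ 2 := by gcongr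
  rw [norm_kinFun_sq, norm_kinFun_sq, ← mul_assoc, ← mul_assoc, ← add_mul]
  gcongr
  linarith

/-- In the last constant, 2 comes from differentiating a square, `d` from the velocity components,
and in `1 + M` the commutator counts once while `M` bounds the coefficient `α_j` of the lower order
term. -/
theorem energyDeriv_le {lam lam' σ s r : ℝ} {M : ℕ} (hl : 0 ≤ lam) (hs : s ∈ Ioc (0 : ℝ) 1)
    (hrd : (d : ℝ) / 2 < r) (hσ : σ = r + (2 + s / 2)) {g : Eucl d → Eucl d → ℝ}
    {U : Eucl d → Eucl d} (hg : IsKinGevrey lam (σ + s / 2) M s g)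
    (hU : IsFluidGevrey lam (σ + s / 2) s U) {α : Fin d → ℕ} (hα : α ∈ multiIndices d M) :
    energyDeriv lam lam' σ (σ + s / 2) s 0 α g U ≤
      (2 * lam' + 4 * lam) * modeNorm lam (σ + s / 2) s α g ^ 2 +
        (d + 2 * M + 4 * (σ + 1)) * modeNorm lam σ s α g ^ 2 +
      2 * d * (1 + M) * ((σ + 10) * 2 ^ σ * (convConst d r).toReal) * triBound lam σ s M g U := by
  have hd0 : (0 : ℝ) ≤ d := Nat.cast_nonneg d
  have hr : 0 ≤ r := le_trans (by positivity) hrd.le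
  have hσ0 : 0 ≤ σ := by have := hs.1; rw [hσ]; linarith
  have hq := quadForm_le (lam' := lam') hl hσ0 hs hg hα
  set K := (σ + 10) * 2 ^ σ with hK
  have hK0 : 0 ≤ K := by positivity
  set R := triBound lam σ s M g U with hR
  have hform : ∀ j, -(M * K * (convConst d r).toReal * R + K * (convConst d r).toReal * R) ≤
      (commForm lam σ (σ + s / 2) s 0 α g U j).re - (lowForm lam σ (σ + s / 2) s 0 α g U j).re := by
    intro j
    have h1 := norm_integral_triForm_le hrd hK0 hl hs hU hg j hα hα
      (norm_commSymbol_le hl hs hr hσ le_rfl j)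
    have h2 := norm_integral_triForm_le hrd (by positivity : 0 ≤ (M : ℝ) * K) hl hs hU hg j
      (lower_mem_multiIndices hα j) hα (m := lowSymbol lam σ s 0 (α j)) fun p => by
        have hαj : (α j : ℝ) ≤ M := by
          exact_mod_cast (Finset.single_le_sum (f := α) (fun _ _ => Nat.zero_le _)
            (Finset.mem_univ j)).trans (Finset.mem_filter.1 hα).2
        have := decay_pos r p.1 p.2.1
        have := symbolMajorant_nonneg hl σ s p
        refine (norm_lowSymbol_le hl hs hr hσ le_rfl (α j) p).trans ?_
        gcongr
    have h3 := (abs_le.1 ((Complex.abs_re_le_norm _).trans h1)).1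
    have h4 := (abs_le.1 ((Complex.abs_re_le_norm _).trans h2)).2
    rw [commForm, lowForm]
    linarith
  have hsum : ∑ _j : Fin d, 2 * (-(M * K * (convConst d r).toReal * R +
      K * (convConst d r).toReal * R)) ≤
      ∑ j, 2 * ((commForm lam σ (σ + s / 2) s 0 α g U j).re -
        (lowForm lam σ (σ + s / 2) s 0 α g U j).re) :=
    Finset.sum_le_sum fun j _ => by linarith [hform j]
  rw [Finset.sum_const, Finset.card_univ, Fintype.card_fin, nsmul_eq_mul] at hsum
  rw [energyDeriv]
  linarith

end VlasovGevrey

/-! ### The proposition -/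

theorem mainTheorem6 (d : ℕ) (s : ℝ) (hs : s ∈ Set.Ioc (0 : ℝ) 1) (M : ℕ) (hM : 0 < M)
    (σ : ℝ) (hσ : (d : ℝ) / 2 + s / 2 + 2 < σ) :
    ∃ C : ℝ, 0 < C ∧
      ∀ (T : ℝ) (lam : ℝ → ℝ) (u : ℝ → Eucl d → Eucl d) (f : ℝ → Eucl d → Eucl d → ℝ),
        ContDiffOn ℝ ∞ lam (Set.Ico 0 T) →
        (∀ t ∈ Set.Ico 0 T, 0 < lam t) →
        IsKinGevreyCurve (Set.Ico 0 T) lam (σ + s / 2) M s f →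
        IsFluidGevreyCurve (Set.Ico 0 T) lam (σ + s / 2) s u →
        IsVlasovSolution (Set.Ico 0 T) u f →
        ∀ t ∈ Set.Ico 0 T, ∃ D : ℝ,
          HasDerivWithinAt (fun τ => kinNorm (lam τ) σ M s (f τ) ^ 2) D (Set.Ico 0 T) t ∧
          1 / 2 * D ≤
            derivWithin lam (Set.Ico 0 T) t * kinNorm (lam t) (σ + s / 2) M s (f t) ^ 2 +
            C * ((lipNorm (u t) + 1) * kinNorm (lam t) σ M s (f t) ^ 2 +
              fluidSobolevNorm σ (u t) * kinSobolevNorm σ M (f t) * kinNorm (lam t) σ M s (f t) +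
              (lam t * (1 + fluidSobolevNorm σ (u t)) +
                  lam t ^ 2 * fluidNorm (lam t) σ s (u t)) *
                kinNorm (lam t) (σ + s / 2) M s (f t) ^ 2 +
              (lam t * kinSobolevNorm σ M (f t) + lam t ^ 2 * kinNorm (lam t) σ M s (f t)) *
                fluidNorm (lam t) (σ + s / 2) s (u t) *
                kinNorm (lam t) (σ + s / 2) M s (f t)) := by
  have hd0 : (0 : ℝ) ≤ d := Nat.cast_nonneg d
  -- The hypothesis on `σ` says precisely that the decay exponent `r` left after spending `2 + s/2`
  -- derivatives exceeds `d/2`.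
  obtain ⟨r, hr⟩ : ∃ r : ℝ, σ = r + (2 + s / 2) := ⟨σ - (2 + s / 2), by ring⟩
  have hrd : (d : ℝ) / 2 < r := by linarith
  have hσ0 : 0 ≤ σ := by linarith [hs.1]
  set c₁ : ℝ := d + 2 * M + 4 * (σ + 1) with hc₁
  set c₂ : ℝ := 2 * d * (1 + M) * ((σ + 10) * 2 ^ σ * (convConst d r).toReal) with hc₂
  set n : ℝ := ((multiIndices d M).card : ℝ) with hn
  have hc₁0 : 0 ≤ c₁ := by positivity
  have hc₂0 : 0 ≤ c₂ := by positivity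
  have hn0 : 0 ≤ n := by positivity
  -- After halving, the quadratic part leaves `c₁/2` and `2λ`, while the trilinear part is bounded
  -- by `2X` for each of the `n` multi-indices, since a single component is estimated by the full
  -- norm.
  refine ⟨c₁ + 2 + n * c₂, by positivity, fun T lam u f hlam hpos hf hu hsol t ht => ?_⟩
  have hl : ∀ t ∈ Set.Ico 0 T, 0 ≤ lam t := fun t ht => (hpos t ht).le
  have hlt := hl t ht
  have hg := hf.mem t ht
  have hU := hu.mem t ht
  have hle : σ ≤ σ + s / 2 := by linarith [hs.1]
  refine ⟨∑ α ∈ multiIndices d M, energyDeriv (lam t) (derivWithin lam (Set.Ico 0 T) t) σ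
    (σ + s / 2) s 0 α (f t) (u t), ?_, ?_⟩
  · have h := HasDerivWithinAt.fun_sum (u := multiIndices d M) fun α hα =>
      hasDerivWithinAt_eLpNorm_kinFun_sq hsol hs hrd hr hf hu hlam hl hα ht
    exact h.congr (fun τ hτ => ((hf.mem τ hτ).mono (gevreyMul_le_gevreyMul hle)).kinNorm_sq)
      (hg.mono (gevreyMul_le_gevreyMul hle)).kinNorm_sq
  · have h1 := Finset.sum_le_sum fun α hα =>
      energyDeriv_le (lam' := derivWithin lam (Set.Ico 0 T) t) hlt hs hrd hr hg hU hα
    rw [Finset.sum_add_distrib, Finset.sum_add_distrib, ← Finset.mul_sum, ← Finset.mul_sum,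
      Finset.sum_const, nsmul_eq_mul, ← hg.kinNorm_sq,
      ← (hg.mono (gevreyMul_le_gevreyMul hle)).kinNorm_sq, ← hc₁, ← hc₂, ← hn] at h1
    have h2 := hg.kinNorm_sq_le hlt hs.1.le
    have hS : 0 ≤ fluidSobolevNorm σ (u t) := Real.sqrt_nonneg _
    have hS' : 0 ≤ kinSobolevNorm σ M (f t) := Real.sqrt_nonneg _
    have hlip : 0 ≤ lipNorm (u t) := by unfold lipNorm; positivity
    have h3 : 0 ≤ fluidNorm (lam t) σ s (u t) := Real.sqrt_nonneg _
    have h4 : 0 ≤ fluidNorm (lam t) (σ + s / 2) s (u t) := Real.sqrt_nonneg _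
    have h5 : 0 ≤ kinNorm (lam t) σ M s (f t) := Real.sqrt_nonneg _
    have h6 : 0 ≤ kinNorm (lam t) (σ + s / 2) M s (f t) := Real.sqrt_nonneg _
    rw [triBound] at h1
    change kinNorm (lam t) σ M s (f t) ^ 2 ≤ kinSobolevNorm σ M (f t) * _ + _ at h2
    have e1 : fluidNorm 0 σ 1 (u t) = fluidSobolevNorm σ (u t) := rfl
    have e2 : kinNorm 0 σ M 1 (f t) = kinSobolevNorm σ M (f t) := rfl
    rw [e1, e2] at h1
    generalize fluidSobolevNorm σ (u t) = uS at *
    generalize kinSobolevNorm σ M (f t) = fS at *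
    generalize fluidNorm (lam t) σ s (u t) = u₀ at *
    generalize fluidNorm (lam t) (σ + s / 2) s (u t) = u₁ at *
    generalize kinNorm (lam t) σ M s (f t) = f₀ at *
    generalize kinNorm (lam t) (σ + s / 2) M s (f t) = f₁ at *
    generalize lipNorm (u t) = L at *
    generalize derivWithin lam (Set.Ico 0 T) t = lam' at *
    generalize lam t = μ at *
    set X := (L + 1) * f₀ ^ 2 + uS * fS * f₀ + (μ * (1 + uS) + μ ^ 2 * u₀) * f₁ ^ 2 +
      (μ * fS + μ ^ 2 * f₀) * u₁ * f₁ with hX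
    -- The summand 1 in `‖u‖_{W^{1,∞}} + 1` already suffices; of the Lipschitz norm only its sign
    -- matters.
    have hX1 : f₀ ^ 2 ≤ X := by
      have : 0 ≤ L * f₀ ^ 2 + uS * fS * f₀ + (μ * (1 + uS) + μ ^ 2 * u₀) * f₁ ^ 2 +
        (μ * fS + μ ^ 2 * f₀) * u₁ * f₁ := by positivity
      linarith
    have hX2 : μ * f₁ ^ 2 ≤ X := by
      have : 0 ≤ (L + 1) * f₀ ^ 2 + uS * fS * f₀ + (μ * uS + μ ^ 2 * u₀) * f₁ ^ 2 +
        (μ * fS + μ ^ 2 * f₀) * u₁ * f₁ := by positivity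
      linarith
    -- Interpolation multiplied by `‖u‖_σ` replaces `‖u‖_σ ‖f‖_{λ,σ}²` by the Sobolev product plus
    -- `λ‖u‖_σ ‖f‖_{λ,σ+s/2}²`. The latter then occurs twice, whence the factor 2.
    have hX3 : uS * f₀ * f₀ + μ * (uS * f₁ * f₁) + μ ^ 2 * (u₀ * f₁ * f₁) +
        μ ^ 2 * (u₁ * f₀ * f₁) + μ * (u₁ * fS * f₁) ≤ 2 * X := by
      have h7 := mul_le_mul_of_nonneg_left h2 hS
      have : 0 ≤ 2 * ((L + 1) * f₀ ^ 2) + uS * fS * f₀ + (2 * μ + μ ^ 2 * u₀) * f₁ ^ 2 +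
        (μ * fS + μ ^ 2 * f₀) * u₁ * f₁ := by positivity
      linarith
    have k1 := mul_le_mul_of_nonneg_left hX1 hc₁0
    have k3 := mul_le_mul_of_nonneg_left hX3 (mul_nonneg hn0 hc₂0)
    have k4 : 0 ≤ c₁ * X := mul_nonneg hc₁0 ((sq_nonneg f₀).trans hX1)
    linarith
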